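/- **Model.** Fix $p=p_2\in(0,1)$, $p_3=1-p_2$ and $f_2,f_3\in(0,1)$. A random grammar with vocabulary size $v$ and depth $L\ge 2$ is drawn as follows: independently for each level $1\le l\le L$, every one of the $v$ symbols of level $l-1$ receives $m_2$ binary rules and $m_3$ ternary rules; all $vm_2$ pairs (resp. $vm_3$ triples) of level-$l$ symbols used as right-hand sides are drawn uniformly without replacement, so that no tuple is produced by two rules. The limit is $v\to\infty$ with $m_2/v\to f_2$, $m_3/v^2\to f_3$. Given the grammar, a sentence $X_1\dots X_d$ is generated from a uniform root symbol $X^{(0)}$: at each of the $L$ levels every symbol is rewritten, independently, by one of its binary rules (probability $p_2/m_2$ each) or one of its ternary rules (probability $p_3/m_3$ each). $\mathbb E$ and $\mathbb P$ below refer to the random grammar; $\mathrm{Cov}$ and $p_{\rm ter}$ are computed for a fixed grammar. **Quantities.** Let $C_1^{(L-1)}(z,\alpha)$, $C_2((a,b),\alpha)$, $C_3((a,b,c),\alpha)$ be the covariances of $\mathbf 1\{X^{(0)}=\alpha\}$ with, respectively, the indicator that a uniformly chosen level-$(L-1)$ node of the derivation is $z$, that $(X_I,X_{I+1})=(a,b)$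 with $I$ uniform in $\{1,\dots,d-1\}$, and that $(X_I,X_{I+1},X_{I+2})=(a,b,c)$ with $I$ uniform in $\{1,\dots,d-2\}$. Let $p_{\rm ter}$ be the probability that $X_I,X_{I+1},X_{I+2}$ ($I$ uniform in $\{1,\dots,d-2\}$) are ternary siblings, i.e. the three children of one level-$(L-1)$ node, and let $R_{z\to(a,b,c)}\in\{0,1/m_3\}$ be the probability of $(a,b,c)$ given that the level-$(L-1)$ symbol $z$ uses a ternary rule. For $t=(a,b,c)$ put $$S(t,\alpha)=p_{\rm ter}\sum_z R_{z\to t}\,C_1^{(L-1)}(z,\alpha),\qquad W(t,\alpha)=C_3(t,\alpha)-\tfrac1v\big(C_2((a,b),\alpha)+C_2((b,c),\alpha)\big).$$ Let $S'$, $W'$ be the versions of $S$, $W$ in which every covariance is taken at the position $I$ of the triple: $C_2((a,b),\cdot)$ and $C_2((b,c),\cdot)$ are replaced by the covariances of $(X_I,X_{I+1})$ and of $(X_{I+1},X_{I+2})$ with the root for $I$ uniform in $\{1,\dots,d-2\}$, and $C_1^{(L-1)}(z,\alpha)$ is replaced by the covariance of the root with the parent symbol conditional on $(X_I,X_{I+1},X_{I+2})$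 being ternary siblings. The noise is $$N(t,\alpha)=\mathrm{Cov}\Big(\mathbf 1_{A}\mathbf 1\{(X_I,X_{I+1})=(a,b)\}\big(\mathbf 1\{X_{I+2}=c\}-\tfrac1v\big)+\mathbf 1_{B}\mathbf 1\{(X_{I+1},X_{I+2})=(b,c)\}\big(\mathbf 1\{X_I=a\}-\tfrac1v\big),\ \mathbf 1\{X^{(0)}=\alpha\}\Big),$$ where $A$ (resp. $B$) is the event that only the first two (resp. only the last two) of the three tokens have the same level-$(L-1)$ parent; it is the part of the binary contribution that comes from the deviation $\Delta$ of the parent-to-child transition probabilities from $1/v$. Finally let $\sigma^2=\mathbb E\,\frac1v\sum_z\|\frac{p_{\rm ter}}{m_3}C_1^{(L-1)}(z,:)\|^2$ be the typical squared norm of the ternary signal $S(t,:)=\frac{p_{\rm ter}}{m_3}C_1^{(L-1)}(z,:)$ of a triple $t$ generated by $z$. **Theorem.** There is a constant $K$ depending only on $p_2,f_2,f_3$ such that for all sequences $m_2=m_2(v)$, $m_3=m_3(v)$ as above, all $L\ge2$ and all $\varepsilon>0$, the following hold for all sufficiently large $v$. 1. (Decomposition.) For all $t=(a,b,c)$ and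 $\alpha$, in mean square over grammars, the root-to-triple covariance is the ternary-sibling term plus $1/v$ times the pair covariances, plus the noise, up to a negligible error: $$\mathbb E\big(W'(t,\alpha)-S'(t,\alpha)-N(t,\alpha)\big)^2\le\varepsilon\,\frac{\sigma^2}{v},\qquad \mathbb E\big(W(t,\alpha)-S(t,\alpha)-N(t,\alpha)\big)^2\le\Big(\frac{K}{2^{L-1}}+\varepsilon\Big)\frac{\sigma^2}{v}.$$ The term $K/2^{L-1}$ is the effect of the finite sentence length (positions at the ends of the sentence and fluctuations of $d$); it does not vanish as $v\to\infty$ at fixed $L$. 2. (Decorrelated noise.) For all triples $t\ne t'$ and all $z$ and $\alpha$: $\mathbb E[N(t,\alpha)\mathbf 1\{z\to t\}]=0$; $\ \mathbb E[\|N(t,:)\|^2\mathbf 1\{z\to t\}]\le K\sigma^2\,\mathbb P(z\to t)$; $\ |\mathbb E[\langle N(t,:),\frac{p_{\rm ter}}{m_3}C_1^{(L-1)}(z,:)\rangle\mathbf 1\{z\to t\}]|\le\varepsilon\sigma^2\,\mathbb P(z\to t)$; and $|\mathbb E[\langle N(t,:),N(t',:)\rangle\mathbf 1\{z\to t,\,z\to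 t'\}]|\le\varepsilon\sigma^2\,\mathbb P(z\to t,\,z\to t')$. Here $z\to t$ means that $t$ is one of the level-$L$ ternary rules of $z$. 3. (Clustering.) For all triples $t\neq t'$ and every event $F$ that prescribes, for each of $t$ and $t'$, its ternary parent nonterminal or that it has none: if $F$ prescribes the same parent nonterminal to both, $$\big|\mathbb E[(\langle W(t,:),W(t',:)\rangle-\|S(t,:)\|^2)\mathbf 1_F]\big|\le\Big(\frac{K}{2^{(L-1)/2}}+\varepsilon\Big)\sigma^2\,\mathbb P(F),$$ and otherwise $\big|\mathbb E[\langle W(t,:),W(t',:)\rangle\mathbf 1_F]\big|$ is bounded by the same right-hand side. The same holds for $W',S'$ with $\varepsilon\sigma^2\,\mathbb P(F)$ on the right-hand side. In this sense, subtracting the pair covariances restores the clustering of triples by the ternary parent nonterminal. -/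

import Mathlib

open Filter Topology
open scoped BigOperators Matrix

namespace RHM

/-! ### The grammar -/

/-- The production rules of one level. Each of the `v` nonterminals carries `m₂` binary and `m₃`
ternary rules; no tuple is used twice (sampling without replacement, unambiguous rules). -/
abbrev Rules (v m₂ m₃ : ℕ) : Type :=
  ((Fin v × Fin m₂) ↪ (Fin v × Fin v)) × ((Fin v × Fin m₃) ↪ (Fin v × Fin v × Fin v))

/-- A grammar of depth `L`: entry `i` rewrites level-`i` symbols into level-`(i+1)` symbols.
The random grammar is uniform on this finite type, so that levels and arities are independent;
averages over grammars are written `𝔼 G : Grammar v m₂ m₃ L, _`. -/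
abbrev Grammar (v m₂ m₃ L : ℕ) : Type := Fin L → Rules v m₂ m₃

/-! ### Derivations -/

/-- The choices made in a derivation of depth `L`: at each internal node a binary rule (one of
`m₂`) or a ternary rule (one of `m₃`), and the derivations of the children. -/
def ParseTree (m₂ m₃ : ℕ) : ℕ → Type
  | 0 => Unit
  | L + 1 => (Fin m₂ × ParseTree m₂ m₃ L × ParseTree m₂ m₃ L) ⊕
      (Fin m₃ × ParseTree m₂ m₃ L × ParseTree m₂ m₃ L × ParseTree m₂ m₃ L)

instance instFintypeParseTree (m₂ m₃ : ℕ) : ∀ L : ℕ, Fintype (ParseTree m₂ m₃ L)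
  | 0 => inferInstanceAs (Fintype Unit)
  | L + 1 =>
    letI : Fintype (ParseTree m₂ m₃ L) := instFintypeParseTree m₂ m₃ L
    inferInstanceAs (Fintype ((Fin m₂ × ParseTree m₂ m₃ L × ParseTree m₂ m₃ L) ⊕
      (Fin m₃ × ParseTree m₂ m₃ L × ParseTree m₂ m₃ L × ParseTree m₂ m₃ L)))

/-- Probability of a derivation: every node independently uses each of its binary rules with
probability `p / m₂` and each of its ternary rules with probability `(1 - p) / m₃`. -/
noncomputable def ParseTree.prob {m₂ m₃ : ℕ} (p : ℝ) : ∀ {L : ℕ}, ParseTree m₂ m₃ L → ℝ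
  | 0, _ => 1
  | _ + 1, Sum.inl (_, s, t) => p / m₂ * (ParseTree.prob p s * ParseTree.prob p t)
  | _ + 1, Sum.inr (_, s, t, u) =>
      (1 - p) / m₃ * (ParseTree.prob p s * ParseTree.prob p t * ParseTree.prob p u)

/-- The level-`ℓ` nodes of a derivation of depth `ℓ + 1` from the root symbol `z`, from left to
right: each one with its symbol and the tuple of tokens that it produces. -/
def blocks {v m₂ m₃ : ℕ} : ∀ (ℓ : ℕ), Grammar v m₂ m₃ (ℓ + 1) → Fin v →
    ParseTree m₂ m₃ (ℓ + 1) → List (Fin v × List (Fin v))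
  | 0, G, z, Sum.inl (k, _, _) =>
      let w := (G 0).1 (z, k)
      [(z, [w.1, w.2])]
  | 0, G, z, Sum.inr (k, _, _, _) =>
      let w := (G 0).2 (z, k)
      [(z, [w.1, w.2.1, w.2.2])]
  | ℓ + 1, G, z, Sum.inl (k, s, t) =>
      let w := (G 0).1 (z, k)
      blocks ℓ (Fin.tail G) w.1 s ++ blocks ℓ (Fin.tail G) w.2 t
  | ℓ + 1, G, z, Sum.inr (k, s, t, u) =>
      let w := (G 0).2 (z, k)
      blocks ℓ (Fin.tail G) w.1 s ++ blocks ℓ (Fin.tail G) w.2.1 t ++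
        blocks ℓ (Fin.tail G) w.2.2 u

/-- A token of the sentence, with the symbol of its parent and the position of the parent in the
sequence of level-`ℓ` nodes. Two tokens are siblings when their `idx` agree. -/
structure Leaf (v : ℕ) where
  sym : Fin v
  parent : Fin v
  idx : ℕ

section sequences

variable {v m₂ m₃ ℓ : ℕ}

/-- The sequence of level-`ℓ` symbols of a derivation of depth `ℓ + 1`. -/
def penultimate (G : Grammar v m₂ m₃ (ℓ + 1)) (r : Fin v) (τ : ParseTree m₂ m₃ (ℓ + 1)) :
    List (Fin v) :=
  (blocks ℓ G r τ).map Prod.fst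

/-- The sentence `X₁, …, X_d` of a derivation. -/
def leaves (G : Grammar v m₂ m₃ (ℓ + 1)) (r : Fin v) (τ : ParseTree m₂ m₃ (ℓ + 1)) :
    List (Leaf v) :=
  (blocks ℓ G r τ).zipIdx.flatMap fun b => b.1.2.map fun x => ⟨x, b.1.1, b.2⟩

/-- The `d - 1` pairs of adjacent tokens. -/
def pairs (G : Grammar v m₂ m₃ (ℓ + 1)) (r : Fin v) (τ : ParseTree m₂ m₃ (ℓ + 1)) :
    List (Leaf v × Leaf v) :=
  (leaves G r τ).zip (leaves G r τ).tail

/-- The `d - 2` triples of adjacent tokens. -/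
def triples (G : Grammar v m₂ m₃ (ℓ + 1)) (r : Fin v) (τ : ParseTree m₂ m₃ (ℓ + 1)) :
    List (Leaf v × Leaf v × Leaf v) :=
  (leaves G r τ).zip ((leaves G r τ).tail.zip (leaves G r τ).tail.tail)

end sequences

/-! ### Expectations and covariances for a fixed grammar -/

open Classical in
/-- Indicator of a proposition. -/
noncomputable def ind (P : Prop) : ℝ := if P then 1 else 0

/-- Fraction of the entries of a list that satisfy `P`, i.e. the probability of `P` for an entry
at a uniformly random position. -/
noncomputable def freq {β : Type} (l : List β) (P : β → Prop) : ℝ :=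
  (l.map fun x => ind (P x)).sum / (l.length : ℝ)

section covariances

variable {v m₂ m₃ : ℕ}

/-- Expectation over a uniform root symbol and a random derivation from it. -/
noncomputable def mean {L : ℕ} (p : ℝ) (X : Fin v → ParseTree m₂ m₃ L → ℝ) : ℝ :=
  ∑ r, ∑ τ, 1 / (v : ℝ) * τ.prob p * X r τ

/-- `Cov (X, 1{X⁽⁰⁾ = α})`, where `X⁽⁰⁾` is the root symbol. -/
noncomputable def rootCov {L : ℕ} (p : ℝ) (X : Fin v → ParseTree m₂ m₃ L → ℝ) (α : Fin v) : ℝ :=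
  mean p (fun r τ => X r τ * ind (r = α)) -
    mean p X * mean (m₂ := m₂) (m₃ := m₃) (L := L) p (fun r _ => ind (r = α))

variable {ℓ : ℕ}

/-- `C₁⁽ᴸ⁻¹⁾(z, α)` with `L = ℓ + 1`: covariance of the root with a level-`(L-1)` symbol at a
uniformly random position. -/
noncomputable def C1 (p : ℝ) (G : Grammar v m₂ m₃ (ℓ + 1)) (z α : Fin v) : ℝ :=
  rootCov p (fun r τ => freq (penultimate G r τ) (fun x => x = z)) α

/-- The root-to-pair covariance `C₂⁽ᴸ⁾((a, b), α)`, position uniform in `{1, …, d - 1}`. -/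
noncomputable def C2 (p : ℝ) (G : Grammar v m₂ m₃ (ℓ + 1)) (a b α : Fin v) : ℝ :=
  rootCov p (fun r τ => freq (pairs G r τ) (fun x => x.1.sym = a ∧ x.2.sym = b)) α

/-- The root-to-triple covariance `C₃⁽ᴸ⁾((a, b, c), α)`, position uniform in `{1, …, d - 2}`. -/
noncomputable def C3 (p : ℝ) (G : Grammar v m₂ m₃ (ℓ + 1)) (a b c α : Fin v) : ℝ :=
  rootCov p (fun r τ => freq (triples G r τ)
    (fun x => x.1.sym = a ∧ x.2.1.sym = b ∧ x.2.2.sym = c)) α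

/-- `Cov (1{(X_I, X_{I+1}) = (a, b)}, 1{X⁽⁰⁾ = α})` with `I` uniform in `{1, …, d - 2}`. -/
noncomputable def C2left (p : ℝ) (G : Grammar v m₂ m₃ (ℓ + 1)) (a b α : Fin v) : ℝ :=
  rootCov p (fun r τ => freq (triples G r τ) (fun x => x.1.sym = a ∧ x.2.1.sym = b)) α

/-- `Cov (1{(X_{I+1}, X_{I+2}) = (b, c)}, 1{X⁽⁰⁾ = α})` with `I` uniform in `{1, …, d - 2}`. -/
noncomputable def C2right (p : ℝ) (G : Grammar v m₂ m₃ (ℓ + 1)) (b c α : Fin v) : ℝ :=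
  rootCov p (fun r τ => freq (triples G r τ) (fun x => x.2.1.sym = b ∧ x.2.2.sym = c)) α

/-- All three tokens have the same parent. -/
def TernarySiblings (x : Leaf v × Leaf v × Leaf v) : Prop :=
  x.1.idx = x.2.1.idx ∧ x.2.1.idx = x.2.2.idx

/-- The first two tokens have the same parent, the third one belongs to the next span. -/
def LeftSiblings (x : Leaf v × Leaf v × Leaf v) : Prop :=
  x.1.idx = x.2.1.idx ∧ x.2.1.idx ≠ x.2.2.idx

/-- The last two tokens have the same parent, the first one belongs to the previous span. -/
def RightSiblings (x : Leaf v × Leaf v × Leaf v) : Prop :=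
  x.1.idx ≠ x.2.1.idx ∧ x.2.1.idx = x.2.2.idx

/-- `p_ter`: probability that three adjacent tokens at a random position are ternary siblings
(its value depends on the distribution of tree shapes only, not on the rules). -/
noncomputable def pTer (p : ℝ) (G : Grammar v m₂ m₃ (ℓ + 1)) : ℝ :=
  mean p (fun r τ => freq (triples G r τ) TernarySiblings)

/-- `p_ter` times the covariance of the root with the parent symbol, conditionally on
`(X_I, X_{I+1}, X_{I+2})` being ternary siblings: the covariance of the root with the indicator
that they are ternary siblings with parent `z`. -/
noncomputable def terCov (p : ℝ) (G : Grammar v m₂ m₃ (ℓ + 1)) (z α : Fin v) : ℝ :=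
  rootCov p (fun r τ => freq (triples G r τ)
    (fun x => TernarySiblings x ∧ x.1.parent = z)) α

/-- `R_{z → (a, b, c)}` at level `L`: probability of `(a, b, c)` given that `z` uses a ternary
rule. -/
noncomputable def ruleProb (G : Grammar v m₂ m₃ (ℓ + 1)) (z : Fin v)
    (t : Fin v × Fin v × Fin v) : ℝ :=
  (∑ k : Fin m₃, ind ((G (Fin.last ℓ)).2 (z, k) = t)) / (m₃ : ℝ)

/-- `p_ter ∑_z R_{z → t} C₁⁽ᴸ⁻¹⁾(z, α)`. -/
noncomputable def signal (p : ℝ) (G : Grammar v m₂ m₃ (ℓ + 1)) (t : Fin v × Fin v × Fin v)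
    (α : Fin v) : ℝ :=
  pTer p G * ∑ z, ruleProb G z t * C1 p G z α

/-- The ternary-sibling term with `C₁⁽ᴸ⁻¹⁾` conditional on the position being that of ternary
siblings. -/
noncomputable def signalCond (p : ℝ) (G : Grammar v m₂ m₃ (ℓ + 1)) (t : Fin v × Fin v × Fin v)
    (α : Fin v) : ℝ :=
  ∑ z, ruleProb G z t * terCov p G z α

/-- The noise term. In the terms of `C₃` in which only two of the three tokens are siblings, the
remaining token `c` (or `a`) of the adjacent node `z'` has transition probability
`P_{z' → c} = 1 / v + Δ_{c, z'}`. The noise is the `Δ` part: the factor `1{X = c}` is replaced by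
`1{X = c} - 1 / v`, whose conditional expectation given the parent `z'` is `Δ_{c, z'}`. -/
noncomputable def noise (p : ℝ) (G : Grammar v m₂ m₃ (ℓ + 1)) (t : Fin v × Fin v × Fin v)
    (α : Fin v) : ℝ :=
  rootCov p (fun r τ =>
    (freq (triples G r τ) (fun x => LeftSiblings x ∧
        (x.1.sym = t.1 ∧ x.2.1.sym = t.2.1) ∧ x.2.2.sym = t.2.2) -
      1 / (v : ℝ) * freq (triples G r τ) (fun x => LeftSiblings x ∧
        (x.1.sym = t.1 ∧ x.2.1.sym = t.2.1))) +
    (freq (triples G r τ) (fun x => RightSiblings x ∧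
        (x.2.1.sym = t.2.1 ∧ x.2.2.sym = t.2.2) ∧ x.1.sym = t.1) -
      1 / (v : ℝ) * freq (triples G r τ) (fun x => RightSiblings x ∧
        (x.2.1.sym = t.2.1 ∧ x.2.2.sym = t.2.2)))) α

/-- The whitened root-to-triple covariance
`C₃((a, b, c), α) - v⁻¹ C₂((a, b), α) - v⁻¹ C₂((b, c), α)`. -/
noncomputable def whitened (p : ℝ) (G : Grammar v m₂ m₃ (ℓ + 1)) (t : Fin v × Fin v × Fin v)
    (α : Fin v) : ℝ :=
  C3 p G t.1 t.2.1 t.2.2 α - 1 / (v : ℝ) * (C2 p G t.1 t.2.1 α + C2 p G t.2.1 t.2.2 α)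

/-- The same, with the pair covariances taken at the position of the triple. -/
noncomputable def whitenedCond (p : ℝ) (G : Grammar v m₂ m₃ (ℓ + 1))
    (t : Fin v × Fin v × Fin v) (α : Fin v) : ℝ :=
  C3 p G t.1 t.2.1 t.2.2 α -
    1 / (v : ℝ) * (C2left p G t.1 t.2.1 α + C2right p G t.2.1 t.2.2 α)

/-- The vector `(p_ter / m₃) C₁⁽ᴸ⁻¹⁾(z, ·)`: the common value of `signal` on all triples generated
by `z`. -/
noncomputable def center (p : ℝ) (G : Grammar v m₂ m₃ (ℓ + 1)) (z α : Fin v) : ℝ :=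
  pTer p G / (m₃ : ℝ) * C1 p G z α

/-- `ParentIs G (some z) t`: `z → t` is a ternary rule of level `L`;
`ParentIs G none t`: no ternary rule of level `L` generates `t`. -/
def ParentIs (G : Grammar v m₂ m₃ (ℓ + 1)) : Option (Fin v) → Fin v × Fin v × Fin v → Prop
  | some z, t => ∃ k, (G (Fin.last ℓ)).2 (z, k) = t
  | none, t => ∀ z k, (G (Fin.last ℓ)).2 (z, k) ≠ t

end covariances

/-! ### Averages over grammars -/

/-- The typical squared size of the signal: the mean square norm of `center p G z`, averaged over
the nonterminal `z` and over the grammar. -/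
noncomputable def scale (p : ℝ) (v m₂ m₃ ℓ : ℕ) : ℝ :=
  𝔼 G : Grammar v m₂ m₃ (ℓ + 1), 1 / (v : ℝ) * ∑ z, center p G z ⬝ᵥ center p G z

/-- The vectors `w G t` cluster by the ternary parent along the vectors `s G t`, up to `δ`: for any
two distinct triples, on average over the grammars in which they have prescribed parents (`none`:
the triple is not generated by a ternary rule), the inner product of their `w`-vectors is, up to
`δ`, the squared norm of the `s`-vector if the two parents agree, and zero if they differ or if
one of the triples has no parent (in the applications `s G t = 0` when `t` has no parent). -/
def Clusters {v m₂ m₃ ℓ : ℕ} (δ : ℝ)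
    (s w : Grammar v m₂ m₃ (ℓ + 1) → Fin v × Fin v × Fin v → Fin v → ℝ) : Prop :=
  ∀ t t' : Fin v × Fin v × Fin v, t ≠ t' → ∀ o o' : Option (Fin v),
    |𝔼 G : Grammar v m₂ m₃ (ℓ + 1), ind (ParentIs G o t ∧ ParentIs G o' t') *
        (w G t ⬝ᵥ w G t' - ind (o = o') * (s G t ⬝ᵥ s G t))| ≤
      δ * 𝔼 G : Grammar v m₂ m₃ (ℓ + 1), ind (ParentIs G o t ∧ ParentIs G o' t')

end RHM

set_option linter.unusedSectionVars false

namespace RHM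

open Finset (sum_congr mul_sum expect_const_zero expect_congr sum_le_sum sum_mul sum_eq_single
  sum_add_distrib sum_sub_distrib)
open Fintype (expect_const card_fin sum_bool card_prod sum_prod_type)

/-- Pairs of symbols. -/
notation "Pair" v:max => Fin v × Fin v

/-- Triples of symbols. -/
notation "Triple" v:max => Fin v × Fin v × Fin v

/-- The binary rules of one level. -/
notation "BinaryRules" v:max m:max => Fin v × Fin m ↪ Fin v × Fin v

/-- The ternary rules of one level. -/
notation "TernaryRules" v:max m:max => Fin v × Fin m ↪ Fin v × Fin v × Fin v

/-! ### Averages over finite types -/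

section Expect

variable {α β γ : Type*} [Fintype α] [Fintype β] [Fintype γ]

lemma expect_const_mul (c : ℝ) (f : α → ℝ) : 𝔼 x, c * f x = c * 𝔼 x, f x :=
  (Finset.mul_expect _ _ _).symm

lemma expect_mul_const (c : ℝ) (f : α → ℝ) : 𝔼 x, f x * c = (𝔼 x, f x) * c :=
  (Finset.expect_mul _ _ _).symm

lemma expect_add (f g : α → ℝ) : 𝔼 x, (f x + g x) = 𝔼 x, f x + 𝔼 x, g x :=
  Finset.expect_add_distrib _ _ _

lemma expect_sub (f g : α → ℝ) : 𝔼 x, (f x - g x) = 𝔼 x, f x - 𝔼 x, g x :=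
  Finset.expect_sub_distrib _ _ _

lemma expect_mono {f g : α → ℝ} (h : ∀ x, f x ≤ g x) : 𝔼 x, f x ≤ 𝔼 x, g x :=
  Finset.expect_le_expect fun x _ => h x

lemma expect_nonneg {f : α → ℝ} (h : ∀ x, 0 ≤ f x) : 0 ≤ 𝔼 x, f x :=
  Finset.expect_nonneg fun x _ => h x

lemma expect_swap (f : α → β → ℝ) : 𝔼 x, 𝔼 y, f x y = 𝔼 y, 𝔼 x, f x y :=
  Finset.expect_comm _ _ _

lemma expect_prod (f : α × β → ℝ) : 𝔼 x, f x = 𝔼 a, 𝔼 b, f (a, b) := by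
  rw [← Finset.univ_product_univ, Finset.expect_product]

lemma expect_sum {κ : Type*} (s : Finset κ) (f : κ → α → ℝ) :
    𝔼 x, ∑ i ∈ s, f i x = ∑ i ∈ s, 𝔼 x, f i x :=
  Finset.expect_sum_comm _ _ _

lemma expect_eq (f : α → ℝ) : 𝔼 x, f x = (1 / (Fintype.card α : ℝ)) * ∑ x, f x := by
  rw [Fintype.expect_eq_sum_div_card]; ring

lemma expect_equiv (e : α ≃ β) (f : β → ℝ) : 𝔼 x, f (e x) = 𝔼 y, f y :=
  Fintype.expect_equiv e _ _ fun _ => rfl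

lemma expect_ite_eq_mul [DecidableEq α] (x : α) (c : ℝ) :
    𝔼 y, (if x = y then c else 0) = 1 / (Fintype.card α : ℝ) * c := by
  rw [expect_eq]; simp

lemma expect_le_of_forall_le [Nonempty α] {f : α → ℝ} {c : ℝ} (h : ∀ x, f x ≤ c) :
    𝔼 x, f x ≤ c :=
  (expect_mono h).trans (expect_const c).le

lemma sq_expect_le (f : α → ℝ) : (𝔼 x, f x) ^ 2 ≤ 𝔼 x, f x ^ 2 := by
  rcases isEmpty_or_nonempty α with h | h
  · simp
  · have := Finset.expect_mul_sq_le_sq_mul_sq Finset.univ f (fun _ : α => (1 : ℝ))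
    simpa using this

lemma sq_expect_mul_le (f g : α → ℝ) :
    (𝔼 x, f x * g x) ^ 2 ≤ (𝔼 x, f x ^ 2) * 𝔼 x, g x ^ 2 :=
  Finset.expect_mul_sq_le_sq_mul_sq _ f g

lemma abs_expect_le_expect_abs (f : α → ℝ) : |𝔼 x, f x| ≤ 𝔼 x, |f x| :=
  Finset.abs_expect_le _ _

/-- Covariance of two functions of a uniformly distributed variable. -/
noncomputable def cvar (f g : α → ℝ) : ℝ := (𝔼 x, f x * g x) - (𝔼 x, f x) * 𝔼 x, g x

/-- The variance. -/
notation "𝕍" f:max => cvar f f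

lemma cvar_comm (f g : α → ℝ) : cvar f g = cvar g f := by
  simp only [cvar, mul_comm]

lemma cvar_add_left (f f' g : α → ℝ) :
    cvar (fun x => f x + f' x) g = cvar f g + cvar f' g := by
  simp only [cvar, add_mul, expect_add]; ring

lemma cvar_add_right (f g g' : α → ℝ) :
    cvar f (fun x => g x + g' x) = cvar f g + cvar f g' := by
  rw [cvar_comm, cvar_add_left, cvar_comm, cvar_comm g']

lemma cvar_const_mul_left (c : ℝ) (f g : α → ℝ) :
    cvar (fun x => c * f x) g = c * cvar f g := by
  simp only [cvar, mul_assoc, expect_const_mul]; ring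

lemma cvar_const_mul_right (c : ℝ) (f g : α → ℝ) :
    cvar f (fun x => c * g x) = c * cvar f g := by
  rw [cvar_comm, cvar_const_mul_left, cvar_comm]

lemma cvar_sub_left (f f' g : α → ℝ) :
    cvar (fun x => f x - f' x) g = cvar f g - cvar f' g := by
  simp only [cvar, sub_mul, expect_sub]; ring

lemma cvar_sub_right (f g g' : α → ℝ) :
    cvar f (fun x => g x - g' x) = cvar f g - cvar f g' := by
  rw [cvar_comm, cvar_sub_left, cvar_comm, cvar_comm g']

lemma cvar_sum_left {κ : Type*} (s : Finset κ) (f : κ → α → ℝ) (g : α → ℝ) :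
    cvar (fun x => ∑ i ∈ s, f i x) g = ∑ i ∈ s, cvar (f i) g := by
  simp only [cvar, sum_mul, expect_sum, sum_sub_distrib]

lemma cvar_const_left [Nonempty α] (c : ℝ) (g : α → ℝ) : cvar (fun _ => c) g = 0 := by
  simp only [cvar, expect_const_mul, expect_const, sub_self]

lemma cvar_const_right [Nonempty α] (c : ℝ) (g : α → ℝ) : cvar g (fun _ => c) = 0 := by
  rw [cvar_comm, cvar_const_left]

lemma cvar_zero_left (g : α → ℝ) : cvar (fun _ => 0) g = 0 := by
  simp [cvar]

lemma cvar_sub_const_left [Nonempty α] (c : ℝ) (f g : α → ℝ) :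
    cvar (fun x => f x - c) g = cvar f g := by
  rw [cvar_sub_left, cvar_const_left, sub_zero]

lemma cvar_sub_const_right [Nonempty α] (c : ℝ) (f g : α → ℝ) :
    cvar f (fun x => g x - c) = cvar f g := by
  rw [cvar_sub_right, cvar_const_right, sub_zero]

lemma cvar_eq_centered [Nonempty α] (f g : α → ℝ) :
    cvar f g = 𝔼 x, (f x - 𝔼 y, f y) * (g x - 𝔼 y, g y) := by
  rw [← cvar_sub_const_left (𝔼 y, f y), ← cvar_sub_const_right (𝔼 y, g y), cvar, expect_sub,
    expect_const]
  simp

lemma cvar_of_expect_left_eq_zero {f : α → ℝ} (hf : 𝔼 x, f x = 0) (g : α → ℝ) :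
    cvar f g = 𝔼 x, f x * g x := by
  rw [cvar, hf, zero_mul, sub_zero]

lemma cvar_self_eq (f : α → ℝ) : 𝕍 f = 𝔼 x, f x ^ 2 - (𝔼 x, f x) ^ 2 := by
  simp only [cvar, sq]

lemma cvar_self_nonneg (f : α → ℝ) : 0 ≤ 𝕍 f := by
  rw [cvar_self_eq]; linarith [sq_expect_le f]

lemma cvar_self_le (f : α → ℝ) : 𝕍 f ≤ 𝔼 x, f x ^ 2 := by
  rw [cvar_self_eq]; linarith [sq_nonneg (𝔼 x, f x)]

lemma two_mul_abs_le_of_quadratic {a b c : ℝ} (h : 0 ≤ a - 2 * b + c) (h' : 0 ≤ a + 2 * b + c) :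
    |b| ≤ (a + c) / 2 := by
  rw [abs_le]; constructor <;> linarith

lemma abs_cvar_le (f g : α → ℝ) : |cvar f g| ≤ (𝕍 f + 𝕍 g) / 2 := by
  apply two_mul_abs_le_of_quadratic
  · have := cvar_self_nonneg (fun x => f x - g x)
    simp only [cvar_sub_left, cvar_sub_right] at this
    linarith [cvar_comm f g]
  · have := cvar_self_nonneg (fun x => f x + g x)
    simp only [cvar_add_left, cvar_add_right] at this
    linarith [cvar_comm f g]

lemma cvar_self_add_le (f g : α → ℝ) :
    𝕍 (fun x => f x + g x) ≤ 2 * (𝕍 f + 𝕍 g) := by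
  have := cvar_self_nonneg (fun x => f x - g x)
  simp only [cvar_sub_left, cvar_sub_right] at this
  simp only [cvar_add_left, cvar_add_right]
  linarith [cvar_comm f g]

lemma cvar_self_sum_le {κ : Type*} (s : Finset κ) (f : κ → α → ℝ) :
    𝕍 (fun x => ∑ i ∈ s, f i x) ≤
      s.card * ∑ i ∈ s, 𝕍 (f i) := by
  rw [cvar_sum_left]
  simp only [cvar_comm _ (fun x => ∑ i ∈ s, f i x), cvar_sum_left]
  calc ∑ i ∈ s, ∑ j ∈ s, cvar (f j) (f i)
      ≤ ∑ i ∈ s, ∑ j ∈ s, (𝕍 (f j) + 𝕍 (f i)) / 2 :=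
        sum_le_sum fun i _ => sum_le_sum fun j _ =>
          (le_abs_self _).trans (abs_cvar_le _ _)
    _ = s.card * ∑ i ∈ s, 𝕍 (f i) := by
        simp only [← Finset.sum_div, sum_add_distrib, Finset.sum_const, nsmul_eq_mul,
          ← mul_sum]
        ring

lemma cvar_prod_add [Nonempty α] [Nonempty β] (f f' : α → ℝ) (g g' : β → ℝ) :
    cvar (fun x : α × β => f x.1 + g x.2) (fun x : α × β => f' x.1 + g' x.2) =
      cvar f f' + cvar g g' := by
  simp only [cvar, expect_prod, add_mul, mul_add, expect_add, expect_const,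
    expect_const_mul, expect_mul_const]
  ring

lemma cvar_comp_fst [Nonempty α] [Nonempty β] (f f' : α → ℝ) :
    cvar (fun x : α × β => f x.1) (fun x : α × β => f' x.1) = cvar f f' := by
  simp only [cvar, expect_prod, expect_const]

lemma cvar_comp_snd [Nonempty α] [Nonempty β] (g g' : β → ℝ) :
    cvar (fun x : α × β => g x.2) (fun x : α × β => g' x.2) = cvar g g' := by
  simp only [cvar, expect_prod, expect_const]

end Expect

lemma ind_nonneg (P : Prop) : 0 ≤ ind P := by unfold ind; split_ifs <;> norm_num
lemma ind_le_one (P : Prop) : ind P ≤ 1 := by unfold ind; split_ifs <;> norm_num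
lemma ind_true {P : Prop} (h : P) : ind P = 1 := by unfold ind; rw [if_pos h]
lemma ind_false {P : Prop} (h : ¬ P) : ind P = 0 := by unfold ind; rw [if_neg h]
lemma ind_sq (P : Prop) : ind P ^ 2 = ind P := by unfold ind; split_ifs <;> norm_num
lemma ind_and (P Q : Prop) : ind (P ∧ Q) = ind P * ind Q := by
  unfold ind; by_cases P <;> by_cases Q <;> simp_all
lemma ind_congr {P Q : Prop} (h : P ↔ Q) : ind P = ind Q := by rw [propext h]
lemma ind_mono {P Q : Prop} (h : P → Q) : ind P ≤ ind Q := by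
  by_cases hP : P
  · rw [ind_true hP, ind_true (h hP)]
  · rw [ind_false hP]; exact ind_nonneg _

/-! ### Uniformly random embeddings -/

section Embedding

variable {ι κ T : Type*} [Fintype ι] [DecidableEq ι] [Fintype κ] [DecidableEq κ] [Fintype T]
  [DecidableEq T]

/-- Postcomposition of an embedding with a permutation. -/
def relabel (σ : Equiv.Perm T) (e : ι ↪ T) : ι ↪ T := e.trans σ.toEmbedding

@[simp] lemma relabel_apply (σ : Equiv.Perm T) (e : ι ↪ T) (i : ι) :
    relabel σ e i = σ (e i) := rfl

lemma expect_relabel (σ : Equiv.Perm T) (f : (ι ↪ T) → ℝ) :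
    𝔼 e, f (relabel σ e) = 𝔼 e, f e :=
  expect_equiv (Equiv.embeddingCongr (Equiv.refl ι) σ) f

lemma expect_reindex (σ : Equiv.Perm ι) (f : (ι ↪ T) → ℝ) :
    𝔼 e : ι ↪ T, f (σ.toEmbedding.trans e) = 𝔼 e, f e := by
  have := expect_equiv (Equiv.embeddingCongr σ.symm (Equiv.refl T)) f
  simpa [Equiv.embeddingCongr, Function.Embedding.congr] using this

lemma expect_ind_mul_eq_expect_swap (i : ι) (t : T) (f : (ι ↪ T) → ℝ) :
    𝔼 e, ind (e i = t) * f e =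
      1 / (Fintype.card T : ℝ) * 𝔼 e : ι ↪ T, f (relabel (Equiv.swap (e i) t) e) := by
  have h1 : ∀ e : ι ↪ T, f (relabel (Equiv.swap (e i) t) e) =
      ∑ s, ind (e i = s) * f (relabel (Equiv.swap s t) e) := by
    intro e
    rw [sum_eq_single (e i)]
    · rw [ind_true rfl, one_mul]
    · intro s _ hs
      rw [ind_false (Ne.symm hs), zero_mul]
    · simp
  have h2 : ∀ s : T, 𝔼 e : ι ↪ T, ind (e i = s) * f (relabel (Equiv.swap s t) e) =
      𝔼 e : ι ↪ T, ind (e i = t) * f e := by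
    intro s
    rw [← expect_relabel (Equiv.swap s t) (fun e : ι ↪ T => ind (e i = t) * f e)]
    refine expect_congr rfl fun e _ => ?_
    congr 1
    refine ind_congr ?_
    rw [relabel_apply, Equiv.swap_apply_eq_iff, Equiv.swap_apply_right]
  simp only [h1, expect_sum, h2, Finset.sum_const, Finset.card_univ, nsmul_eq_mul]
  rcases isEmpty_or_nonempty T with h | h
  · exact h.elim t
  · field_simp

lemma expect_mul_eq_expect_swap (i : ι) (f : T → ℝ) (g : (ι ↪ T) → ℝ) :
    𝔼 e : ι ↪ T, f (e i) * g e =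
      𝔼 t, f t * 𝔼 e : ι ↪ T, g (relabel (Equiv.swap (e i) t) e) := by
  have h1 : ∀ e : ι ↪ T, f (e i) * g e = ∑ t, f t * (ind (e i = t) * g e) := by
    intro e
    rw [sum_eq_single (e i)]
    · rw [ind_true rfl, one_mul]
    · intro s _ hs
      rw [ind_false (Ne.symm hs), zero_mul, mul_zero]
    · simp
  simp only [h1, expect_sum, expect_const_mul, expect_ind_mul_eq_expect_swap]
  rw [expect_eq (α := T), mul_sum]
  exact sum_congr rfl fun t _ => by ring

variable [Nonempty (ι ↪ T)]

lemma expect_embedding_apply (i : ι) (f : T → ℝ) : 𝔼 e : ι ↪ T, f (e i) = 𝔼 t, f t := by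
  simpa using expect_mul_eq_expect_swap i f (fun _ : ι ↪ T => (1 : ℝ))

/-- The joint law of two values of a uniformly random embedding. -/
lemma expect_embedding_apply₂ (hT : 2 ≤ Fintype.card T) (i j : ι) (f g : T → ℝ) :
    𝔼 e : ι ↪ T, f (e i) * g (e j) = (𝔼 t, f t) * (𝔼 t, g t)
      - cvar f g / ((Fintype.card T : ℝ) - 1)
      + (if i = j then (Fintype.card T : ℝ) / ((Fintype.card T : ℝ) - 1) * cvar f g else 0) := by
  have hN : (1 : ℝ) < (Fintype.card T : ℝ) := by exact_mod_cast hT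
  set N : ℝ := (Fintype.card T : ℝ) with hNdef
  by_cases hij : i = j
  · subst hij
    rw [if_pos rfl, expect_embedding_apply i (fun t => f t * g t), cvar]
    have : N - 1 ≠ 0 := by linarith
    field_simp
    ring
  · rw [if_neg hij, add_zero]
    have key : ∀ (i j : ι) (_ : i ≠ j) (f g : T → ℝ), 𝔼 e : ι ↪ T, f (e i) * g (e j) =
        (𝔼 t, f t) * (𝔼 t, g t) +
          1 / N * (𝔼 e : ι ↪ T, f (e j) * g (e i) - 𝔼 t, f t * g t) := by
      intro i j hij f g
      rw [expect_mul_eq_expect_swap i f (fun e => g (e j))]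
      simp only [relabel_apply, ← expect_const_mul]
      rw [expect_swap]
      have h1 : ∀ e : ι ↪ T, 𝔼 t, f t * g (Equiv.swap (e i) t (e j)) =
          (𝔼 t, f t) * g (e j) + 1 / N * (f (e j) * g (e i) - f (e j) * g (e j)) := by
        intro e
        have : ∀ t, f t * g (Equiv.swap (e i) t (e j)) = f t * g (e j) +
            if e j = t then f (e j) * g (e i) - f (e j) * g (e j) else 0 := by
          intro t
          have hne : e j ≠ e i := fun h => hij (e.injective h).symm
          split_ifs with h
          · subst h; rw [Equiv.swap_apply_right]; ring
          · rw [Equiv.swap_apply_of_ne_of_ne hne h]; ring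
        simp only [this, expect_add, expect_mul_const, expect_ite_eq_mul]
        rfl
      simp only [h1, expect_add, expect_const_mul, expect_sub]
      rw [expect_embedding_apply j g, expect_embedding_apply j (fun t => f t * g t)]
    have h1 := key i j hij f g
    have h2 := key j i (Ne.symm hij) f g
    set Q := 𝔼 e : ι ↪ T, f (e i) * g (e j)
    set Q' := 𝔼 e : ι ↪ T, f (e j) * g (e i)
    have hN0 : N ≠ 0 := by linarith
    have hN1 : N - 1 ≠ 0 := by linarith
    have e1 : N * Q = N * ((𝔼 t, f t) * (𝔼 t, g t)) + (Q' - 𝔼 t, f t * g t) := by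
      rw [h1]; field_simp
    have e2 : N * Q' = N * ((𝔼 t, f t) * (𝔼 t, g t)) + (Q - 𝔼 t, f t * g t) := by
      rw [h2]; field_simp
    have e3 : Q = Q' := by
      have : (N + 1) * (Q - Q') = 0 := by linarith
      rcases mul_eq_zero.1 this with h | h <;> linarith
    rw [← e3] at e1
    rw [cvar]
    field_simp
    linarith

end Embedding

/-! ### Row averages of a random embedding -/

section Rows

variable {α κ T : Type*} [Fintype α] [DecidableEq α] [Fintype κ] [DecidableEq κ] [Fintype T]
  [DecidableEq T]

/-- Average of `f` over the values of the embedding on the row `x`. -/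
noncomputable def rowAvg (e : α × κ ↪ T) (f : T → ℝ) (x : α) : ℝ := 𝔼 k, f (e (x, k))

lemma rowAvg_nonneg (e : α × κ ↪ T) {f : T → ℝ} (hf : ∀ t, 0 ≤ f t) (x : α) :
    0 ≤ rowAvg e f x := expect_nonneg fun _ => hf _

lemma rowAvg_const [Nonempty κ] (e : α × κ ↪ T) (c : ℝ) (x : α) :
    rowAvg e (fun _ => c) x = c := expect_const _

lemma rowAvg_le_one [Nonempty κ] (e : α × κ ↪ T) {f : T → ℝ} (hf : ∀ t, f t ≤ 1) (x : α) :
    rowAvg e f x ≤ 1 := expect_le_of_forall_le fun _ => hf _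

/-- Since the values are distinct, the average over all rows is controlled by the average over
the target. -/
lemma expect_rowAvg_le (e : α × κ ↪ T) {f : T → ℝ} (hf : ∀ t, 0 ≤ f t) :
    𝔼 x, rowAvg e f x ≤
      (Fintype.card T : ℝ) / ((Fintype.card α : ℝ) * Fintype.card κ) * 𝔼 t, f t := by
  have h1 : 𝔼 x, rowAvg e f x = 𝔼 i, f (e i) := (expect_prod fun i => f (e i)).symm
  have h2 : ∑ i, f (e i) ≤ ∑ t, f t := by
    have := Finset.sum_map Finset.univ e f
    rw [← this]
    exact Finset.sum_le_sum_of_subset_of_nonneg (Finset.subset_univ _) fun t _ _ => hf t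
  rw [h1, expect_eq, expect_eq, card_prod, Nat.cast_mul]
  rcases isEmpty_or_nonempty T with h | h
  · have : IsEmpty (α × κ) := Function.isEmpty e
    simp
  · have : (Fintype.card T : ℝ) ≠ 0 := by positivity
    calc 1 / ((Fintype.card α : ℝ) * Fintype.card κ) * ∑ i, f (e i)
        ≤ 1 / ((Fintype.card α : ℝ) * Fintype.card κ) * ∑ t, f t := by gcongr
      _ = _ := by field_simp

variable [Nonempty α] [Nonempty κ] [Nonempty (α × κ ↪ T)]

lemma expect_rowAvg (f : T → ℝ) (x : α) : 𝔼 e : α × κ ↪ T, rowAvg e f x = 𝔼 t, f t := by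
  simp only [rowAvg]
  rw [expect_swap]
  simp only [expect_embedding_apply (ι := α × κ), expect_const]

lemma expect_rowAvg_mul_rowAvg (hT : 2 ≤ Fintype.card T) (f g : T → ℝ) (x x' : α) :
    𝔼 e : α × κ ↪ T, rowAvg e f x * rowAvg e g x' = (𝔼 t, f t) * (𝔼 t, g t)
      - cvar f g / ((Fintype.card T : ℝ) - 1)
      + (if x = x' then 1 / (Fintype.card κ : ℝ) *
          ((Fintype.card T : ℝ) / ((Fintype.card T : ℝ) - 1) * cvar f g) else 0) := by
  have h1 : ∀ e : α × κ ↪ T, rowAvg e f x * rowAvg e g x' =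
      𝔼 k, 𝔼 k', f (e (x, k)) * g (e (x', k')) := by
    intro e
    simp only [rowAvg, expect_const_mul, expect_mul_const]
  simp only [h1]
  rw [expect_swap]
  have h2 : ∀ k : κ, 𝔼 e : α × κ ↪ T, 𝔼 k', f (e (x, k)) * g (e (x', k')) =
      (𝔼 t, f t) * (𝔼 t, g t) - cvar f g / ((Fintype.card T : ℝ) - 1)
      + (if x = x' then 1 / (Fintype.card κ : ℝ) *
          ((Fintype.card T : ℝ) / ((Fintype.card T : ℝ) - 1) * cvar f g) else 0) := by
    intro k
    rw [expect_swap]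
    simp only [expect_embedding_apply₂ hT, expect_add, expect_const, Prod.mk.injEq]
    congr 1
    by_cases h : x = x'
    · simp only [h, true_and, if_true, expect_ite_eq_mul]
    · simp [h]
  simp only [h2, expect_const]

/-- Contraction of variances along one row average: the exact formula. -/
lemma expect_cvar_rowAvg (hT : 2 ≤ Fintype.card T) (f g : T → ℝ) :
    𝔼 e : α × κ ↪ T, cvar (rowAvg e f) (rowAvg e g) =
      (1 - 1 / (Fintype.card α : ℝ)) * (1 / (Fintype.card κ : ℝ) *
          ((Fintype.card T : ℝ) / ((Fintype.card T : ℝ) - 1))) * cvar f g := by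
  have h1 : ∀ e : α × κ ↪ T, cvar (rowAvg e f) (rowAvg e g) =
      𝔼 x, rowAvg e f x * rowAvg e g x - 𝔼 x, 𝔼 x', rowAvg e f x * rowAvg e g x' := by
    intro e
    simp only [cvar, expect_const_mul, expect_mul_const]
  have h2 : 𝔼 e : α × κ ↪ T, 𝔼 x, rowAvg e f x * rowAvg e g x =
      𝔼 x, 𝔼 e : α × κ ↪ T, rowAvg e f x * rowAvg e g x := expect_swap _
  have h3 : 𝔼 e : α × κ ↪ T, 𝔼 x, 𝔼 x', rowAvg e f x * rowAvg e g x' =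
      𝔼 x, 𝔼 x', 𝔼 e : α × κ ↪ T, rowAvg e f x * rowAvg e g x' := by
    rw [expect_swap]
    exact expect_congr rfl fun x _ => expect_swap _
  rw [expect_congr rfl fun e _ => h1 e, expect_sub, h2, h3]
  simp only [expect_rowAvg_mul_rowAvg hT, expect_add, expect_const, if_true,
    expect_ite_eq_mul]
  ring

omit [Nonempty α] [Nonempty (α × κ ↪ T)] in
lemma card_pos_real : (0 : ℝ) < (Fintype.card κ : ℝ) := by
  exact_mod_cast Fintype.card_pos

lemma expect_cvar_rowAvg_le (hT : 2 ≤ Fintype.card T) (f : T → ℝ) :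
    𝔼 e : α × κ ↪ T, 𝕍 (rowAvg e f) ≤ 2 / (Fintype.card κ : ℝ) * 𝕍 f := by
  rw [expect_cvar_rowAvg hT]
  refine mul_le_mul_of_nonneg_right ?_ (cvar_self_nonneg f)
  have hN : (2 : ℝ) ≤ (Fintype.card T : ℝ) := by exact_mod_cast hT
  have hk : (0 : ℝ) < (Fintype.card κ : ℝ) := card_pos_real
  have hv : 0 ≤ 1 / (Fintype.card α : ℝ) := by positivity
  have h1 : (Fintype.card T : ℝ) / ((Fintype.card T : ℝ) - 1) ≤ 2 := by
    rw [div_le_iff₀ (by linarith)]; linarith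
  have h0 : 0 ≤ (Fintype.card T : ℝ) / ((Fintype.card T : ℝ) - 1) := by
    apply div_nonneg <;> linarith
  calc (1 - 1 / (Fintype.card α : ℝ)) * (1 / (Fintype.card κ : ℝ) *
          ((Fintype.card T : ℝ) / ((Fintype.card T : ℝ) - 1)))
      ≤ 1 * (1 / (Fintype.card κ : ℝ) * 2) := by
        apply mul_le_mul
        · linarith
        · gcongr
        · positivity
        · norm_num
    _ = _ := by ring

/-- A row average concentrates around the average over the target. -/
lemma expect_sq_rowAvg_sub_le (hT : 2 ≤ Fintype.card T) (f : T → ℝ) (x : α) :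
    𝔼 e : α × κ ↪ T, (rowAvg e f x - 𝔼 t, f t) ^ 2 ≤ 1 / (Fintype.card κ : ℝ) * 𝕍 f := by
  have h1 : ∀ e : α × κ ↪ T, (rowAvg e f x - 𝔼 t, f t) ^ 2 =
      rowAvg e f x * rowAvg e f x - 2 * (𝔼 t, f t) * rowAvg e f x + (𝔼 t, f t) ^ 2 := by
    intro e; ring
  simp only [h1, expect_add, expect_sub, expect_const_mul, expect_rowAvg,
    expect_rowAvg_mul_rowAvg hT, expect_const, if_true]
  have hN : (2 : ℝ) ≤ (Fintype.card T : ℝ) := by exact_mod_cast hT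
  have hk : (1 : ℝ) ≤ (Fintype.card κ : ℝ) := by exact_mod_cast Fintype.card_pos
  set N : ℝ := (Fintype.card T : ℝ)
  set m : ℝ := (Fintype.card κ : ℝ)
  have hc := cvar_self_nonneg f
  have : 1 / m * 𝕍 f - ((𝔼 t, f t) * (𝔼 t, f t) - 𝕍 f / (N - 1) +
      1 / m * (N / (N - 1) * 𝕍 f) - 2 * (𝔼 t, f t) * (𝔼 t, f t) + (𝔼 t, f t) ^ 2) =
      (m - 1) / (m * (N - 1)) * 𝕍 f := by
    have : N - 1 ≠ 0 := by linarith
    field_simp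
    ring
  have h2 : 0 ≤ (m - 1) / (m * (N - 1)) * 𝕍 f := by
    apply mul_nonneg _ hc
    apply div_nonneg
    · linarith
    · apply mul_nonneg <;> linarith
  linarith

/-- The average over all rows concentrates even better. -/
lemma expect_sq_expect_rowAvg_sub_le (hT : 2 ≤ Fintype.card T) (f : T → ℝ) :
    𝔼 e : α × κ ↪ T, ((𝔼 x, rowAvg e f x) - 𝔼 t, f t) ^ 2 ≤
      1 / ((Fintype.card α : ℝ) * Fintype.card κ) * 𝕍 f := by
  have h1 : ∀ e : α × κ ↪ T, ((𝔼 x, rowAvg e f x) - 𝔼 t, f t) ^ 2 =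
      (𝔼 x, 𝔼 x', rowAvg e f x * rowAvg e f x') - 2 * (𝔼 t, f t) * (𝔼 x, rowAvg e f x)
        + (𝔼 t, f t) ^ 2 := by
    intro e; simp only [expect_const_mul, expect_mul_const]; ring
  have h2 : 𝔼 e : α × κ ↪ T, 𝔼 x, 𝔼 x', rowAvg e f x * rowAvg e f x' =
      𝔼 x, 𝔼 x', 𝔼 e : α × κ ↪ T, rowAvg e f x * rowAvg e f x' := by
    rw [expect_swap]
    exact expect_congr rfl fun x _ => expect_swap _
  have h3 : 𝔼 e : α × κ ↪ T, 𝔼 x, rowAvg e f x = 𝔼 t, f t := by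
    rw [expect_swap]; simp only [expect_rowAvg, expect_const]
  rw [expect_congr rfl fun e _ => h1 e, expect_add, expect_sub, h2, expect_const_mul, h3]
  simp only [expect_rowAvg_mul_rowAvg hT, expect_add, expect_const, expect_ite_eq_mul]
  have hN : (2 : ℝ) ≤ (Fintype.card T : ℝ) := by exact_mod_cast hT
  have hk : (1 : ℝ) ≤ (Fintype.card κ : ℝ) := by exact_mod_cast Fintype.card_pos
  have hv : (1 : ℝ) ≤ (Fintype.card α : ℝ) := by exact_mod_cast Fintype.card_pos
  set N : ℝ := (Fintype.card T : ℝ)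
  set m : ℝ := (Fintype.card κ : ℝ)
  set v : ℝ := (Fintype.card α : ℝ)
  have hc := cvar_self_nonneg f
  have : 1 / (v * m) * 𝕍 f - ((𝔼 t, f t) * (𝔼 t, f t) - 𝕍 f / (N - 1) +
      1 / v * (1 / m * (N / (N - 1) * 𝕍 f)) - 2 * (𝔼 t, f t) * (𝔼 t, f t)
        + (𝔼 t, f t) ^ 2) = (v * m - 1) / (v * m * (N - 1)) * 𝕍 f := by
    have : N - 1 ≠ 0 := by linarith
    field_simp
    ring
  have h2 : 0 ≤ (v * m - 1) / (v * m * (N - 1)) * 𝕍 f := by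
    apply mul_nonneg _ hc
    have : 1 ≤ v * m := one_le_mul_of_one_le_of_one_le hv hk
    apply div_nonneg
    · linarith
    · apply mul_nonneg <;> linarith
  linarith

omit [Nonempty α] [Nonempty (α × κ ↪ T)] in
/-- A transposition of the target moves at most two entries of a row. -/
lemma abs_rowAvg_relabel_swap_sub_le (e : α × κ ↪ T) {f : T → ℝ} (hf : ∀ t, 0 ≤ f t)
    (hf' : ∀ t, f t ≤ 1) (s t : T) (x : α) :
    |rowAvg (relabel (Equiv.swap s t) e) f x - rowAvg e f x| ≤ 2 / (Fintype.card κ : ℝ) := by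
  have h1 : ∀ u : T, ∑ k, ind (e (x, k) = u) ≤ 1 := by
    intro u
    by_cases h : ∃ k, e (x, k) = u
    · obtain ⟨k, hk⟩ := h
      rw [sum_eq_single k]
      · exact ind_le_one _
      · intro j _ hj
        refine ind_false fun h => hj ?_
        have := e.injective (h.trans hk.symm)
        simpa using this
      · simp
    · rw [Finset.sum_eq_zero fun k _ => ind_false fun hk => h ⟨k, hk⟩]
      exact zero_le_one
  have h2 : ∀ k, |f (relabel (Equiv.swap s t) e (x, k)) - f (e (x, k))| ≤
      ind (e (x, k) = s) + ind (e (x, k) = t) := by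
    intro k
    rw [relabel_apply]
    by_cases hs : e (x, k) = s
    · rw [ind_true hs]
      have := ind_nonneg (e (x, k) = t)
      have : ∀ a b : T, |f a - f b| ≤ 1 := fun a b => by
        rw [abs_le]; constructor <;> linarith [hf a, hf' a, hf b, hf' b]
      linarith [this (Equiv.swap s t (e (x, k))) (e (x, k))]
    · by_cases ht : e (x, k) = t
      · rw [ind_true ht]
        have := ind_nonneg (e (x, k) = s)
        have : ∀ a b : T, |f a - f b| ≤ 1 := fun a b => by
          rw [abs_le]; constructor <;> linarith [hf a, hf' a, hf b, hf' b]
        linarith [this (Equiv.swap s t (e (x, k))) (e (x, k))]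
      · rw [Equiv.swap_apply_of_ne_of_ne hs ht, sub_self, abs_zero]
        exact add_nonneg (ind_nonneg _) (ind_nonneg _)
  have hk : (0 : ℝ) < (Fintype.card κ : ℝ) := card_pos_real
  simp only [rowAvg, ← expect_sub]
  refine (abs_expect_le_expect_abs _).trans ((expect_mono h2).trans ?_)
  rw [expect_eq, sum_add_distrib]
  calc _ ≤ 1 / (Fintype.card κ : ℝ) * 2 :=
        mul_le_mul_of_nonneg_left (by linarith [h1 s, h1 t]) (by positivity)
    _ = _ := by ring

omit [Nonempty α] in
lemma expect_rowAvg_mul_le {f : T → ℝ} (hf : ∀ t, 0 ≤ f t) (x : α)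
    {Y Z : (α × κ ↪ T) → ℝ} (h : ∀ e s t, Y (relabel (Equiv.swap s t) e) ≤ Z e) :
    𝔼 e : α × κ ↪ T, rowAvg e f x * Y e ≤ (𝔼 t, f t) * 𝔼 e, Z e := by
  have h1 : ∀ e : α × κ ↪ T, rowAvg e f x * Y e = 𝔼 k, f (e (x, k)) * Y e := by
    intro e; rw [rowAvg, expect_mul_const]
  simp only [h1]
  rw [expect_swap]
  refine expect_le_of_forall_le fun k => ?_
  rw [expect_mul_eq_expect_swap, ← expect_mul_const]
  exact expect_mono fun t => mul_le_mul_of_nonneg_left (expect_mono fun e => h e _ _) (hf t)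

/-- Second moment of a row average. -/
lemma expect_rowAvg_sq_le {f : T → ℝ} (hf : ∀ t, 0 ≤ f t) (hf' : ∀ t, f t ≤ 1) (x : α) :
    𝔼 e : α × κ ↪ T, rowAvg e f x ^ 2 ≤
      (𝔼 t, f t) * ((𝔼 t, f t) + 2 / (Fintype.card κ : ℝ)) := by
  simp only [sq]
  refine (expect_rowAvg_mul_le hf x (Z := fun e => rowAvg e f x + 2 / (Fintype.card κ : ℝ))
    fun e s t => ?_).trans ?_
  · linarith [(abs_le.1 (abs_rowAvg_relabel_swap_sub_le e hf hf' s t x)).2]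
  · rw [expect_add, expect_const, expect_rowAvg]

/-- Third moment of a row average. -/
lemma expect_rowAvg_cube_le {f : T → ℝ} (hf : ∀ t, 0 ≤ f t) (hf' : ∀ t, f t ≤ 1) (x : α) :
    𝔼 e : α × κ ↪ T, rowAvg e f x ^ 3 ≤ (𝔼 t, f t) * ((𝔼 t, f t) * ((𝔼 t, f t) +
      6 / (Fintype.card κ : ℝ)) + 4 / (Fintype.card κ : ℝ) ^ 2) := by
  have h3 : ∀ e : α × κ ↪ T, rowAvg e f x ^ 3 = rowAvg e f x * rowAvg e f x ^ 2 :=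
    fun e => by ring
  simp only [h3]
  have hk : (0 : ℝ) < (Fintype.card κ : ℝ) := card_pos_real
  refine (expect_rowAvg_mul_le hf x
    (Z := fun e => rowAvg e f x ^ 2 + (4 / (Fintype.card κ : ℝ)) * rowAvg e f x +
      4 / (Fintype.card κ : ℝ) ^ 2) fun e s t => ?_).trans ?_
  · have h1 := (abs_le.1 (abs_rowAvg_relabel_swap_sub_le e hf hf' s t x)).2
    have h2 : rowAvg (relabel (Equiv.swap s t) e) f x ≤
      rowAvg e f x + 2 / (Fintype.card κ : ℝ) := by linarith
    have h0 := rowAvg_nonneg (relabel (Equiv.swap s t) e) hf x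
    calc _ ≤ (rowAvg e f x + 2 / (Fintype.card κ : ℝ)) ^ 2 := by gcongr
      _ = _ := by ring
  · rw [expect_add, expect_add, expect_const, expect_const_mul, expect_rowAvg]
    refine mul_le_mul_of_nonneg_left ?_ (expect_nonneg hf)
    have := expect_rowAvg_sq_le (κ := κ) hf hf' x
    calc _ ≤ (𝔼 t, f t) * ((𝔼 t, f t) + 2 / (Fintype.card κ : ℝ)) +
          4 / (Fintype.card κ : ℝ) * (𝔼 t, f t) + 4 / (Fintype.card κ : ℝ) ^ 2 := by gcongr
      _ = _ := by ring

end Rows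

/-- Symmetrization over relabelings: only collisions contribute to the second moment of a
centered function. -/
lemma expect_perm_sq_expect_le {κ : Type*} [Fintype κ] {v : ℕ} (hv : 2 ≤ v)
    (u : κ → Fin v) (φ : Fin v → ℝ) (hφ : 𝔼 y, φ y = 0) :
    𝔼 σ : Equiv.Perm (Fin v), (𝔼 k, φ (σ (u k))) ^ 2 ≤
      (𝔼 k, 𝔼 k', ind (u k = u k')) * 𝔼 y, φ y ^ 2 := by
  have h1 : ∀ σ : Equiv.Perm (Fin v), (𝔼 k, φ (σ (u k))) ^ 2 =
      𝔼 k, 𝔼 k', φ (σ (u k)) * φ (σ (u k')) := by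
    intro σ; simp only [sq, expect_const_mul, expect_mul_const]
  have : NeZero v := ⟨by omega⟩
  have h2 : ∀ k k', 𝔼 σ : Equiv.Perm (Fin v), φ (σ (u k)) * φ (σ (u k')) ≤
      ind (u k = u k') * 𝔼 y, φ y ^ 2 := by
    intro k k'
    have := expect_equiv (Equiv.embeddingEquivOfFinite (Fin v))
      (fun σ : Equiv.Perm (Fin v) => φ (σ (u k)) * φ (σ (u k')))
    rw [← this]
    have h3 : ∀ e : Fin v ↪ Fin v, φ (Equiv.embeddingEquivOfFinite (Fin v) e (u k)) *
        φ (Equiv.embeddingEquivOfFinite (Fin v) e (u k')) = φ (e (u k)) * φ (e (u k')) := by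
      intro e; rfl
    have hc : 𝕍 φ = 𝔼 y, φ y ^ 2 := by rw [cvar_self_eq, hφ]; ring
    have : Nonempty (Fin v ↪ Fin v) := ⟨Function.Embedding.refl _⟩
    simp only [h3]
    rw [expect_embedding_apply₂ (by simpa using hv), hφ, hc, card_fin]
    have hv' : (2 : ℝ) ≤ v := by exact_mod_cast hv
    have hn : 0 ≤ 𝔼 y, φ y ^ 2 := expect_nonneg fun _ => sq_nonneg _
    by_cases h : u k = u k'
    · rw [if_pos h, ind_true h]
      have : (v : ℝ) - 1 ≠ 0 := by linarith
      apply le_of_eq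
      field_simp
      ring
    · rw [if_neg h, ind_false h]
      have : 0 ≤ (𝔼 y, φ y ^ 2) / ((v : ℝ) - 1) := div_nonneg hn (by linarith)
      linarith
  simp only [h1]
  rw [expect_swap, ← expect_mul_const]
  refine expect_mono fun k => ?_
  rw [expect_swap, ← expect_mul_const]
  exact expect_mono fun k' => h2 k k'

/-! ### One level of the grammar -/

/-- The sizes of the rule sets are comparable with `v` and `v ^ 2`, and a positive fraction of the
triples is not used. -/
structure Regime (c : ℝ) (v m2 m3 : ℕ) : Prop where
  pos : 0 < c
  two_le : 2 ≤ v
  m2_le : m2 ≤ v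
  le_m2 : c * v ≤ m2
  le_m3 : c * (v : ℝ) ^ 2 ≤ m3
  m3_le : (m3 : ℝ) ≤ (1 - c) * (v : ℝ) ^ 2

namespace Regime

variable {c : ℝ} {v m2 m3 : ℕ} (h : Regime c v m2 m3)

include h

lemma two_le_real : (2 : ℝ) ≤ v := by exact_mod_cast h.two_le

lemma v_pos : (0 : ℝ) < v := by linarith [h.two_le_real]

lemma m2_pos_real : (0 : ℝ) < m2 := (mul_pos h.pos h.v_pos).trans_le h.le_m2

lemma m2_pos : 0 < m2 := by exact_mod_cast h.m2_pos_real

lemma m3_pos_real : (0 : ℝ) < m3 := (mul_pos h.pos (pow_pos h.v_pos 2)).trans_le h.le_m3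

lemma m3_pos : 0 < m3 := by exact_mod_cast h.m3_pos_real

lemma m2_le_real : (m2 : ℝ) ≤ v := by exact_mod_cast h.m2_le

lemma le_one : c ≤ 1 := by
  have := h.le_m2.trans h.m2_le_real
  exact le_of_mul_le_mul_right (by linarith) h.v_pos

lemma m3_le_sq : (m3 : ℝ) ≤ (v : ℝ) ^ 2 :=
  h.m3_le.trans (by nlinarith [h.pos, sq_nonneg (v : ℝ)])

lemma le_m3' : c * (v : ℝ) ≤ m3 := by
  refine le_trans ?_ h.le_m3
  refine mul_le_mul_of_nonneg_left ?_ h.pos.le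
  nlinarith [h.two_le_real]

lemma neZero : NeZero v := ⟨by have := h.two_le; omega⟩

lemma nonempty_fin : Nonempty (Fin v) := ⟨⟨0, by have := h.two_le; omega⟩⟩

lemma nonempty_m2 : Nonempty (Fin m2) := ⟨⟨0, h.m2_pos⟩⟩

lemma nonempty_m3 : Nonempty (Fin m3) := ⟨⟨0, h.m3_pos⟩⟩

lemma nonempty₂ : Nonempty (BinaryRules v m2) := by
  rw [Function.Embedding.nonempty_iff_card_le]
  simpa using Nat.mul_le_mul_left v h.m2_le

lemma nonempty₃ : Nonempty (TernaryRules v m3) := by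
  rw [Function.Embedding.nonempty_iff_card_le]
  have : m3 ≤ v ^ 2 := by exact_mod_cast h.m3_le_sq
  simpa [sq] using Nat.mul_le_mul_left v this

lemma nonempty_rules : Nonempty (Rules v m2 m3) :=
  have := h.nonempty₂
  have := h.nonempty₃
  inferInstance

lemma insts : NeZero v ∧ Nonempty (Fin m2) ∧ Nonempty (Fin m3) ∧ Nonempty (BinaryRules v m2) ∧
    Nonempty (TernaryRules v m3) ∧ Nonempty (Rules v m2 m3) :=
  ⟨h.neZero, h.nonempty_m2, h.nonempty_m3, h.nonempty₂, h.nonempty₃, h.nonempty_rules⟩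

lemma card₂ : 2 ≤ Fintype.card (Pair v) := by
  simp only [card_prod, card_fin]; nlinarith [h.two_le]

lemma card₃ : 2 ≤ Fintype.card (Triple v) := by
  simp only [card_prod, card_fin]
  have := h.two_le
  nlinarith [Nat.mul_le_mul this this]

lemma inv_m2_le : 1 / (m2 : ℝ) ≤ 1 / (c * v) :=
  one_div_le_one_div_of_le (mul_pos h.pos h.v_pos) h.le_m2

lemma inv_m3_le : 1 / (m3 : ℝ) ≤ 1 / (c * (v : ℝ) ^ 2) :=
  one_div_le_one_div_of_le (mul_pos h.pos (pow_pos h.v_pos 2)) h.le_m3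

lemma inv_m3_le' : 1 / (m3 : ℝ) ≤ 1 / (c * v) :=
  one_div_le_one_div_of_le (mul_pos h.pos h.v_pos) h.le_m3'

lemma ratio₂_le : ((Fintype.card (Pair v) : ℕ) : ℝ) /
    ((Fintype.card (Fin v) : ℝ) * Fintype.card (Fin m2)) ≤ 1 / c := by
  simp only [card_prod, card_fin, Nat.cast_mul]
  have := h.v_pos
  have := h.pos
  rw [div_le_div_iff₀ (mul_pos h.v_pos h.m2_pos_real) h.pos]
  nlinarith [h.le_m2]

lemma ratio₃_le : ((Fintype.card (Triple v) : ℕ) : ℝ) /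
    ((Fintype.card (Fin v) : ℝ) * Fintype.card (Fin m3)) ≤ 1 / c := by
  simp only [card_prod, card_fin, Nat.cast_mul]
  have := h.v_pos
  have := h.pos
  rw [div_le_div_iff₀ (mul_pos h.v_pos h.m3_pos_real) h.pos]
  nlinarith [h.le_m3]

end Regime

section Level

variable {v m2 m3 : ℕ}

lemma expect_rules (f : Rules v m2 m3 → ℝ) : 𝔼 ρ, f ρ = 𝔼 e₂, 𝔼 e₃, f (e₂, e₃) :=
  expect_prod f

/-- Average of `φ` over the last child of `x` among its binary (`false`) or ternary (`true`)
rules. -/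
noncomputable def lastChild : Bool → Rules v m2 m3 → (Fin v → ℝ) → Fin v → ℝ
  | false, ρ, φ => rowAvg ρ.1 fun t => φ t.2
  | true, ρ, φ => rowAvg ρ.2 fun t => φ t.2.2

/-- Average of `φ` over the first child of `x` among its binary (`false`) or ternary (`true`)
rules. -/
noncomputable def firstChild : Bool → Rules v m2 m3 → (Fin v → ℝ) → Fin v → ℝ
  | false, ρ, φ => rowAvg ρ.1 fun t => φ t.1
  | true, ρ, φ => rowAvg ρ.2 fun t => φ t.1

/-- Average over the root rule of a derivation. -/
noncomputable def stepAvg (p : ℝ) (ρ : Rules v m2 m3) (f : Pair v → ℝ)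
    (F : Triple v → ℝ) (r : Fin v) : ℝ :=
  p * rowAvg ρ.1 f r + (1 - p) * rowAvg ρ.2 F r

/-- Contraction factor of variances for binary rules. -/
noncomputable def gain₂ (p : ℝ) (v m2 : ℕ) : ℝ :=
  p ^ 2 * ((1 - 1 / (v : ℝ)) * (1 / (m2 : ℝ) * ((v : ℝ) ^ 2 / ((v : ℝ) ^ 2 - 1))))

/-- Contraction factor of variances for ternary rules. -/
noncomputable def gain₃ (p : ℝ) (v m3 : ℕ) : ℝ :=
  (1 - p) ^ 2 * ((1 - 1 / (v : ℝ)) * (1 / (m3 : ℝ) * ((v : ℝ) ^ 3 / ((v : ℝ) ^ 3 - 1))))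

variable {c : ℝ} (h : Regime c v m2 m3)

include h

lemma expect_cvar_stepAvg (p : ℝ) (f g : Pair v → ℝ) (F G : Triple v → ℝ) :
    𝔼 ρ : Rules v m2 m3, cvar (stepAvg p ρ f F) (stepAvg p ρ g G) =
      gain₂ p v m2 * cvar f g + gain₃ p v m3 * cvar F G := by
  obtain ⟨_, _, _, _, _, _⟩ := h.insts
  have h1 : ∀ ρ : Rules v m2 m3, cvar (stepAvg p ρ f F) (stepAvg p ρ g G) =
      p ^ 2 * cvar (rowAvg ρ.1 f) (rowAvg ρ.1 g) +
        p * (1 - p) * cvar (rowAvg ρ.1 f) (rowAvg ρ.2 G) +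
        p * (1 - p) * cvar (rowAvg ρ.2 F) (rowAvg ρ.1 g) +
        (1 - p) ^ 2 * cvar (rowAvg ρ.2 F) (rowAvg ρ.2 G) := by
    intro ρ
    unfold stepAvg
    simp only [cvar_add_left, cvar_add_right, cvar_const_mul_left, cvar_const_mul_right]
    ring
  have h2 : ∀ (f : Pair v → ℝ) (G : Triple v → ℝ),
      𝔼 e₂ : BinaryRules v m2, 𝔼 e₃ : TernaryRules v m3,
        cvar (rowAvg e₂ f) (rowAvg e₃ G) = 0 := by
    intro f G
    have h3 : ∀ e₂ : BinaryRules v m2,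
        𝔼 e₃ : TernaryRules v m3,
          cvar (rowAvg e₂ f) (rowAvg e₃ G) = 0 := by
      intro e₂
      simp only [cvar, expect_sub, expect_const_mul]
      rw [expect_swap, expect_swap (fun (e : TernaryRules v m3) x =>
        rowAvg e G x)]
      simp only [expect_const_mul, expect_rowAvg, expect_mul_const, expect_const, sub_self]
    simp only [h3, expect_const]
  have h2' : ∀ (F : Triple v → ℝ) (g : Pair v → ℝ),
      𝔼 e₂ : BinaryRules v m2, 𝔼 e₃ : TernaryRules v m3,
        cvar (rowAvg e₃ F) (rowAvg e₂ g) = 0 := by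
    intro F g
    simp only [cvar_comm (rowAvg _ F)]
    exact h2 g F
  simp only [h1, expect_rules, expect_add, expect_const_mul, h2, h2', expect_const,
    expect_cvar_rowAvg h.card₂, expect_cvar_rowAvg h.card₃, gain₂, gain₃]
  simp only [card_prod, card_fin, Nat.cast_mul]
  ring_nf

lemma gain₂_nonneg (p : ℝ) : 0 ≤ gain₂ p v m2 := by
  have h2 := h.two_le_real
  have : 1 / (v : ℝ) ≤ 1 := by rw [div_le_one h.v_pos]; linarith
  have h4 : 0 ≤ (v : ℝ) ^ 2 - 1 := by nlinarith
  exact mul_nonneg (sq_nonneg _) (mul_nonneg (by linarith) (by positivity))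

lemma gain₃_nonneg (p : ℝ) : 0 ≤ gain₃ p v m3 := by
  have h2 := h.two_le_real
  have : 1 / (v : ℝ) ≤ 1 := by rw [div_le_one h.v_pos]; linarith
  have h3 : (v : ℝ) ^ 3 = v * (v : ℝ) ^ 2 := by ring
  have h4 : 0 ≤ (v : ℝ) ^ 3 - 1 := by nlinarith
  exact mul_nonneg (sq_nonneg _) (mul_nonneg (by linarith) (by positivity))

lemma gain₂_eq (p : ℝ) : gain₂ p v m2 = p ^ 2 * (1 / m2 * (v / (v + 1))) := by
  have h2 := h.two_le_real
  have h1 : (v : ℝ) ^ 2 - 1 = (v - 1) * (v + 1) := by ring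
  have h3 : (v : ℝ) - 1 ≠ 0 := by linarith
  have h5 : (v : ℝ) + 1 ≠ 0 := by linarith
  have h6 : (v : ℝ) ≠ 0 := by linarith
  rw [gain₂, h1]
  have := h.m2_pos_real.ne'
  field_simp

lemma gain₂_le {p : ℝ} (hp : 0 ≤ p) (hp' : p ≤ 1) : gain₂ p v m2 ≤ 2 / (c * v) := by
  rw [gain₂_eq h]
  have h2 := h.two_le_real
  have h3 : (v : ℝ) / (v + 1) ≤ 1 := by rw [div_le_one (by linarith)]; linarith
  have h4 : p ^ 2 ≤ 1 := pow_le_one₀ hp hp'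
  have h5 := h.inv_m2_le
  have h6 : 0 < 1 / (c * v) := one_div_pos.2 (mul_pos h.pos h.v_pos)
  calc _ ≤ 1 * (1 / (c * v) * 1) := by gcongr
    _ ≤ 2 * (1 / (c * v)) := by linarith
    _ = _ := by ring

lemma le_gain₂ (p : ℝ) : p ^ 2 / (2 * v) ≤ gain₂ p v m2 := by
  rw [gain₂_eq h]
  have h2 := h.two_le_real
  have h3 : 1 / 2 ≤ (v : ℝ) / (v + 1) := by
    rw [div_le_div_iff₀ (by norm_num) (by linarith)]; linarith
  have h5 : 1 / (v : ℝ) ≤ 1 / m2 := one_div_le_one_div_of_le h.m2_pos_real h.m2_le_real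
  calc p ^ 2 / (2 * v) = p ^ 2 * (1 / v * (1 / 2)) := by field_simp
    _ ≤ _ := by gcongr

lemma gain₃_le {p : ℝ} (hp : 0 ≤ p) (hp' : p ≤ 1) : gain₃ p v m3 ≤ 2 / (c * v) := by
  have h2 := h.two_le_real
  have h6 : 0 < 1 / (c * v) := one_div_pos.2 (mul_pos h.pos h.v_pos)
  have h4 : (1 - p) ^ 2 ≤ 1 := pow_le_one₀ (by linarith) (by linarith)
  have h7 : 1 / (v : ℝ) ≤ 1 := by rw [div_le_one h.v_pos]; linarith
  have h8 : 0 < 1 / (v : ℝ) := one_div_pos.2 h.v_pos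
  have h9 : (4 : ℝ) * v ≤ (v : ℝ) ^ 3 := by
    have : (v : ℝ) ^ 3 = v * (v * v) := by ring
    rw [this]; nlinarith [mul_le_mul h2 h2 (by norm_num) h.v_pos.le]
  have h3 : (v : ℝ) ^ 3 / ((v : ℝ) ^ 3 - 1) ≤ 2 := by
    rw [div_le_iff₀ (by linarith)]; linarith
  have h5 := h.inv_m3_le'
  have h10 : 0 ≤ (v : ℝ) ^ 3 / ((v : ℝ) ^ 3 - 1) := div_nonneg (by positivity) (by linarith)
  calc gain₃ p v m3 ≤ 1 * (1 * (1 / (c * v) * 2)) := by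
        unfold gain₃
        have h11 : 0 ≤ 1 - 1 / (v : ℝ) := by linarith
        have h12 : 1 - 1 / (v : ℝ) ≤ 1 := by linarith
        gcongr
    _ = _ := by ring

omit h in
lemma firstChild_nonneg (b : Bool) (ρ : Rules v m2 m3) {φ : Fin v → ℝ} (hφ : ∀ y, 0 ≤ φ y)
    (x : Fin v) : 0 ≤ firstChild b ρ φ x := by
  cases b <;> exact expect_nonneg fun _ => hφ _

lemma lastChild_const (b : Bool) (ρ : Rules v m2 m3) (a : ℝ) (x : Fin v) :
    lastChild b ρ (fun _ => a) x = a := by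
  have := h.nonempty_m2
  have := h.nonempty_m3
  cases b <;> exact expect_const _

omit h in
lemma sq_firstChild_le (b : Bool) (ρ : Rules v m2 m3) (φ : Fin v → ℝ) (x : Fin v) :
    firstChild b ρ φ x ^ 2 ≤ firstChild b ρ (fun y => φ y ^ 2) x := by
  cases b <;> exact sq_expect_le _

omit h in
lemma sq_lastChild_le (b : Bool) (ρ : Rules v m2 m3) (φ : Fin v → ℝ) (x : Fin v) :
    lastChild b ρ φ x ^ 2 ≤ lastChild b ρ (fun y => φ y ^ 2) x := by
  cases b <;> exact sq_expect_le _

omit h in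
lemma firstChild_add (b : Bool) (ρ : Rules v m2 m3) (φ ψ : Fin v → ℝ) (x : Fin v) :
    firstChild b ρ (fun y => φ y + ψ y) x = firstChild b ρ φ x + firstChild b ρ ψ x := by
  cases b <;> exact expect_add _ _

omit h in
lemma lastChild_sub (b : Bool) (ρ : Rules v m2 m3) (φ ψ : Fin v → ℝ) (x : Fin v) :
    lastChild b ρ (fun y => φ y - ψ y) x = lastChild b ρ φ x - lastChild b ρ ψ x := by
  cases b <;> exact expect_sub _ _

omit h in
lemma firstChild_sub (b : Bool) (ρ : Rules v m2 m3) (φ ψ : Fin v → ℝ) (x : Fin v) :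
    firstChild b ρ (fun y => φ y - ψ y) x = firstChild b ρ φ x - firstChild b ρ ψ x := by
  cases b <;> exact expect_sub _ _

omit h in
lemma firstChild_const_mul (b : Bool) (ρ : Rules v m2 m3) (a : ℝ) (φ : Fin v → ℝ) (x : Fin v) :
    firstChild b ρ (fun y => a * φ y) x = a * firstChild b ρ φ x := by
  cases b <;> exact expect_const_mul _ _

omit h in
lemma lastChild_const_mul (b : Bool) (ρ : Rules v m2 m3) (a : ℝ) (φ : Fin v → ℝ) (x : Fin v) :
    lastChild b ρ (fun y => a * φ y) x = a * lastChild b ρ φ x := by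
  cases b <;> exact expect_const_mul _ _

omit h in
lemma expect_lastChild_comm {β : Type*} [Fintype β] (b : Bool) (ρ : Rules v m2 m3)
    (φ : β → Fin v → ℝ) (x : Fin v) :
    𝔼 y, lastChild b ρ (φ y) x = lastChild b ρ (fun z => 𝔼 y, φ y z) x := by
  cases b <;> exact expect_swap _

lemma expect_fst₂ (φ : Fin v → ℝ) : 𝔼 t : Pair v, φ t.1 = 𝔼 y, φ y := by
  have := h.nonempty_fin
  simp only [expect_prod, expect_const]

lemma expect_snd₂ (φ : Fin v → ℝ) : 𝔼 t : Pair v, φ t.2 = 𝔼 y, φ y := by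
  have := h.nonempty_fin
  simp only [expect_prod, expect_const]

lemma expect_fst₃ (φ : Fin v → ℝ) : 𝔼 t : Triple v, φ t.1 = 𝔼 y, φ y := by
  have := h.nonempty_fin
  simp only [expect_prod, expect_const]

lemma expect_snd₃ (φ : Fin v → ℝ) : 𝔼 t : Triple v, φ t.2.2 = 𝔼 y, φ y := by
  have := h.nonempty_fin
  simp only [expect_prod, expect_const]

/-- Columns of the transition matrices have bounded sums, since no tuple is used twice. -/
lemma expect_firstChild_le (b : Bool) (ρ : Rules v m2 m3) {φ : Fin v → ℝ} (hφ : ∀ y, 0 ≤ φ y) :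
    𝔼 x, firstChild b ρ φ x ≤ 1 / c * 𝔼 y, φ y := by
  cases b
  · refine (expect_rowAvg_le ρ.1 fun t => hφ t.1).trans ?_
    rw [expect_fst₂ h]
    exact mul_le_mul_of_nonneg_right h.ratio₂_le (expect_nonneg hφ)
  · refine (expect_rowAvg_le ρ.2 fun t => hφ t.1).trans ?_
    rw [expect_fst₃ h]
    exact mul_le_mul_of_nonneg_right h.ratio₃_le (expect_nonneg hφ)

omit h in
lemma expect_rules_fst [Nonempty (TernaryRules v m3)]
    (f : BinaryRules v m2 → ℝ) :
    𝔼 ρ : Rules v m2 m3, f ρ.1 = 𝔼 e, f e := by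
  simp only [expect_rules, expect_const]

omit h in
lemma expect_rules_snd [Nonempty (BinaryRules v m2)]
    (f : TernaryRules v m3 → ℝ) :
    𝔼 ρ : Rules v m2 m3, f ρ.2 = 𝔼 e, f e := by
  simp only [expect_rules, expect_const]

lemma cvar_fst₂ (φ : Fin v → ℝ) : 𝕍 (fun t : Pair v => φ t.1) =
    𝕍 φ := have := h.nonempty_fin; cvar_comp_fst φ φ

lemma cvar_snd₂ (φ : Fin v → ℝ) : 𝕍 (fun t : Pair v => φ t.2) =
    𝕍 φ := have := h.nonempty_fin; cvar_comp_snd φ φ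

lemma cvar_fst₃ (φ : Fin v → ℝ) :
    𝕍 (fun t : Triple v => φ t.1) = 𝕍 φ :=
  have := h.nonempty_fin; cvar_comp_fst φ φ

lemma cvar_snd₃ (φ : Fin v → ℝ) :
    𝕍 (fun t : Triple v => φ t.2.2) = 𝕍 φ := by
  have := h.nonempty_fin
  rw [cvar_comp_snd (fun t : Pair v => φ t.2) (fun t : Pair v => φ t.2)]
  exact cvar_comp_snd φ φ

lemma expect_cvar_firstChild_le (b : Bool) (φ : Fin v → ℝ) :
    𝔼 ρ : Rules v m2 m3, 𝕍 (firstChild b ρ φ) ≤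
      2 / (c * v) * 𝕍 φ := by
  obtain ⟨_, _, _, _, _, _⟩ := h.insts
  cases b
  · refine (expect_rules_fst fun e => 𝕍 (rowAvg e fun t => φ t.1)).trans_le ((expect_cvar_rowAvg_le h.card₂ fun t => φ t.1).trans ?_)
    rw [cvar_fst₂ h, card_fin]
    refine mul_le_mul_of_nonneg_right ?_ (cvar_self_nonneg _)
    have := h.inv_m2_le
    rw [div_eq_mul_one_div, div_eq_mul_one_div 2 (c * v)]; linarith
  · refine (expect_rules_snd fun e => 𝕍 (rowAvg e fun t => φ t.1)).trans_le ((expect_cvar_rowAvg_le h.card₃ fun t => φ t.1).trans ?_)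
    rw [cvar_fst₃ h, card_fin]
    refine mul_le_mul_of_nonneg_right ?_ (cvar_self_nonneg _)
    have := h.inv_m3_le'
    rw [div_eq_mul_one_div, div_eq_mul_one_div 2 (c * v)]; linarith

lemma expect_sq_lastChild_sub_le (b : Bool) (φ : Fin v → ℝ) (x : Fin v) :
    𝔼 ρ : Rules v m2 m3, (lastChild b ρ φ x - 𝔼 y, φ y) ^ 2 ≤ 1 / (c * v) * 𝕍 φ := by
  obtain ⟨_, _, _, _, _, _⟩ := h.insts
  cases b
  · have := expect_sq_rowAvg_sub_le (κ := Fin m2) h.card₂ (fun t : Pair v => φ t.2) x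
    rw [expect_snd₂ h, cvar_snd₂ h, card_fin] at this
    refine (expect_rules_fst fun e => (rowAvg e (fun t => φ t.2) x - 𝔼 y, φ y) ^ 2).trans_le
      (this.trans ?_)
    exact mul_le_mul_of_nonneg_right h.inv_m2_le (cvar_self_nonneg _)
  · have := expect_sq_rowAvg_sub_le (κ := Fin m3) h.card₃
      (fun t : Triple v => φ t.2.2) x
    rw [expect_snd₃ h, cvar_snd₃ h, card_fin] at this
    refine (expect_rules_snd fun e => (rowAvg e (fun t => φ t.2.2) x - 𝔼 y, φ y) ^ 2).trans_le
      (this.trans ?_)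
    exact mul_le_mul_of_nonneg_right h.inv_m3_le' (cvar_self_nonneg _)

omit h in
/-- Law of total variance. -/
lemma cvar_prod_eq {α β : Type*} [Fintype α] [Fintype β] [Nonempty α] [Nonempty β]
    (κ : α × β → ℝ) :
    𝕍 κ = 𝕍 (fun y' => 𝔼 y, κ (y, y')) +
      𝔼 y', 𝕍 (fun y => κ (y, y')) := by
  have h1 : 𝔼 x, κ x * κ x = 𝔼 y', 𝔼 y, κ (y, y') * κ (y, y') := by
    rw [expect_prod, expect_swap]
  have h2 : 𝔼 x, κ x = 𝔼 y', 𝔼 y, κ (y, y') := by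
    rw [expect_prod, expect_swap]
  simp only [cvar, h1, h2, expect_sub]
  ring

omit h in
lemma cvar_add_le_of_snd {α β : Type*} [Fintype α] [Fintype β] [Nonempty α] [Nonempty β]
    (A : β → ℝ) (B : α → β → ℝ) :
    𝕍 (fun x : α × β => A x.2 + B x.1 x.2) ≤
      2 * (𝕍 A + 𝔼 x, 𝔼 x', B x x' ^ 2) := by
  refine (cvar_self_add_le (fun x : α × β => A x.2) (fun x : α × β => B x.1 x.2)).trans ?_
  rw [cvar_comp_snd (α := α) A A]
  refine mul_le_mul_of_nonneg_left (add_le_add le_rfl ?_) (by norm_num)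
  refine (cvar_self_le _).trans ?_
  rw [expect_prod]

/-- One level of contraction for a function of two adjacent symbols. -/
lemma expect_cvar_lastChild_firstChild_le (b b' : Bool) (κ : Pair v → ℝ) :
    𝔼 ρ : Rules v m2 m3,
      𝕍 (fun x : Pair v => lastChild b ρ (fun y =>
          firstChild b' ρ (fun y' => κ (y, y')) x.2) x.1) ≤ 4 / (c ^ 2 * v) * 𝕍 κ := by
  have := h.nonempty_fin
  have hcomm : ∀ (ρ : Rules v m2 m3) (κ : Pair v → ℝ) (x x' : Fin v),
      lastChild b ρ (fun y => firstChild b' ρ (fun y' => κ (y, y')) x') x =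
        firstChild b' ρ (fun y' => lastChild b ρ (fun y => κ (y, y')) x) x' := by
    intro ρ κ x x'
    cases b' <;> exact (expect_lastChild_comm _ _ _ _).symm
  set κ₂ : Fin v → ℝ := fun y' => 𝔼 y, κ (y, y') with hκ₂
  have hpt : ∀ ρ : Rules v m2 m3,
      𝕍 (fun x : Pair v => lastChild b ρ (fun y =>
          firstChild b' ρ (fun y' => κ (y, y')) x.2) x.1) ≤
      2 * (𝕍 (firstChild b' ρ κ₂) +
        1 / c * 𝔼 x, 𝔼 y', (lastChild b ρ (fun y => κ (y, y')) x - κ₂ y') ^ 2) := by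
    intro ρ
    have h1 : ∀ x : Pair v, lastChild b ρ (fun y =>
          firstChild b' ρ (fun y' => κ (y, y')) x.2) x.1 = firstChild b' ρ κ₂ x.2 +
        firstChild b' ρ (fun y' => lastChild b ρ (fun y => κ (y, y')) x.1 - κ₂ y') x.2 := by
      intro x
      rw [hcomm, firstChild_sub]; ring
    simp only [h1]
    refine (cvar_add_le_of_snd (firstChild b' ρ κ₂) fun x => firstChild b' ρ fun y' =>
      lastChild b ρ (fun y => κ (y, y')) x - κ₂ y').trans ?_
    refine mul_le_mul_of_nonneg_left (add_le_add le_rfl ?_) (by norm_num)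
    rw [← expect_const_mul]
    refine expect_mono fun x => ?_
    refine le_trans (expect_mono fun x' => sq_firstChild_le _ _ _ _) ?_
    exact expect_firstChild_le h b' ρ fun y' => sq_nonneg _
  refine (expect_mono hpt).trans ?_
  rw [expect_const_mul, expect_add, expect_const_mul]
  have h2 : 𝔼 ρ : Rules v m2 m3, 𝔼 x, 𝔼 y', (lastChild b ρ (fun y => κ (y, y')) x - κ₂ y') ^ 2 ≤
      1 / (c * v) * 𝔼 y', 𝕍 (fun y => κ (y, y')) := by
    rw [expect_swap]
    refine expect_le_of_forall_le fun x => ?_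
    rw [expect_swap, ← expect_const_mul]
    exact expect_mono fun y' => expect_sq_lastChild_sub_le h b _ x
  have h3 := expect_cvar_firstChild_le h b' κ₂
  rw [cvar_prod_eq κ]
  have hA := cvar_self_nonneg κ₂
  have hB : 0 ≤ 𝔼 y', 𝕍 (fun y => κ (y, y')) :=
    expect_nonneg fun _ => cvar_self_nonneg _
  have hc := h.pos
  have hc1 := h.le_one
  have hv := h.v_pos
  have h4 : 2 / (c * v) ≤ 2 / (c ^ 2 * v) := by
    apply div_le_div_of_nonneg_left (by norm_num) (by positivity)
    gcongr; nlinarith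
  calc _ ≤ 2 * (2 / (c * v) * 𝕍 κ₂ + 1 / c * (1 / (c * v) *
          𝔼 y', 𝕍 (fun y => κ (y, y')))) := by gcongr
    _ ≤ 2 * (2 / (c ^ 2 * v) * 𝕍 κ₂ + 2 * (1 / c * (1 / (c * v) *
          𝔼 y', 𝕍 (fun y => κ (y, y'))))) := by
        have : 0 ≤ 1 / c * (1 / (c * v) *
          𝔼 y', 𝕍 (fun y => κ (y, y'))) := by positivity
        exact mul_le_mul_of_nonneg_left (add_le_add (mul_le_mul_of_nonneg_right h4 hA)
          (by linarith)) (by norm_num)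
    _ = _ := by rw [← hκ₂]; field_simp; ring

end Level

/-! ### Double contraction -/

section Double

variable {v m2 m3 : ℕ}

/-- Relabeling of the first symbols of all right-hand sides. -/
def relabelFirst (σ : Equiv.Perm (Fin v)) (ρ : Rules v m2 m3) : Rules v m2 m3 :=
  (relabel (Equiv.prodCongr σ (Equiv.refl _)) ρ.1, relabel (Equiv.prodCongr σ (Equiv.refl _)) ρ.2)

/-- Relabeling of the last symbols of all right-hand sides. -/
def relabelLast (σ : Equiv.Perm (Fin v)) (ρ : Rules v m2 m3) : Rules v m2 m3 :=
  (relabel (Equiv.prodCongr (Equiv.refl _) σ) ρ.1,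
    relabel (Equiv.prodCongr (Equiv.refl _) (Equiv.prodCongr (Equiv.refl _) σ)) ρ.2)

lemma expect_relabelFirst (σ : Equiv.Perm (Fin v)) (f : Rules v m2 m3 → ℝ) :
    𝔼 ρ, f (relabelFirst σ ρ) = 𝔼 ρ, f ρ := by
  simp only [expect_rules, relabelFirst]
  rw [expect_relabel (Equiv.prodCongr σ (Equiv.refl _)) fun e₂ =>
    𝔼 e₃, f (e₂, relabel (Equiv.prodCongr σ (Equiv.refl _)) e₃)]
  exact expect_congr rfl fun e₂ _ => expect_relabel _ fun e₃ => f (e₂, e₃)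

lemma expect_relabelLast (σ : Equiv.Perm (Fin v)) (f : Rules v m2 m3 → ℝ) :
    𝔼 ρ, f (relabelLast σ ρ) = 𝔼 ρ, f ρ := by
  simp only [expect_rules, relabelLast]
  rw [expect_relabel (Equiv.prodCongr (Equiv.refl _) σ) fun e₂ => 𝔼 e₃, f (e₂,
    relabel (Equiv.prodCongr (Equiv.refl _) (Equiv.prodCongr (Equiv.refl _) σ)) e₃)]
  exact expect_congr rfl fun e₂ _ => expect_relabel _ fun e₃ => f (e₂, e₃)

lemma firstChild_relabelFirst (b : Bool) (σ : Equiv.Perm (Fin v)) (ρ : Rules v m2 m3)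
    (φ : Fin v → ℝ) (x : Fin v) :
    firstChild b (relabelFirst σ ρ) φ x = firstChild b ρ (fun y => φ (σ y)) x := by
  cases b <;> rfl

lemma lastChild_relabelFirst (b : Bool) (σ : Equiv.Perm (Fin v)) (ρ : Rules v m2 m3)
    (φ : Fin v → ℝ) (x : Fin v) :
    lastChild b (relabelFirst σ ρ) φ x = lastChild b ρ φ x := by
  cases b <;> rfl

lemma lastChild_relabelLast (b : Bool) (σ : Equiv.Perm (Fin v)) (ρ : Rules v m2 m3)
    (φ : Fin v → ℝ) (x : Fin v) :
    lastChild b (relabelLast σ ρ) φ x = lastChild b ρ (fun y => φ (σ y)) x := by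
  cases b <;> rfl

lemma firstChild_relabelLast (b : Bool) (σ : Equiv.Perm (Fin v)) (ρ : Rules v m2 m3)
    (φ : Fin v → ℝ) (x : Fin v) :
    firstChild b (relabelLast σ ρ) φ x = firstChild b ρ φ x := by
  cases b <;> rfl

/-- Probability that two independent rules of `x` have the same first symbol. -/
noncomputable def collFirst (b : Bool) (ρ : Rules v m2 m3) (x : Fin v) : ℝ :=
  firstChild b ρ (fun y => firstChild b ρ (fun y' => ind (y = y')) x) x

/-- Probability that two independent rules of `x` have the same last symbol. -/
noncomputable def collLast (b : Bool) (ρ : Rules v m2 m3) (x : Fin v) : ℝ :=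
  lastChild b ρ (fun y => lastChild b ρ (fun y' => ind (y = y')) x) x

lemma firstChild_eq_sum (b : Bool) (ρ : Rules v m2 m3) (φ : Fin v → ℝ) (x : Fin v) :
    firstChild b ρ φ x = ∑ a, firstChild b ρ (fun y => ind (a = y)) x * φ a := by
  have h1 : ∀ y, φ y = ∑ a, ind (a = y) * φ a := by
    intro y
    rw [sum_eq_single y (fun a _ ha => by rw [ind_false ha, zero_mul]) (by simp),
      ind_true rfl, one_mul]
  cases b
  · simp only [firstChild, rowAvg, ← expect_mul_const, ← expect_sum, ← h1]
  · simp only [firstChild, rowAvg, ← expect_mul_const, ← expect_sum, ← h1]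

lemma lastChild_eq_sum (b : Bool) (ρ : Rules v m2 m3) (φ : Fin v → ℝ) (x : Fin v) :
    lastChild b ρ φ x = ∑ a, lastChild b ρ (fun y => ind (a = y)) x * φ a := by
  have h1 : ∀ y, φ y = ∑ a, ind (a = y) * φ a := by
    intro y
    rw [sum_eq_single y (fun a _ ha => by rw [ind_false ha, zero_mul]) (by simp),
      ind_true rfl, one_mul]
  cases b
  · simp only [lastChild, rowAvg, ← expect_mul_const, ← expect_sum, ← h1]
  · simp only [lastChild, rowAvg, ← expect_mul_const, ← expect_sum, ← h1]

lemma sq_collFirst_le (b : Bool) (ρ : Rules v m2 m3) (x : Fin v) :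
    collFirst b ρ x ^ 2 ≤ ∑ a, firstChild b ρ (fun y => ind (a = y)) x ^ 3 := by
  refine (sq_firstChild_le _ _ _ _).trans_eq ?_
  rw [firstChild_eq_sum]
  exact sum_congr rfl fun a _ => by ring

lemma sq_collLast_le (b : Bool) (ρ : Rules v m2 m3) (x : Fin v) :
    collLast b ρ x ^ 2 ≤ ∑ a, lastChild b ρ (fun y => ind (a = y)) x ^ 3 := by
  refine (sq_lastChild_le _ _ _ _).trans_eq ?_
  rw [lastChild_eq_sum]
  exact sum_congr rfl fun a _ => by ring

lemma collFirst_nonneg (b : Bool) (ρ : Rules v m2 m3) (x : Fin v) : 0 ≤ collFirst b ρ x :=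
  firstChild_nonneg _ _ (fun _ => firstChild_nonneg _ _ (fun _ => ind_nonneg _) _) _

lemma expect_perm_sq_firstChild_le (hv : 2 ≤ v) (b : Bool) (ρ : Rules v m2 m3) (φ : Fin v → ℝ)
    (hφ : 𝔼 y, φ y = 0) (x : Fin v) :
    𝔼 σ : Equiv.Perm (Fin v), firstChild b ρ (fun y => φ (σ y)) x ^ 2 ≤
      collFirst b ρ x * 𝔼 y, φ y ^ 2 := by
  cases b
  · exact expect_perm_sq_expect_le hv (fun k => (ρ.1 (x, k)).1) φ hφ
  · exact expect_perm_sq_expect_le hv (fun k => (ρ.2 (x, k)).1) φ hφ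

lemma expect_perm_sq_lastChild_le (hv : 2 ≤ v) (b : Bool) (ρ : Rules v m2 m3) (φ : Fin v → ℝ)
    (hφ : 𝔼 y, φ y = 0) (x : Fin v) :
    𝔼 σ : Equiv.Perm (Fin v), lastChild b ρ (fun y => φ (σ y)) x ^ 2 ≤
      collLast b ρ x * 𝔼 y, φ y ^ 2 := by
  cases b
  · exact expect_perm_sq_expect_le hv (fun k => (ρ.1 (x, k)).2) φ hφ
  · exact expect_perm_sq_expect_le hv (fun k => (ρ.2 (x, k)).2.2) φ hφ

lemma expect_ind_eq (a : Fin v) : 𝔼 y, ind (a = y) = 1 / (v : ℝ) := by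
  have : ∀ y, ind (a = y) = if a = y then 1 else 0 := fun y => by
    unfold ind; split_ifs <;> rfl
  simp only [this, expect_ite_eq_mul, card_fin, mul_one]

variable {c : ℝ} (h : Regime c v m2 m3)

include h

lemma cube_bound {m : ℕ} (hm : c * (v : ℝ) ≤ m) :
    1 / (v : ℝ) * (1 / (v : ℝ) * (1 / (v : ℝ) + 6 / (m : ℝ)) + 4 / (m : ℝ) ^ 2) ≤
      11 / (c ^ 2 * (v : ℝ) ^ 3) := by
  have hc := h.pos
  have hv := h.v_pos
  have hcv : 0 < c * v := mul_pos hc hv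
  have hm0 : (0 : ℝ) < m := hcv.trans_le hm
  have hc1 := h.le_one
  have h1 : 6 / (m : ℝ) ≤ 6 / (c * v) := div_le_div_of_nonneg_left (by norm_num) hcv hm
  have h2 : 4 / (m : ℝ) ^ 2 ≤ 4 / (c * v) ^ 2 :=
    div_le_div_of_nonneg_left (by norm_num) (by positivity) (by gcongr)
  calc _ ≤ 1 / (v : ℝ) * (1 / (v : ℝ) * (1 / (v : ℝ) + 6 / (c * v)) + 4 / (c * v) ^ 2) := by
        gcongr
    _ = (c ^ 2 + 6 * c + 4) / (c ^ 2 * (v : ℝ) ^ 3) := by field_simp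
    _ ≤ _ := by
        apply div_le_div_of_nonneg_right _ (by positivity)
        nlinarith

/-- Third moments of the transition probabilities. -/
lemma expect_firstChild_cube_le (b : Bool) (a x : Fin v) :
    𝔼 ρ : Rules v m2 m3, firstChild b ρ (fun y => ind (a = y)) x ^ 3 ≤
      11 / (c ^ 2 * (v : ℝ) ^ 3) := by
  obtain ⟨_, _, _, _, _, _⟩ := h.insts
  cases b
  · refine (expect_rules_fst fun e => rowAvg e (fun t => ind (a = t.1)) x ^ 3).trans_le ?_
    refine (expect_rowAvg_cube_le (fun t => ind_nonneg _) (fun t => ind_le_one _) x).trans ?_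
    rw [expect_fst₂ h fun y => ind (a = y), expect_ind_eq, card_fin]
    exact cube_bound h h.le_m2
  · refine (expect_rules_snd fun e => rowAvg e (fun t => ind (a = t.1)) x ^ 3).trans_le ?_
    refine (expect_rowAvg_cube_le (fun t => ind_nonneg _) (fun t => ind_le_one _) x).trans ?_
    rw [expect_fst₃ h fun y => ind (a = y), expect_ind_eq, card_fin]
    exact cube_bound h h.le_m3'

lemma expect_lastChild_cube_le (b : Bool) (a x : Fin v) :
    𝔼 ρ : Rules v m2 m3, lastChild b ρ (fun y => ind (a = y)) x ^ 3 ≤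
      11 / (c ^ 2 * (v : ℝ) ^ 3) := by
  obtain ⟨_, _, _, _, _, _⟩ := h.insts
  cases b
  · refine (expect_rules_fst fun e => rowAvg e (fun t => ind (a = t.2)) x ^ 3).trans_le ?_
    refine (expect_rowAvg_cube_le (fun t => ind_nonneg _) (fun t => ind_le_one _) x).trans ?_
    rw [expect_snd₂ h fun y => ind (a = y), expect_ind_eq, card_fin]
    exact cube_bound h h.le_m2
  · refine (expect_rules_snd fun e => rowAvg e (fun t => ind (a = t.2.2)) x ^ 3).trans_le ?_
    refine (expect_rowAvg_cube_le (fun t => ind_nonneg _) (fun t => ind_le_one _) x).trans ?_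
    rw [expect_snd₃ h fun y => ind (a = y), expect_ind_eq, card_fin]
    exact cube_bound h h.le_m3'

/-- Collisions are rare. -/
lemma expect_coll_mul_coll_le (b b' : Bool) :
    𝔼 ρ : Rules v m2 m3, (𝔼 x, collFirst b' ρ x) * (𝔼 x, collLast b ρ x) ≤
      11 / (c ^ 2 * (v : ℝ) ^ 2) := by
  have := h.nonempty_fin
  have hv := h.v_pos
  have hc := h.pos
  have h1 : ∀ ρ : Rules v m2 m3, (𝔼 x, collFirst b' ρ x) * (𝔼 x, collLast b ρ x) ≤
      1 / 2 * (𝔼 x, ∑ a, firstChild b' ρ (fun y => ind (a = y)) x ^ 3) +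
      1 / 2 * (𝔼 x, ∑ a, lastChild b ρ (fun y => ind (a = y)) x ^ 3) := by
    intro ρ
    have e1 := (sq_expect_le (collFirst b' ρ)).trans (expect_mono (sq_collFirst_le b' ρ))
    have e2 := (sq_expect_le (collLast b ρ)).trans (expect_mono (sq_collLast_le b ρ))
    nlinarith [sq_nonneg ((𝔼 x, collFirst b' ρ x) - 𝔼 x, collLast b ρ x)]
  refine (expect_mono h1).trans ?_
  have hs : ∀ f : Rules v m2 m3 → Fin v → Fin v → ℝ,
      (∀ x a, 𝔼 ρ, f ρ x a ≤ 11 / (c ^ 2 * (v : ℝ) ^ 3)) →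
      𝔼 ρ, 𝔼 x, ∑ a, f ρ x a ≤ 11 / (c ^ 2 * (v : ℝ) ^ 2) := by
    intro f hf
    rw [expect_swap]
    refine expect_le_of_forall_le fun x => ?_
    rw [expect_sum]
    refine (sum_le_sum fun a _ => hf x a).trans ?_
    rw [Finset.sum_const, Finset.card_univ, card_fin, nsmul_eq_mul]
    apply le_of_eq
    field_simp
  rw [expect_add, expect_const_mul, expect_const_mul]
  have e1 := hs (fun ρ x a => firstChild b' ρ (fun y => ind (a = y)) x ^ 3)
    fun x a => expect_firstChild_cube_le h b' a x
  have e2 := hs (fun ρ x a => lastChild b ρ (fun y => ind (a = y)) x ^ 3)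
    fun x a => expect_lastChild_cube_le h b a x
  linarith

/-- For a doubly centered function of two adjacent symbols, one level contracts twice. -/
lemma expect_sq_lastChild_firstChild_le (b b' : Bool) (g : Fin v → Fin v → ℝ)
    (hg : ∀ y, 𝔼 y', g y y' = 0) (hg' : ∀ y', 𝔼 y, g y y' = 0) :
    𝔼 ρ : Rules v m2 m3, 𝔼 x, 𝔼 x',
        firstChild b' ρ (fun y' => lastChild b ρ (fun y => g y y') x) x' ^ 2 ≤
      11 / (c ^ 2 * (v : ℝ) ^ 2) * 𝔼 y, 𝔼 y', g y y' ^ 2 := by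
  have := h.nonempty_fin
  have hψ : ∀ (ρ : Rules v m2 m3) x, 𝔼 y', lastChild b ρ (fun y => g y y') x = 0 := by
    intro ρ x
    rw [expect_lastChild_comm b ρ (fun y' y => g y y') x]
    simp only [hg]
    exact lastChild_const h b ρ 0 x
  set H : Rules v m2 m3 → ℝ := fun ρ => 𝔼 x, 𝔼 x',
        firstChild b' ρ (fun y' => lastChild b ρ (fun y => g y y') x) x' ^ 2 with hH
  set H₂ : Rules v m2 m3 → ℝ := fun ρ => (𝔼 x, collFirst b' ρ x) *
    𝔼 x, 𝔼 y', lastChild b ρ (fun y => g y y') x ^ 2 with hH₂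
  have s1 : 𝔼 ρ, H ρ ≤ 𝔼 ρ, H₂ ρ := by
    have e1 : 𝔼 ρ, H ρ = 𝔼 σ : Equiv.Perm (Fin v), 𝔼 ρ, H (relabelFirst σ ρ) := by
      simp only [expect_relabelFirst, expect_const]
    rw [e1, expect_swap]
    refine expect_mono fun ρ => ?_
    simp only [hH, hH₂, firstChild_relabelFirst, lastChild_relabelFirst]
    rw [expect_swap, ← expect_const_mul]
    refine expect_mono fun x => ?_
    rw [expect_swap, ← expect_mul_const]
    refine expect_mono fun x' => ?_
    exact expect_perm_sq_firstChild_le h.two_le b' ρ _ (hψ ρ x) x'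
  have s2 : 𝔼 ρ, H₂ ρ ≤ 𝔼 ρ : Rules v m2 m3, (𝔼 x, collFirst b' ρ x) * (𝔼 x, collLast b ρ x) *
      𝔼 y', 𝔼 y, g y y' ^ 2 := by
    have e1 : 𝔼 ρ, H₂ ρ = 𝔼 σ : Equiv.Perm (Fin v), 𝔼 ρ, H₂ (relabelLast σ ρ) := by
      simp only [expect_relabelLast, expect_const]
    rw [e1, expect_swap]
    refine expect_mono fun ρ => ?_
    have e2 : ∀ σ : Equiv.Perm (Fin v), 𝔼 x, collFirst b' (relabelLast σ ρ) x =
        𝔼 x, collFirst b' ρ x := by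
      intro σ
      simp only [collFirst, firstChild_relabelLast]
    simp only [hH₂, e2, lastChild_relabelLast, expect_const_mul, mul_assoc]
    refine mul_le_mul_of_nonneg_left ?_ (expect_nonneg fun x => collFirst_nonneg _ _ _)
    rw [expect_swap, ← expect_mul_const]
    refine expect_mono fun x => ?_
    rw [expect_swap, ← expect_const_mul]
    refine expect_mono fun y' => ?_
    exact expect_perm_sq_lastChild_le h.two_le b ρ (fun y => g y y') (hg' y') x
  refine s1.trans (s2.trans ?_)
  rw [expect_mul_const, expect_swap fun y y' => g y y' ^ 2]
  exact mul_le_mul_of_nonneg_right (expect_coll_mul_coll_le h b b')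
    (expect_nonneg fun _ => expect_nonneg fun _ => sq_nonneg _)

end Double

/-! ### Averages over derivations -/

section Trees

variable {v m2 m3 : ℕ}

/-- Average over the derivations of a given depth. -/
noncomputable def treeE (p : ℝ) {ℓ : ℕ} (Φ : ParseTree m2 m3 ℓ → ℝ) : ℝ := ∑ τ, τ.prob p * Φ τ

/-- Number of nodes of the last level of a derivation. -/
def ParseTree.size : ∀ {ℓ : ℕ}, ParseTree m2 m3 ℓ → ℕ
  | 0, _ => 1
  | _ + 1, Sum.inl (_, s, t) => s.size + t.size
  | _ + 1, Sum.inr (_, s, t, u) => s.size + t.size + u.size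

/-- The symbols of the last level of a derivation. -/
def nodes : ∀ {ℓ : ℕ}, Grammar v m2 m3 ℓ → Fin v → ParseTree m2 m3 ℓ → List (Fin v)
  | 0, _, r, _ => [r]
  | _ + 1, U, r, Sum.inl (k, s, t) =>
      nodes (Fin.tail U) ((U 0).1 (r, k)).1 s ++ nodes (Fin.tail U) ((U 0).1 (r, k)).2 t
  | _ + 1, U, r, Sum.inr (k, s, t, u) =>
      nodes (Fin.tail U) ((U 0).2 (r, k)).1 s ++ nodes (Fin.tail U) ((U 0).2 (r, k)).2.1 t ++
        nodes (Fin.tail U) ((U 0).2 (r, k)).2.2 u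

/-- The first symbol of the last level. -/
def firstNode : ∀ {ℓ : ℕ}, Grammar v m2 m3 ℓ → Fin v → ParseTree m2 m3 ℓ → Fin v
  | 0, _, r, _ => r
  | _ + 1, U, r, Sum.inl (k, s, _) => firstNode (Fin.tail U) ((U 0).1 (r, k)).1 s
  | _ + 1, U, r, Sum.inr (k, s, _, _) => firstNode (Fin.tail U) ((U 0).2 (r, k)).1 s

/-- The last symbol of the last level. -/
def lastNode : ∀ {ℓ : ℕ}, Grammar v m2 m3 ℓ → Fin v → ParseTree m2 m3 ℓ → Fin v
  | 0, _, r, _ => r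
  | _ + 1, U, r, Sum.inl (k, _, t) => lastNode (Fin.tail U) ((U 0).1 (r, k)).2 t
  | _ + 1, U, r, Sum.inr (k, _, _, u) => lastNode (Fin.tail U) ((U 0).2 (r, k)).2.2 u

/-- Sum of `g` over the adjacent pairs of symbols of the last level; a pair that branches `k + 1`
levels above has the weight `a k`. -/
noncomputable def adjSum (a : ℕ → ℝ) (g : Fin v → Fin v → ℝ) :
    ∀ {ℓ : ℕ}, Grammar v m2 m3 ℓ → Fin v → ParseTree m2 m3 ℓ → ℝ
  | 0, _, _, _ => 0
  | ℓ + 1, U, r, Sum.inl (k, s, t) =>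
      adjSum a g (Fin.tail U) ((U 0).1 (r, k)).1 s + adjSum a g (Fin.tail U) ((U 0).1 (r, k)).2 t +
        a ℓ * g (lastNode (Fin.tail U) ((U 0).1 (r, k)).1 s)
          (firstNode (Fin.tail U) ((U 0).1 (r, k)).2 t)
  | ℓ + 1, U, r, Sum.inr (k, s, t, u) =>
      adjSum a g (Fin.tail U) ((U 0).2 (r, k)).1 s +
        adjSum a g (Fin.tail U) ((U 0).2 (r, k)).2.1 t +
        adjSum a g (Fin.tail U) ((U 0).2 (r, k)).2.2 u +
        a ℓ * g (lastNode (Fin.tail U) ((U 0).2 (r, k)).1 s)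
          (firstNode (Fin.tail U) ((U 0).2 (r, k)).2.1 t) +
        a ℓ * g (lastNode (Fin.tail U) ((U 0).2 (r, k)).2.1 t)
          (firstNode (Fin.tail U) ((U 0).2 (r, k)).2.2 u)

section treeE

variable (p : ℝ) {ℓ ℓ' : ℕ}

lemma treeE_add (Φ Ψ : ParseTree m2 m3 ℓ → ℝ) :
    treeE p (fun τ => Φ τ + Ψ τ) = treeE p Φ + treeE p Ψ := by
  simp only [treeE, mul_add, sum_add_distrib]

lemma treeE_sub (Φ Ψ : ParseTree m2 m3 ℓ → ℝ) :
    treeE p (fun τ => Φ τ - Ψ τ) = treeE p Φ - treeE p Ψ := by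
  simp only [treeE, mul_sub, sum_sub_distrib]

lemma treeE_const_mul (c : ℝ) (Φ : ParseTree m2 m3 ℓ → ℝ) :
    treeE p (fun τ => c * Φ τ) = c * treeE p Φ := by
  simp only [treeE, mul_sum]
  exact sum_congr rfl fun τ _ => by ring

lemma treeE_mul_const (c : ℝ) (Φ : ParseTree m2 m3 ℓ → ℝ) :
    treeE p (fun τ => Φ τ * c) = treeE p Φ * c := by
  simp only [mul_comm _ c, treeE_const_mul]

lemma treeE_sum {κ : Type*} (s : Finset κ) (f : κ → ParseTree m2 m3 ℓ → ℝ) :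
    treeE p (fun τ => ∑ i ∈ s, f i τ) = ∑ i ∈ s, treeE p (f i) := by
  simp only [treeE, mul_sum]
  exact Finset.sum_comm

lemma treeE_expect {κ : Type*} [Fintype κ] (f : κ → ParseTree m2 m3 ℓ → ℝ) :
    treeE p (fun τ => 𝔼 i, f i τ) = 𝔼 i, treeE p (f i) := by
  simp only [treeE, expect_sum, expect_const_mul]

lemma treeE_comm (f : ParseTree m2 m3 ℓ → ParseTree m2 m3 ℓ' → ℝ) :
    treeE p (fun τ => treeE p fun τ' => f τ τ') = treeE p fun τ' => treeE p fun τ => f τ τ' := by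
  simp only [treeE, mul_sum]
  rw [Finset.sum_comm]
  exact sum_congr rfl fun τ _ => sum_congr rfl fun τ' _ => by ring

lemma treeE_zero (Φ : ParseTree m2 m3 0 → ℝ) : treeE p Φ = Φ () := by
  exact (Fintype.sum_unique (ι := Unit) (fun τ : Unit => (1 : ℝ) * Φ τ)).trans (one_mul _)

lemma treeE_succ (Φ : ParseTree m2 m3 (ℓ + 1) → ℝ) :
    treeE p Φ = p * (𝔼 k, treeE p fun s => treeE p fun t => Φ (Sum.inl (k, s, t))) +
      (1 - p) * 𝔼 k, treeE p fun s => treeE p fun t => treeE p fun u =>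
        Φ (Sum.inr (k, s, t, u)) := by
  refine (Fintype.sum_sum_type (α₁ := Fin m2 × ParseTree m2 m3 ℓ × ParseTree m2 m3 ℓ)
    (α₂ := Fin m3 × ParseTree m2 m3 ℓ × ParseTree m2 m3 ℓ × ParseTree m2 m3 ℓ)
    fun τ => ParseTree.prob (L := ℓ + 1) p τ * Φ τ).trans ?_
  congr 1
  · rw [sum_prod_type, expect_eq, card_fin, mul_sum, mul_sum]
    refine sum_congr rfl fun k _ => ?_
    rw [sum_prod_type]
    simp only [treeE, mul_sum]
    refine sum_congr rfl fun s _ => sum_congr rfl fun t _ => ?_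
    simp only [ParseTree.prob]
    ring
  · rw [sum_prod_type, expect_eq, card_fin, mul_sum, mul_sum]
    refine sum_congr rfl fun k _ => ?_
    rw [sum_prod_type]
    simp only [sum_prod_type, treeE, mul_sum]
    refine sum_congr rfl fun s _ => sum_congr rfl fun t _ =>
      sum_congr rfl fun u _ => ?_
    simp only [ParseTree.prob]
    ring

lemma prob_nonneg {p : ℝ} (hp : 0 ≤ p) (hp' : p ≤ 1) :
    ∀ {ℓ : ℕ} (τ : ParseTree m2 m3 ℓ), 0 ≤ τ.prob p
  | 0, _ => zero_le_one
  | _ + 1, Sum.inl (_, s, t) =>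
      mul_nonneg (by positivity) (mul_nonneg (prob_nonneg hp hp' s) (prob_nonneg hp hp' t))
  | _ + 1, Sum.inr (_, s, t, u) =>
      mul_nonneg (div_nonneg (by linarith) (by positivity))
        (mul_nonneg (mul_nonneg (prob_nonneg hp hp' s) (prob_nonneg hp hp' t))
          (prob_nonneg hp hp' u))

lemma two_pow_le_size : ∀ {ℓ : ℕ} (τ : ParseTree m2 m3 ℓ), 2 ^ ℓ ≤ τ.size
  | 0, _ => le_rfl
  | _ + 1, Sum.inl (_, s, t) => by
      have := two_pow_le_size s
      have := two_pow_le_size t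
      simp only [ParseTree.size, pow_succ]; omega
  | _ + 1, Sum.inr (_, s, t, u) => by
      have := two_pow_le_size s
      have := two_pow_le_size t
      simp only [ParseTree.size, pow_succ]; omega

lemma size_le_three_pow : ∀ {ℓ : ℕ} (τ : ParseTree m2 m3 ℓ), τ.size ≤ 3 ^ ℓ
  | 0, _ => le_rfl
  | _ + 1, Sum.inl (_, s, t) => by
      have := size_le_three_pow s
      have := size_le_three_pow t
      simp only [ParseTree.size, pow_succ]; omega
  | _ + 1, Sum.inr (_, s, t, u) => by
      have := size_le_three_pow s
      have := size_le_three_pow t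
      have := size_le_three_pow u
      simp only [ParseTree.size, pow_succ]; omega

lemma treeE_mono {p : ℝ} (hp : 0 ≤ p) (hp' : p ≤ 1) {Φ Ψ : ParseTree m2 m3 ℓ → ℝ}
    (h : ∀ τ, Φ τ ≤ Ψ τ) : treeE p Φ ≤ treeE p Ψ :=
  sum_le_sum fun τ _ => mul_le_mul_of_nonneg_left (h τ) (prob_nonneg hp hp' τ)

lemma treeE_one [Nonempty (Fin m2)] [Nonempty (Fin m3)] :
    ∀ ℓ : ℕ, treeE p (fun _ : ParseTree m2 m3 ℓ => 1) = 1
  | 0 => treeE_zero _ _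
  | ℓ + 1 => by
      rw [treeE_succ]
      simp only [treeE_one ℓ, expect_const]
      ring

lemma treeE_const [Nonempty (Fin m2)] [Nonempty (Fin m3)] (c : ℝ) :
    treeE p (fun _ : ParseTree m2 m3 ℓ => c) = c := by
  have := treeE_const_mul (m2 := m2) (m3 := m3) p c (fun _ : ParseTree m2 m3 ℓ => 1)
  simpa [treeE_one] using this

lemma abs_treeE_le {p : ℝ} (hp : 0 ≤ p) (hp' : p ≤ 1) (Φ : ParseTree m2 m3 ℓ → ℝ) :
    |treeE p Φ| ≤ treeE p fun τ => |Φ τ| := by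
  refine (Finset.abs_sum_le_sum_abs _ _).trans (le_of_eq ?_)
  exact sum_congr rfl fun τ _ => by rw [abs_mul, abs_of_nonneg (prob_nonneg hp hp' τ)]

end treeE

/-- Average of `h` over the size of an independent derivation of depth `ℓ` added to `n`. -/
noncomputable def conv (p : ℝ) (m2 m3 ℓ : ℕ) (h : ℕ → ℝ) (n : ℕ) : ℝ :=
  treeE p fun τ : ParseTree m2 m3 ℓ => h (n + τ.size)

/-- `conv` once for a binary rule, twice for a ternary one: the effect of the siblings of a given
child. -/
noncomputable def convs (p : ℝ) (m2 m3 ℓ : ℕ) : Bool → (ℕ → ℝ) → ℕ → ℝ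
  | false, h => conv p m2 m3 ℓ h
  | true, h => conv p m2 m3 ℓ (conv p m2 m3 ℓ h)

variable (p : ℝ)

lemma treeE₂_left {ℓ : ℕ} (h : ℕ → ℝ) (X : ParseTree m2 m3 ℓ → ℝ) :
    treeE p (fun s => treeE p fun t : ParseTree m2 m3 ℓ => h (s.size + t.size) * X s) =
      treeE p fun s => conv p m2 m3 ℓ h s.size * X s := by
  simp only [treeE_mul_const, conv]

lemma treeE₂_right {ℓ : ℕ} (h : ℕ → ℝ) (X : ParseTree m2 m3 ℓ → ℝ) :
    treeE p (fun s : ParseTree m2 m3 ℓ => treeE p fun t => h (s.size + t.size) * X t) =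
      treeE p fun s => conv p m2 m3 ℓ h s.size * X s := by
  rw [treeE_comm, ← treeE₂_left]
  simp only [add_comm]

lemma treeE₃_left {ℓ : ℕ} (h : ℕ → ℝ) (X : ParseTree m2 m3 ℓ → ParseTree m2 m3 ℓ → ℝ) :
    treeE p (fun s => treeE p fun t => treeE p fun u : ParseTree m2 m3 ℓ =>
      h (s.size + t.size + u.size) * X s t) =
    treeE p fun s => treeE p fun t => conv p m2 m3 ℓ h (s.size + t.size) * X s t := by
  simp only [treeE_mul_const, conv]

lemma treeE₃_right {ℓ : ℕ} (h : ℕ → ℝ) (X : ParseTree m2 m3 ℓ → ParseTree m2 m3 ℓ → ℝ) :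
    treeE p (fun s : ParseTree m2 m3 ℓ => treeE p fun t => treeE p fun u =>
      h (s.size + t.size + u.size) * X t u) =
    treeE p fun s => treeE p fun t => conv p m2 m3 ℓ h (s.size + t.size) * X s t := by
  rw [treeE_comm]
  have : ∀ t : ParseTree m2 m3 ℓ, treeE p (fun s : ParseTree m2 m3 ℓ => treeE p fun u =>
      h (s.size + t.size + u.size) * X t u) = treeE p fun u =>
        conv p m2 m3 ℓ h (t.size + u.size) * X t u := by
    intro t
    rw [treeE_comm]
    simp only [treeE_mul_const, conv]
    congr 1; funext u; congr 2; funext s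
    congr 1; omega
  simp only [this]

/-! ### The functionals of derivations -/

/-- Root-conditional average of `h (size) * ∑ F` over the symbols of the last level. -/
noncomputable def nodeF {ℓ : ℕ} (h : ℕ → ℝ) (F : Fin v → ℝ) (U : Grammar v m2 m3 ℓ) (r : Fin v) :
    ℝ := treeE p fun τ => h τ.size * ((nodes U r τ).map F).sum

/-- Root-conditional average of `h (size) * F (first symbol)`. -/
noncomputable def firstF {ℓ : ℕ} (h : ℕ → ℝ) (F : Fin v → ℝ) (U : Grammar v m2 m3 ℓ) (r : Fin v) :
    ℝ := treeE p fun τ => h τ.size * F (firstNode U r τ)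

/-- Root-conditional average of `h (size) * F (last symbol)`. -/
noncomputable def lastF {ℓ : ℕ} (h : ℕ → ℝ) (F : Fin v → ℝ) (U : Grammar v m2 m3 ℓ) (r : Fin v) :
    ℝ := treeE p fun τ => h τ.size * F (lastNode U r τ)

/-- Root-conditional average of `h (size) * adjSum`. -/
noncomputable def adjF {ℓ : ℕ} (a : ℕ → ℝ) (h : ℕ → ℝ) (g : Fin v → Fin v → ℝ)
    (U : Grammar v m2 m3 ℓ) (r : Fin v) : ℝ :=
  treeE p fun τ => h τ.size * adjSum a g U r τ

/-- Average of `h (size) * g (last symbol, first symbol)` over adjacent derivations. -/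
noncomputable def crossF {ℓ : ℕ} (h : ℕ → ℝ) (g : Fin v → Fin v → ℝ) (U : Grammar v m2 m3 ℓ)
    (x x' : Fin v) : ℝ :=
  treeE p fun s => treeE p fun t => h (s.size + t.size) * g (lastNode U x s) (firstNode U x' t)

lemma nodeF_zero (h : ℕ → ℝ) (F : Fin v → ℝ) (U : Grammar v m2 m3 0) (r : Fin v) :
    nodeF p h F U r = h 1 * F r := by
  rw [nodeF, treeE_zero]; simp [nodes, ParseTree.size]

lemma firstF_zero (h : ℕ → ℝ) (F : Fin v → ℝ) (U : Grammar v m2 m3 0) (r : Fin v) :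
    firstF p h F U r = h 1 * F r := by
  rw [firstF, treeE_zero]; simp [firstNode, ParseTree.size]

lemma lastF_zero (h : ℕ → ℝ) (F : Fin v → ℝ) (U : Grammar v m2 m3 0) (r : Fin v) :
    lastF p h F U r = h 1 * F r := by
  rw [lastF, treeE_zero]; simp [lastNode, ParseTree.size]

lemma adjF_zero (a h : ℕ → ℝ) (g : Fin v → Fin v → ℝ) (U : Grammar v m2 m3 0) (r : Fin v) :
    adjF p a h g U r = 0 := by
  rw [adjF, treeE_zero]; simp [adjSum]

lemma crossF_zero (h : ℕ → ℝ) (g : Fin v → Fin v → ℝ) (U : Grammar v m2 m3 0) (x x' : Fin v) :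
    crossF p h g U x x' = h 2 * g x x' := by
  rw [crossF, treeE_zero, treeE_zero]; simp [lastNode, firstNode, ParseTree.size]

lemma nodeF_succ {ℓ : ℕ} (h : ℕ → ℝ) (F : Fin v → ℝ) (U : Grammar v m2 m3 (ℓ + 1)) :
    nodeF p h F U = stepAvg p (U 0)
      (fun w => nodeF p (convs p m2 m3 ℓ false h) F (Fin.tail U) w.1 +
        nodeF p (convs p m2 m3 ℓ false h) F (Fin.tail U) w.2)
      (fun w => nodeF p (convs p m2 m3 ℓ true h) F (Fin.tail U) w.1 +
        (nodeF p (convs p m2 m3 ℓ true h) F (Fin.tail U) w.2.1 +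
        nodeF p (convs p m2 m3 ℓ true h) F (Fin.tail U) w.2.2)) := by
  funext r
  rw [nodeF, treeE_succ, stepAvg, rowAvg, rowAvg]
  congr 2
  · refine expect_congr rfl fun k _ => ?_
    simp only [nodes, ParseTree.size, List.map_append, List.sum_append, mul_add, treeE_add]
    rw [treeE₂_left, treeE₂_right]
    rfl
  · refine expect_congr rfl fun k _ => ?_
    simp only [nodes, ParseTree.size, List.map_append, List.sum_append, mul_add, treeE_add]
    rw [treeE₃_left p h fun s t => ((nodes (Fin.tail U) ((U 0).2 (r, k)).1 s).map F).sum,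
      treeE₃_left p h fun s t => ((nodes (Fin.tail U) ((U 0).2 (r, k)).2.1 t).map F).sum,
      treeE₃_right p h fun t u => ((nodes (Fin.tail U) ((U 0).2 (r, k)).2.2 u).map F).sum,
      treeE₂_left, treeE₂_right, treeE₂_right, add_assoc]
    rfl

lemma firstF_succ {ℓ : ℕ} (h : ℕ → ℝ) (F : Fin v → ℝ) (U : Grammar v m2 m3 (ℓ + 1)) :
    firstF p h F U = stepAvg p (U 0)
      (fun w => firstF p (convs p m2 m3 ℓ false h) F (Fin.tail U) w.1)
      (fun w => firstF p (convs p m2 m3 ℓ true h) F (Fin.tail U) w.1) := by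
  funext r
  rw [firstF, treeE_succ, stepAvg, rowAvg, rowAvg]
  congr 2
  · refine expect_congr rfl fun k _ => ?_
    simp only [firstNode, ParseTree.size]
    rw [treeE₂_left]
    rfl
  · refine expect_congr rfl fun k _ => ?_
    simp only [firstNode, ParseTree.size]
    rw [treeE₃_left p h fun s t => F (firstNode (Fin.tail U) ((U 0).2 (r, k)).1 s), treeE₂_left]
    rfl

lemma lastF_succ {ℓ : ℕ} (h : ℕ → ℝ) (F : Fin v → ℝ) (U : Grammar v m2 m3 (ℓ + 1)) :
    lastF p h F U = stepAvg p (U 0)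
      (fun w => lastF p (convs p m2 m3 ℓ false h) F (Fin.tail U) w.2)
      (fun w => lastF p (convs p m2 m3 ℓ true h) F (Fin.tail U) w.2.2) := by
  funext r
  rw [lastF, treeE_succ, stepAvg, rowAvg, rowAvg]
  congr 2
  · refine expect_congr rfl fun k _ => ?_
    simp only [lastNode, ParseTree.size]
    rw [treeE₂_right]
    rfl
  · refine expect_congr rfl fun k _ => ?_
    simp only [lastNode, ParseTree.size]
    rw [treeE₃_right p h fun t u => F (lastNode (Fin.tail U) ((U 0).2 (r, k)).2.2 u), treeE₂_right]
    rfl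

lemma adjF_succ {ℓ : ℕ} (a h : ℕ → ℝ) (g : Fin v → Fin v → ℝ) (U : Grammar v m2 m3 (ℓ + 1)) :
    adjF p a h g U = stepAvg p (U 0)
      (fun w => adjF p a (convs p m2 m3 ℓ false h) g (Fin.tail U) w.1 +
        adjF p a (convs p m2 m3 ℓ false h) g (Fin.tail U) w.2 +
        a ℓ * crossF p h g (Fin.tail U) w.1 w.2)
      (fun w => adjF p a (convs p m2 m3 ℓ true h) g (Fin.tail U) w.1 +
        (adjF p a (convs p m2 m3 ℓ true h) g (Fin.tail U) w.2.1 +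
        adjF p a (convs p m2 m3 ℓ true h) g (Fin.tail U) w.2.2) +
        a ℓ * crossF p (convs p m2 m3 ℓ false h) g (Fin.tail U) w.1 w.2.1 +
        a ℓ * crossF p (convs p m2 m3 ℓ false h) g (Fin.tail U) w.2.1 w.2.2) := by
  funext r
  rw [adjF, treeE_succ, stepAvg, rowAvg, rowAvg]
  have hm : ∀ x y z : ℝ, x * (y * z) = y * (x * z) := fun x y z => by ring
  congr 2
  · refine expect_congr rfl fun k _ => ?_
    simp only [adjSum, ParseTree.size, mul_add, treeE_add, hm _ (a ℓ), treeE_const_mul]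
    rw [treeE₂_left, treeE₂_right]
    rfl
  · refine expect_congr rfl fun k _ => ?_
    simp only [adjSum, ParseTree.size, mul_add, treeE_add, hm _ (a ℓ), treeE_const_mul]
    rw [treeE₃_left p h fun s t => adjSum a g (Fin.tail U) ((U 0).2 (r, k)).1 s,
      treeE₃_left p h fun s t => adjSum a g (Fin.tail U) ((U 0).2 (r, k)).2.1 t,
      treeE₃_right p h fun t u => adjSum a g (Fin.tail U) ((U 0).2 (r, k)).2.2 u,
      treeE₂_left, treeE₂_right, treeE₂_right, add_assoc (adjF p a _ g _ _),
      treeE₃_left p h fun s t => g (lastNode (Fin.tail U) ((U 0).2 (r, k)).1 s)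
          (firstNode (Fin.tail U) ((U 0).2 (r, k)).2.1 t),
      treeE₃_right p h fun t u => g (lastNode (Fin.tail U) ((U 0).2 (r, k)).2.1 t)
          (firstNode (Fin.tail U) ((U 0).2 (r, k)).2.2 u)]
    simp only [adjF, crossF, convs]
    ring

/-- Probability of a binary (`false`) or ternary (`true`) rule. -/
def arityProb (p : ℝ) : Bool → ℝ
  | false => p
  | true => 1 - p

lemma treeE_firstNode {ℓ : ℕ} (h : ℕ → ℝ) (γ : Fin v → ℝ) (U : Grammar v m2 m3 (ℓ + 1))
    (x : Fin v) :
    treeE p (fun t => h t.size * γ (firstNode U x t)) = ∑ b, arityProb p b *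
      firstChild b (U 0) (fun y => treeE p fun t => convs p m2 m3 ℓ b h t.size *
        γ (firstNode (Fin.tail U) y t)) x := by
  have := congrFun (firstF_succ p h γ U) x
  rw [sum_bool]
  exact this.trans (add_comm _ _)

lemma treeE_lastNode {ℓ : ℕ} (h : ℕ → ℝ) (γ : Fin v → ℝ) (U : Grammar v m2 m3 (ℓ + 1))
    (x : Fin v) :
    treeE p (fun t => h t.size * γ (lastNode U x t)) = ∑ b, arityProb p b *
      lastChild b (U 0) (fun y => treeE p fun t => convs p m2 m3 ℓ b h t.size *
        γ (lastNode (Fin.tail U) y t)) x := by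
  have := congrFun (lastF_succ p h γ U) x
  rw [sum_bool]
  exact this.trans (add_comm _ _)

lemma convs_shift {ℓ : ℕ} (b : Bool) (h : ℕ → ℝ) (m n : ℕ) :
    convs p m2 m3 ℓ b (fun n => h (m + n)) n = convs p m2 m3 ℓ b h (m + n) := by
  cases b <;> simp only [convs, conv, add_assoc]

lemma treeE_lastChild {ℓ : ℕ} (b : Bool) (ρ : Rules v m2 m3) (φ : ParseTree m2 m3 ℓ → Fin v → ℝ)
    (x : Fin v) : treeE p (fun s => lastChild b ρ (φ s) x) =
      lastChild b ρ (fun y => treeE p fun s => φ s y) x := by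
  cases b <;> simp only [lastChild, rowAvg, treeE_expect]

lemma treeE_firstChild {ℓ : ℕ} (b : Bool) (ρ : Rules v m2 m3) (φ : ParseTree m2 m3 ℓ → Fin v → ℝ)
    (x : Fin v) : treeE p (fun s => firstChild b ρ (φ s) x) =
      firstChild b ρ (fun y => treeE p fun s => φ s y) x := by
  cases b <;> simp only [firstChild, rowAvg, treeE_expect]

lemma lastChild_firstChild_comm (b b' : Bool) (ρ : Rules v m2 m3) (κ : Fin v → Fin v → ℝ)
    (x x' : Fin v) :
    lastChild b ρ (fun y => firstChild b' ρ (fun y' => κ y y') x') x =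
      firstChild b' ρ (fun y' => lastChild b ρ (fun y => κ y y') x) x' := by
  cases b' <;> exact (expect_lastChild_comm _ _ _ _).symm

lemma crossF_succ {ℓ : ℕ} (h : ℕ → ℝ) (g : Fin v → Fin v → ℝ) (U : Grammar v m2 m3 (ℓ + 1))
    (x x' : Fin v) :
    crossF p h g U x x' = ∑ i : Bool × Bool, arityProb p i.1 * arityProb p i.2 *
      lastChild i.1 (U 0) (fun y => firstChild i.2 (U 0) (fun y' =>
        crossF p (convs p m2 m3 ℓ i.1 (convs p m2 m3 ℓ i.2 h)) g (Fin.tail U) y y') x') x := by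
  have h1 : ∀ s : ParseTree m2 m3 (ℓ + 1), treeE p (fun t : ParseTree m2 m3 (ℓ + 1) =>
      h (s.size + t.size) * g (lastNode U x s) (firstNode U x' t)) =
      ∑ b', arityProb p b' * firstChild b' (U 0) (fun y' => treeE p fun t =>
        convs p m2 m3 ℓ b' h (t.size + s.size) *
          g (lastNode U x s) (firstNode (Fin.tail U) y' t)) x' := by
    intro s
    rw [treeE_firstNode p (fun n => h (s.size + n))]
    simp only [convs_shift]
    simp only [add_comm s.size]
  have h2 : ∀ (b' : Bool) (y' : Fin v) (t : ParseTree m2 m3 ℓ),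
      treeE p (fun s : ParseTree m2 m3 (ℓ + 1) => convs p m2 m3 ℓ b' h (t.size + s.size) *
          g (lastNode U x s) (firstNode (Fin.tail U) y' t)) =
      ∑ b, arityProb p b * lastChild b (U 0) (fun y => treeE p fun s : ParseTree m2 m3 ℓ =>
        convs p m2 m3 ℓ b (convs p m2 m3 ℓ b' h) (s.size + t.size) *
          g (lastNode (Fin.tail U) y s) (firstNode (Fin.tail U) y' t)) x := by
    intro b' y' t
    rw [treeE_lastNode p (fun n => convs p m2 m3 ℓ b' h (t.size + n))
      (fun z => g z (firstNode (Fin.tail U) y' t))]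
    simp only [convs_shift]
    simp only [add_comm t.size]
  rw [crossF]
  simp only [h1, treeE_sum, treeE_const_mul, treeE_firstChild]
  have h3 : ∀ b' : Bool, firstChild b' (U 0) (fun y' => treeE p fun s : ParseTree m2 m3 (ℓ + 1) =>
      treeE p fun t => convs p m2 m3 ℓ b' h (t.size + s.size) *
          g (lastNode U x s) (firstNode (Fin.tail U) y' t)) x' =
      ∑ b, arityProb p b * lastChild b (U 0) (fun y => firstChild b' (U 0) (fun y' =>
        crossF p (convs p m2 m3 ℓ b (convs p m2 m3 ℓ b' h)) g (Fin.tail U) y y') x') x := by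
    intro b'
    have h4 : ∀ y', (treeE p fun s : ParseTree m2 m3 (ℓ + 1) =>
      treeE p fun t => convs p m2 m3 ℓ b' h (t.size + s.size) *
          g (lastNode U x s) (firstNode (Fin.tail U) y' t)) =
        ∑ b, arityProb p b * lastChild b (U 0) (fun y =>
        crossF p (convs p m2 m3 ℓ b (convs p m2 m3 ℓ b' h)) g (Fin.tail U) y y') x := by
      intro y'
      rw [treeE_comm]
      simp only [h2, treeE_sum, treeE_const_mul, treeE_lastChild, crossF]
      refine sum_congr rfl fun b _ => ?_
      congr 2; funext y
      rw [treeE_comm]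
    simp only [h4, lastChild_firstChild_comm]
    simp only [sum_bool, firstChild_add, firstChild_const_mul]
  simp only [h3, mul_sum, sum_prod_type]
  rw [Finset.sum_comm]
  exact sum_congr rfl fun b _ => sum_congr rfl fun b' _ => by ring

end Trees

/-! ### Quadratic forms over the upper levels -/

section Quadratic

variable {v m2 m3 : ℕ}

lemma expect_grammar_succ {ℓ : ℕ} (f : Grammar v m2 m3 (ℓ + 1) → ℝ) :
    𝔼 U, f U = 𝔼 U' : Grammar v m2 m3 ℓ, 𝔼 ρ : Rules v m2 m3, f (Fin.cons ρ U') := by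
  rw [expect_swap, ← expect_equiv (Fin.consEquiv fun _ : Fin (ℓ + 1) => Rules v m2 m3) f,
    expect_prod]
  rfl

/-- Average over the upper levels of the covariance, for a uniform root, of two functionals. -/
noncomputable def qf {ℓ : ℕ} (Φ Ψ : Grammar v m2 m3 ℓ → Fin v → ℝ) : ℝ := 𝔼 U, cvar (Φ U) (Ψ U)

/-- The average variance of a functional. -/
notation "𝕢" f:max => qf f f

/-- Contraction factor of the functionals `nodeF` with size weights `h`, `h'`. -/
noncomputable def theta (p : ℝ) (v m2 m3 : ℕ) : ℕ → (ℕ → ℝ) → (ℕ → ℝ) → ℝ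
  | 0, h, h' => h 1 * h' 1
  | ℓ + 1, h, h' =>
    2 * gain₂ p v m2 * theta p v m2 m3 ℓ (convs p m2 m3 ℓ false h) (convs p m2 m3 ℓ false h') +
    3 * gain₃ p v m3 * theta p v m2 m3 ℓ (convs p m2 m3 ℓ true h) (convs p m2 m3 ℓ true h')

/-- The analogous factor for functionals of two siblings of the last level. -/
noncomputable def thetaSib (p : ℝ) (v m2 m3 : ℕ) : ℕ → (ℕ → ℝ) → (ℕ → ℝ) → ℝ
  | 0, h, h' => gain₂ p v m2 * (h 2 * h' 2) + 2 * gain₃ p v m3 * (h 3 * h' 3)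
  | ℓ + 1, h, h' =>
    2 * gain₂ p v m2 *
      thetaSib p v m2 m3 ℓ (convs p m2 m3 (ℓ + 1) false h) (convs p m2 m3 (ℓ + 1) false h') +
    3 * gain₃ p v m3 *
      thetaSib p v m2 m3 ℓ (convs p m2 m3 (ℓ + 1) true h) (convs p m2 m3 (ℓ + 1) true h')

lemma conv_zero (p : ℝ) (h : ℕ → ℝ) (n : ℕ) : conv p m2 m3 0 h n = h (n + 1) := by
  rw [conv, treeE_zero]; rfl

lemma qf_self_nonneg {ℓ : ℕ} (Φ : Grammar v m2 m3 ℓ → Fin v → ℝ) : 0 ≤ 𝕢 Φ :=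
  expect_nonneg fun _ => cvar_self_nonneg _

lemma cvar_triple_add [Nonempty (Fin v)] (A B : Fin v → ℝ) :
    cvar (fun w : Triple v => A w.1 + (A w.2.1 + A w.2.2))
      (fun w => B w.1 + (B w.2.1 + B w.2.2)) = 3 * cvar A B := by
  rw [cvar_prod_add A B (fun w : Pair v => A w.1 + A w.2)
    (fun w : Pair v => B w.1 + B w.2), cvar_prod_add]
  ring

lemma cvar_triple_left [Nonempty (Fin v)] (K K' : Pair v → ℝ) :
    cvar (fun w : Triple v => K (w.1, w.2.1)) (fun w => K' (w.1, w.2.1)) =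
      cvar K K' := by
  simp only [cvar, expect_prod, expect_const]

variable {p c : ℝ} (h : Regime c v m2 m3)

include h

lemma qf_succ {ℓ : ℕ} {Φ Ψ : Grammar v m2 m3 (ℓ + 1) → Fin v → ℝ}
    {f g : Grammar v m2 m3 ℓ → Pair v → ℝ}
    {F G : Grammar v m2 m3 ℓ → Triple v → ℝ}
    (hΦ : ∀ U, Φ U = stepAvg p (U 0) (f (Fin.tail U)) (F (Fin.tail U)))
    (hΨ : ∀ U, Ψ U = stepAvg p (U 0) (g (Fin.tail U)) (G (Fin.tail U))) :
    qf Φ Ψ = gain₂ p v m2 * (𝔼 U, cvar (f U) (g U)) + gain₃ p v m3 * 𝔼 U, cvar (F U) (G U) := by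
  rw [qf, expect_grammar_succ]
  simp only [hΦ, hΨ, Fin.cons_zero, Fin.tail_cons, expect_cvar_stepAvg h, expect_add,
    expect_const_mul]

lemma qf_succ_self {ℓ : ℕ} {Φ : Grammar v m2 m3 (ℓ + 1) → Fin v → ℝ}
    (f : Grammar v m2 m3 ℓ → Pair v → ℝ) (F : Grammar v m2 m3 ℓ → Triple v → ℝ)
    (hΦ : ∀ U, Φ U = stepAvg p (U 0) (f (Fin.tail U)) (F (Fin.tail U))) :
    𝕢 Φ = gain₂ p v m2 * (𝔼 U, 𝕍 (f U)) + gain₃ p v m3 * 𝔼 U, 𝕍 (F U) :=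
  qf_succ h hΦ hΦ

/-- Recursion for sums over the children of the root. -/
lemma qf_succ_sum {ℓ : ℕ} {Φ Ψ : Grammar v m2 m3 (ℓ + 1) → Fin v → ℝ}
    (A A' B B' : Grammar v m2 m3 ℓ → Fin v → ℝ)
    (hΦ : ∀ U, Φ U = stepAvg p (U 0) (fun x => A (Fin.tail U) x.1 + A (Fin.tail U) x.2)
      fun x => B (Fin.tail U) x.1 + (B (Fin.tail U) x.2.1 + B (Fin.tail U) x.2.2))
    (hΨ : ∀ U, Ψ U = stepAvg p (U 0) (fun x => A' (Fin.tail U) x.1 + A' (Fin.tail U) x.2)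
      fun x => B' (Fin.tail U) x.1 + (B' (Fin.tail U) x.2.1 + B' (Fin.tail U) x.2.2)) :
    qf Φ Ψ = 2 * gain₂ p v m2 * qf A A' + 3 * gain₃ p v m3 * qf B B' := by
  have := h.nonempty_fin
  rw [qf_succ h (f := fun U x => A U x.1 + A U x.2) (g := fun U x => A' U x.1 + A' U x.2)
    (F := fun U x => B U x.1 + (B U x.2.1 + B U x.2.2))
    (G := fun U x => B' U x.1 + (B' U x.2.1 + B' U x.2.2)) hΦ hΨ]
  simp only [cvar_prod_add (A _), cvar_triple_add, expect_add, expect_const_mul, qf]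
  ring

/-- Exact covariances of the functionals `nodeF`. -/
lemma qf_nodeF : ∀ (ℓ : ℕ) (w w' : ℕ → ℝ) (F F' : Fin v → ℝ),
    qf (fun U : Grammar v m2 m3 ℓ => nodeF p w F U) (fun U => nodeF p w' F' U) =
      theta p v m2 m3 ℓ w w' * cvar F F'
  | 0, w, w', F, F' => by
      have h1 : ∀ (w : ℕ → ℝ) F (U : Grammar v m2 m3 0), nodeF p w F U = fun r => w 1 * F r :=
        fun w F U => funext fun r => nodeF_zero p w F U r
      have := h.nonempty_rules
      simp only [qf, h1, cvar_const_mul_left, cvar_const_mul_right, expect_const, theta]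
      ring
  | ℓ + 1, w, w', F, F' => by
      rw [qf_succ_sum h (nodeF p (convs p m2 m3 ℓ false w) F)
        (nodeF p (convs p m2 m3 ℓ false w') F') (nodeF p (convs p m2 m3 ℓ true w) F)
        (nodeF p (convs p m2 m3 ℓ true w') F') (fun U => nodeF_succ p w F U)
        fun U => nodeF_succ p w' F' U, qf_nodeF ℓ, qf_nodeF ℓ, theta]
      ring

lemma abs_convs_le_one (hp : 0 ≤ p) (hp' : p ≤ 1) {ℓ : ℕ} {w : ℕ → ℝ} (hw : ∀ n, |w n| ≤ 1)
    (b : Bool) (n : ℕ) : |convs p m2 m3 ℓ b w n| ≤ 1 := by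
  have := h.nonempty_m2
  have := h.nonempty_m3
  have h1 : ∀ {w : ℕ → ℝ} (_ : ∀ n, |w n| ≤ 1) (n : ℕ), |conv p m2 m3 ℓ w n| ≤ 1 := by
    intro w hw n
    exact (abs_treeE_le hp hp' _).trans ((treeE_mono hp hp' fun τ => hw _).trans_eq (treeE_one p ℓ))
  cases b
  · exact h1 hw n
  · exact h1 (h1 hw) n

/-- `theta` is monotone in the size of the weights, on the sizes that occur. -/
lemma theta_self_mono (hp : 0 ≤ p) (hp' : p ≤ 1) (C : ℝ) : ∀ (ℓ : ℕ) (w w' : ℕ → ℝ),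
    (∀ n, 2 ^ ℓ ≤ n → |w n| ≤ C * w' n) →
      theta p v m2 m3 ℓ w w ≤ C ^ 2 * theta p v m2 m3 ℓ w' w'
  | 0, w, w', hw => by
      have h1 := hw 1 le_rfl
      have h2 := abs_nonneg (w 1)
      simp only [theta]
      rw [← abs_mul_abs_self]
      nlinarith
  | ℓ + 1, w, w', hw => by
      have h1 : ∀ {w w' : ℕ → ℝ} {N : ℕ} (_ : ∀ n, N + 2 ^ ℓ ≤ n → |w n| ≤ C * w' n) (n : ℕ),
          N ≤ n → |conv p m2 m3 ℓ w n| ≤ C * conv p m2 m3 ℓ w' n := by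
        intro w w' N hw n hn
        refine (abs_treeE_le hp hp' _).trans ?_
        rw [conv, ← treeE_const_mul]
        exact treeE_mono hp hp' fun τ => hw _ (add_le_add hn (two_pow_le_size τ))
      have h2 : ∀ b n, 2 ^ ℓ ≤ n →
          |convs p m2 m3 ℓ b w n| ≤ C * convs p m2 m3 ℓ b w' n := by
        intro b n hn
        cases b
        · refine h1 (N := 2 ^ ℓ) (fun n hn => hw n ?_) n hn
          rw [pow_succ]; omega
        · refine h1 (N := 2 ^ ℓ) (fun n hn => h1 (N := 2 ^ ℓ) (fun n hn => hw n ?_) n ?_) n hn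
          · rw [pow_succ]; omega
          · omega
      have h3 := theta_self_mono hp hp' C ℓ _ _ (h2 false)
      have h4 := theta_self_mono hp hp' C ℓ _ _ (h2 true)
      have g2 := gain₂_nonneg h p
      have g3 := gain₃_nonneg h p
      simp only [theta]
      nlinarith [mul_le_mul_of_nonneg_left h3 g2, mul_le_mul_of_nonneg_left h4 g3]

lemma theta_self_nonneg : ∀ (ℓ : ℕ) (w : ℕ → ℝ), 0 ≤ theta p v m2 m3 ℓ w w
  | 0, w => mul_self_nonneg _
  | ℓ + 1, w => by
      have h3 := theta_self_nonneg ℓ (convs p m2 m3 ℓ false w)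
      have h4 := theta_self_nonneg ℓ (convs p m2 m3 ℓ true w)
      have g2 := gain₂_nonneg h p
      have g3 := gain₃_nonneg h p
      simp only [theta]
      positivity

lemma thetaSib_self_le : ∀ (ℓ : ℕ) (w : ℕ → ℝ),
    thetaSib p v m2 m3 ℓ w w ≤ theta p v m2 m3 (ℓ + 1) w w
  | 0, w => by
      have g2 := gain₂_nonneg h p
      have g3 := gain₃_nonneg h p
      simp only [theta, thetaSib, convs, conv_zero]
      nlinarith [mul_nonneg g2 (mul_self_nonneg (w 2)), mul_nonneg g3 (mul_self_nonneg (w 3))]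
  | ℓ + 1, w => by
      have h3 := thetaSib_self_le ℓ (convs p m2 m3 (ℓ + 1) false w)
      have h4 := thetaSib_self_le ℓ (convs p m2 m3 (ℓ + 1) true w)
      have g2 := gain₂_nonneg h p
      have g3 := gain₃_nonneg h p
      rw [thetaSib, theta]
      gcongr

lemma thetaSib_self_nonneg : ∀ (ℓ : ℕ) (w : ℕ → ℝ), 0 ≤ thetaSib p v m2 m3 ℓ w w
  | 0, w => by
      have g2 := gain₂_nonneg h p
      have g3 := gain₃_nonneg h p
      simp only [thetaSib]
      have := mul_self_nonneg (w 2)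
      have := mul_self_nonneg (w 3)
      positivity
  | ℓ + 1, w => by
      have h3 := thetaSib_self_nonneg ℓ (convs p m2 m3 (ℓ + 1) false w)
      have h4 := thetaSib_self_nonneg ℓ (convs p m2 m3 (ℓ + 1) true w)
      have g2 := gain₂_nonneg h p
      have g3 := gain₃_nonneg h p
      rw [thetaSib]
      positivity

lemma qf_end_le {F : Fin v → ℝ} (Q : ∀ ℓ, (ℕ → ℝ) → Grammar v m2 m3 ℓ → Fin v → ℝ)
    (h0 : ∀ w U, Q 0 w U = fun r => w 1 * F r)
    (h1 : ∀ ℓ w, 𝕢 (Q (ℓ + 1) w) = gain₂ p v m2 * 𝕢 (Q ℓ (convs p m2 m3 ℓ false w)) +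
      gain₃ p v m3 * 𝕢 (Q ℓ (convs p m2 m3 ℓ true w))) : ∀ (ℓ : ℕ) (w : ℕ → ℝ),
    𝕢 (Q ℓ w) ≤ (1 / 2) ^ ℓ * theta p v m2 m3 ℓ w w * 𝕍 F
  | 0, w => by
      have := h.nonempty_rules
      simp only [qf, h0, cvar_const_mul_left, cvar_const_mul_right, expect_const, theta]
      apply le_of_eq; ring
  | ℓ + 1, w => by
      have e2 := qf_end_le Q h0 h1 ℓ (convs p m2 m3 ℓ false w)
      have e3 := qf_end_le Q h0 h1 ℓ (convs p m2 m3 ℓ true w)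
      have g3 := gain₃_nonneg h p
      have t3 := theta_self_nonneg h ℓ (p := p) (convs p m2 m3 ℓ true w)
      have hF := cvar_self_nonneg F
      have : 0 ≤ gain₃ p v m3 * ((1 / 2) ^ ℓ * theta p v m2 m3 ℓ (convs p m2 m3 ℓ true w)
          (convs p m2 m3 ℓ true w) * 𝕍 F) := by positivity
      rw [h1]
      refine (add_le_add (mul_le_mul_of_nonneg_left e2 (gain₂_nonneg h p))
        (mul_le_mul_of_nonneg_left e3 g3)).trans ?_
      rw [theta, pow_succ]; nlinarith

/-- The functionals of one end of the sentence are small. -/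
lemma qf_lastF_le (ℓ : ℕ) (w : ℕ → ℝ) (F : Fin v → ℝ) :
    𝕢 (fun U : Grammar v m2 m3 ℓ => lastF p w F U) ≤
      (1 / 2) ^ ℓ * theta p v m2 m3 ℓ w w * 𝕍 F := by
  refine qf_end_le h (fun ℓ w U => lastF p w F U)
    (fun w U => funext fun r => lastF_zero p w F U r) (fun ℓ w => ?_) ℓ w
  rw [qf_succ_self h (fun U x => lastF p (convs p m2 m3 ℓ false w) F U x.2)
    (fun U x => lastF p (convs p m2 m3 ℓ true w) F U x.2.2) fun U => lastF_succ p w F U]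
  simp only [qf, cvar_snd₂ h (lastF p (convs p m2 m3 ℓ false w) F _),
    cvar_snd₃ h (lastF p (convs p m2 m3 ℓ true w) F _)]

lemma qf_firstF_le (ℓ : ℕ) (w : ℕ → ℝ) (F : Fin v → ℝ) :
    𝕢 (fun U : Grammar v m2 m3 ℓ => firstF p w F U) ≤
      (1 / 2) ^ ℓ * theta p v m2 m3 ℓ w w * 𝕍 F := by
  refine qf_end_le h (fun ℓ w U => firstF p w F U)
    (fun w U => funext fun r => firstF_zero p w F U r) (fun ℓ w => ?_) ℓ w
  rw [qf_succ_self h (fun U x => firstF p (convs p m2 m3 ℓ false w) F U x.1)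
    (fun U x => firstF p (convs p m2 m3 ℓ true w) F U x.1) fun U => firstF_succ p w F U]
  simp only [qf, cvar_fst₂ h (firstF p (convs p m2 m3 ℓ false w) F _),
    cvar_fst₃ h (firstF p (convs p m2 m3 ℓ true w) F _)]

/-- A lower bound for the contraction factor. -/
lemma le_theta_self (hp : 0 ≤ p) (hp' : p ≤ 1) {a : ℝ} (ha : 0 ≤ a) : ∀ (ℓ N : ℕ) (w : ℕ → ℝ),
    (∀ n, 1 ≤ n → n ≤ N → a ≤ w n) → 3 ^ ℓ ≤ N →
      (p ^ 2 / v) ^ ℓ * a ^ 2 ≤ theta p v m2 m3 ℓ w w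
  | 0, N, w, hw, hN => by
      have h1 := hw 1 le_rfl hN
      simp only [theta, pow_zero, one_mul]
      nlinarith
  | ℓ + 1, N, w, hw, hN => by
      have := h.nonempty_m2
      have := h.nonempty_m3
      have h1 : ∀ n, 1 ≤ n → n ≤ 3 ^ ℓ → a ≤ convs p m2 m3 ℓ false w n := by
        intro n hn hn'
        have := treeE_mono (m2 := m2) (m3 := m3) (ℓ := ℓ) hp hp' (Φ := fun _ => a)
          (Ψ := fun τ => w (n + τ.size)) fun τ => hw _ (by omega) (by
            have := size_le_three_pow τ
            rw [pow_succ] at hN; omega)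
        rwa [treeE_const] at this
      have h2 := le_theta_self hp hp' ha ℓ _ _ h1 le_rfl
      have g2 := le_gain₂ h p
      have g3 := gain₃_nonneg h p
      have t3 := theta_self_nonneg h ℓ (p := p) (convs p m2 m3 ℓ true w)
      have hv := h.v_pos
      have g2' := gain₂_nonneg h p
      rw [theta]
      calc (p ^ 2 / v) ^ (ℓ + 1) * a ^ 2 = 2 * (p ^ 2 / (2 * v)) * ((p ^ 2 / v) ^ ℓ * a ^ 2) := by
            rw [pow_succ]; field_simp
        _ ≤ 2 * gain₂ p v m2 * theta p v m2 m3 ℓ (convs p m2 m3 ℓ false w)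
              (convs p m2 m3 ℓ false w) := by gcongr
        _ ≤ _ := by
            have : 0 ≤ 3 * gain₃ p v m3 * theta p v m2 m3 ℓ (convs p m2 m3 ℓ true w)
              (convs p m2 m3 ℓ true w) := by positivity
            linarith

omit h in
lemma cvar_self_weighted_sum_le {α κ : Type*} [Fintype α] (s : Finset κ) (a : κ → ℝ)
    (ha : ∀ i ∈ s, 0 ≤ a i) (ha' : ∑ i ∈ s, a i = 1) (f : κ → α → ℝ) :
    𝕍 (fun x => ∑ i ∈ s, a i * f i x) ≤
      ∑ i ∈ s, a i * 𝕍 (f i) := by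
  rw [cvar_sum_left]
  have h0 : ∀ i, cvar (fun x => a i * f i x) (fun x => ∑ j ∈ s, a j * f j x) =
      ∑ j ∈ s, a j * (a i * cvar (f j) (f i)) := by
    intro i
    rw [cvar_comm, cvar_sum_left]
    exact sum_congr rfl fun j _ => by rw [cvar_const_mul_left, cvar_const_mul_right]
  simp only [h0]
  have hb : ∀ x y b : ℝ, 0 ≤ b → |x| ≤ y → b * x ≤ b * y := fun x y b hb hxy =>
    mul_le_mul_of_nonneg_left ((le_abs_self x).trans hxy) hb
  calc ∑ i ∈ s, ∑ j ∈ s, a j * (a i * cvar (f j) (f i))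
      ≤ ∑ i ∈ s, ∑ j ∈ s, a j * (a i * ((𝕍 (f j) + 𝕍 (f i)) / 2)) :=
        sum_le_sum fun i hi => sum_le_sum fun j hj =>
          mul_le_mul_of_nonneg_left (hb _ _ _ (ha i hi) (abs_cvar_le _ _)) (ha j hj)
    _ = ∑ i ∈ s, (a i / 2 * (∑ j ∈ s, a j * 𝕍 (f j)) +
          a i / 2 * 𝕍 (f i) * ∑ j ∈ s, a j) := by
        refine sum_congr rfl fun i _ => ?_
        rw [mul_sum, mul_sum, ← sum_add_distrib]
        exact sum_congr rfl fun j _ => by ring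
    _ = 1 / 2 * (∑ j ∈ s, a j * 𝕍 (f j)) + 1 / 2 * ∑ j ∈ s, a j * 𝕍 (f j) := by
        rw [sum_add_distrib, ← sum_mul, ← Finset.sum_div, ha', mul_sum]
        congr 1
        exact sum_congr rfl fun j _ => by ring
    _ = _ := by ring

omit h in
lemma arityProb_nonneg (hp : 0 ≤ p) (hp' : p ≤ 1) (b : Bool) : 0 ≤ arityProb p b := by
  cases b
  · exact hp
  · exact sub_nonneg.2 hp'

omit h in
lemma sum_arityProb : ∑ i : Bool × Bool, arityProb p i.1 * arityProb p i.2 = 1 := by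
  simp only [sum_prod_type, sum_bool, arityProb]; ring

omit h in
/-- Mean square covariance of the functional of two adjacent derivations. -/
lemma cvar_crossF_succ_le (hp : 0 ≤ p) (hp' : p ≤ 1) {ℓ : ℕ} (w : ℕ → ℝ) (g : Fin v → Fin v → ℝ)
    (U : Grammar v m2 m3 (ℓ + 1)) :
    𝕍 (fun x : Pair v => crossF p w g U x.1 x.2) ≤
      ∑ i : Bool × Bool, arityProb p i.1 * arityProb p i.2 *
        𝕍 (fun x : Pair v => lastChild i.1 (U 0) (fun y => firstChild i.2 (U 0) (fun y' =>
          crossF p (convs p m2 m3 ℓ i.1 (convs p m2 m3 ℓ i.2 w)) g (Fin.tail U) y y') x.2) x.1) := by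
  simp only [crossF_succ]
  exact cvar_self_weighted_sum_le Finset.univ
    (fun i : Bool × Bool => arityProb p i.1 * arityProb p i.2)
    (fun i _ => mul_nonneg (arityProb_nonneg hp hp' _) (arityProb_nonneg hp hp' _))
    sum_arityProb _

lemma expect_cvar_crossF_succ_le (hp : 0 ≤ p) (hp' : p ≤ 1) {ℓ : ℕ} (g : Fin v → Fin v → ℝ) {B : ℝ}
    (hB : ∀ w : ℕ → ℝ, (∀ n, |w n| ≤ 1) → 𝔼 U : Grammar v m2 m3 ℓ,
      𝕍 (fun x : Pair v => crossF p w g U x.1 x.2) ≤ B)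
    (w : ℕ → ℝ) (hw : ∀ n, |w n| ≤ 1) :
    𝔼 U : Grammar v m2 m3 (ℓ + 1),
      𝕍 (fun x : Pair v => crossF p w g U x.1 x.2) ≤
      4 / (c ^ 2 * v) * B := by
  refine (expect_mono fun U => cvar_crossF_succ_le hp hp' w g U).trans ?_
  rw [expect_sum]
  have hc : 0 ≤ 4 / (c ^ 2 * v) := by have := h.v_pos; positivity
  calc _ ≤ ∑ i : Bool × Bool, arityProb p i.1 * arityProb p i.2 * (4 / (c ^ 2 * v) * B) := by
        refine sum_le_sum fun i _ => ?_
        rw [expect_const_mul]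
        refine mul_le_mul_of_nonneg_left ?_
          (mul_nonneg (arityProb_nonneg hp hp' _) (arityProb_nonneg hp hp' _))
        rw [expect_grammar_succ]
        simp only [Fin.cons_zero, Fin.tail_cons]
        refine (expect_mono fun U' => expect_cvar_lastChild_firstChild_le h i.1 i.2
          fun y => crossF p (convs p m2 m3 ℓ i.1 (convs p m2 m3 ℓ i.2 w)) g U' y.1 y.2).trans ?_
        rw [expect_const_mul]
        refine mul_le_mul_of_nonneg_left (hB _ ?_) hc
        exact abs_convs_le_one h hp hp' (abs_convs_le_one h hp hp' hw _) _
    _ = _ := by rw [← sum_mul, sum_arityProb, one_mul]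

omit h in
lemma sq_le_one_of_abs {x : ℝ} (hx : |x| ≤ 1) : x * x ≤ 1 := by
  rw [← abs_mul_abs_self]; nlinarith [abs_nonneg x]

lemma expect_cvar_crossF_le (hp : 0 ≤ p) (hp' : p ≤ 1) (g : Fin v → Fin v → ℝ) :
    ∀ (ℓ : ℕ) (w : ℕ → ℝ), (∀ n, |w n| ≤ 1) →
    𝔼 U : Grammar v m2 m3 ℓ,
      𝕍 (fun x : Pair v => crossF p w g U x.1 x.2) ≤
      (4 / (c ^ 2 * v)) ^ ℓ * 𝕍 (fun x : Pair v => g x.1 x.2)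
  | 0, w, hw => by
      have := h.nonempty_rules
      simp only [crossF_zero, cvar_const_mul_left, cvar_const_mul_right, expect_const,
        pow_zero, one_mul]
      have h1 := cvar_self_nonneg fun x : Pair v => g x.1 x.2
      nlinarith [sq_le_one_of_abs (hw 2)]
  | ℓ + 1, w, hw => by
      refine (expect_cvar_crossF_succ_le h hp hp' g (expect_cvar_crossF_le hp hp' g ℓ)
        w hw).trans_eq ?_
      rw [pow_succ]; ring

/-- For a doubly centered function, adjacent derivations that are not single nodes contribute
less. -/
lemma expect_cvar_crossF_centered_le (hp : 0 ≤ p) (hp' : p ≤ 1) (g : Fin v → Fin v → ℝ)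
    (hg : ∀ y, 𝔼 y', g y y' = 0) (hg' : ∀ y', 𝔼 y, g y y' = 0) :
    ∀ (ℓ : ℕ) (w : ℕ → ℝ), (∀ n, |w n| ≤ 1) →
    𝔼 U : Grammar v m2 m3 (ℓ + 1),
      𝕍 (fun x : Pair v => crossF p w g U x.1 x.2) ≤
      (4 / (c ^ 2 * v)) ^ ℓ * (11 / (c ^ 2 * (v : ℝ) ^ 2) * 𝔼 y, 𝔼 y', g y y' ^ 2)
  | 0, w, hw => by
      have := h.nonempty_rules
      rw [pow_zero, one_mul]
      refine (expect_mono fun U => cvar_crossF_succ_le hp hp' w g U).trans ?_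
      rw [expect_sum]
      set B := 11 / (c ^ 2 * (v : ℝ) ^ 2) * 𝔼 y, 𝔼 y', g y y' ^ 2 with hB
      calc _ ≤ ∑ i : Bool × Bool, arityProb p i.1 * arityProb p i.2 * B := by
            refine sum_le_sum fun i _ => ?_
            rw [expect_const_mul]
            refine mul_le_mul_of_nonneg_left ?_
              (mul_nonneg (arityProb_nonneg hp hp' _) (arityProb_nonneg hp hp' _))
            rw [expect_grammar_succ]
            simp only [Fin.cons_zero, crossF_zero, firstChild_const_mul, lastChild_const_mul,
              cvar_const_mul_left, cvar_const_mul_right, expect_const, expect_const_mul]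
            set a := convs p m2 m3 0 i.1 (convs p m2 m3 0 i.2 w) 2 with ha
            have ha1 : a * a ≤ 1 := sq_le_one_of_abs
              (abs_convs_le_one h hp hp' (abs_convs_le_one h hp hp' hw _) _ _)
            have h1 : 𝔼 ρ : Rules v m2 m3,
                𝕍 (fun x : Pair v => lastChild i.1 ρ (fun y => firstChild i.2 ρ
                  (fun y' => g y y') x.2) x.1) ≤ B := by
              refine le_trans (expect_mono fun ρ => ?_)
                (expect_sq_lastChild_firstChild_le h i.1 i.2 g hg hg')
              refine (cvar_self_le _).trans_eq ?_
              rw [expect_prod]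
              simp only [lastChild_firstChild_comm]
            have h0 : 0 ≤ 𝔼 ρ : Rules v m2 m3,
                𝕍 (fun x : Pair v => lastChild i.1 ρ (fun y => firstChild i.2 ρ
                  (fun y' => g y y') x.2) x.1) :=
              expect_nonneg fun _ => cvar_self_nonneg _
            nlinarith
        _ = _ := by rw [← sum_mul, sum_arityProb, one_mul]
  | ℓ + 1, w, hw => by
      refine (expect_cvar_crossF_succ_le h hp hp' g
        (expect_cvar_crossF_centered_le hp hp' g hg hg' ℓ) w hw).trans_eq ?_
      rw [pow_succ]; ring

lemma cvar_pair_sum_le (A : Fin v → ℝ) (K : Fin v → Fin v → ℝ) (a : ℝ) :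
    𝕍 (fun x : Pair v => A x.1 + A x.2 + a * K x.1 x.2) ≤
      4 * 𝕍 A + 2 * (a * (a * 𝕍 (fun x : Pair v => K x.1 x.2))) := by
  have := h.nonempty_fin
  refine (cvar_self_add_le _ _).trans ?_
  rw [cvar_prod_add A, cvar_const_mul_left, cvar_const_mul_right]
  linarith

lemma cvar_triple_sum_le (A : Fin v → ℝ) (K : Fin v → Fin v → ℝ) (a : ℝ) :
    𝕍 (fun x : Triple v => A x.1 + (A x.2.1 + A x.2.2) + a * K x.1 x.2.1 + a * K x.2.1 x.2.2) ≤
      12 * 𝕍 A + 6 * (a * (a * 𝕍 (fun x : Pair v => K x.1 x.2))) := by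
  have := h.nonempty_fin
  refine (cvar_self_add_le _ _).trans ?_
  have e1 := cvar_self_add_le (fun x : Triple v => A x.1 + (A x.2.1 + A x.2.2))
    (fun x => a * K x.1 x.2.1)
  rw [cvar_triple_add, cvar_const_mul_left, cvar_const_mul_right,
    cvar_triple_left (fun x => K x.1 x.2) (fun x => K x.1 x.2)] at e1
  rw [cvar_const_mul_left, cvar_const_mul_right, cvar_comp_snd (α := Fin v)
    (fun x : Pair v => K x.1 x.2) (fun x : Pair v => K x.1 x.2)]
  linarith

/-- Crude bound for the functionals of adjacent pairs. -/
lemma qf_adjF_le_of_crossF (hp : 0 ≤ p) (hp' : p ≤ 1) (a : ℕ → ℝ) (g : Fin v → Fin v → ℝ) {B : ℝ}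
    (hB : 0 ≤ B)
    (hK : ∀ (ℓ : ℕ) (w : ℕ → ℝ), (∀ n, |w n| ≤ 1) → a ℓ * (a ℓ * 𝔼 U : Grammar v m2 m3 ℓ,
      𝕍 (fun x : Pair v => crossF p w g U x.1 x.2)) ≤ (200 / (c ^ 2 * v)) ^ ℓ * B) :
    ∀ (ℓ : ℕ) (w : ℕ → ℝ), (∀ n, |w n| ≤ 1) →
      𝕢 (fun U : Grammar v m2 m3 ℓ => adjF p a w g U) ≤ (200 / (c ^ 2 * v)) ^ ℓ * B
  | 0, w, hw => by
      have h1 : ∀ U : Grammar v m2 m3 0, adjF p a w g U = fun _ => 0 :=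
        fun U => funext fun r => adjF_zero p a w g U r
      simp only [qf, h1, cvar_zero_left, expect_const_zero, pow_zero, one_mul]
      exact hB
  | ℓ + 1, w, hw => by
      have hv := h.v_pos
      have hc := h.pos
      have hw1 : ∀ b, ∀ n, |convs p m2 m3 ℓ b w n| ≤ 1 := fun b => abs_convs_le_one h hp hp' hw b
      have A1 := qf_adjF_le_of_crossF hp hp' a g hB hK ℓ _ (hw1 false)
      have A2 := qf_adjF_le_of_crossF hp hp' a g hB hK ℓ _ (hw1 true)
      have K1 := hK ℓ w hw
      have K2 := hK ℓ _ (hw1 false)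
      rw [qf] at A1 A2
      rw [qf_succ_self h
        (fun U x => adjF p a (convs p m2 m3 ℓ false w) g U x.1 +
          adjF p a (convs p m2 m3 ℓ false w) g U x.2 + a ℓ * crossF p w g U x.1 x.2)
        (fun U x => adjF p a (convs p m2 m3 ℓ true w) g U x.1 +
          (adjF p a (convs p m2 m3 ℓ true w) g U x.2.1 +
            adjF p a (convs p m2 m3 ℓ true w) g U x.2.2) +
          a ℓ * crossF p (convs p m2 m3 ℓ false w) g U x.1 x.2.1 +
          a ℓ * crossF p (convs p m2 m3 ℓ false w) g U x.2.1 x.2.2)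
        fun U => adjF_succ p a w g U]
      set E := (200 / (c ^ 2 * v)) ^ ℓ * B with hE
      have hE0 : 0 ≤ E := by positivity
      have b2 := expect_mono fun U : Grammar v m2 m3 ℓ => cvar_pair_sum_le h
        (adjF p a (convs p m2 m3 ℓ false w) g U) (crossF p w g U) (a ℓ)
      have b3 := expect_mono fun U : Grammar v m2 m3 ℓ => cvar_triple_sum_le h
        (adjF p a (convs p m2 m3 ℓ true w) g U) (crossF p (convs p m2 m3 ℓ false w) g U) (a ℓ)
      simp only [expect_add, expect_const_mul] at b2 b3
      have g2 := gain₂_nonneg h p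
      have g3 := gain₃_nonneg h p
      have g2' := gain₂_le h hp hp'
      have g3' := gain₃_le h hp hp'
      have hcv : 2 / (c * v) ≤ 2 / (c ^ 2 * v) := by
        apply div_le_div_of_nonneg_left (by norm_num) (by positivity)
        have := h.le_one
        gcongr; nlinarith
      calc _ ≤ gain₂ p v m2 * (10 * E) + gain₃ p v m3 * (18 * E) :=
            add_le_add (mul_le_mul_of_nonneg_left (b2.trans (by linarith)) g2)
              (mul_le_mul_of_nonneg_left (b3.trans (by linarith)) g3)
        _ ≤ 2 / (c ^ 2 * v) * (10 * E) + 2 / (c ^ 2 * v) * (18 * E) := by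
            gcongr <;> linarith
        _ = 56 / (c ^ 2 * v) * E := by ring
        _ ≤ 200 / (c ^ 2 * v) * E := by gcongr; norm_num
        _ = _ := by rw [hE, pow_succ]; ring

end Quadratic

/-! ### Sibling pairs and distant pairs -/

section Siblings

variable {v m2 m3 : ℕ}

/-- Weight of the adjacent pairs that are siblings. -/
def sibW (k : ℕ) : ℝ := if k = 0 then 1 else 0

/-- Weight of the adjacent pairs that are not siblings. -/
def farW (k : ℕ) : ℝ := if k = 0 then 0 else 1

lemma adjSum_add_weight (a a' : ℕ → ℝ) (g : Fin v → Fin v → ℝ) :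
    ∀ {ℓ : ℕ} (U : Grammar v m2 m3 ℓ) (r : Fin v) (τ : ParseTree m2 m3 ℓ),
      adjSum (fun k => a k + a' k) g U r τ = adjSum a g U r τ + adjSum a' g U r τ
  | 0, _, _, _ => by simp only [adjSum, add_zero]
  | _ + 1, U, r, Sum.inl (k, s, t) => by
      simp only [adjSum, adjSum_add_weight a a' g]; ring
  | _ + 1, U, r, Sum.inr (k, s, t, u) => by
      simp only [adjSum, adjSum_add_weight a a' g]; ring

lemma adjSum_add (a : ℕ → ℝ) (g g' : Fin v → Fin v → ℝ) :
    ∀ {ℓ : ℕ} (U : Grammar v m2 m3 ℓ) (r : Fin v) (τ : ParseTree m2 m3 ℓ),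
      adjSum a (fun y y' => g y y' + g' y y') U r τ = adjSum a g U r τ + adjSum a g' U r τ
  | 0, _, _, _ => by simp only [adjSum, add_zero]
  | _ + 1, U, r, Sum.inl (k, s, t) => by
      simp only [adjSum, adjSum_add a g g']; ring
  | _ + 1, U, r, Sum.inr (k, s, t, u) => by
      simp only [adjSum, adjSum_add a g g']; ring

lemma adjSum_const_mul (a : ℕ → ℝ) (c : ℝ) (g : Fin v → Fin v → ℝ) :
    ∀ {ℓ : ℕ} (U : Grammar v m2 m3 ℓ) (r : Fin v) (τ : ParseTree m2 m3 ℓ),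
      adjSum a (fun y y' => c * g y y') U r τ = c * adjSum a g U r τ
  | 0, _, _, _ => by simp only [adjSum, mul_zero]
  | _ + 1, U, r, Sum.inl (k, s, t) => by
      simp only [adjSum, adjSum_const_mul a c g]; ring
  | _ + 1, U, r, Sum.inr (k, s, t, u) => by
      simp only [adjSum, adjSum_const_mul a c g]; ring

variable (p : ℝ) {ℓ : ℕ}

lemma adjF_add_weight (a a' h : ℕ → ℝ) (g : Fin v → Fin v → ℝ) (U : Grammar v m2 m3 ℓ)
    (r : Fin v) :
    adjF p (fun k => a k + a' k) h g U r = adjF p a h g U r + adjF p a' h g U r := by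
  simp only [adjF, adjSum_add_weight, mul_add, treeE_add]

lemma adjF_one (h : ℕ → ℝ) (g : Fin v → Fin v → ℝ) (U : Grammar v m2 m3 ℓ) (r : Fin v) :
    adjF p (fun _ => 1) h g U r = adjF p sibW h g U r + adjF p farW h g U r := by
  rw [← adjF_add_weight]
  congr; funext k
  unfold sibW farW; split_ifs <;> norm_num

lemma adjF_add (a h : ℕ → ℝ) (g g' : Fin v → Fin v → ℝ) (U : Grammar v m2 m3 ℓ) (r : Fin v) :
    adjF p a h (fun y y' => g y y' + g' y y') U r = adjF p a h g U r + adjF p a h g' U r := by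
  simp only [adjF, adjSum_add, mul_add, treeE_add]

lemma adjF_const_mul (a h : ℕ → ℝ) (c : ℝ) (g : Fin v → Fin v → ℝ) (U : Grammar v m2 m3 ℓ)
    (r : Fin v) : adjF p a h (fun y y' => c * g y y') U r = c * adjF p a h g U r := by
  simp only [adjF, adjSum_const_mul, mul_left_comm _ c, treeE_const_mul]

lemma nodeF_add (h : ℕ → ℝ) (F F' : Fin v → ℝ) (U : Grammar v m2 m3 ℓ) (r : Fin v) :
    nodeF p h (fun y => F y + F' y) U r = nodeF p h F U r + nodeF p h F' U r := by
  simp only [nodeF, List.sum_map_add, mul_add, treeE_add]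

lemma nodeF_const_mul (h : ℕ → ℝ) (c : ℝ) (F : Fin v → ℝ) (U : Grammar v m2 m3 ℓ) (r : Fin v) :
    nodeF p h (fun y => c * F y) U r = c * nodeF p h F U r := by
  simp only [nodeF, List.sum_map_mul_left, mul_left_comm _ c, treeE_const_mul]

lemma nodeF_sub_weight (h h' : ℕ → ℝ) (F : Fin v → ℝ) (U : Grammar v m2 m3 ℓ) (r : Fin v) :
    nodeF p (fun n => h n - h' n) F U r = nodeF p h F U r - nodeF p h' F U r := by
  simp only [nodeF, sub_mul, treeE_sub]

lemma nodeF_const_mul_weight (c : ℝ) (h : ℕ → ℝ) (F : Fin v → ℝ) (U : Grammar v m2 m3 ℓ)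
    (r : Fin v) : nodeF p (fun n => c * h n) F U r = c * nodeF p h F U r := by
  simp only [nodeF, mul_assoc, treeE_const_mul]

variable {p} {c : ℝ} (h : Regime c v m2 m3)

lemma adjF_sibW_one (w : ℕ → ℝ) (g : Fin v → Fin v → ℝ) (U : Grammar v m2 m3 1) :
    adjF p sibW w g U = stepAvg p (U 0) (fun x => w 2 * g x.1 x.2)
      (fun x => w 3 * (g x.1 x.2.1 + g x.2.1 x.2.2)) := by
  rw [adjF_succ]
  congr 1
  · funext x
    simp only [adjF_zero, crossF_zero, sibW]; simp
  · funext x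
    simp only [adjF_zero, crossF_zero, sibW, convs, conv_zero]; simp; ring

lemma adjF_sibW_succ (w : ℕ → ℝ) (g : Fin v → Fin v → ℝ) (U : Grammar v m2 m3 (ℓ + 2)) :
    adjF p sibW w g U = stepAvg p (U 0)
      (fun x => adjF p sibW (convs p m2 m3 (ℓ + 1) false w) g (Fin.tail U) x.1 +
        adjF p sibW (convs p m2 m3 (ℓ + 1) false w) g (Fin.tail U) x.2)
      (fun x => adjF p sibW (convs p m2 m3 (ℓ + 1) true w) g (Fin.tail U) x.1 +
        (adjF p sibW (convs p m2 m3 (ℓ + 1) true w) g (Fin.tail U) x.2.1 +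
        adjF p sibW (convs p m2 m3 (ℓ + 1) true w) g (Fin.tail U) x.2.2)) := by
  rw [adjF_succ]
  have : sibW (ℓ + 1) = 0 := rfl
  simp only [this, zero_mul, add_zero]

lemma expect_pair_eq_zero {g : Fin v → Fin v → ℝ} (hg : ∀ y, 𝔼 y', g y y' = 0) :
    𝔼 x : Pair v, g x.1 x.2 = 0 := by
  rw [expect_prod]
  simp only [hg, expect_const_zero]

include h

lemma qf_sibW (g g' : Fin v → Fin v → ℝ) (hg : ∀ y, 𝔼 y', g y y' = 0)
    (hg' : ∀ y, 𝔼 y', g' y y' = 0) :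
    ∀ (ℓ : ℕ) (w w' : ℕ → ℝ),
      qf (fun U : Grammar v m2 m3 (ℓ + 1) => adjF p sibW w g U)
        (fun U => adjF p sibW w' g' U) =
        thetaSib p v m2 m3 ℓ w w' * 𝔼 y, 𝔼 y', g y y' * g' y y'
  | 0, w, w' => by
      have := h.nonempty_fin
      have := h.nonempty_rules
      rw [qf_succ h
        (f := fun _ x => w 2 * g x.1 x.2) (g := fun _ x => w' 2 * g' x.1 x.2)
        (F := fun _ x => w 3 * (g x.1 x.2.1 + g x.2.1 x.2.2))
        (G := fun _ x => w' 3 * (g' x.1 x.2.1 + g' x.2.1 x.2.2))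
        (fun U => adjF_sibW_one w g U) (fun U => adjF_sibW_one w' g' U)]
      have e2 : cvar (fun x : Pair v => g x.1 x.2) (fun x => g' x.1 x.2) =
          𝔼 y, 𝔼 y', g y y' * g' y y' := by
        rw [cvar_of_expect_left_eq_zero (expect_pair_eq_zero hg), expect_prod]
      have e3 : cvar (fun x : Triple v => g x.1 x.2.1 + g x.2.1 x.2.2)
          (fun x => g' x.1 x.2.1 + g' x.2.1 x.2.2) = 2 * 𝔼 y, 𝔼 y', g y y' * g' y y' := by
        have z1 : cvar (fun x : Triple v => g x.1 x.2.1) (fun x => g' x.2.1 x.2.2) =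
            0 := by
          simp only [cvar, expect_prod, expect_const_mul, hg', mul_zero, expect_const_zero,
            sub_zero]
        have z2 : cvar (fun x : Triple v => g x.2.1 x.2.2) (fun x => g' x.1 x.2.1) =
            0 := by
          simp only [cvar, expect_prod, expect_mul_const, hg, zero_mul, expect_const_zero,
            sub_zero]
        rw [cvar_add_left, cvar_add_right, cvar_add_right, z1, z2,
          cvar_triple_left (fun x => g x.1 x.2) (fun x => g' x.1 x.2),
          cvar_comp_snd (α := Fin v) (fun x : Pair v => g x.1 x.2)
            (fun x : Pair v => g' x.1 x.2), e2]
        ring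
      simp only [cvar_const_mul_left, cvar_const_mul_right, e2, e3, expect_const, thetaSib]
      ring
  | ℓ + 1, w, w' => by
      rw [qf_succ_sum h (adjF p sibW (convs p m2 m3 (ℓ + 1) false w) g)
        (adjF p sibW (convs p m2 m3 (ℓ + 1) false w') g')
        (adjF p sibW (convs p m2 m3 (ℓ + 1) true w) g)
        (adjF p sibW (convs p m2 m3 (ℓ + 1) true w') g') (fun U => adjF_sibW_succ w g U)
        fun U => adjF_sibW_succ w' g' U, qf_sibW g g' hg hg' ℓ, qf_sibW g g' hg hg' ℓ, thetaSib]
      ring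

/-- Functionals of sibling pairs with doubly centered functions are uncorrelated with the
functionals `nodeF`. -/
lemma qf_sibW_nodeF (g : Fin v → Fin v → ℝ) (hg : ∀ y, 𝔼 y', g y y' = 0)
    (hg' : ∀ y', 𝔼 y, g y y' = 0) (F : Fin v → ℝ) :
    ∀ (ℓ : ℕ) (w w' : ℕ → ℝ),
      qf (fun U : Grammar v m2 m3 (ℓ + 1) => adjF p sibW w g U)
        (fun U => nodeF p w' F U) = 0
  | 0, w, w' => by
      have := h.nonempty_fin
      have := h.nonempty_rules
      rw [qf_succ h
        (f := fun _ x => w 2 * g x.1 x.2)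
        (g := fun U x => nodeF p (convs p m2 m3 0 false w') F U x.1 +
          nodeF p (convs p m2 m3 0 false w') F U x.2)
        (F := fun _ x => w 3 * (g x.1 x.2.1 + g x.2.1 x.2.2))
        (G := fun U x => nodeF p (convs p m2 m3 0 true w') F U x.1 +
          (nodeF p (convs p m2 m3 0 true w') F U x.2.1 +
            nodeF p (convs p m2 m3 0 true w') F U x.2.2))
        (fun U => adjF_sibW_one w g U) (fun U => nodeF_succ p w' F U)]
      have e2 : ∀ φ : Fin v → ℝ, cvar (fun x : Pair v => g x.1 x.2)
          (fun x => φ x.1 + φ x.2) = 0 := by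
        intro φ
        rw [cvar_of_expect_left_eq_zero (expect_pair_eq_zero hg), expect_prod]
        simp only [mul_add, expect_add, expect_mul_const, hg, zero_mul, zero_add]
        rw [expect_swap]
        simp only [expect_mul_const, hg', zero_mul, expect_const_zero]
      have e3 : ∀ φ : Fin v → ℝ, cvar (fun x : Triple v => g x.1 x.2.1 + g x.2.1 x.2.2)
          (fun x => φ x.1 + (φ x.2.1 + φ x.2.2)) = 0 := by
        intro φ
        have z0 : ∀ ψ : Fin v → ℝ, 𝔼 y, 𝔼 y', g y y' * ψ y' = 0 := by
          intro ψ
          rw [expect_swap]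
          simp only [expect_mul_const, hg', zero_mul, expect_const_zero]
        have z1 : cvar (fun x : Triple v => g x.1 x.2.1)
            (fun x => φ x.1 + (φ x.2.1 + φ x.2.2)) = 0 := by
          rw [cvar_of_expect_left_eq_zero (by simp only [expect_prod, hg,
            expect_const])]
          simp only [expect_prod, mul_add, expect_add, expect_const_mul, expect_mul_const, hg,
            expect_const, z0, zero_mul, expect_const_zero, add_zero]
        have z2 : cvar (fun x : Triple v => g x.2.1 x.2.2)
            (fun x => φ x.1 + (φ x.2.1 + φ x.2.2)) = 0 := by
          rw [cvar_of_expect_left_eq_zero (by simp only [expect_prod, hg,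
            expect_const_zero])]
          simp only [expect_prod, mul_add, expect_add, expect_mul_const, hg, z0, zero_mul,
            expect_const_zero, add_zero]
        rw [cvar_add_left, z1, z2, add_zero]
      simp only [cvar_const_mul_left, e2, e3, expect_const_zero, mul_zero, add_zero]
  | ℓ + 1, w, w' => by
      rw [qf_succ_sum h (adjF p sibW (convs p m2 m3 (ℓ + 1) false w) g)
        (nodeF p (convs p m2 m3 (ℓ + 1) false w') F)
        (adjF p sibW (convs p m2 m3 (ℓ + 1) true w) g)
        (nodeF p (convs p m2 m3 (ℓ + 1) true w') F) (fun U => adjF_sibW_succ w g U)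
        fun U => nodeF_succ p w' F U, qf_sibW_nodeF g hg hg' F ℓ, qf_sibW_nodeF g hg hg' F ℓ]
      ring

/-- Crude bound for the functionals of all adjacent pairs. -/
lemma qf_adjF_one_le (hp : 0 ≤ p) (hp' : p ≤ 1) (g : Fin v → Fin v → ℝ) (ℓ : ℕ) (w : ℕ → ℝ)
    (hw : ∀ n, |w n| ≤ 1) :
    𝕢 (fun U : Grammar v m2 m3 ℓ => adjF p (fun _ => 1) w g U) ≤
      (200 / (c ^ 2 * v)) ^ ℓ * 𝕍 (fun x : Pair v => g x.1 x.2) := by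
  have hv := h.v_pos
  have hc := h.pos
  have h0 := cvar_self_nonneg fun x : Pair v => g x.1 x.2
  refine qf_adjF_le_of_crossF h hp hp' _ g h0 (fun ℓ w hw => ?_) ℓ w hw
  rw [one_mul, one_mul]
  refine (expect_cvar_crossF_le h hp hp' g ℓ w hw).trans ?_
  gcongr
  norm_num

/-- Bound for the functionals of distant pairs with doubly centered functions. -/
lemma qf_adjF_farW_le (hp : 0 ≤ p) (hp' : p ≤ 1) (g : Fin v → Fin v → ℝ)
    (hg : ∀ y, 𝔼 y', g y y' = 0) (hg' : ∀ y', 𝔼 y, g y y' = 0) (ℓ : ℕ) (w : ℕ → ℝ)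
    (hw : ∀ n, |w n| ≤ 1) :
    𝕢 (fun U : Grammar v m2 m3 ℓ => adjF p farW w g U) ≤
      (200 / (c ^ 2 * v)) ^ ℓ * (1 / v * 𝔼 y, 𝔼 y', g y y' ^ 2) := by
  have hv := h.v_pos
  have hc := h.pos
  have h0 : 0 ≤ 𝔼 y, 𝔼 y', g y y' ^ 2 := expect_nonneg fun _ => expect_nonneg fun _ => sq_nonneg _
  refine qf_adjF_le_of_crossF h hp hp' _ g (by positivity) (fun ℓ w hw => ?_) ℓ w hw
  cases ℓ with
  | zero => simp only [farW, if_true, zero_mul]; positivity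
  | succ ℓ =>
    have : farW (ℓ + 1) = 1 := rfl
    rw [this, one_mul, one_mul]
    refine (expect_cvar_crossF_centered_le h hp hp' g hg hg' ℓ w hw).trans ?_
    have e : (200 / (c ^ 2 * v)) ^ (ℓ + 1) * (1 / v * 𝔼 y, 𝔼 y', g y y' ^ 2) =
        (200 / (c ^ 2 * v)) ^ ℓ * (200 / (c ^ 2 * (v : ℝ) ^ 2) * 𝔼 y, 𝔼 y', g y y' ^ 2) := by
      rw [pow_succ]; field_simp
    rw [e]
    gcongr <;> norm_num

end Siblings

/-! ### Averages over the last level -/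

section LastLevel

variable {v m2 m3 : ℕ}

/-- The tokens produced by a node of the last but one level. -/
abbrev Span (v : ℕ) : Type := (Pair v) ⊕ (Triple v)

/-- The list of the tokens of a span. -/
def tokens : Span v → List (Fin v)
  | Sum.inl w => [w.1, w.2]
  | Sum.inr w => [w.1, w.2.1, w.2.2]

/-- Number of tokens of a span. -/
def spanLen : Span v → ℕ
  | Sum.inl _ => 2
  | Sum.inr _ => 3

/-- Number of tokens of a binary (`false`) or ternary (`true`) span. -/
def arity : Bool → ℕ
  | false => 2
  | true => 3

/-- Total number of tokens. -/
def totalLen (bs : List (Fin v × Span v)) : ℕ := (bs.map fun b => spanLen b.2).sum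

/-- Average over the binary (`false`) or ternary (`true`) rules of `z`. -/
noncomputable def spanAvg : Bool → Rules v m2 m3 → (Span v → ℝ) → Fin v → ℝ
  | false, Λ, φ => rowAvg Λ.1 fun w => φ (Sum.inl w)
  | true, Λ, φ => rowAvg Λ.2 fun w => φ (Sum.inr w)

variable (p : ℝ) (Λ : Rules v m2 m3)

/-- Average over the rules of `z`. -/
noncomputable def spanE (z : Fin v) (φ : Span v → ℝ) : ℝ :=
  ∑ b, arityProb p b * spanAvg b Λ φ z

/-- Average over the rules of a sequence of symbols. -/
noncomputable def spansE : List (Fin v) → (List (Fin v × Span v) → ℝ) → ℝ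
  | [], X => X []
  | z :: l, X => spanE p Λ z fun s => spansE l fun bs => X ((z, s) :: bs)

lemma spanAvg_add (b : Bool) (φ ψ : Span v → ℝ) (z : Fin v) :
    spanAvg b Λ (fun s => φ s + ψ s) z = spanAvg b Λ φ z + spanAvg b Λ ψ z := by
  cases b <;> exact expect_add _ _

lemma spanAvg_const_mul (b : Bool) (c : ℝ) (φ : Span v → ℝ) (z : Fin v) :
    spanAvg b Λ (fun s => c * φ s) z = c * spanAvg b Λ φ z := by
  cases b <;> exact expect_const_mul _ _

lemma spanAvg_mul_const (b : Bool) (c : ℝ) (φ : Span v → ℝ) (z : Fin v) :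
    spanAvg b Λ (fun s => φ s * c) z = spanAvg b Λ φ z * c := by
  cases b <;> exact expect_mul_const _ _

lemma spanAvg_sum {κ : Type*} (t : Finset κ) (b : Bool) (φ : κ → Span v → ℝ) (z : Fin v) :
    spanAvg b Λ (fun s => ∑ i ∈ t, φ i s) z = ∑ i ∈ t, spanAvg b Λ (φ i) z := by
  cases b <;> exact expect_sum _ _

lemma spanAvg_spanLen (b : Bool) (f : ℕ → ℝ) (φ : Span v → ℝ) (z : Fin v) :
    spanAvg b Λ (fun s => f (spanLen s) * φ s) z = f (arity b) * spanAvg b Λ φ z := by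
  cases b
  · exact expect_const_mul (f 2) fun k => φ (Sum.inl (Λ.1 (z, k)))
  · exact expect_const_mul (f 3) fun k => φ (Sum.inr (Λ.2 (z, k)))

lemma spanE_add (φ ψ : Span v → ℝ) (z : Fin v) :
    spanE p Λ z (fun s => φ s + ψ s) = spanE p Λ z φ + spanE p Λ z ψ := by
  simp only [spanE, spanAvg_add, mul_add, sum_add_distrib]

lemma spanE_const_mul (c : ℝ) (φ : Span v → ℝ) (z : Fin v) :
    spanE p Λ z (fun s => c * φ s) = c * spanE p Λ z φ := by
  simp only [spanE, spanAvg_const_mul, mul_sum]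
  exact sum_congr rfl fun _ _ => by ring

lemma spanE_mul_const (c : ℝ) (φ : Span v → ℝ) (z : Fin v) :
    spanE p Λ z (fun s => φ s * c) = spanE p Λ z φ * c := by
  simp only [mul_comm _ c, spanE_const_mul]

lemma spanE_sum {κ : Type*} (t : Finset κ) (φ : κ → Span v → ℝ) (z : Fin v) :
    spanE p Λ z (fun s => ∑ i ∈ t, φ i s) = ∑ i ∈ t, spanE p Λ z (φ i) := by
  simp only [spanE, spanAvg_sum, mul_sum]
  exact Finset.sum_comm

lemma spansE_add : ∀ (l : List (Fin v)) (X Y : List (Fin v × Span v) → ℝ),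
    spansE p Λ l (fun bs => X bs + Y bs) = spansE p Λ l X + spansE p Λ l Y
  | [], _, _ => rfl
  | z :: l, X, Y => by simp only [spansE, spansE_add l, spanE_add]

lemma spansE_const_mul : ∀ (l : List (Fin v)) (c : ℝ) (X : List (Fin v × Span v) → ℝ),
    spansE p Λ l (fun bs => c * X bs) = c * spansE p Λ l X
  | [], _, _ => rfl
  | z :: l, c, X => by simp only [spansE, spansE_const_mul l, spanE_const_mul]

lemma spansE_sum {κ : Type*} (t : Finset κ) : ∀ (l : List (Fin v))
    (X : κ → List (Fin v × Span v) → ℝ),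
    spansE p Λ l (fun bs => ∑ i ∈ t, X i bs) = ∑ i ∈ t, spansE p Λ l (X i)
  | [], _ => rfl
  | z :: l, X => by simp only [spansE, spansE_sum t l, spanE_sum]

lemma spansE_append : ∀ (l l' : List (Fin v)) (X : List (Fin v × Span v) → ℝ),
    spansE p Λ (l ++ l') X = spansE p Λ l fun bs => spansE p Λ l' fun bs' => X (bs ++ bs')
  | [], _, _ => rfl
  | z :: l, l', X => by
      simp only [List.cons_append, spansE, spansE_append l]

lemma spansE_treeE {ℓ : ℕ} (l : List (Fin v))
    (X : ParseTree m2 m3 ℓ → List (Fin v × Span v) → ℝ) :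
    spansE p Λ l (fun bs => treeE p fun τ => X τ bs) = treeE p fun τ => spansE p Λ l (X τ) := by
  simp only [treeE, spansE_sum, spansE_const_mul]

/-- The blocks of a derivation, as an average over the last level given the upper ones. -/
lemma treeE_blocks : ∀ (ℓ : ℕ) (G : Grammar v m2 m3 (ℓ + 1)) (r : Fin v)
    (X : List (Fin v × List (Fin v)) → ℝ),
    treeE p (fun τ => X (blocks ℓ G r τ)) = treeE p fun τ : ParseTree m2 m3 ℓ =>
      spansE p (G (Fin.last ℓ)) (nodes (Fin.init G) r τ)
        fun bs => X (bs.map fun b => (b.1, tokens b.2))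
  | 0, G, r, X => by
      rw [treeE_succ, treeE_zero]
      simp only [treeE_zero, blocks, nodes, spansE, spanE, sum_bool, arityProb, spanAvg,
        rowAvg, List.map_cons, List.map_nil, tokens]
      exact add_comm _ _
  | ℓ + 1, G, r, X => by
      rw [treeE_succ, treeE_succ]
      have hl : (Fin.tail G) (Fin.last ℓ) = G (Fin.last (ℓ + 1)) := rfl
      have hi : Fin.init (Fin.tail G) = Fin.tail (Fin.init G) := Fin.tail_init_eq_init_tail G
      have h0 : (Fin.init G) 0 = G 0 := rfl
      have key : ∀ (x : Fin v) (Y : List (Fin v × List (Fin v)) → ℝ),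
          treeE p (fun τ => Y (blocks ℓ (Fin.tail G) x τ)) = treeE p fun τ : ParseTree m2 m3 ℓ =>
            spansE p (G (Fin.last (ℓ + 1))) (nodes (Fin.tail (Fin.init G)) x τ)
              fun bs => Y (bs.map fun b => (b.1, tokens b.2)) := by
        intro x Y
        rw [treeE_blocks ℓ (Fin.tail G) x Y, hl, hi]
      congr 2
      · refine expect_congr rfl fun k _ => ?_
        simp only [blocks, nodes, h0, spansE_append, List.map_append]
        have e1 : ∀ s, treeE p (fun t => X (blocks ℓ (Fin.tail G) ((G 0).1 (r, k)).1 s ++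
            blocks ℓ (Fin.tail G) ((G 0).1 (r, k)).2 t)) = _ := fun s =>
          key _ fun l => X (blocks ℓ (Fin.tail G) ((G 0).1 (r, k)).1 s ++ l)
        simp only [e1]
        rw [key _ fun l => treeE p fun τ : ParseTree m2 m3 ℓ =>
          spansE p (G (Fin.last (ℓ + 1))) (nodes (Fin.tail (Fin.init G)) ((G 0).1 (r, k)).2 τ)
              fun bs => X (l ++ bs.map fun b => (b.1, tokens b.2))]
        simp only [spansE_treeE]
      · refine expect_congr rfl fun k _ => ?_
        simp only [blocks, nodes, h0, spansE_append, List.map_append]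
        have e1 : ∀ s t, treeE p (fun u => X (blocks ℓ (Fin.tail G) ((G 0).2 (r, k)).1 s ++
            blocks ℓ (Fin.tail G) ((G 0).2 (r, k)).2.1 t ++
            blocks ℓ (Fin.tail G) ((G 0).2 (r, k)).2.2 u)) = _ := fun s t =>
          key _ fun l => X (blocks ℓ (Fin.tail G) ((G 0).2 (r, k)).1 s ++
            blocks ℓ (Fin.tail G) ((G 0).2 (r, k)).2.1 t ++ l)
        simp only [e1]
        have e2 : ∀ s, treeE p (fun t => treeE p fun τ : ParseTree m2 m3 ℓ =>
            spansE p (G (Fin.last (ℓ + 1))) (nodes (Fin.tail (Fin.init G)) ((G 0).2 (r, k)).2.2 τ)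
              fun bs => X (blocks ℓ (Fin.tail G) ((G 0).2 (r, k)).1 s ++
                blocks ℓ (Fin.tail G) ((G 0).2 (r, k)).2.1 t ++
                bs.map fun b => (b.1, tokens b.2))) = _ := fun s =>
          key _ fun l => treeE p fun τ : ParseTree m2 m3 ℓ =>
            spansE p (G (Fin.last (ℓ + 1))) (nodes (Fin.tail (Fin.init G)) ((G 0).2 (r, k)).2.2 τ)
              fun bs => X (blocks ℓ (Fin.tail G) ((G 0).2 (r, k)).1 s ++ l ++
                bs.map fun b => (b.1, tokens b.2))
        simp only [e2]
        rw [key _ fun l => treeE p fun τ' : ParseTree m2 m3 ℓ =>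
          spansE p (G (Fin.last (ℓ + 1))) (nodes (Fin.tail (Fin.init G)) ((G 0).2 (r, k)).2.1 τ')
            fun bs' => treeE p fun τ : ParseTree m2 m3 ℓ =>
          spansE p (G (Fin.last (ℓ + 1))) (nodes (Fin.tail (Fin.init G)) ((G 0).2 (r, k)).2.2 τ)
              fun bs => X (l ++ (bs'.map fun b => (b.1, tokens b.2)) ++
                bs.map fun b => (b.1, tokens b.2))]
        simp only [spansE_treeE]

/-! ### Sums over blocks -/

/-- Average of `h (length)` over the lengths of `m` spans added to `d`. -/
noncomputable def lenE (h : ℕ → ℝ) : ℕ → ℕ → ℝ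
  | 0, d => h d
  | m + 1, d => ∑ b, arityProb p b * lenE h m (d + arity b)

/-- Sum of `g` over the pairs of adjacent entries of a list. -/
def adjL {β : Type*} (g : β → β → ℝ) : List β → ℝ
  | x :: y :: l => g x y + adjL g (y :: l)
  | _ => 0

/-- Value of `g` at the last entry of a list, zero for the empty list. -/
def lastL {β : Type*} (g : β → ℝ) : List β → ℝ
  | [] => 0
  | [x] => g x
  | _ :: y :: l => lastL g (y :: l)

/-- Value of `g` at the first entry of a list, zero for the empty list. -/
def firstL {β : Type*} (g : β → ℝ) : List β → ℝ
  | [] => 0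
  | x :: _ => g x

lemma totalLen_cons (b : Fin v × Span v) (bs : List (Fin v × Span v)) :
    totalLen (b :: bs) = spanLen b.2 + totalLen bs := by
  simp only [totalLen, List.map_cons, List.sum_cons]

lemma spanE_lenE (h : ℕ → ℝ) (m d : ℕ) (φ : Span v → ℝ) (z : Fin v) :
    spanE p Λ z (fun s => lenE p h m (d + spanLen s) * φ s) =
      ∑ b, arityProb p b * (lenE p h m (d + arity b) * spanAvg b Λ φ z) := by
  simp only [spanE, spanAvg_spanLen Λ _ (fun n => lenE p h m (d + n))]

variable [Nonempty (Fin m2)] [Nonempty (Fin m3)]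

lemma spanAvg_const (b : Bool) (c : ℝ) (z : Fin v) : spanAvg b Λ (fun _ => c) z = c := by
  cases b
  · exact rowAvg_const Λ.1 c z
  · exact rowAvg_const Λ.2 c z

lemma spanE_lenE_one (h : ℕ → ℝ) (m d : ℕ) (z : Fin v) :
    spanE p Λ z (fun s => lenE p h m (d + spanLen s)) = lenE p h (m + 1) d := by
  have := spanE_lenE p Λ h m d (fun _ => 1) z
  simpa only [mul_one, spanAvg_const, lenE] using this

lemma spansE_totalLen (h : ℕ → ℝ) : ∀ (l : List (Fin v)) (d : ℕ),
    spansE p Λ l (fun bs => h (d + totalLen bs)) = lenE p h l.length d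
  | [], d => rfl
  | z :: l, d => by
      simp only [spansE, totalLen_cons, ← add_assoc, spansE_totalLen h l, spanE_lenE_one,
        List.length_cons]

lemma spanE_list_sum {β : Type*} (φ : Span v → β → ℝ) (z : Fin v) : ∀ (l : List β),
    spanE p Λ z (fun s => (l.map (φ s)).sum) = (l.map fun y => spanE p Λ z fun s => φ s y).sum
  | [] => by simp [spanE, spanAvg_const]
  | y :: l => by simp only [List.map_cons, List.sum_cons, spanE_add, spanE_list_sum φ z l]

lemma spansE_sum_map (h : ℕ → ℝ) (φ : Fin v × Span v → ℝ) : ∀ (l : List (Fin v)) (d : ℕ),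
    spansE p Λ l (fun bs => h (d + totalLen bs) * (bs.map φ).sum) =
      (l.map fun z => ∑ b, arityProb p b * (lenE p h (l.length - 1) (d + arity b) *
        spanAvg b Λ (fun s => φ (z, s)) z)).sum
  | [], d => by simp [spansE]
  | z :: l, d => by
      simp only [spansE, totalLen_cons, ← add_assoc, List.map_cons, List.sum_cons, mul_add,
        spansE_add, spanE_add, spansE_sum_map h φ l, List.length_cons, Nat.add_sub_cancel]
      simp only [mul_comm (h _) (φ _), spansE_const_mul, spansE_totalLen]
      simp only [mul_comm (φ _) (lenE _ _ _ _), spanE_lenE]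
      congr 1
      rw [spanE_list_sum p Λ (fun s y => ∑ b, arityProb p b * (lenE p h (l.length - 1)
        (d + spanLen s + arity b) * spanAvg b Λ (fun s => φ (y, s)) y))]
      rcases l with _ | ⟨y, l⟩
      · rfl
      · congr 2; funext x
        simp only [List.length_cons, Nat.add_sub_cancel, spanE_sum, spanE_const_mul,
          spanE_mul_const]
        refine sum_congr rfl fun b _ => ?_
        have := spanE_lenE_one p Λ h l.length (d + arity b) z
        have e : ∀ s : Span v, d + arity b + spanLen s = d + spanLen s + arity b := fun s => by omega
        simp only [e] at this
        rw [this]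

lemma spanE_adjL {β : Type*} (ψ : Span v → β → β → ℝ) (z : Fin v) : ∀ (l : List β),
    spanE p Λ z (fun s => adjL (ψ s) l) = adjL (fun y y' => spanE p Λ z fun s => ψ s y y') l
  | [] => by simp [adjL, spanE, spanAvg_const]
  | [y] => by simp [adjL, spanE, spanAvg_const]
  | y :: y' :: l => by simp only [adjL, spanE_add, spanE_adjL ψ z (y' :: l)]

lemma spansE_adjL (h : ℕ → ℝ) (ψ : Fin v × Span v → Fin v × Span v → ℝ) :
    ∀ (l : List (Fin v)) (d : ℕ),
    spansE p Λ l (fun bs => h (d + totalLen bs) * adjL ψ bs) =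
      adjL (fun z z' => ∑ b, arityProb p b * ∑ b', arityProb p b' *
        (lenE p h (l.length - 2) (d + arity b + arity b') *
        spanAvg b Λ (fun s => spanAvg b' Λ (fun s' => ψ (z, s) (z', s')) z') z)) l
  | [], d => by simp [spansE, adjL]
  | [z], d => by simp [spansE, adjL, spanE, spanAvg_const]
  | z :: z' :: l, d => by
      have ih := spansE_adjL h ψ (z' :: l)
      have e1 : spansE p Λ (z :: z' :: l) (fun bs => h (d + totalLen bs) * adjL ψ bs) =
          (spanE p Λ z fun s => spanE p Λ z' fun s' =>
            lenE p h l.length (d + spanLen s + spanLen s') * ψ (z, s) (z', s')) +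
          spanE p Λ z fun s => spansE p Λ (z' :: l) fun bs =>
            h (d + spanLen s + totalLen bs) * adjL ψ bs := by
        simp only [spansE, totalLen_cons, ← add_assoc, adjL, mul_add, spansE_add, spanE_add]
        simp only [mul_comm (h _) (ψ _ _), spansE_const_mul, spansE_totalLen]
        simp only [mul_comm (ψ _ _) (lenE _ _ _ _)]
      rw [e1]
      simp only [ih, adjL, spanE_lenE, List.length_cons, Nat.reduceSubDiff]
      congr 1
      · rw [spanE]
        refine sum_congr rfl fun b _ => ?_
        rw [spanAvg_sum]
        congr 1
        refine sum_congr rfl fun b' _ => ?_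
        rw [spanAvg_const_mul]
        congr 1
        exact spanAvg_spanLen Λ b (fun n => lenE p h l.length (d + n + arity b')) _ z
      · rw [spanE_adjL]
        rcases l with _ | ⟨y, l⟩
        · rfl
        · congr 1; funext x x'
          simp only [List.length_cons, Nat.add_sub_cancel, spanE_sum, spanE_const_mul,
            spanE_mul_const]
          refine sum_congr rfl fun b _ => ?_
          congr 1
          refine sum_congr rfl fun b' _ => ?_
          have := spanE_lenE_one p Λ h l.length (d + arity b + arity b') z
          have e : ∀ s : Span v, d + arity b + arity b' + spanLen s =
            d + spanLen s + arity b + arity b' := fun s => by omega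
          simp only [e] at this
          rw [this]

lemma spansE_lastL (h : ℕ → ℝ) (φ : Fin v × Span v → ℝ) : ∀ (l : List (Fin v)) (d : ℕ),
    spansE p Λ l (fun bs => h (d + totalLen bs) * lastL φ bs) =
      lastL (fun z => ∑ b, arityProb p b * (lenE p h (l.length - 1) (d + arity b) *
        spanAvg b Λ (fun s => φ (z, s)) z)) l
  | [], d => by simp [spansE, lastL]
  | [z], d => by
      simp only [spansE, lastL, List.length_cons, List.length_nil, totalLen_cons, ← add_assoc]
      exact spanE_lenE p Λ h 0 d (fun s => φ (z, s)) z
  | z :: y :: l, d => by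
      have e1 : spansE p Λ (z :: y :: l) (fun bs => h (d + totalLen bs) * lastL φ bs) =
          spanE p Λ z fun s => spansE p Λ (y :: l) fun bs =>
            h (d + spanLen s + totalLen bs) * lastL φ bs := by
        simp only [spansE, totalLen_cons, ← add_assoc, lastL]
      have hl : ∀ (ψ : Span v → Fin v → ℝ) (y : Fin v) (l : List (Fin v)),
          spanE p Λ z (fun s => lastL (ψ s) (y :: l)) =
          lastL (fun x => spanE p Λ z fun s => ψ s x) (y :: l) := by
        intro ψ y l
        induction l generalizing y with
        | nil => rfl
        | cons y' l ih => simp only [lastL, ih]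
      rw [e1]
      simp only [spansE_lastL h φ (y :: l), hl, lastL, List.length_cons, Nat.add_sub_cancel]
      congr 1; funext x
      simp only [spanE_sum, spanE_const_mul, spanE_mul_const]
      refine sum_congr rfl fun b _ => ?_
      have := spanE_lenE_one p Λ h l.length (d + arity b) z
      have e : ∀ s : Span v, d + arity b + spanLen s = d + spanLen s + arity b := fun s => by omega
      simp only [e] at this
      rw [this]

lemma spansE_firstL (h : ℕ → ℝ) (φ : Fin v × Span v → ℝ) (l : List (Fin v)) (d : ℕ) :
    spansE p Λ l (fun bs => h (d + totalLen bs) * firstL φ bs) =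
      firstL (fun z => ∑ b, arityProb p b * (lenE p h (l.length - 1) (d + arity b) *
        spanAvg b Λ (fun s => φ (z, s)) z)) l := by
  rcases l with _ | ⟨z, l⟩
  · simp [spansE, firstL]
  · simp only [spansE, firstL, totalLen_cons, ← add_assoc, mul_comm (h _) (φ _), spansE_const_mul,
      spansE_totalLen]
    simp only [mul_comm (φ _) (lenE _ _ _ _), spanE_lenE, List.length_cons, Nat.add_sub_cancel]

end LastLevel

/-! ### From the tokens to the functionals of derivations -/

section Tokens

variable {v m2 m3 : ℕ}

/-- Average of `f` over the entries of a list. -/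
noncomputable def listAvg {β : Type*} (f : β → ℝ) (l : List β) : ℝ :=
  (l.map f).sum / (l.length : ℝ)

lemma freq_eq_listAvg {β : Type} (l : List β) (P : β → Prop) :
    freq l P = listAvg (fun x => ind (P x)) l := rfl

lemma listAvg_add {β : Type*} (f g : β → ℝ) (l : List β) :
    listAvg (fun x => f x + g x) l = listAvg f l + listAvg g l := by
  simp only [listAvg, List.sum_map_add, add_div]

lemma listAvg_const_mul {β : Type*} (c : ℝ) (f : β → ℝ) (l : List β) :
    listAvg (fun x => c * f x) l = c * listAvg f l := by
  simp only [listAvg, List.sum_map_mul_left, mul_div_assoc]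

lemma listAvg_sub {β : Type*} (f g : β → ℝ) (l : List β) :
    listAvg (fun x => f x - g x) l = listAvg f l - listAvg g l := by
  have := listAvg_add (fun x => f x - g x) g l
  simp only [sub_add_cancel] at this
  linarith

/-- The first two tokens of a span. -/
def first2 : Span v → Pair v
  | Sum.inl w => w
  | Sum.inr w => (w.1, w.2.1)

/-- The last two tokens of a span. -/
def last2 : Span v → Pair v
  | Sum.inl w => w
  | Sum.inr w => w.2

/-- The tokens of a sequence of spans; the spans are numbered from `n`. -/
def leavesFrom : ℕ → List (Fin v × Span v) → List (Leaf v)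
  | _, [] => []
  | n, b :: bs => ((tokens b.2).map fun x => ⟨x, b.1, n⟩) ++ leavesFrom (n + 1) bs

lemma leavesFrom_eq : ∀ (bs : List (Fin v × Span v)) (n : ℕ),
    (((bs.map fun b => (b.1, tokens b.2)).zipIdx n).flatMap fun b =>
      b.1.2.map fun x => (⟨x, b.1.1, b.2⟩ : Leaf v)) = leavesFrom n bs
  | [], n => rfl
  | b :: bs, n => by
      simp only [List.map_cons, List.zipIdx_cons, List.flatMap_cons, leavesFrom,
        leavesFrom_eq bs (n + 1)]

lemma length_leavesFrom : ∀ (bs : List (Fin v × Span v)) (n : ℕ),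
    (leavesFrom n bs).length = totalLen bs
  | [], n => rfl
  | (z, s) :: bs, n => by
      rw [totalLen_cons, ← length_leavesFrom bs (n + 1)]
      cases s <;> simp [leavesFrom, tokens, spanLen] <;> omega

/-- Sum over the triples of consecutive entries. -/
def sumTrip {β : Type*} (f : β × β × β → ℝ) : List β → ℝ
  | x :: y :: z :: l => f (x, y, z) + sumTrip f (y :: z :: l)
  | _ => 0

lemma sum_map_triples {β : Type*} (f : β × β × β → ℝ) : ∀ l : List β,
    ((l.zip (l.tail.zip l.tail.tail)).map f).sum = sumTrip f l
  | [] => rfl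
  | [_] => rfl
  | [_, _] => rfl
  | x :: y :: z :: l => by
      have := sum_map_triples f (y :: z :: l)
      simp only [List.tail_cons] at this ⊢
      simp only [List.zip_cons_cons, List.map_cons, List.sum_cons, sumTrip, this]

lemma sum_map_pairs {β : Type*} (f : β → β → ℝ) : ∀ l : List β,
    ((l.zip l.tail).map fun x => f x.1 x.2).sum = adjL f l
  | [] => rfl
  | [_] => rfl
  | x :: y :: l => by
      have := sum_map_pairs f (y :: l)
      simp only [List.tail_cons] at this ⊢
      simp only [List.zip_cons_cons, List.map_cons, List.sum_cons, adjL, this]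

lemma sumTrip_leavesFrom (f : Leaf v × Leaf v × Leaf v → ℝ) (φ : Fin v × Span v → ℝ)
    (ψ : Fin v × Span v → Fin v × Span v → ℝ) (hφ : ∀ z w, φ (z, Sum.inl w) = 0)
    (hφ' : ∀ n z w, f (⟨w.1, z, n⟩, ⟨w.2.1, z, n⟩, ⟨w.2.2, z, n⟩) = φ (z, Sum.inr w))
    (hψ : ∀ n z z' s s',
      f (⟨(last2 s).1, z, n⟩, ⟨(last2 s).2, z, n⟩, ⟨(first2 s').1, z', n + 1⟩) +
        f (⟨(last2 s).2, z, n⟩, ⟨(first2 s').1, z', n + 1⟩, ⟨(first2 s').2, z', n + 1⟩) =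
        ψ (z, s) (z', s')) :
    ∀ (bs : List (Fin v × Span v)) (n : ℕ),
      sumTrip f (leavesFrom n bs) = (bs.map φ).sum + adjL ψ bs
  | [], _ => by simp [leavesFrom, sumTrip, adjL]
  | [(z, s)], n => by
      cases s with
      | inl w => simp [leavesFrom, sumTrip, tokens, adjL, hφ]
      | inr w => simp [leavesFrom, sumTrip, tokens, adjL, ← hφ' n]
  | (z, s) :: (z', s') :: bs, n => by
      have ih := sumTrip_leavesFrom f φ ψ hφ hφ' hψ ((z', s') :: bs) (n + 1)
      have h1 := hψ n z z' s s'
      rw [List.map_cons, List.sum_cons, adjL]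
      cases s with
      | inl w =>
        have h0 := hφ z w
        cases s' <;>
        · simp only [leavesFrom, tokens, List.map_cons, List.map_nil, List.cons_append,
            List.nil_append, sumTrip, first2, last2] at ih h1 ⊢
          linarith
      | inr w =>
        have h0 := hφ' n z w
        cases s' <;>
        · simp only [leavesFrom, tokens, List.map_cons, List.map_nil, List.cons_append,
            List.nil_append, sumTrip, first2, last2] at ih h1 ⊢
          linarith

lemma adjL_leavesFrom (g : Fin v → Fin v → ℝ) : ∀ (bs : List (Fin v × Span v)) (n : ℕ),
    adjL (fun x y : Leaf v => g x.sym y.sym) (leavesFrom n bs) =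
      (bs.map fun b => Sum.elim (fun w => g w.1 w.2) (fun w => g w.1 w.2.1 + g w.2.1 w.2.2)
        b.2).sum + adjL (fun b b' => g (last2 b.2).2 (first2 b'.2).1) bs
  | [], _ => by simp [leavesFrom, adjL]
  | [(z, s)], n => by
      cases s with
      | inl w => simp [leavesFrom, tokens, adjL]
      | inr w => simp [leavesFrom, tokens, adjL]
  | (z, s) :: (z', s') :: bs, n => by
      have ih := adjL_leavesFrom g ((z', s') :: bs) (n + 1)
      rw [List.map_cons, List.sum_cons, adjL]
      cases s <;> cases s' <;>
      · simp only [leavesFrom, tokens, List.map_cons, List.map_nil, List.cons_append,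
          List.nil_append, adjL, first2, last2, Sum.elim_inl, Sum.elim_inr] at ih ⊢
        linarith

lemma adjL_add {β : Type*} (f g : β → β → ℝ) : ∀ l : List β,
    adjL (fun x y => f x y + g x y) l = adjL f l + adjL g l
  | [] => by simp [adjL]
  | [_] => by simp [adjL]
  | x :: y :: l => by simp only [adjL, adjL_add f g (y :: l)]; ring

lemma adjL_const_mul {β : Type*} (c : ℝ) (g : β → β → ℝ) : ∀ l : List β,
    adjL (fun x y => c * g x y) l = c * adjL g l
  | [] => by simp [adjL]
  | [_] => by simp [adjL]
  | x :: y :: l => by simp only [adjL, adjL_const_mul c g (y :: l)]; ring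

lemma adjL_left {β : Type*} (g : β → ℝ) : ∀ l : List β,
    adjL (fun x _ => g x) l = (l.map g).sum - lastL g l
  | [] => by simp [adjL, lastL]
  | [_] => by simp [adjL, lastL]
  | x :: y :: l => by
      simp only [adjL, adjL_left g (y :: l), List.map_cons, List.sum_cons, lastL]; ring

lemma adjL_right {β : Type*} (g : β → ℝ) : ∀ l : List β,
    adjL (fun _ y => g y) l = (l.map g).sum - firstL g l
  | [] => by simp [adjL, firstL]
  | [_] => by simp [adjL, firstL]
  | x :: y :: l => by
      simp only [adjL, adjL_right g (y :: l), List.map_cons, List.sum_cons, firstL]; ring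

lemma adjL_append {β : Type*} (g : β → β → ℝ) (x y : β) (l' : List β) : ∀ l : List β,
    adjL g ((l ++ [x]) ++ (y :: l')) = adjL g (l ++ [x]) + adjL g (y :: l') + g x y
  | [] => by simp [adjL]; ring
  | [z] => by simp [adjL]; ring
  | z :: z' :: l => by
      have := adjL_append g x y l' (z' :: l)
      simp only [List.cons_append, adjL] at this ⊢
      linarith

lemma lastL_append {β : Type*} (g : β → ℝ) (x : β) : ∀ l : List β, lastL g (l ++ [x]) = g x
  | [] => rfl
  | [_] => rfl
  | _ :: y :: l => by
      have := lastL_append g x (y :: l)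
      simpa only [List.cons_append, lastL] using this

lemma length_nodes : ∀ {ℓ : ℕ} (U : Grammar v m2 m3 ℓ) (r : Fin v) (τ : ParseTree m2 m3 ℓ),
    (nodes U r τ).length = τ.size
  | 0, _, _, _ => rfl
  | _ + 1, U, r, Sum.inl (k, s, t) => by
      simp only [nodes, List.length_append, length_nodes, ParseTree.size]
  | _ + 1, U, r, Sum.inr (k, s, t, u) => by
      simp only [nodes, List.length_append, length_nodes, ParseTree.size]

lemma exists_nodes_eq_cons : ∀ {ℓ : ℕ} (U : Grammar v m2 m3 ℓ) (r : Fin v)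
    (τ : ParseTree m2 m3 ℓ), ∃ l, nodes U r τ = firstNode U r τ :: l
  | 0, _, _, _ => ⟨[], rfl⟩
  | _ + 1, U, r, Sum.inl (k, s, t) => by
      obtain ⟨l, hl⟩ := exists_nodes_eq_cons (Fin.tail U) ((U 0).1 (r, k)).1 s
      exact ⟨_, by rw [nodes, hl, firstNode]; rfl⟩
  | _ + 1, U, r, Sum.inr (k, s, t, u) => by
      obtain ⟨l, hl⟩ := exists_nodes_eq_cons (Fin.tail U) ((U 0).2 (r, k)).1 s
      exact ⟨_, by rw [nodes, hl, firstNode]; rfl⟩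

lemma exists_nodes_eq_append : ∀ {ℓ : ℕ} (U : Grammar v m2 m3 ℓ) (r : Fin v)
    (τ : ParseTree m2 m3 ℓ), ∃ l, nodes U r τ = l ++ [lastNode U r τ]
  | 0, _, _, _ => ⟨[], rfl⟩
  | _ + 1, U, r, Sum.inl (k, s, t) => by
      obtain ⟨l, hl⟩ := exists_nodes_eq_append (Fin.tail U) ((U 0).1 (r, k)).2 t
      exact ⟨_, by rw [nodes, hl, lastNode, ← List.append_assoc]⟩
  | _ + 1, U, r, Sum.inr (k, s, t, u) => by
      obtain ⟨l, hl⟩ := exists_nodes_eq_append (Fin.tail U) ((U 0).2 (r, k)).2.2 u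
      exact ⟨_, by rw [nodes, hl, lastNode, ← List.append_assoc]⟩

lemma adjL_nodes_append {ℓ : ℕ} (g : Fin v → Fin v → ℝ) (U : Grammar v m2 m3 ℓ) (x y : Fin v)
    (s t : ParseTree m2 m3 ℓ) : adjL g (nodes U x s ++ nodes U y t) =
      adjL g (nodes U x s) + adjL g (nodes U y t) + g (lastNode U x s) (firstNode U y t) := by
  obtain ⟨l, hl⟩ := exists_nodes_eq_append U x s
  obtain ⟨l', hl'⟩ := exists_nodes_eq_cons U y t
  rw [hl, hl', adjL_append]

lemma adjL_nodes (g : Fin v → Fin v → ℝ) : ∀ {ℓ : ℕ} (U : Grammar v m2 m3 ℓ) (r : Fin v)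
    (τ : ParseTree m2 m3 ℓ), adjL g (nodes U r τ) = adjSum (fun _ => 1) g U r τ
  | 0, _, _, _ => rfl
  | _ + 1, U, r, Sum.inl (k, s, t) => by
      rw [nodes, adjL_nodes_append, adjSum, adjL_nodes g, adjL_nodes g, one_mul]
  | _ + 1, U, r, Sum.inr (k, s, t, u) => by
      obtain ⟨l, hl⟩ := exists_nodes_eq_append (Fin.tail U) ((U 0).2 (r, k)).2.1 t
      obtain ⟨l', hl'⟩ := exists_nodes_eq_cons (Fin.tail U) ((U 0).2 (r, k)).2.2 u
      have h1 := adjL_append g (lastNode (Fin.tail U) ((U 0).2 (r, k)).2.1 t)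
        (firstNode (Fin.tail U) ((U 0).2 (r, k)).2.2 u) l'
        (nodes (Fin.tail U) ((U 0).2 (r, k)).1 s ++ l)
      rw [List.append_assoc (nodes _ _ _), ← hl, ← hl', adjL_nodes_append] at h1
      rw [nodes, h1, adjSum, adjL_nodes g, adjL_nodes g, adjL_nodes g]
      ring

lemma lastL_nodes {ℓ : ℕ} (g : Fin v → ℝ) (U : Grammar v m2 m3 ℓ) (r : Fin v)
    (τ : ParseTree m2 m3 ℓ) : lastL g (nodes U r τ) = g (lastNode U r τ) := by
  obtain ⟨l, hl⟩ := exists_nodes_eq_append U r τ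
  rw [hl, lastL_append]

lemma firstL_nodes {ℓ : ℕ} (g : Fin v → ℝ) (U : Grammar v m2 m3 ℓ) (r : Fin v)
    (τ : ParseTree m2 m3 ℓ) : firstL g (nodes U r τ) = g (firstNode U r τ) := by
  obtain ⟨l, hl⟩ := exists_nodes_eq_cons U r τ
  rw [hl, firstL]

/-! ### Averages over blocks as functionals of the upper levels -/

/-- Size weight of a node with a binary or ternary span. -/
noncomputable def nodeW (p : ℝ) (h : ℕ → ℝ) (b : Bool) (n : ℕ) : ℝ :=
  arityProb p b * lenE p h (n - 1) (arity b)

/-- Size weight of a pair of adjacent nodes. -/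
noncomputable def adjW (p : ℝ) (h : ℕ → ℝ) (i : Bool × Bool) (n : ℕ) : ℝ :=
  arityProb p i.1 * (arityProb p i.2 * lenE p h (n - 2) (arity i.1 + arity i.2))

/-- Average of `φ` over the spans of a node. -/
noncomputable def spanF (b : Bool) (Λ : Rules v m2 m3) (φ : Fin v × Span v → ℝ) (z : Fin v) : ℝ :=
  spanAvg b Λ (fun s => φ (z, s)) z

/-- Average of `ψ` over the spans of two nodes. -/
noncomputable def pairF (i : Bool × Bool) (Λ : Rules v m2 m3)
    (ψ : Fin v × Span v → Fin v × Span v → ℝ) (z z' : Fin v) : ℝ :=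
  spanAvg i.1 Λ (fun s => spanAvg i.2 Λ (fun s' => ψ (z, s) (z', s')) z') z

variable (p : ℝ) (Λ : Rules v m2 m3) {ℓ : ℕ} (U : Grammar v m2 m3 ℓ) (r : Fin v)
variable [Nonempty (Fin m2)] [Nonempty (Fin m3)]

lemma treeE_spansE_sum (h : ℕ → ℝ) (φ : Fin v × Span v → ℝ) :
    treeE p (fun τ => spansE p Λ (nodes U r τ) fun bs => h (totalLen bs) * (bs.map φ).sum) =
      ∑ b, nodeF p (nodeW p h b) (spanF b Λ φ) U r := by
  simp only [nodeF, ← treeE_sum]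
  congr 1; funext τ
  have := spansE_sum_map p Λ h φ (nodes U r τ) 0
  simp only [zero_add] at this
  rw [this, length_nodes, sum_bool]
  simp only [sum_bool, List.sum_map_add, ← mul_assoc, List.sum_map_mul_left, nodeW]
  rfl

lemma treeE_spansE_adjL (h : ℕ → ℝ) (ψ : Fin v × Span v → Fin v × Span v → ℝ) :
    treeE p (fun τ => spansE p Λ (nodes U r τ) fun bs => h (totalLen bs) * adjL ψ bs) =
      ∑ i, adjF p (fun _ => 1) (adjW p h i) (pairF i Λ ψ) U r := by
  simp only [adjF, ← treeE_sum]
  congr 1; funext τ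
  have := spansE_adjL p Λ h ψ (nodes U r τ) 0
  simp only [zero_add] at this
  rw [this, length_nodes]
  simp only [sum_prod_type, sum_bool, mul_add, adjL_add, ← mul_assoc,
    adjL_const_mul, adjW]
  simp only [← adjL_nodes]
  rfl

lemma treeE_spansE_lastL (h : ℕ → ℝ) (φ : Fin v × Span v → ℝ) :
    treeE p (fun τ => spansE p Λ (nodes U r τ) fun bs => h (totalLen bs) * lastL φ bs) =
      ∑ b, lastF p (nodeW p h b) (spanF b Λ φ) U r := by
  simp only [lastF, ← treeE_sum]
  congr 1; funext τ
  have := spansE_lastL p Λ h φ (nodes U r τ) 0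
  simp only [zero_add] at this
  rw [this, length_nodes, lastL_nodes]
  simp only [sum_bool, ← mul_assoc, nodeW]
  rfl

lemma treeE_spansE_firstL (h : ℕ → ℝ) (φ : Fin v × Span v → ℝ) :
    treeE p (fun τ => spansE p Λ (nodes U r τ) fun bs => h (totalLen bs) * firstL φ bs) =
      ∑ b, firstF p (nodeW p h b) (spanF b Λ φ) U r := by
  simp only [firstF, ← treeE_sum]
  congr 1; funext τ
  have := spansE_firstL p Λ h φ (nodes U r τ) 0
  simp only [zero_add] at this
  rw [this, length_nodes, firstL_nodes]
  simp only [sum_bool, ← mul_assoc, nodeW]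
  rfl

/-- Weight of a sentence of length `d` in averages over triples. -/
noncomputable def tripleW (d : ℕ) : ℝ := 1 / ((d - 2 : ℕ) : ℝ)

/-- Weight of a sentence of length `d` in averages over pairs. -/
noncomputable def pairW (d : ℕ) : ℝ := 1 / ((d - 1 : ℕ) : ℝ)

omit [Nonempty (Fin m2)] [Nonempty (Fin m3)] in
lemma treeE_triples_eq (G : Grammar v m2 m3 (ℓ + 1)) (f : Leaf v × Leaf v × Leaf v → ℝ) :
    treeE p (fun τ => listAvg f (triples G r τ)) = treeE p fun τ =>
      spansE p (G (Fin.last ℓ)) (nodes (Fin.init G) r τ) fun bs =>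
        tripleW (totalLen bs) * sumTrip f (leavesFrom 0 bs) := by
  have h := treeE_blocks p ℓ G r fun bs => tripleW (bs.zipIdx.flatMap fun b =>
      b.1.2.map fun x => (⟨x, b.1.1, b.2⟩ : Leaf v)).length * sumTrip f (bs.zipIdx.flatMap fun b =>
      b.1.2.map fun x => (⟨x, b.1.1, b.2⟩ : Leaf v))
  simp only [leavesFrom_eq, length_leavesFrom] at h
  rw [← h]
  congr 1; funext τ
  rw [listAvg, triples, sum_map_triples, tripleW]
  have hl : ((leaves G r τ).zip ((leaves G r τ).tail.zip (leaves G r τ).tail.tail)).length =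
      (leaves G r τ).length - 2 := by
    simp only [List.length_zip, List.length_tail]; omega
  rw [hl, leaves]
  ring

omit [Nonempty (Fin m2)] [Nonempty (Fin m3)] in
lemma treeE_pairs_eq (G : Grammar v m2 m3 (ℓ + 1)) (g : Fin v → Fin v → ℝ) :
    treeE p (fun τ => listAvg (fun x => g x.1.sym x.2.sym) (pairs G r τ)) = treeE p fun τ =>
      spansE p (G (Fin.last ℓ)) (nodes (Fin.init G) r τ) fun bs =>
        pairW (totalLen bs) * adjL (fun x y => g x.sym y.sym) (leavesFrom 0 bs) := by
  have h := treeE_blocks p ℓ G r fun bs => pairW (bs.zipIdx.flatMap fun b =>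
      b.1.2.map fun x => (⟨x, b.1.1, b.2⟩ : Leaf v)).length *
      adjL (fun x y => g x.sym y.sym) (bs.zipIdx.flatMap fun b =>
      b.1.2.map fun x => (⟨x, b.1.1, b.2⟩ : Leaf v))
  simp only [leavesFrom_eq, length_leavesFrom] at h
  rw [← h]
  congr 1; funext τ
  rw [listAvg, pairs, sum_map_pairs (fun x y : Leaf v => g x.sym y.sym), pairW]
  have hl : ((leaves G r τ).zip (leaves G r τ).tail).length = (leaves G r τ).length - 1 := by
    simp only [List.length_zip, List.length_tail]; omega
  rw [hl, leaves]
  ring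

/-- Averages over the triples of a sentence. -/
lemma treeE_triples (G : Grammar v m2 m3 (ℓ + 1)) (f : Leaf v × Leaf v × Leaf v → ℝ)
    (φ : Fin v × Span v → ℝ)
    (ψ : Fin v × Span v → Fin v × Span v → ℝ) (hφ : ∀ z w, φ (z, Sum.inl w) = 0)
    (hφ' : ∀ n z w, f (⟨w.1, z, n⟩, ⟨w.2.1, z, n⟩, ⟨w.2.2, z, n⟩) = φ (z, Sum.inr w))
    (hψ : ∀ n z z' s s',
      f (⟨(last2 s).1, z, n⟩, ⟨(last2 s).2, z, n⟩, ⟨(first2 s').1, z', n + 1⟩) +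
        f (⟨(last2 s).2, z, n⟩, ⟨(first2 s').1, z', n + 1⟩, ⟨(first2 s').2, z', n + 1⟩) =
        ψ (z, s) (z', s')) :
    treeE p (fun τ => listAvg f (triples G r τ)) =
      ∑ b, nodeF p (nodeW p tripleW b) (spanF b (G (Fin.last ℓ)) φ) (Fin.init G) r +
      ∑ i, adjF p (fun _ => 1) (adjW p tripleW i) (pairF i (G (Fin.last ℓ)) ψ) (Fin.init G) r := by
  rw [treeE_triples_eq, ← treeE_spansE_sum, ← treeE_spansE_adjL, ← treeE_add]
  simp only [sumTrip_leavesFrom f φ ψ hφ hφ' hψ, mul_add, spansE_add]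

/-- Number of occurrences of a pair in a span. -/
noncomputable def pairCount (g : Fin v → Fin v → ℝ) (b : Fin v × Span v) : ℝ :=
  Sum.elim (fun w => g w.1 w.2) (fun w => g w.1 w.2.1 + g w.2.1 w.2.2) b.2

/-- Averages over the pairs of a sentence. -/
lemma treeE_pairs (G : Grammar v m2 m3 (ℓ + 1)) (g : Fin v → Fin v → ℝ) :
    treeE p (fun τ => listAvg (fun x => g x.1.sym x.2.sym) (pairs G r τ)) =
      ∑ b, nodeF p (nodeW p pairW b) (spanF b (G (Fin.last ℓ)) (pairCount g)) (Fin.init G) r +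
      ∑ i, adjF p (fun _ => 1) (adjW p pairW i) (pairF i (G (Fin.last ℓ))
        fun b b' => g (last2 b.2).2 (first2 b'.2).1) (Fin.init G) r := by
  rw [treeE_pairs_eq, ← treeE_spansE_sum, ← treeE_spansE_adjL, ← treeE_add]
  simp only [adjL_leavesFrom, mul_add, spansE_add]
  rfl

/-- Averages over the first pairs of the triples of a sentence. -/
lemma treeE_triples_left (G : Grammar v m2 m3 (ℓ + 1)) (g : Fin v → Fin v → ℝ) :
    treeE p (fun τ => listAvg (fun x => g x.1.sym x.2.1.sym) (triples G r τ)) =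
      ∑ b, nodeF p (nodeW p tripleW b) (spanF b (G (Fin.last ℓ)) (pairCount g)) (Fin.init G) r +
      ∑ i, adjF p (fun _ => 1) (adjW p tripleW i) (pairF i (G (Fin.last ℓ))
        fun b b' => g (last2 b.2).2 (first2 b'.2).1) (Fin.init G) r -
      ∑ b, lastF p (nodeW p tripleW b) (spanF b (G (Fin.last ℓ))
        fun b => g (last2 b.2).1 (last2 b.2).2) (Fin.init G) r := by
  have h1 : ∀ bs : List (Fin v × Span v),
      sumTrip (fun x => g x.1.sym x.2.1.sym) (leavesFrom 0 bs) = (bs.map (pairCount g)).sum +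
        adjL (fun b b' => g (last2 b.2).2 (first2 b'.2).1) bs +
        (-1) * lastL (fun b => g (last2 b.2).1 (last2 b.2).2) bs := by
    intro bs
    rw [sumTrip_leavesFrom _ (fun b => pairCount g b - g (last2 b.2).1 (last2 b.2).2)
      (fun b b' => g (last2 b.2).1 (last2 b.2).2 + g (last2 b.2).2 (first2 b'.2).1),
      adjL_add, adjL_left]
    · have := List.sum_map_add (l := bs)
        (f := fun b => pairCount g b - g (last2 b.2).1 (last2 b.2).2)
        (g := fun b => g (last2 b.2).1 (last2 b.2).2)
      simp only [sub_add_cancel] at this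
      rw [this]; ring
    · intro z w; simp [pairCount, last2]
    · intro n z w; simp [pairCount, last2]
    · intros; rfl
  rw [treeE_triples_eq, ← treeE_spansE_sum, ← treeE_spansE_adjL, ← treeE_spansE_lastL, ← treeE_add,
    ← treeE_sub]
  simp only [h1, mul_add, spansE_add]
  congr 1; funext τ
  simp only [mul_left_comm _ (-1 : ℝ), spansE_const_mul]
  ring

/-- Averages over the last pairs of the triples of a sentence. -/
lemma treeE_triples_right (G : Grammar v m2 m3 (ℓ + 1)) (g : Fin v → Fin v → ℝ) :
    treeE p (fun τ => listAvg (fun x => g x.2.1.sym x.2.2.sym) (triples G r τ)) =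
      ∑ b, nodeF p (nodeW p tripleW b) (spanF b (G (Fin.last ℓ)) (pairCount g)) (Fin.init G) r +
      ∑ i, adjF p (fun _ => 1) (adjW p tripleW i) (pairF i (G (Fin.last ℓ))
        fun b b' => g (last2 b.2).2 (first2 b'.2).1) (Fin.init G) r -
      ∑ b, firstF p (nodeW p tripleW b) (spanF b (G (Fin.last ℓ))
        fun b => g (first2 b.2).1 (first2 b.2).2) (Fin.init G) r := by
  have h1 : ∀ bs : List (Fin v × Span v),
      sumTrip (fun x => g x.2.1.sym x.2.2.sym) (leavesFrom 0 bs) = (bs.map (pairCount g)).sum +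
        adjL (fun b b' => g (last2 b.2).2 (first2 b'.2).1) bs +
        (-1) * firstL (fun b => g (first2 b.2).1 (first2 b.2).2) bs := by
    intro bs
    rw [sumTrip_leavesFrom _ (fun b => pairCount g b - g (first2 b.2).1 (first2 b.2).2)
      (fun b b' => g (first2 b'.2).1 (first2 b'.2).2 + g (last2 b.2).2 (first2 b'.2).1),
      adjL_add, adjL_right]
    · have := List.sum_map_add (l := bs)
        (f := fun b => pairCount g b - g (first2 b.2).1 (first2 b.2).2)
        (g := fun b => g (first2 b.2).1 (first2 b.2).2)
      simp only [sub_add_cancel] at this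
      rw [this]; ring
    · intro z w; simp [pairCount, first2]
    · intro n z w; simp [pairCount, first2]
    · intros; exact add_comm _ _
  rw [treeE_triples_eq, ← treeE_spansE_sum, ← treeE_spansE_adjL, ← treeE_spansE_firstL, ← treeE_add,
    ← treeE_sub]
  simp only [h1, mul_add, spansE_add]
  congr 1; funext τ
  simp only [mul_left_comm _ (-1 : ℝ), spansE_const_mul]
  ring

/-- Averages over the nodes of the last but one level. -/
lemma treeE_penultimate (G : Grammar v m2 m3 (ℓ + 1)) (F : Fin v → ℝ) :
    treeE p (fun τ => listAvg F (penultimate G r τ)) =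
      nodeF p (fun n => 1 / (n : ℝ)) F (Fin.init G) r := by
  have h := treeE_blocks p ℓ G r fun bs => listAvg F (bs.map Prod.fst)
  simp only [List.map_map] at h
  refine h.trans ?_
  rw [nodeF]
  congr 1; funext τ
  have h1 : ∀ (l : List (Fin v)) (X : List (Fin v) → ℝ),
      spansE p (G (Fin.last ℓ)) l (fun bs => X (bs.map fun b => b.1)) = X l := by
    intro l
    induction l with
    | nil => intro X; rfl
    | cons z l ih =>
      intro X
      simp only [spansE, List.map_cons]
      have : spansE p (G (Fin.last ℓ)) l (fun bs => X (z :: bs.map fun b => b.1)) = X (z :: l) :=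
        ih fun l => X (z :: l)
      simp only [this, spanE, spanAvg_const, sum_bool, arityProb]
      ring
  refine (h1 (nodes (Fin.init G) r τ) (listAvg F)).trans ?_
  rw [listAvg, length_nodes]
  ring

end Tokens

/-! ### The covariances as functionals of the upper levels -/

section Linking

variable {v m2 m3 : ℕ}

/-- Covariances with the indicators of the root, for a function of the root. -/
noncomputable def rootVec (φ : Fin v → ℝ) (α : Fin v) : ℝ := 1 / (v : ℝ) * (φ α - 𝔼 r, φ r)

lemma rootVec_add (φ ψ : Fin v → ℝ) (α : Fin v) :
    rootVec (fun r => φ r + ψ r) α = rootVec φ α + rootVec ψ α := by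
  simp only [rootVec, expect_add]; ring

lemma rootVec_sub (φ ψ : Fin v → ℝ) (α : Fin v) :
    rootVec (fun r => φ r - ψ r) α = rootVec φ α - rootVec ψ α := by
  simp only [rootVec, expect_sub]; ring

lemma rootVec_const_mul (c : ℝ) (φ : Fin v → ℝ) (α : Fin v) :
    rootVec (fun r => c * φ r) α = c * rootVec φ α := by
  simp only [rootVec, expect_const_mul]; ring

lemma rootVec_sum {κ : Type*} (s : Finset κ) (φ : κ → Fin v → ℝ) (α : Fin v) :
    rootVec (fun r => ∑ i ∈ s, φ i r) α = ∑ i ∈ s, rootVec (φ i) α := by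
  simp only [rootVec, expect_sum, ← sum_sub_distrib, mul_sum]

lemma sum_eq_mul_expect [NeZero v] (f : Fin v → ℝ) : ∑ r, f r = v * 𝔼 r, f r := by
  have : (v : ℝ) ≠ 0 := NeZero.ne _
  rw [expect_eq, card_fin, ← mul_assoc, mul_one_div_cancel this, one_mul]

lemma rootVec_dotProduct [NeZero v] (φ ψ : Fin v → ℝ) :
    rootVec φ ⬝ᵥ rootVec ψ = 1 / (v : ℝ) * cvar φ ψ := by
  have hv : (v : ℝ) ≠ 0 := NeZero.ne _
  have : Nonempty (Fin v) := ⟨0⟩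
  have h : ∀ α, rootVec φ α * rootVec ψ α =
      1 / (v : ℝ) ^ 2 * ((φ α - 𝔼 r, φ r) * (ψ α - 𝔼 r, ψ r)) := fun α => by
    rw [rootVec, rootVec]; ring
  rw [dotProduct, sum_eq_mul_expect, cvar_eq_centered]
  simp only [h, expect_const_mul]
  generalize (𝔼 r, (φ r - 𝔼 x, φ x) * (ψ r - 𝔼 x, ψ x)) = A
  field_simp

lemma sum_rootVec [NeZero v] (φ : Fin v → ℝ) : ∑ α, rootVec φ α = 0 := by
  have : Nonempty (Fin v) := ⟨0⟩
  rw [sum_eq_mul_expect]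
  simp only [rootVec, expect_const_mul, expect_sub, expect_const, sub_self, mul_zero]

variable (p : ℝ) {ℓ : ℕ}

section

variable [NeZero v] [Nonempty (Fin m2)] [Nonempty (Fin m3)]

lemma mean_eq (X : Fin v → ParseTree m2 m3 ℓ → ℝ) : mean p X = 𝔼 r, treeE p (X r) := by
  rw [expect_eq, card_fin, mean, mul_sum]
  refine sum_congr rfl fun r _ => ?_
  rw [treeE, mul_sum]
  exact sum_congr rfl fun τ _ => by ring

lemma rootCov_eq (X : Fin v → ParseTree m2 m3 ℓ → ℝ) (α : Fin v) :
    rootCov p X α = rootVec (fun r => treeE p (X r)) α := by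
  have h1 : ∀ φ : Fin v → ℝ, 𝔼 r, φ r * ind (r = α) = 1 / (v : ℝ) * φ α := by
    intro φ
    rw [expect_eq, card_fin, sum_eq_single α]
    · rw [ind_true rfl, mul_one]
    · intro b _ hb; rw [ind_false hb, mul_zero]
    · intro h; exact absurd (Finset.mem_univ _) h
  rw [rootCov, mean_eq, mean_eq, mean_eq]
  simp only [treeE_mul_const, treeE_const, h1, rootVec]
  have h2 := h1 fun _ => 1
  simp only [one_mul, mul_one] at h2
  rw [h2]; ring

end

lemma nodeF_zero_fun (h : ℕ → ℝ) (U : Grammar v m2 m3 ℓ) (r : Fin v) :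
    nodeF p h (fun _ => 0) U r = 0 := by
  simp [nodeF, treeE]

lemma adjSum_zero_fun (a : ℕ → ℝ) (U : Grammar v m2 m3 ℓ) (r : Fin v) (τ : ParseTree m2 m3 ℓ) :
    adjSum a (fun _ _ => 0) U r τ = 0 := by
  have := adjSum_const_mul a 0 (fun _ _ => 0) U r τ
  simpa using this

lemma adjF_zero_fun (a h : ℕ → ℝ) (U : Grammar v m2 m3 ℓ) (r : Fin v) :
    adjF p a h (fun _ _ => 0) U r = 0 := by
  simp [adjF, adjSum_zero_fun, treeE]

/-- Probability that the last two tokens of a span of `z` are `x`, `y`. -/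
noncomputable def endPair (b : Bool) (Λ : Rules v m2 m3) (x y z : Fin v) : ℝ :=
  spanAvg b Λ (fun s => ind ((last2 s).1 = x ∧ (last2 s).2 = y)) z

/-- Probability that the first two tokens of a span of `z` are `x`, `y`. -/
noncomputable def startPair (b : Bool) (Λ : Rules v m2 m3) (x y z : Fin v) : ℝ :=
  spanAvg b Λ (fun s => ind ((first2 s).1 = x ∧ (first2 s).2 = y)) z

/-- Mean number of occurrences of the pair `x`, `y` in a span of `z`. -/
noncomputable def pairOcc : Bool → Rules v m2 m3 → Fin v → Fin v → Fin v → ℝ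
  | false, Λ, x, y, z => endPair false Λ x y z
  | true, Λ, x, y, z => startPair true Λ x y z + endPair true Λ x y z

/-- Probability that the last token of a span of `z` is `x`. -/
noncomputable def lastTok (b : Bool) (Λ : Rules v m2 m3) (x z : Fin v) : ℝ :=
  lastChild b Λ (fun y => ind (x = y)) z

/-- Probability that the first token of a span of `z` is `x`. -/
noncomputable def firstTok (b : Bool) (Λ : Rules v m2 m3) (x z : Fin v) : ℝ :=
  firstChild b Λ (fun y => ind (x = y)) z

/-- Probability of the triple `t` for a ternary span of `z`. -/
noncomputable def ruleF (Λ : Rules v m2 m3) (t : Triple v) (z : Fin v) : ℝ :=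
  rowAvg Λ.2 (fun w => ind (w = t)) z

lemma ruleProb_eq (G : Grammar v m2 m3 (ℓ + 1)) (z : Fin v) (t : Triple v) :
    ruleProb G z t = ruleF (G (Fin.last ℓ)) t z := by
  rw [ruleProb, ruleF, rowAvg, expect_eq, card_fin]; ring

lemma spanAvg_last2 (b : Bool) (Λ : Rules v m2 m3) (f : Fin v → ℝ) (z : Fin v) :
    spanAvg b Λ (fun s => f (last2 s).2) z = lastChild b Λ f z := by
  cases b <;> rfl

lemma spanAvg_first2 (b : Bool) (Λ : Rules v m2 m3) (f : Fin v → ℝ) (z : Fin v) :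
    spanAvg b Λ (fun s => f (first2 s).1) z = firstChild b Λ f z := by
  cases b <;> rfl

lemma pairF_mul (i : Bool × Bool) (Λ : Rules v m2 m3) (A B : Span v → ℝ) (z z' : Fin v) :
    pairF i Λ (fun b b' => A b.2 * B b'.2) z z' = spanAvg i.1 Λ A z * spanAvg i.2 Λ B z' := by
  simp only [pairF, spanAvg_const_mul, spanAvg_mul_const]

lemma pairF_add (i : Bool × Bool) (Λ : Rules v m2 m3) (φ ψ : Fin v × Span v → Fin v × Span v → ℝ)
    (z z' : Fin v) : pairF i Λ (fun b b' => φ b b' + ψ b b') z z' =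
      pairF i Λ φ z z' + pairF i Λ ψ z z' := by
  simp only [pairF, spanAvg_add]

lemma pairF_const_mul (i : Bool × Bool) (Λ : Rules v m2 m3) (c : ℝ)
    (φ : Fin v × Span v → Fin v × Span v → ℝ) (z z' : Fin v) :
    pairF i Λ (fun b b' => c * φ b b') z z' = c * pairF i Λ φ z z' := by
  simp only [pairF, spanAvg_const_mul]

/-- Kernel of the noise for a pair of adjacent nodes. -/
noncomputable def noiseK (i : Bool × Bool) (Λ : Rules v m2 m3) (t : Triple v)
    (z z' : Fin v) : ℝ :=
  endPair i.1 Λ t.1 t.2.1 z * (firstTok i.2 Λ t.2.2 z' - 1 / (v : ℝ)) +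
    (lastTok i.1 Λ t.1 z - 1 / (v : ℝ)) * startPair i.2 Λ t.2.1 t.2.2 z'

/-- Probability of the pair `x`, `y` at the boundary of two adjacent nodes. -/
noncomputable def boundK (i : Bool × Bool) (Λ : Rules v m2 m3) (x y z z' : Fin v) : ℝ :=
  lastTok i.1 Λ x z * firstTok i.2 Λ y z'

/-- Root-conditional average of the noise variable. -/
noncomputable def noiseHat (Λ : Rules v m2 m3) (t : Triple v) (U : Grammar v m2 m3 ℓ)
    (r : Fin v) : ℝ := ∑ i, adjF p (fun _ => 1) (adjW p tripleW i) (noiseK i Λ t) U r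

/-- Root-conditional average of the error of the decomposition at the position of the triple. -/
noncomputable def errHat (Λ : Rules v m2 m3) (t : Triple v) (U : Grammar v m2 m3 ℓ)
    (r : Fin v) : ℝ :=
  -(1 / (v : ℝ)) * (nodeF p (nodeW p tripleW true) (fun z => startPair true Λ t.1 t.2.1 z +
      endPair true Λ t.2.1 t.2.2 z) U r +
    ∑ i, adjF p (fun _ => 1) (adjW p tripleW i) (fun z z' => boundK i Λ t.1 t.2.1 z z' +
      boundK i Λ t.2.1 t.2.2 z z') U r)

/-- Root-conditional average of the frequency of a pair, with length weight `h`. -/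
noncomputable def pairHat (h : ℕ → ℝ) (Λ : Rules v m2 m3) (x y : Fin v) (U : Grammar v m2 m3 ℓ)
    (r : Fin v) : ℝ :=
  ∑ b, nodeF p (nodeW p h b) (pairOcc b Λ x y) U r +
    ∑ i, adjF p (fun _ => 1) (adjW p h i) (boundK i Λ x y) U r

/-- The value of `pTer`. -/
noncomputable def terProb (m2 m3 ℓ : ℕ) : ℝ :=
  treeE p fun τ : ParseTree m2 m3 ℓ => nodeW p tripleW true τ.size * (τ.size : ℝ)

/-- Size weight of the signal. -/
noncomputable def signalW (m2 m3 ℓ n : ℕ) : ℝ := terProb p m2 m3 ℓ * (1 / (n : ℝ))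

variable [NeZero v] [Nonempty (Fin m2)] [Nonempty (Fin m3)]

lemma ind_eq_comm {β : Type*} (x y : β) : ind (x = y) = ind (y = x) := ind_congr eq_comm

lemma pTer_eq (G : Grammar v m2 m3 (ℓ + 1)) : pTer p G = terProb p m2 m3 ℓ := by
  have : Nonempty (Fin v) := ⟨0⟩
  rw [pTer, mean_eq]
  simp only [freq_eq_listAvg]
  have h : ∀ r, treeE p (fun τ => listAvg (fun x => ind (TernarySiblings x)) (triples G r τ)) =
      terProb p m2 m3 ℓ := by
    intro r
    rw [treeE_triples p r G _ (fun b => Sum.elim (fun _ => 0) (fun _ => 1) b.2) (fun _ _ => 0)]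
    · have e1 : spanF false (G (Fin.last ℓ)) (fun b => Sum.elim (fun _ => 0) (fun _ => 1) b.2) =
          fun _ : Fin v => (0 : ℝ) := funext fun z => spanAvg_const _ false 0 z
      have e2 : spanF true (G (Fin.last ℓ)) (fun b => Sum.elim (fun _ => 0) (fun _ => 1) b.2) =
          fun _ : Fin v => (1 : ℝ) := funext fun z => spanAvg_const _ true 1 z
      have e3 : ∀ i, pairF i (G (Fin.last ℓ)) (fun _ _ => 0) = fun _ _ : Fin v => (0 : ℝ) :=
        fun i => funext fun z => funext fun z' => by simp only [pairF, spanAvg_const]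
      simp only [sum_bool, e1, e2, e3, nodeF_zero_fun, adjF_zero_fun,
        Finset.sum_const_zero, add_zero]
      rw [nodeF, terProb]
      congr 1; funext τ
      rw [← length_nodes (Fin.init G) r τ]; simp
    · intros; rfl
    · intro n z w; exact ind_true ⟨rfl, rfl⟩
    · intro n z z' s s'
      rw [ind_false (fun h => (Nat.succ_ne_self n) h.2.symm),
        ind_false (fun h => (Nat.succ_ne_self n) h.1.symm), add_zero]
  simp only [h, expect_const]

lemma C1_eq (G : Grammar v m2 m3 (ℓ + 1)) (z α : Fin v) :
    C1 p G z α = rootVec (nodeF p (fun n => 1 / (n : ℝ)) (fun y => ind (y = z)) (Fin.init G)) α := by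
  rw [C1, rootCov_eq]
  congr; funext r
  exact treeE_penultimate p r G _

lemma terCov_eq (G : Grammar v m2 m3 (ℓ + 1)) (z α : Fin v) :
    terCov p G z α =
      rootVec (nodeF p (nodeW p tripleW true) (fun y => ind (y = z)) (Fin.init G)) α := by
  rw [terCov, rootCov_eq]
  congr; funext r
  simp only [freq_eq_listAvg]
  rw [treeE_triples p r G _ (fun b => Sum.elim (fun _ => 0) (fun _ => ind (b.1 = z)) b.2)
    (fun _ _ => 0)]
  · have e1 : spanF false (G (Fin.last ℓ)) (fun b => Sum.elim (fun _ => 0)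
        (fun _ => ind (b.1 = z)) b.2) = fun _ : Fin v => (0 : ℝ) :=
      funext fun z => spanAvg_const _ false 0 z
    have e2 : spanF true (G (Fin.last ℓ)) (fun b => Sum.elim (fun _ => 0)
        (fun _ => ind (b.1 = z)) b.2) = fun y : Fin v => ind (y = z) :=
      funext fun y => spanAvg_const _ true (ind (y = z)) y
    have e3 : ∀ i, pairF i (G (Fin.last ℓ)) (fun _ _ => 0) = fun _ _ : Fin v => (0 : ℝ) :=
      fun i => funext fun z => funext fun z' => by simp only [pairF, spanAvg_const]
    simp only [sum_bool, e1, e2, e3, nodeF_zero_fun, adjF_zero_fun,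
      Finset.sum_const_zero, add_zero]
  · intros; rfl
  · intro n z w
    exact ind_congr ⟨fun h => h.2, fun h => ⟨⟨rfl, rfl⟩, h⟩⟩
  · intro n z z' s s'
    rw [ind_false (fun h => (Nat.succ_ne_self n) h.1.2.symm),
      ind_false (fun h => (Nat.succ_ne_self n) h.1.1.symm), add_zero]

lemma sum_ruleProb_rootVec (G : Grammar v m2 m3 (ℓ + 1)) (w : ℕ → ℝ)
    (t : Triple v) (α : Fin v) :
    ∑ z, ruleProb G z t * rootVec (nodeF p w (fun y => ind (y = z)) (Fin.init G)) α =
      rootVec (nodeF p w (ruleF (G (Fin.last ℓ)) t) (Fin.init G)) α := by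
  simp only [← rootVec_const_mul, ← rootVec_sum, ← nodeF_const_mul]
  congr 1; funext r
  simp only [nodeF, ← treeE_sum, ← mul_sum]
  congr 1; funext τ
  congr 1
  generalize nodes (Fin.init G) r τ = l
  have hy : ∀ y, ∑ z, ruleProb G z t * ind (y = z) = ruleF (G (Fin.last ℓ)) t y := by
    intro y
    rw [sum_eq_single y]
    · rw [ind_true rfl, mul_one, ruleProb_eq]
    · intro b _ hb; rw [ind_false hb.symm, mul_zero]
    · intro h; exact absurd (Finset.mem_univ _) h
  induction l with
  | nil => simp
  | cons y l ih =>
    simp only [List.map_cons, List.sum_cons, sum_add_distrib, ih, hy]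

lemma signalCond_eq (G : Grammar v m2 m3 (ℓ + 1)) (t : Triple v) (α : Fin v) :
    signalCond p G t α =
      rootVec (nodeF p (nodeW p tripleW true) (ruleF (G (Fin.last ℓ)) t) (Fin.init G)) α := by
  simp only [signalCond, terCov_eq, sum_ruleProb_rootVec]

lemma signal_eq (G : Grammar v m2 m3 (ℓ + 1)) (t : Triple v) (α : Fin v) :
    signal p G t α =
      rootVec (nodeF p (signalW p m2 m3 ℓ) (ruleF (G (Fin.last ℓ)) t) (Fin.init G)) α := by
  simp only [signal, C1_eq, sum_ruleProb_rootVec, pTer_eq]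
  rw [← rootVec_const_mul]
  congr 1; funext r
  exact (nodeF_const_mul_weight p _ _ _ _ r).symm

lemma center_eq (G : Grammar v m2 m3 (ℓ + 1)) (z α : Fin v) :
    center p G z α = rootVec (nodeF p (signalW p m2 m3 ℓ)
      (fun y => 1 / (m3 : ℝ) * ind (y = z)) (Fin.init G)) α := by
  rw [center, C1_eq, pTer_eq, ← rootVec_const_mul]
  congr 1; funext r
  rw [nodeF_const_mul]
  unfold signalW
  rw [nodeF_const_mul_weight]
  ring

lemma C2_eq (G : Grammar v m2 m3 (ℓ + 1)) (x y α : Fin v) :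
    C2 p G x y α = rootVec (pairHat p pairW (G (Fin.last ℓ)) x y (Fin.init G)) α := by
  rw [C2, rootCov_eq]
  congr 1; funext r
  simp only [freq_eq_listAvg]
  rw [treeE_pairs p r G fun a b => ind (a = x ∧ b = y), pairHat]
  congr 1
  · refine sum_congr rfl fun b _ => ?_
    congr 1; funext z
    cases b
    · rfl
    · exact spanAvg_add _ true
        (fun s => ind ((first2 s).1 = x ∧ (first2 s).2 = y))
        (fun s => ind ((last2 s).1 = x ∧ (last2 s).2 = y)) z
  · refine sum_congr rfl fun i _ => ?_
    congr 1; funext z z'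
    simp only [ind_and]
    rw [pairF_mul i _ (fun s => ind ((last2 s).2 = x)) (fun s => ind ((first2 s).1 = y)), boundK,
      lastTok, firstTok, ← spanAvg_last2, ← spanAvg_first2]
    simp only [ind_eq_comm]

lemma spanF_pairCount (b : Bool) (Λ : Rules v m2 m3) (x y : Fin v) :
    spanF b Λ (pairCount fun a b => ind (a = x ∧ b = y)) = pairOcc b Λ x y := by
  funext z
  cases b
  · rfl
  · exact spanAvg_add _ true
      (fun s => ind ((first2 s).1 = x ∧ (first2 s).2 = y))
      (fun s => ind ((last2 s).1 = x ∧ (last2 s).2 = y)) z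

lemma pairF_bound (i : Bool × Bool) (Λ : Rules v m2 m3) (x y : Fin v) :
    pairF i Λ (fun b b' => ind ((last2 b.2).2 = x ∧ (first2 b'.2).1 = y)) = boundK i Λ x y := by
  funext z z'
  simp only [ind_and]
  rw [pairF_mul i _ (fun s => ind ((last2 s).2 = x)) (fun s => ind ((first2 s).1 = y)), boundK,
    lastTok, firstTok, ← spanAvg_last2, ← spanAvg_first2]
  simp only [ind_eq_comm]

lemma C2left_eq (G : Grammar v m2 m3 (ℓ + 1)) (x y α : Fin v) :
    C2left p G x y α = rootVec (fun r => pairHat p tripleW (G (Fin.last ℓ)) x y (Fin.init G) r -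
      ∑ b, lastF p (nodeW p tripleW b) (endPair b (G (Fin.last ℓ)) x y) (Fin.init G) r) α := by
  rw [C2left, rootCov_eq]
  congr 1; funext r
  simp only [freq_eq_listAvg]
  rw [treeE_triples_left p r G fun a b => ind (a = x ∧ b = y), pairHat]
  simp only [spanF_pairCount, pairF_bound]
  rfl

lemma C2right_eq (G : Grammar v m2 m3 (ℓ + 1)) (x y α : Fin v) :
    C2right p G x y α = rootVec (fun r => pairHat p tripleW (G (Fin.last ℓ)) x y (Fin.init G) r -
      ∑ b, firstF p (nodeW p tripleW b) (startPair b (G (Fin.last ℓ)) x y) (Fin.init G) r) α := by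
  rw [C2right, rootCov_eq]
  congr 1; funext r
  simp only [freq_eq_listAvg]
  rw [treeE_triples_right p r G fun a b => ind (a = x ∧ b = y), pairHat]
  simp only [spanF_pairCount, pairF_bound]
  rfl

/-- The noise variable of a triple of tokens. -/
noncomputable def noiseVar (t : Triple v) (x : Leaf v × Leaf v × Leaf v) : ℝ :=
  (ind (LeftSiblings x ∧ (x.1.sym = t.1 ∧ x.2.1.sym = t.2.1) ∧ x.2.2.sym = t.2.2) -
      1 / (v : ℝ) * ind (LeftSiblings x ∧ (x.1.sym = t.1 ∧ x.2.1.sym = t.2.1))) +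
    (ind (RightSiblings x ∧ (x.2.1.sym = t.2.1 ∧ x.2.2.sym = t.2.2) ∧ x.1.sym = t.1) -
      1 / (v : ℝ) * ind (RightSiblings x ∧ (x.2.1.sym = t.2.1 ∧ x.2.2.sym = t.2.2)))

lemma noise_eq_rootVec (G : Grammar v m2 m3 (ℓ + 1)) (t : Triple v) (α : Fin v) :
    noise p G t α =
      rootVec (fun r => treeE p fun τ => listAvg (noiseVar t) (triples G r τ)) α := by
  rw [noise, rootCov_eq]
  simp only [freq_eq_listAvg, ← listAvg_const_mul, ← listAvg_sub, ← listAvg_add]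
  rfl

omit [NeZero v] in
lemma noiseVar_ternary (t : Triple v) (n : ℕ) (z : Fin v) (w : Triple v) :
    noiseVar t (⟨w.1, z, n⟩, ⟨w.2.1, z, n⟩, ⟨w.2.2, z, n⟩) = 0 := by
  simp only [noiseVar]
  rw [ind_false (fun h => h.1.2 rfl), ind_false (fun h => h.1.2 rfl),
    ind_false (fun h => h.1.1 rfl), ind_false (fun h => h.1.1 rfl)]
  ring

omit [NeZero v] in
lemma noiseVar_left (t : Triple v) (n : ℕ) (z z' x y w : Fin v) :
    noiseVar t (⟨x, z, n⟩, ⟨y, z, n⟩, ⟨w, z', n + 1⟩) =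
      ind (x = t.1 ∧ y = t.2.1) * (ind (t.2.2 = w) - 1 / (v : ℝ)) := by
  have hL : LeftSiblings ((⟨x, z, n⟩, ⟨y, z, n⟩, ⟨w, z', n + 1⟩) : Leaf v × Leaf v × Leaf v) :=
    ⟨rfl, (Nat.succ_ne_self n).symm⟩
  have hR : ¬ RightSiblings ((⟨x, z, n⟩, ⟨y, z, n⟩, ⟨w, z', n + 1⟩) : Leaf v × Leaf v × Leaf v) :=
    fun h => h.1 rfl
  simp only [noiseVar, ind_and, ind_true hL, ind_false hR, ind_eq_comm t.2.2]
  ring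

omit [NeZero v] in
lemma noiseVar_right (t : Triple v) (n : ℕ) (z z' x y w : Fin v) :
    noiseVar t (⟨x, z, n⟩, ⟨y, z', n + 1⟩, ⟨w, z', n + 1⟩) =
      (ind (t.1 = x) - 1 / (v : ℝ)) * ind (y = t.2.1 ∧ w = t.2.2) := by
  have hL : ¬ LeftSiblings ((⟨x, z, n⟩, ⟨y, z', n + 1⟩, ⟨w, z', n + 1⟩) :
    Leaf v × Leaf v × Leaf v) := fun h => (Nat.succ_ne_self n) h.1.symm
  have hR : RightSiblings ((⟨x, z, n⟩, ⟨y, z', n + 1⟩, ⟨w, z', n + 1⟩) :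
    Leaf v × Leaf v × Leaf v) := ⟨(Nat.succ_ne_self n).symm, rfl⟩
  simp only [noiseVar, ind_and, ind_true hR, ind_false hL, ind_eq_comm t.1]
  ring

lemma noise_eq (G : Grammar v m2 m3 (ℓ + 1)) (t : Triple v) (α : Fin v) :
    noise p G t α = rootVec (noiseHat p (G (Fin.last ℓ)) t (Fin.init G)) α := by
  rw [noise_eq_rootVec]
  congr 1; funext r
  rw [treeE_triples p r G (noiseVar t) (fun _ => 0) (fun b b' =>
    ind ((last2 b.2).1 = t.1 ∧ (last2 b.2).2 = t.2.1) *
      (ind (t.2.2 = (first2 b'.2).1) - 1 / (v : ℝ)) +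
    (ind (t.1 = (last2 b.2).2) - 1 / (v : ℝ)) *
      ind ((first2 b'.2).1 = t.2.1 ∧ (first2 b'.2).2 = t.2.2))]
  · have e1 : ∀ b, spanF b (G (Fin.last ℓ)) (fun _ => 0) = fun _ : Fin v => (0 : ℝ) :=
      fun b => funext fun z => spanAvg_const _ b 0 z
    simp only [e1, nodeF_zero_fun, Finset.sum_const_zero, zero_add, noiseHat]
    refine sum_congr rfl fun i _ => ?_
    congr 1; funext z z'
    rw [pairF_add, pairF_mul i _ (fun s => ind ((last2 s).1 = t.1 ∧ (last2 s).2 = t.2.1))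
      (fun s => ind (t.2.2 = (first2 s).1) - 1 / (v : ℝ)),
      pairF_mul i _ (fun s => ind (t.1 = (last2 s).2) - 1 / (v : ℝ))
      (fun s => ind ((first2 s).1 = t.2.1 ∧ (first2 s).2 = t.2.2)),
      spanAvg_first2 i.2 _ (fun y => ind (t.2.2 = y) - 1 / (v : ℝ)),
      spanAvg_last2 i.1 _ (fun y => ind (t.1 = y) - 1 / (v : ℝ)), firstChild_sub, lastChild_sub]
    have c1 : ∀ b x, firstChild b (G (Fin.last ℓ)) (fun _ => 1 / (v : ℝ)) x = 1 / (v : ℝ) := by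
      intro b x; rw [← spanAvg_first2, spanAvg_const]
    have c2 : ∀ b x, lastChild b (G (Fin.last ℓ)) (fun _ => 1 / (v : ℝ)) x = 1 / (v : ℝ) := by
      intro b x; rw [← spanAvg_last2, spanAvg_const]
    rw [c1, c2]
    rfl
  · intros; rfl
  · exact fun n z w => noiseVar_ternary t n z w
  · intro n z z' s s'
    rw [noiseVar_left, noiseVar_right]

/-- The error of the decomposition at the position of the triple. -/
lemma sub_whitenedCond_eq (G : Grammar v m2 m3 (ℓ + 1)) (t : Triple v) (α : Fin v) :
    C3 p G t.1 t.2.1 t.2.2 α - (signalCond p G t α +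
      1 / (v : ℝ) * (C2left p G t.1 t.2.1 α + C2right p G t.2.1 t.2.2 α) + noise p G t α) =
      rootVec (errHat p (G (Fin.last ℓ)) t (Fin.init G)) α := by
  have hv : (v : ℝ) ≠ 0 := NeZero.ne _
  have h0 : C3 p G t.1 t.2.1 t.2.2 α -
      1 / (v : ℝ) * (C2left p G t.1 t.2.1 α + C2right p G t.2.1 t.2.2 α) - noise p G t α =
      rootVec (fun r => treeE p fun τ => listAvg (fun x =>
        ind (x.1.sym = t.1 ∧ x.2.1.sym = t.2.1 ∧ x.2.2.sym = t.2.2) -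
        1 / (v : ℝ) * (ind (x.1.sym = t.1 ∧ x.2.1.sym = t.2.1) +
          ind (x.2.1.sym = t.2.1 ∧ x.2.2.sym = t.2.2)) - noiseVar t x) (triples G r τ)) α := by
    rw [noise_eq_rootVec, C3, C2left, C2right, rootCov_eq, rootCov_eq, rootCov_eq, ← rootVec_add,
      ← rootVec_const_mul, ← rootVec_sub, ← rootVec_sub]
    simp only [freq_eq_listAvg, listAvg_sub, listAvg_const_mul, listAvg_add, treeE_sub, treeE_add,
      treeE_const_mul]
  have h1 : ∀ r, (treeE p fun τ => listAvg (fun x =>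
        ind (x.1.sym = t.1 ∧ x.2.1.sym = t.2.1 ∧ x.2.2.sym = t.2.2) -
        1 / (v : ℝ) * (ind (x.1.sym = t.1 ∧ x.2.1.sym = t.2.1) +
          ind (x.2.1.sym = t.2.1 ∧ x.2.2.sym = t.2.2)) - noiseVar t x) (triples G r τ)) =
      nodeF p (nodeW p tripleW true) (ruleF (G (Fin.last ℓ)) t) (Fin.init G) r +
        errHat p (G (Fin.last ℓ)) t (Fin.init G) r := by
    intro r
    rw [treeE_triples p r G _ (fun b => Sum.elim (fun _ => 0) (fun w => ind (w = t) +
        (-(1 / (v : ℝ))) * (ind (w.1 = t.1 ∧ w.2.1 = t.2.1) +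
          ind (w.2.1 = t.2.1 ∧ w.2.2 = t.2.2))) b.2)
      (fun b b' => (-(1 / (v : ℝ))) * (ind ((last2 b.2).2 = t.1 ∧ (first2 b'.2).1 = t.2.1) +
        ind ((last2 b.2).2 = t.2.1 ∧ (first2 b'.2).1 = t.2.2)))]
    · have e1 : spanF false (G (Fin.last ℓ)) (fun b => Sum.elim (fun _ => 0) (fun w =>
          ind (w = t) + (-(1 / (v : ℝ))) * (ind (w.1 = t.1 ∧ w.2.1 = t.2.1) +
          ind (w.2.1 = t.2.1 ∧ w.2.2 = t.2.2))) b.2) = fun _ : Fin v => (0 : ℝ) :=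
        funext fun z => spanAvg_const _ false 0 z
      have e2 : spanF true (G (Fin.last ℓ)) (fun b => Sum.elim (fun _ => 0) (fun w =>
          ind (w = t) + (-(1 / (v : ℝ))) * (ind (w.1 = t.1 ∧ w.2.1 = t.2.1) +
          ind (w.2.1 = t.2.1 ∧ w.2.2 = t.2.2))) b.2) = fun z : Fin v =>
          ruleF (G (Fin.last ℓ)) t z + (-(1 / (v : ℝ))) *
            (startPair true (G (Fin.last ℓ)) t.1 t.2.1 z +
              endPair true (G (Fin.last ℓ)) t.2.1 t.2.2 z) := by
        funext z
        refine (expect_add _ _).trans (congrArg₂ _ rfl ?_)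
        exact (expect_const_mul _ _).trans (congrArg _ (expect_add _ _))
      simp only [sum_bool, e1, e2, nodeF_zero_fun, nodeF_add _ _ (ruleF _ _),
        nodeF_const_mul, add_zero]
      have e3 : ∀ i, pairF i (G (Fin.last ℓ)) (fun b b' => (-(1 / (v : ℝ))) *
          (ind ((last2 b.2).2 = t.1 ∧ (first2 b'.2).1 = t.2.1) +
          ind ((last2 b.2).2 = t.2.1 ∧ (first2 b'.2).1 = t.2.2))) = fun z z' =>
          (-(1 / (v : ℝ))) * (boundK i (G (Fin.last ℓ)) t.1 t.2.1 z z' +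
            boundK i (G (Fin.last ℓ)) t.2.1 t.2.2 z z') := by
        intro i
        funext z z'
        rw [pairF_const_mul, pairF_add, pairF_bound, pairF_bound]
      simp only [e3, adjF_const_mul, ← mul_sum, errHat]
      ring
    · intros; rfl
    · intro n z w
      rw [noiseVar_ternary]
      simp only [Sum.elim_inr]
      have : ind (w.1 = t.1 ∧ w.2.1 = t.2.1 ∧ w.2.2 = t.2.2) = ind (w = t) :=
        ind_congr (by rw [Prod.ext_iff, Prod.ext_iff])
      rw [this]; ring
    · intro n z z' s s'
      simp only [noiseVar_left, noiseVar_right, ind_and, ind_eq_comm t.1, ind_eq_comm t.2.2]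
      ring
  simp only [h1] at h0
  rw [rootVec_add, ← signalCond_eq] at h0
  linarith

end Linking

/-! ### Size weights -/

section Weights

variable {p : ℝ}

lemma sum_arityProb_bool : ∑ b, arityProb p b = 1 := by
  simp only [sum_bool, arityProb]; ring

lemma arityProb_le_one (hp : 0 ≤ p) (hp' : p ≤ 1) (b : Bool) : arityProb p b ≤ 1 := by
  cases b
  · exact hp'
  · simpa [arityProb] using hp

lemma two_le_arity (b : Bool) : 2 ≤ arity b := by cases b <;> simp [arity]

lemma arity_le_three (b : Bool) : arity b ≤ 3 := by cases b <;> simp [arity]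

lemma lenE_mono (hp : 0 ≤ p) (hp' : p ≤ 1) {f g : ℕ → ℝ} : ∀ (m d : ℕ),
    (∀ e, d + 2 * m ≤ e → e ≤ d + 3 * m → f e ≤ g e) → lenE p f m d ≤ lenE p g m d
  | 0, d, h => h d (by omega) (by omega)
  | m + 1, d, h => sum_le_sum fun b _ =>
      mul_le_mul_of_nonneg_left (lenE_mono hp hp' m _ fun e he he' => h e
        (by have := two_le_arity b; omega) (by have := arity_le_three b; omega))
        (arityProb_nonneg hp hp' b)

lemma lenE_const (c : ℝ) : ∀ m d : ℕ, lenE p (fun _ => c) m d = c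
  | 0, _ => rfl
  | m + 1, d => by simp only [lenE, lenE_const c m, ← sum_mul, sum_arityProb_bool, one_mul]

lemma lenE_add (f g : ℕ → ℝ) : ∀ m d : ℕ,
    lenE p (fun e => f e + g e) m d = lenE p f m d + lenE p g m d
  | 0, _ => rfl
  | m + 1, d => by simp only [lenE, lenE_add f g m, mul_add, sum_add_distrib]

lemma lenE_const_mul (c : ℝ) (f : ℕ → ℝ) : ∀ m d : ℕ,
    lenE p (fun e => c * f e) m d = c * lenE p f m d
  | 0, _ => rfl
  | m + 1, d => by
      simp only [lenE, lenE_const_mul c f m, mul_sum]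
      exact sum_congr rfl fun b _ => by ring

lemma lenE_sub (f g : ℕ → ℝ) (m d : ℕ) :
    lenE p (fun e => f e - g e) m d = lenE p f m d - lenE p g m d := by
  have := lenE_add (p := p) (fun e => f e - g e) g m d
  simp only [sub_add_cancel] at this
  linarith

lemma abs_lenE_le (hp : 0 ≤ p) (hp' : p ≤ 1) (f : ℕ → ℝ) {g : ℕ → ℝ} (m d : ℕ)
    (h : ∀ e, d + 2 * m ≤ e → e ≤ d + 3 * m → |f e| ≤ g e) : |lenE p f m d| ≤ lenE p g m d := by
  rw [abs_le]
  constructor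
  · have := lenE_mono hp hp' (f := fun e => (-1) * g e) (g := f) m d fun e he he' => by
      have := (abs_le.1 (h e he he')).1; linarith
    rw [lenE_const_mul] at this
    linarith
  · exact lenE_mono hp hp' m d fun e he he' => (abs_le.1 (h e he he')).2

/-- Second moment of the length of `m` spans. -/
lemma lenE_sq (a : ℝ) : ∀ m d : ℕ, lenE p (fun e => ((e : ℝ) - a) ^ 2) m d =
    ((d : ℝ) + (3 - p) * m - a) ^ 2 + m * (p * (1 - p))
  | 0, d => by simp [lenE]
  | m + 1, d => by
      simp only [lenE, lenE_sq a m, sum_bool, arityProb, arity]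
      push_cast
      ring

lemma abs_tripleW_le_one (d : ℕ) : |tripleW d| ≤ 1 := by
  rw [tripleW, abs_of_nonneg (by positivity)]
  rcases Nat.eq_zero_or_pos (d - 2) with h | h
  · simp [h]
  · rw [div_le_one (by exact_mod_cast h)]; exact_mod_cast h

lemma abs_pairW_le_one (d : ℕ) : |pairW d| ≤ 1 := by
  rw [pairW, abs_of_nonneg (by positivity)]
  rcases Nat.eq_zero_or_pos (d - 1) with h | h
  · simp [h]
  · rw [div_le_one (by exact_mod_cast h)]; exact_mod_cast h

lemma abs_adjW_le_one (hp : 0 ≤ p) (hp' : p ≤ 1) {h : ℕ → ℝ} (hh : ∀ d, |h d| ≤ 1)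
    (i : Bool × Bool) (n : ℕ) : |adjW p h i n| ≤ 1 := by
  rw [adjW, abs_mul, abs_mul, abs_of_nonneg (arityProb_nonneg hp hp' _),
    abs_of_nonneg (arityProb_nonneg hp hp' _)]
  have h1 := abs_lenE_le hp hp' h (g := fun _ => 1) (n - 2) (arity i.1 + arity i.2)
    fun e _ _ => hh e
  rw [lenE_const] at h1
  exact mul_le_one₀ (arityProb_le_one hp hp' _) (by
    have := arityProb_nonneg hp hp' i.2; positivity)
    (mul_le_one₀ (arityProb_le_one hp hp' _) (abs_nonneg _) h1)

lemma abs_nodeW_le (hp : 0 ≤ p) (hp' : p ≤ 1) (b : Bool) {h : ℕ → ℝ} {n : ℕ} {C : ℝ}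
    (hh : ∀ e, 2 * n ≤ e → |h e| ≤ C) (hn : 1 ≤ n) : |nodeW p h b n| ≤ C := by
  have h1 := abs_lenE_le hp hp' h (g := fun _ => C) (n - 1) (arity b) fun e he _ => hh e (by
    have := two_le_arity b; omega)
  rw [lenE_const] at h1
  rw [nodeW, abs_mul, abs_of_nonneg (arityProb_nonneg hp hp' b)]
  exact (mul_le_of_le_one_left (abs_nonneg _) (arityProb_le_one hp hp' b)).trans h1

lemma abs_nodeW_tripleW_le (hp : 0 ≤ p) (hp' : p ≤ 1) (b : Bool) {n : ℕ} (hn : 2 ≤ n) :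
    |nodeW p tripleW b n| ≤ 1 / n := by
  refine abs_nodeW_le hp hp' b (fun e he => ?_) (by omega)
  rw [tripleW, abs_of_nonneg (by positivity)]
  have h1 : (n : ℝ) ≤ ((e - 2 : ℕ) : ℝ) := by exact_mod_cast (by omega : n ≤ e - 2)
  have h2 : (0 : ℝ) < n := by exact_mod_cast (by omega : 0 < n)
  exact one_div_le_one_div_of_le h2 h1

lemma abs_nodeW_sub_le (hp : 0 ≤ p) (hp' : p ≤ 1) (b : Bool) {N n : ℕ} (hN : 2 ≤ N) (hn : N ≤ n) :
    |nodeW p tripleW b n - nodeW p pairW b n| ≤ 1 / N * (1 / n) := by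
  have e0 : nodeW p tripleW b n - nodeW p pairW b n =
      nodeW p (fun e => tripleW e - pairW e) b n := by
    simp only [nodeW, lenE_sub]; ring
  rw [e0]
  refine abs_nodeW_le hp hp' b (fun e he => ?_) (by omega)
  have h0 : (2 : ℝ) ≤ N := by exact_mod_cast hN
  have h1 : (N : ℝ) ≤ n := by exact_mod_cast hn
  have h2 : (2 * n : ℝ) ≤ e := by exact_mod_cast he
  rw [tripleW, pairW, Nat.cast_sub (by omega), Nat.cast_sub (by omega)]
  push_cast
  have e1 : (1 : ℝ) / (e - 2) - 1 / (e - 1) = 1 / ((e - 2) * (e - 1)) := by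
    have : (e : ℝ) - 2 ≠ 0 := by nlinarith
    have : (e : ℝ) - 1 ≠ 0 := by nlinarith
    field_simp
    ring
  rw [e1, abs_of_nonneg (by apply div_nonneg zero_le_one; nlinarith), ← one_div_mul_one_div_rev,
    mul_comm]
  apply mul_le_mul
  · exact one_div_le_one_div_of_le (by linarith) (by linarith)
  · exact one_div_le_one_div_of_le (by linarith) (by linarith)
  · apply div_nonneg zero_le_one; linarith
  · positivity

lemma abs_mul_nodeW_sub_le (hp : 0 ≤ p) (hp' : p ≤ 1) {s : ℝ} (hs : 0 < s) {n : ℕ} (hn : 2 ≤ n)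
    (hsn : s ^ 2 ≤ n) : |n * nodeW p tripleW true n - (1 - p) / (3 - p)| ≤ 1 / s := by
  have hn' : (2 : ℝ) ≤ n := by exact_mod_cast hn
  have hq : (2 : ℝ) ≤ 3 - p := by linarith
  set a : ℝ := (3 - p) * n + 2 with ha
  have e0 : (n : ℝ) * nodeW p tripleW true n - (1 - p) / (3 - p) =
      (1 - p) * lenE p (fun e => n * tripleW e - 1 / (3 - p)) (n - 1) 3 := by
    rw [lenE_sub, lenE_const_mul, lenE_const, nodeW]
    simp only [arityProb, arity]
    ring
  have h1 : |lenE p (fun e => n * tripleW e - 1 / (3 - p)) (n - 1) 3| ≤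
      lenE p (fun e => s / (4 * n ^ 2) * ((e : ℝ) - a) ^ 2 + 1 / (4 * s)) (n - 1) 3 := by
    refine abs_lenE_le hp hp' _ _ _ fun e he he' => ?_
    have h2 : (2 * n + 1 : ℝ) ≤ e := by exact_mod_cast (by omega : 2 * n + 1 ≤ e)
    rw [tripleW, Nat.cast_sub (by omega)]
    push_cast
    have hd : (0 : ℝ) < (e - 2) * (3 - p) := by apply mul_pos <;> linarith
    have e1 : (n : ℝ) * (1 / (e - 2)) - 1 / (3 - p) = -((e - a) / ((e - 2) * (3 - p))) := by
      have : (e : ℝ) - 2 ≠ 0 := by nlinarith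
      have : 3 - p ≠ 0 := by linarith
      rw [ha]; field_simp; ring
    have h3 : (2 * n : ℝ) ≤ (e - 2) * (3 - p) := by nlinarith
    rw [e1, abs_neg, abs_div, abs_of_pos hd]
    have h4 : |(e : ℝ) - a| / ((e - 2) * (3 - p)) ≤ |(e : ℝ) - a| / (2 * n) :=
      div_le_div_of_nonneg_left (abs_nonneg _) (by linarith) h3
    refine h4.trans ?_
    have e2 : s / (4 * (n : ℝ) ^ 2) * ((e : ℝ) - a) ^ 2 + 1 / (4 * s) - |(e : ℝ) - a| / (2 * n) =
        (s * |(e : ℝ) - a| - n) ^ 2 / (4 * s * n ^ 2) := by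
      rw [← sq_abs ((e : ℝ) - a)]
      field_simp
      ring
    have : 0 ≤ (s * |(e : ℝ) - a| - n) ^ 2 / (4 * s * n ^ 2) := by positivity
    linarith
  rw [lenE_add, lenE_const_mul, lenE_const, lenE_sq] at h1
  have hc : ((n - 1 : ℕ) : ℝ) = n - 1 := by rw [Nat.cast_sub (by omega)]; simp
  rw [hc] at h1
  have h5 : (((3 : ℕ) : ℝ) + (3 - p) * (n - 1) - a) ^ 2 + (n - 1) * (p * (1 - p)) ≤ 3 * n := by
    have e : (((3 : ℕ) : ℝ) + (3 - p) * (n - 1) - a) ^ 2 = (2 - p) ^ 2 := by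
      rw [ha]; push_cast; ring
    have e1 : (2 - p) ^ 2 ≤ 4 := by nlinarith
    have e2 : p * (1 - p) ≤ 1 := by nlinarith
    have e3 : (n - 1) * (p * (1 - p)) ≤ (n - 1 : ℝ) * 1 := by
      apply mul_le_mul_of_nonneg_left e2; linarith
    rw [e]; linarith
  have h6 : s / (4 * (n : ℝ) ^ 2) * ((((3 : ℕ) : ℝ) + (3 - p) * (n - 1) - a) ^ 2 +
      (n - 1) * (p * (1 - p))) ≤ 3 / (4 * s) := by
    calc _ ≤ s / (4 * (n : ℝ) ^ 2) * (3 * n) := by gcongr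
      _ = 3 * s ^ 2 / (4 * s * n) := by field_simp
      _ ≤ 3 * n / (4 * s * n) := by gcongr
      _ = _ := by field_simp
  have h7 : 3 / (4 * s) + 1 / (4 * s) = 1 / s := by field_simp; norm_num
  rw [e0, abs_mul, abs_of_nonneg (sub_nonneg.2 hp')]
  exact (mul_le_of_le_one_left (abs_nonneg _) (by linarith)).trans (by linarith)

section

variable {m2 m3 : ℕ} [Nonempty (Fin m2)] [Nonempty (Fin m3)]

lemma terProb_le_one (hp : 0 ≤ p) (hp' : p ≤ 1) {ℓ : ℕ} (hℓ : 1 ≤ ℓ) : terProb p m2 m3 ℓ ≤ 1 := by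
  have h := treeE_mono (m2 := m2) (m3 := m3) (ℓ := ℓ) hp hp'
    (Φ := fun τ => nodeW p tripleW true τ.size * (τ.size : ℝ)) (Ψ := fun _ => 1) fun τ => by
      have h1 : 2 ≤ τ.size := le_trans (by
        calc 2 = 2 ^ 1 := rfl
          _ ≤ 2 ^ ℓ := Nat.pow_le_pow_right (by norm_num) hℓ) (two_pow_le_size τ)
      have h2 := (abs_le.1 (abs_nodeW_tripleW_le hp hp' true h1)).2
      have h3 : (0 : ℝ) < τ.size := by exact_mod_cast (by omega : 0 < τ.size)
      calc _ ≤ 1 / (τ.size : ℝ) * τ.size := by gcongr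
        _ = 1 := by field_simp
  rwa [treeE_const] at h

lemma le_terProb (hp : 0 ≤ p) (hp' : p ≤ 1) {ℓ : ℕ} : (1 - p) / 3 ≤ terProb p m2 m3 ℓ := by
  have h := treeE_mono (m2 := m2) (m3 := m3) (ℓ := ℓ) hp hp' (Φ := fun _ => (1 - p) / 3)
    (Ψ := fun τ => nodeW p tripleW true τ.size * (τ.size : ℝ)) fun τ => by
      have h1 : 1 ≤ τ.size := Nat.one_le_two_pow.trans (two_pow_le_size τ)
      have h3 : (1 : ℝ) ≤ τ.size := by exact_mod_cast h1
      have h2 := lenE_mono hp hp' (f := fun _ => 1 / (3 * (τ.size : ℝ))) (g := tripleW)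
        (τ.size - 1) 3 fun e he he' => by
          rw [tripleW]
          apply one_div_le_one_div_of_le
          · exact_mod_cast (by omega : 0 < e - 2)
          · exact_mod_cast (by omega : e - 2 ≤ 3 * τ.size)
      rw [lenE_const] at h2
      calc (1 - p) / 3 = (1 - p) * (1 / (3 * (τ.size : ℝ))) * τ.size := by field_simp
        _ ≤ (1 - p) * lenE p tripleW (τ.size - 1) 3 * τ.size := by gcongr
        _ = _ := rfl
  rwa [treeE_const] at h

lemma abs_nodeW_sub_signalW_le (hp : 0 ≤ p) (hp' : p ≤ 1) {ℓ : ℕ} (hℓ : 1 ≤ ℓ) {n : ℕ}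
    (hn : 2 ^ ℓ ≤ n) :
    |nodeW p tripleW true n - signalW p m2 m3 ℓ n| ≤ 2 / Real.sqrt 2 ^ ℓ * (1 / n) := by
  have h2 : 2 ≤ 2 ^ ℓ := by
    calc 2 = 2 ^ 1 := rfl
      _ ≤ 2 ^ ℓ := Nat.pow_le_pow_right (by norm_num) hℓ
  have hs : 0 < Real.sqrt 2 ^ ℓ := by positivity
  have hs2 : (Real.sqrt 2 ^ ℓ) ^ 2 = 2 ^ ℓ := by
    rw [← pow_mul, mul_comm, pow_mul, Real.sq_sqrt (by norm_num)]
  have key : ∀ n : ℕ, 2 ^ ℓ ≤ n →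
      |n * nodeW p tripleW true n - (1 - p) / (3 - p)| ≤ 1 / Real.sqrt 2 ^ ℓ := fun n hn =>
    abs_mul_nodeW_sub_le hp hp' hs (h2.trans hn) (by rw [hs2]; exact_mod_cast hn)
  have ht : |terProb p m2 m3 ℓ - (1 - p) / (3 - p)| ≤ 1 / Real.sqrt 2 ^ ℓ := by
    have e : terProb p m2 m3 ℓ - (1 - p) / (3 - p) = treeE p fun τ : ParseTree m2 m3 ℓ =>
        nodeW p tripleW true τ.size * (τ.size : ℝ) - (1 - p) / (3 - p) := by
      rw [treeE_sub, treeE_const, terProb]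
    rw [e]
    refine (abs_treeE_le hp hp' _).trans ?_
    refine (treeE_mono hp hp' (Ψ := fun _ => 1 / Real.sqrt 2 ^ ℓ) fun τ => ?_).trans_eq
      (treeE_const _ _)
    rw [mul_comm]
    exact key _ (two_pow_le_size τ)
  have h1 := key n hn
  have hn0 : (0 : ℝ) < n := by exact_mod_cast (by omega : 0 < n)
  have e : nodeW p tripleW true n - signalW p m2 m3 ℓ n =
      ((n * nodeW p tripleW true n - (1 - p) / (3 - p)) -
        (terProb p m2 m3 ℓ - (1 - p) / (3 - p))) * (1 / n) := by
    rw [signalW]; field_simp; ring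
  rw [e, abs_mul, abs_of_pos (by positivity : (0 : ℝ) < 1 / n)]
  gcongr
  refine (abs_sub _ _).trans ?_
  calc _ ≤ 1 / Real.sqrt 2 ^ ℓ + 1 / Real.sqrt 2 ^ ℓ := add_le_add h1 ht
    _ = _ := by ring

end

end Weights

/-! ### Conditioning on the parents of two triples -/

section Transfer

variable {ι T : Type*} [Fintype ι] [DecidableEq ι] [Fintype T] [DecidableEq T]

/-- Averages of nonnegative functions against the weight `w` are bounded by averages without the
weight, for functions that are stable under two transpositions of the values. -/
structure Transfers (C : ℝ) (w : (ι ↪ T) → ℝ) : Prop where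
  nonneg : ∀ e, 0 ≤ w e
  bound : ∀ Y Z : (ι ↪ T) → ℝ, (∀ e, 0 ≤ Y e) →
    (∀ e s t s' t', Y (relabel (Equiv.swap s t) (relabel (Equiv.swap s' t') e)) ≤ Z e) →
    𝔼 e, w e * Y e ≤ C * (𝔼 e, w e) * 𝔼 e, Z e

lemma relabel_swap_self (s : T) (e : ι ↪ T) : relabel (Equiv.swap s s) e = e := by
  ext i; simp [relabel]

lemma le_of_swaps {Y Z : (ι ↪ T) → ℝ}
    (h : ∀ e s t s' t', Y (relabel (Equiv.swap s t) (relabel (Equiv.swap s' t') e)) ≤ Z e)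
    [Nonempty ι] (e : ι ↪ T) : Y e ≤ Z e := by
  obtain ⟨i⟩ := ‹Nonempty ι›
  simpa only [relabel_swap_self] using h e (e i) (e i) (e i) (e i)

lemma expect_ind_mul_le {Y Z : (ι ↪ T) → ℝ}
    (h : ∀ e s t s' t', Y (relabel (Equiv.swap s t) (relabel (Equiv.swap s' t') e)) ≤ Z e)
    (i : ι) (t : T) : 𝔼 e, ind (e i = t) * Y e ≤ 1 / (Fintype.card T : ℝ) * 𝔼 e, Z e := by
  rw [expect_ind_mul_eq_expect_swap]
  refine mul_le_mul_of_nonneg_left (expect_mono fun e => ?_) (by positivity)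
  have := h e (e i) t t t
  rwa [relabel_swap_self] at this

lemma expect_ind_mul_ind_mul_le {Y Z : (ι ↪ T) → ℝ} (hY : ∀ e, 0 ≤ Y e)
    (h : ∀ e s t s' t', Y (relabel (Equiv.swap s t) (relabel (Equiv.swap s' t') e)) ≤ Z e)
    {i j : ι} (hij : i ≠ j) (t t' : T) :
    𝔼 e, ind (e j = t') * (ind (e i = t) * Y e) ≤ 2 / (Fintype.card T : ℝ) ^ 2 * 𝔼 e, Z e := by
  rw [expect_ind_mul_eq_expect_swap]
  have h1 : ∀ e : ι ↪ T, ind (relabel (Equiv.swap (e j) t') e i = t) *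
      Y (relabel (Equiv.swap (e j) t') e) ≤
      ind (e i = t) * Y (relabel (Equiv.swap (e j) t') e) +
        ind (e i = t') * Y (relabel (Equiv.swap (e j) t') e) := by
    intro e
    rw [← add_mul]
    refine mul_le_mul_of_nonneg_right ?_ (hY _)
    by_cases h2 : relabel (Equiv.swap (e j) t') e i = t
    · have hne : e i ≠ e j := fun h => hij (e.injective h)
      have h3 : Equiv.swap (e j) t' (e i) = t := h2
      by_cases h4 : e i = t'
      · rw [ind_true h2, ind_true h4]
        linarith [ind_nonneg (e i = t)]
      · rw [Equiv.swap_apply_of_ne_of_ne hne h4] at h3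
        rw [ind_true h2, ind_true h3]
        linarith [ind_nonneg (e i = t')]
    · rw [ind_false h2]
      exact add_nonneg (ind_nonneg _) (ind_nonneg _)
  have h2 : ∀ s : T, 𝔼 e : ι ↪ T, ind (e i = s) * Y (relabel (Equiv.swap (e j) t') e) ≤
      1 / (Fintype.card T : ℝ) * 𝔼 e, Z e := by
    intro s
    rw [expect_ind_mul_eq_expect_swap i s fun e : ι ↪ T => Y (relabel (Equiv.swap (e j) t') e)]
    exact mul_le_mul_of_nonneg_left (expect_mono fun e => h e _ _ _ _) (by positivity)
  have h3 := expect_mono h1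
  rw [expect_add] at h3
  calc _ ≤ 1 / (Fintype.card T : ℝ) * (1 / (Fintype.card T : ℝ) * (𝔼 e, Z e) +
        1 / (Fintype.card T : ℝ) * 𝔼 e, Z e) :=
        mul_le_mul_of_nonneg_left (h3.trans (add_le_add (h2 t) (h2 t'))) (by positivity)
    _ = _ := by ring

lemma expect_ind_eq' (t : T) : 𝔼 s, ind (s = t) = 1 / (Fintype.card T : ℝ) := by
  rw [expect_eq, sum_eq_single t]
  · rw [ind_true rfl, mul_one]
  · intro b _ hb; exact ind_false hb
  · intro h; exact absurd (Finset.mem_univ _) h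

lemma ind_mul_ind_of_ne {t t' : T} (ht : t ≠ t') (s : T) : ind (s = t) * ind (s = t') = 0 := by
  rw [← ind_and]
  exact ind_false fun h => ht (h.1.symm.trans h.2)

lemma cvar_ind_ind {t t' : T} (ht : t ≠ t') :
    cvar (fun s => ind (s = t)) (fun s => ind (s = t')) = -(1 / (Fintype.card T : ℝ) ^ 2) := by
  rw [cvar]
  simp only [ind_mul_ind_of_ne ht, expect_ind_eq', expect_const_zero]
  ring

variable [Nonempty (ι ↪ T)]

lemma expect_ind_apply (i : ι) (t : T) : 𝔼 e : ι ↪ T, ind (e i = t) =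
    1 / (Fintype.card T : ℝ) := by
  rw [expect_embedding_apply i fun s => ind (s = t), expect_ind_eq']

/-- Probability of prescribing two values. -/
lemma expect_ind_mul_ind (hT : 2 ≤ Fintype.card T) {i j : ι} (hij : i ≠ j) {t t' : T}
    (ht : t ≠ t') : 𝔼 e : ι ↪ T, ind (e i = t) * ind (e j = t') =
      1 / ((Fintype.card T : ℝ) * (Fintype.card T - 1)) := by
  have hN : (2 : ℝ) ≤ Fintype.card T := by exact_mod_cast hT
  have hN' : (Fintype.card T : ℝ) - 1 ≠ 0 := by linarith
  have hN'' : (Fintype.card T : ℝ) ≠ 0 := by linarith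
  rw [expect_embedding_apply₂ hT i j (fun s => ind (s = t)) (fun s => ind (s = t')), if_neg hij,
    cvar_ind_ind ht, expect_ind_eq', expect_ind_eq']
  field_simp
  ring

lemma expect_ind_mul_ind_ite (hT : 2 ≤ Fintype.card T) (i j : ι) {t t' : T}
    (ht : t ≠ t') : 𝔼 e : ι ↪ T, ind (e i = t) * ind (e j = t') =
      1 / ((Fintype.card T : ℝ) * (Fintype.card T - 1)) -
        if i = j then 1 / ((Fintype.card T : ℝ) * (Fintype.card T - 1)) else 0 := by
  split_ifs with hij
  · simp only [hij, ind_mul_ind_of_ne ht, expect_const_zero, sub_self]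
  · rw [expect_ind_mul_ind hT hij ht, sub_zero]

end Transfer

section Parents

variable {v m2 m3 : ℕ}

/-- `ParentIs`, in terms of the ternary rules of the last level. -/
def HasParent (e : TernaryRules v m3) :
    Option (Fin v) → Triple v → Prop
  | some z, t => ∃ k, e (z, k) = t
  | none, t => ∀ z k, e (z, k) ≠ t

lemma parentIs_iff {ℓ : ℕ} (G : Grammar v m2 m3 (ℓ + 1)) (o : Option (Fin v))
    (t : Triple v) : ParentIs G o t ↔ HasParent (G (Fin.last ℓ)).2 o t := by
  cases o <;> rfl

lemma sum_ind_eq {ι T : Type*} [Fintype ι] (e : ι ↪ T) (t : T) :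
    ∑ i, ind (e i = t) = ind (∃ i, e i = t) := by
  by_cases h : ∃ i, e i = t
  · obtain ⟨i, hi⟩ := h
    rw [sum_eq_single i, ind_true hi, ind_true ⟨i, hi⟩]
    · intro j _ hj
      exact ind_false fun h => hj (e.injective (h.trans hi.symm))
    · intro h; exact absurd (Finset.mem_univ _) h
  · rw [ind_false h]
    exact Finset.sum_eq_zero fun i _ => ind_false fun hi => h ⟨i, hi⟩

lemma ind_hasParent_some (e : TernaryRules v m3) (z : Fin v)
    (t : Triple v) : ind (HasParent e (some z) t) = ∑ k, ind (e (z, k) = t) := by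
  have h := sum_ind_eq (Function.Embedding.trans ⟨fun k : Fin m3 => (z, k), fun k k' hk => by
    simpa using hk⟩ e) t
  exact h.symm

lemma ind_not (P : Prop) : ind (¬ P) = 1 - ind P := by
  by_cases h : P
  · rw [ind_true h, ind_false (not_not.2 h)]; ring
  · rw [ind_true h, ind_false h]; ring

lemma ind_hasParent_none (e : TernaryRules v m3)
    (t : Triple v) : ind (HasParent e none t) = 1 - ∑ i, ind (e i = t) := by
  rw [sum_ind_eq, ← ind_not]
  exact ind_congr ⟨fun h ⟨i, hi⟩ => h i.1 i.2 hi, fun h z k hk => h ⟨(z, k), hk⟩⟩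

variable {c : ℝ} (h : Regime c v m2 m3)

include h

lemma transfers_one : Transfers (ι := Fin v × Fin m3) (T := Triple v) 1
    (fun _ => 1) := by
  obtain ⟨_, _, _, _, _, _⟩ := h.insts
  refine ⟨fun _ => zero_le_one, fun Y Z _ hZ => ?_⟩
  simp only [one_mul, expect_const]
  exact expect_mono fun e => le_of_swaps hZ e

lemma transfers_some (z : Fin v) (t : Triple v) :
    Transfers (ι := Fin v × Fin m3) 1 (fun e => ind (HasParent e (some z) t)) := by
  have := h.nonempty₃
  refine ⟨fun _ => ind_nonneg _, fun Y Z _ hZ => ?_⟩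
  simp only [ind_hasParent_some, sum_mul, expect_sum, expect_ind_apply]
  rw [one_mul, sum_mul]
  exact sum_le_sum fun k _ => expect_ind_mul_le hZ (z, k) t

lemma expect_hasParent_some_none {t t' : Triple v} (ht : t ≠ t') (z : Fin v) :
    c * (m3 * (1 / (Fintype.card (Triple v) : ℝ))) ≤
      𝔼 e : TernaryRules v m3,
        ind (HasParent e (some z) t ∧ HasParent e none t') := by
  have := h.nonempty₃
  have hN := h.card₃
  set N : ℝ := (Fintype.card (Triple v) : ℝ) with hNdef
  have hNv : N = (v : ℝ) ^ 3 := by rw [hNdef]; simp; ring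
  have hN2 : (2 : ℝ) ≤ N := by rw [hNdef]; exact_mod_cast hN
  have h1 : ∀ k : Fin m3, c * (1 / N) ≤ 𝔼 e : TernaryRules v m3,
      ind (e (z, k) = t) * (1 - ∑ i, ind (e i = t')) := by
    intro k
    simp only [mul_sub, mul_one, expect_sub, mul_sum, expect_sum, expect_ind_apply]
    simp only [expect_ind_mul_ind_ite hN _ _ ht, ← hNdef]
    rw [sum_sub_distrib, Finset.sum_const, Finset.card_univ, card_prod,
      card_fin, card_fin, Finset.sum_ite_eq, if_pos (Finset.mem_univ _),
      nsmul_eq_mul]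
    push_cast
    have hM : (v : ℝ) * m3 ≤ (1 - c) * N := by
      rw [hNv]
      nlinarith [mul_le_mul_of_nonneg_left h.m3_le h.v_pos.le]
    have h3 : (v : ℝ) * m3 * (1 / (N * (N - 1))) - 1 / (N * (N - 1)) ≤ (1 - c) * (1 / N) := by
      have e1 : (v : ℝ) * m3 * (1 / (N * (N - 1))) - 1 / (N * (N - 1)) =
          ((v : ℝ) * m3 - 1) / (N - 1) * (1 / N) := by
        have : N - 1 ≠ 0 := by linarith
        field_simp
      rw [e1]
      refine mul_le_mul_of_nonneg_right ?_ (by positivity)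
      rw [div_le_iff₀ (by linarith)]
      nlinarith [h.pos]
    nlinarith
  simp only [ind_and, ind_hasParent_none, ind_hasParent_some, sum_mul, expect_sum]
  calc c * (m3 * (1 / N)) = ∑ k : Fin m3, c * (1 / N) := by
        rw [Finset.sum_const, Finset.card_univ, card_fin, nsmul_eq_mul]; ring
    _ ≤ _ := sum_le_sum fun k _ => h1 k

lemma expect_hasParent_none_none (hcv : 2 ≤ c * v) {t t' : Triple v} (ht : t ≠ t') :
    c ^ 2 / 2 ≤ 𝔼 e : TernaryRules v m3,
        ind (HasParent e none t ∧ HasParent e none t') := by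
  have := h.nonempty₃
  have hc := h.pos
  have hN := h.card₃
  set N : ℝ := (Fintype.card (Triple v) : ℝ) with hNdef
  have hNv : N = (v : ℝ) ^ 3 := by rw [hNdef]; simp; ring
  have hN2 : (2 : ℝ) ≤ N := by rw [hNdef]; exact_mod_cast hN
  set M : ℝ := (v : ℝ) * m3 with hMdef
  have hM : M ≤ (1 - c) * N := by
    rw [hNv]
    nlinarith [mul_le_mul_of_nonneg_left h.m3_le h.v_pos.le]
  have hcN : 2 ≤ c * N := by
    rw [hNv]
    have h2 := h.two_le_real
    have : (v : ℝ) ≤ (v : ℝ) ^ 3 := by nlinarith [sq_nonneg ((v : ℝ) - 1)]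
    nlinarith
  have hs : ∀ s, 𝔼 e : TernaryRules v m3, ∑ i, ind (e i = s) = M * (1 / N) := by
    intro s
    simp only [expect_sum, expect_ind_apply, Finset.sum_const, Finset.card_univ, card_prod,
      card_fin, nsmul_eq_mul]
    push_cast
    rw [hMdef, hNdef]; simp
  have hp : 𝔼 e : TernaryRules v m3,
      (∑ i, ind (e i = t)) * ∑ j, ind (e j = t') = M * (M - 1) * (1 / (N * (N - 1))) := by
    simp only [Finset.sum_mul_sum, expect_sum]
    simp only [expect_ind_mul_ind_ite hN _ _ ht, ← hNdef]
    simp only [sum_sub_distrib, Finset.sum_ite_eq, Finset.mem_univ, if_true,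
      Finset.sum_const, Finset.card_univ, card_prod, card_fin, nsmul_eq_mul]
    push_cast
    rw [hMdef]; ring
  have key : 𝔼 e : TernaryRules v m3,
        ind (HasParent e none t ∧ HasParent e none t') =
      1 - 2 * (M * (1 / N)) + M * (M - 1) * (1 / (N * (N - 1))) := by
    have e1 : ∀ e : TernaryRules v m3,
        ind (HasParent e none t ∧ HasParent e none t') = 1 - (∑ i, ind (e i = t)) -
          (∑ i, ind (e i = t')) + (∑ i, ind (e i = t)) * ∑ j, ind (e j = t') := by
      intro e
      rw [ind_and, ind_hasParent_none, ind_hasParent_none]; ring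
    simp only [e1, expect_add, expect_sub, expect_const, hs, hp]
    ring
  have e2 : 1 - 2 * (M * (1 / N)) + M * (M - 1) * (1 / (N * (N - 1))) =
      (N - M) / N * ((N - M - 1) / (N - 1)) := by
    have : N - 1 ≠ 0 := by linarith
    have : N ≠ 0 := by linarith
    field_simp
    ring
  rw [key, e2]
  have h5 : c ≤ (N - M) / N := by
    rw [le_div_iff₀ (by linarith)]; linarith
  have h6 : c / 2 ≤ (N - M - 1) / (N - 1) := by
    rw [le_div_iff₀ (by linarith)]; nlinarith
  calc c ^ 2 / 2 = c * (c / 2) := by ring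
    _ ≤ _ := by gcongr; exact hc.le.trans h5

/-- Conditioning on the parents of two triples. -/
lemma transfers_parents (hcv : 2 ≤ c * v) {t t' : Triple v} (ht : t ≠ t')
    (o o' : Option (Fin v)) : Transfers (ι := Fin v × Fin m3) (2 / c ^ 2)
      (fun e => ind (HasParent e o t ∧ HasParent e o' t')) := by
  obtain ⟨_, _, _, _, _, _⟩ := h.insts
  have hc := h.pos
  have hc1 := h.le_one
  have hN := h.card₃
  have hN2 : (2 : ℝ) ≤ (Fintype.card (Triple v) : ℝ) := by exact_mod_cast hN
  refine ⟨fun _ => ind_nonneg _, fun Y Z hY hZ => ?_⟩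
  have hYZ := fun e => le_of_swaps hZ e
  have hZ0 : 0 ≤ 𝔼 e, Z e := expect_nonneg fun e => (hY e).trans (hYZ e)
  have hsn : ∀ {t t' : Triple v} (_ : t ≠ t') (z : Fin v),
      𝔼 e : TernaryRules v m3,
        ind (HasParent e (some z) t ∧ HasParent e none t') * Y e ≤
      2 / c ^ 2 * (𝔼 e : TernaryRules v m3,
        ind (HasParent e (some z) t ∧ HasParent e none t')) * 𝔼 e, Z e := by
    intro t t' ht z
    have h1 := (transfers_some h z t).bound Y Z hY hZ
    simp only [ind_hasParent_some, expect_sum, expect_ind_apply, Finset.sum_const,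
      Finset.card_univ, card_fin, nsmul_eq_mul, one_mul] at h1
    have h2 := expect_hasParent_some_none h ht z
    have h3 : (m3 : ℝ) * (1 / (Fintype.card (Triple v) : ℝ)) ≤
        2 / c ^ 2 * (𝔼 e : TernaryRules v m3,
        ind (HasParent e (some z) t ∧ HasParent e none t')) := by
      have h4 : 0 ≤ (m3 : ℝ) * (1 / (Fintype.card (Triple v) : ℝ)) := by positivity
      calc (m3 : ℝ) * (1 / (Fintype.card (Triple v) : ℝ)) ≤ 2 / c ^ 2 *
            (c * ((m3 : ℝ) * (1 / (Fintype.card (Triple v) : ℝ)))) := by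
            have : 1 ≤ 2 / c ^ 2 * c := by
              rw [div_mul_eq_mul_div, le_div_iff₀ (by positivity)]; nlinarith
            rw [← mul_assoc]
            nlinarith
        _ ≤ _ := by gcongr
    refine (expect_mono fun e => ?_).trans (h1.trans (mul_le_mul_of_nonneg_right h3 hZ0))
    refine mul_le_mul_of_nonneg_right ?_ (hY e)
    rw [← ind_hasParent_some]
    exact ind_mono fun h => h.1
  rcases o with _ | z <;> rcases o' with _ | z'
  · have h1 := expect_hasParent_none_none h hcv ht
    calc _ ≤ 𝔼 e, Z e := expect_mono fun e =>
          (mul_le_of_le_one_left (hY e) (ind_le_one _)).trans (hYZ e)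
      _ = 2 / c ^ 2 * (c ^ 2 / 2) * 𝔼 e, Z e := by field_simp
      _ ≤ _ := by gcongr
  · have h1 := hsn (Ne.symm ht) z'
    simp only [and_comm (a := HasParent _ none t)]
    exact h1
  · exact hsn ht z
  · have h1 : 𝔼 e : TernaryRules v m3,
        ind (HasParent e (some z) t ∧ HasParent e (some z') t') * Y e ≤
      2 * (𝔼 e : TernaryRules v m3,
        ind (HasParent e (some z) t ∧ HasParent e (some z') t')) * 𝔼 e, Z e := by
      have e1 : ∀ e : TernaryRules v m3,
          ind (HasParent e (some z) t ∧ HasParent e (some z') t') =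
            ∑ k, ∑ k', ind (e (z, k) = t) * ind (e (z', k') = t') := by
        intro e
        rw [ind_and, ind_hasParent_some, ind_hasParent_some, Finset.sum_mul_sum]
      simp only [e1, sum_mul, expect_sum]
      rw [mul_sum, sum_mul]
      refine sum_le_sum fun k _ => ?_
      rw [mul_sum, sum_mul]
      refine sum_le_sum fun k' _ => ?_
      by_cases hk : (z, k) = (z', k')
      · simp only [← hk, ind_mul_ind_of_ne ht, zero_mul, mul_zero, expect_const_zero, le_refl]
      · have h2 := expect_ind_mul_ind_mul_le hY hZ hk t t'
        rw [expect_ind_mul_ind hN hk ht]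
        simp only [mul_comm (ind (_ = t)) (ind (_ = t')), mul_assoc]
        rw [← mul_assoc 2]
        refine h2.trans (mul_le_mul_of_nonneg_right ?_ hZ0)
        rw [div_eq_mul_one_div]
        refine mul_le_mul_of_nonneg_left ?_ (by norm_num)
        apply one_div_le_one_div_of_le
        · apply mul_pos <;> linarith
        · nlinarith
    refine h1.trans ?_
    have : (2 : ℝ) ≤ 2 / c ^ 2 := by
      rw [le_div_iff₀ (by positivity)]; nlinarith
    have h0 : 0 ≤ 𝔼 e : TernaryRules v m3,
        ind (HasParent e (some z) t ∧ HasParent e (some z') t') :=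
      expect_nonneg fun _ => ind_nonneg _
    gcongr

end Parents

/-! ### Statistics of the rules of the last level -/

section RowAvg

variable {α κ T : Type*} [Fintype α] [DecidableEq α] [Fintype κ] [DecidableEq κ] [Fintype T]
  [DecidableEq T] [Nonempty α] [Nonempty κ]

lemma rowAvg_le_sum_div (e : α × κ ↪ T) {f : T → ℝ} (hf : ∀ t, 0 ≤ f t) (x : α) :
    rowAvg e f x ≤ (∑ t, f t) / (Fintype.card κ : ℝ) := by
  rw [rowAvg, Fintype.expect_eq_sum_div_card]
  refine div_le_div_of_nonneg_right ?_ (Nat.cast_nonneg _)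
  have hinj : Function.Injective fun k => e (x, k) := fun k k' hk => by
    simpa using e.injective hk
  rw [← Finset.sum_image (f := f) (g := fun k => e (x, k)) fun k _ k' _ hk => hinj hk]
  exact Finset.sum_le_sum_of_subset_of_nonneg (Finset.subset_univ _) fun t _ _ => hf t

lemma expect_rowAvg_le_sum_div (e : α × κ ↪ T) {f : T → ℝ} (hf : ∀ t, 0 ≤ f t) :
    𝔼 x, rowAvg e f x ≤ (∑ t, f t) / ((Fintype.card α : ℝ) * Fintype.card κ) := by
  refine (expect_rowAvg_le e hf).trans_eq ?_
  have : Nonempty T := ⟨e (Classical.arbitrary _)⟩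
  have hT : (Fintype.card T : ℝ) ≠ 0 := by exact_mod_cast Fintype.card_ne_zero
  rw [expect_eq]
  field_simp

lemma expect_sq_rowAvg_le (e : α × κ ↪ T) {f : T → ℝ} (hf : ∀ t, 0 ≤ f t) :
    𝔼 x, rowAvg e f x ^ 2 ≤
      (∑ t, f t) ^ 2 / ((Fintype.card α : ℝ) * (Fintype.card κ : ℝ) ^ 2) := by
  have h0 : 0 ≤ ∑ t, f t := Finset.sum_nonneg fun t _ => hf t
  calc 𝔼 x, rowAvg e f x ^ 2 ≤ 𝔼 x, (∑ t, f t) / (Fintype.card κ : ℝ) * rowAvg e f x :=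
        expect_mono fun x => by
          rw [sq]
          exact mul_le_mul_of_nonneg_right (rowAvg_le_sum_div e hf x) (rowAvg_nonneg e hf x)
    _ ≤ (∑ t, f t) / (Fintype.card κ : ℝ) *
          ((∑ t, f t) / ((Fintype.card α : ℝ) * Fintype.card κ)) := by
        rw [expect_const_mul]
        exact mul_le_mul_of_nonneg_left (expect_rowAvg_le_sum_div e hf) (by positivity)
    _ = _ := by ring

lemma abs_rowAvg_swap_swap_sub_le (e : α × κ ↪ T) {f : T → ℝ} (hf : ∀ t, 0 ≤ f t)
    (hf' : ∀ t, f t ≤ 1) (s t s' t' : T) (x : α) :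
    |rowAvg (relabel (Equiv.swap s t) (relabel (Equiv.swap s' t') e)) f x - rowAvg e f x| ≤
      4 / (Fintype.card κ : ℝ) := by
  have h1 := abs_rowAvg_relabel_swap_sub_le (relabel (Equiv.swap s' t') e) hf hf' s t x
  have h2 := abs_rowAvg_relabel_swap_sub_le e hf hf' s' t' x
  calc _ = |(rowAvg (relabel (Equiv.swap s t) (relabel (Equiv.swap s' t') e)) f x -
        rowAvg (relabel (Equiv.swap s' t') e) f x) +
        (rowAvg (relabel (Equiv.swap s' t') e) f x - rowAvg e f x)| := by ring_nf
    _ ≤ _ := abs_add_le _ _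
    _ ≤ 2 / (Fintype.card κ : ℝ) + 2 / (Fintype.card κ : ℝ) := add_le_add h1 h2
    _ = _ := by ring

lemma sq_sub_le_of_abs_sub_le {x y a δ : ℝ} (h : |y - x| ≤ δ) :
    (y - a) ^ 2 ≤ 2 * (x - a) ^ 2 + 2 * δ ^ 2 := by
  have h1 : (y - x) ^ 2 ≤ δ ^ 2 := sq_le_sq' (abs_le.1 h).1 (abs_le.1 h).2
  nlinarith [sq_nonneg ((y - x) - (x - a))]

lemma expect_sq_rowAvg_swap_swap_le (e : α × κ ↪ T) {f : T → ℝ} (hf : ∀ t, 0 ≤ f t)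
    (hf' : ∀ t, f t ≤ 1) (a : ℝ) (s t s' t' : T) :
    𝔼 x, (rowAvg (relabel (Equiv.swap s t) (relabel (Equiv.swap s' t') e)) f x - a) ^ 2 ≤
      2 * (𝔼 x, (rowAvg e f x - a) ^ 2) + 32 * (1 / (Fintype.card κ : ℝ)) ^ 2 := by
  calc _ ≤ 𝔼 x, (2 * (rowAvg e f x - a) ^ 2 + 32 * (1 / (Fintype.card κ : ℝ)) ^ 2) :=
        expect_mono fun x => (sq_sub_le_of_abs_sub_le
          (abs_rowAvg_swap_swap_sub_le e hf hf' s t s' t' x)).trans_eq (by ring)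
    _ = _ := by rw [expect_add, expect_const_mul, expect_const]

/-- Mean square deviations, under conditioning. -/
lemma Transfers.expect_mul_sq_rowAvg_sub_le {C : ℝ} {w : (α × κ ↪ T) → ℝ} (hw : Transfers C w)
    [Nonempty (α × κ ↪ T)] {f : T → ℝ} (hf : ∀ t, 0 ≤ f t) (hf' : ∀ t, f t ≤ 1) (a : ℝ) :
    𝔼 e, w e * 𝔼 x, (rowAvg e f x - a) ^ 2 ≤ C * (𝔼 e, w e) *
      (2 * (𝔼 e : α × κ ↪ T, 𝔼 x, (rowAvg e f x - a) ^ 2) +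
        32 * (1 / (Fintype.card κ : ℝ)) ^ 2) := by
  have := hw.bound (fun e => 𝔼 x, (rowAvg e f x - a) ^ 2)
    (fun e => 2 * (𝔼 x, (rowAvg e f x - a) ^ 2) + 32 * (1 / (Fintype.card κ : ℝ)) ^ 2)
    (fun e => expect_nonneg fun x => sq_nonneg _)
    fun e s t s' t' => expect_sq_rowAvg_swap_swap_le e hf hf' a s t s' t'
  rwa [expect_add, expect_const_mul, expect_const] at this

/-- Joint moment of two indicator rows against a swap-stable function. -/
lemma expect_rowAvg_ind_mul_mul_le {Y Z : (α × κ ↪ T) → ℝ} (hY : ∀ e, 0 ≤ Y e)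
    (h : ∀ e s t s' t', Y (relabel (Equiv.swap s t) (relabel (Equiv.swap s' t') e)) ≤ Z e)
    {t t' : T} (ht : t ≠ t') :
    𝔼 e : α × κ ↪ T, (𝔼 x, rowAvg e (fun s => ind (s = t)) x *
      rowAvg e (fun s => ind (s = t')) x) * Y e ≤
      2 / (Fintype.card T : ℝ) ^ 2 * 𝔼 e, Z e := by
  have hZ : 0 ≤ 𝔼 e, Z e := expect_nonneg fun e => (hY e).trans (le_of_swaps h e)
  have h1 : ∀ e : α × κ ↪ T, (𝔼 x, rowAvg e (fun s => ind (s = t)) x *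
      rowAvg e (fun s => ind (s = t')) x) * Y e =
      𝔼 x, 𝔼 k, 𝔼 k', ind (e (x, k') = t') * (ind (e (x, k) = t) * Y e) := by
    intro e
    rw [← expect_mul_const]
    congr 1; funext x
    simp only [rowAvg]
    rw [← expect_mul_const, ← expect_mul_const]
    congr 1; funext k
    rw [mul_assoc, mul_comm (𝔼 k, _), ← mul_assoc, ← expect_const_mul]
    congr 1; funext k'
    ring
  simp only [h1]
  rw [expect_swap]
  refine expect_le_of_forall_le fun x => ?_
  rw [expect_swap]
  refine expect_le_of_forall_le fun k => ?_
  rw [expect_swap]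
  refine expect_le_of_forall_le fun k' => ?_
  by_cases hk : k = k'
  · have h0 : ∀ e : α × κ ↪ T, ind (e (x, k') = t') * (ind (e (x, k) = t) * Y e) = 0 := by
      intro e
      rw [← hk]
      by_cases hs : e (x, k) = t
      · rw [ind_false (fun h : e (x, k) = t' => ht (hs.symm.trans h)), zero_mul]
      · rw [ind_false hs, zero_mul, mul_zero]
    simp only [h0, expect_const_zero]
    positivity
  · exact expect_ind_mul_ind_mul_le hY h (fun h' => hk (Prod.mk.inj h').2) t t'

end RowAvg

section Binary

variable {v m : ℕ}

/-- Probability that the pair `s` is the span of `z`. -/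
noncomputable def prF (e : BinaryRules v m) (s : Pair v) (z : Fin v) : ℝ :=
  rowAvg e (fun w => ind (w = s)) z

/-- Probability that `c` is the first symbol of the span of `z`. -/
noncomputable def fsF (e : BinaryRules v m) (c z : Fin v) : ℝ :=
  rowAvg e (fun w => ind (c = w.1)) z

/-- Probability that `a` is the last symbol of the span of `z`. -/
noncomputable def snF (e : BinaryRules v m) (a z : Fin v) : ℝ :=
  rowAvg e (fun w => ind (a = w.2)) z

/-- Exchange of the two symbols of every rule. -/
def mirror (e : BinaryRules v m) : BinaryRules v m :=
  relabel (Equiv.prodComm _ _) e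

lemma prF_mirror (e : BinaryRules v m) (s : Pair v) (z : Fin v) :
    prF (mirror e) s z = prF e s.swap z := by
  simp only [prF, rowAvg, mirror, relabel_apply]
  congr 1; funext k
  exact ind_congr (by rw [← Prod.swap_inj]; simp [Equiv.prodComm])

lemma expect_mirror (f : BinaryRules v m → ℝ) :
    𝔼 e, f (mirror e) = 𝔼 e, f e := expect_relabel _ f

lemma prF_nonneg (e : BinaryRules v m) (s : Pair v) (z : Fin v) :
    0 ≤ prF e s z := rowAvg_nonneg _ (fun _ => ind_nonneg _) _

lemma fsF_nonneg (e : BinaryRules v m) (c z : Fin v) :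
    0 ≤ fsF e c z := rowAvg_nonneg _ (fun _ => ind_nonneg _) _

variable {m3 : ℕ} {c : ℝ} (h : Regime c v m m3)

include h

lemma inv_m2_le_mul : 1 / (m : ℝ) ≤ 1 / c * (1 / v) := by
  rw [one_div_mul_one_div]; exact h.inv_m2_le

lemma inv_m3_le_mul : 1 / (m3 : ℝ) ≤ 1 / c * (1 / v) ^ 2 := by
  refine h.inv_m3_le.trans_eq ?_
  rw [one_div_pow, one_div_mul_one_div]

lemma one_le_inv : 1 ≤ 1 / c := by
  rw [le_div_iff₀ h.pos, one_mul]; exact h.le_one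

lemma inv_v_pos : 0 < 1 / (v : ℝ) := one_div_pos.2 h.v_pos

lemma inv_v_le_one : 1 / (v : ℝ) ≤ 1 := by
  rw [div_le_one h.v_pos]; linarith [h.two_le_real]

omit h in
lemma sum_ind_eq_right {T : Type*} [Fintype T] (s : T) : ∑ w, ind (w = s) = 1 := by
  rw [sum_eq_single s, ind_true rfl]
  · intro b _ hb; exact ind_false hb
  · intro hs; exact absurd (Finset.mem_univ _) hs

lemma expect_prF_le (e : BinaryRules v m) (s : Pair v) :
    𝔼 z, prF e s z ≤ 1 / c * (1 / v) ^ 2 := by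
  have := h.nonempty_fin
  have := h.nonempty_m2
  refine (expect_rowAvg_le_sum_div e fun _ => ind_nonneg _).trans ?_
  rw [sum_ind_eq_right, card_fin, card_fin, ← one_div_mul_one_div]
  calc 1 / (v : ℝ) * (1 / m) ≤ 1 / v * (1 / c * (1 / v)) :=
        mul_le_mul_of_nonneg_left (inv_m2_le_mul h) (inv_v_pos h).le
    _ = _ := by ring

lemma expect_prF_nonneg (e : BinaryRules v m) (s : Pair v) :
    0 ≤ 𝔼 z, prF e s z := expect_nonneg fun _ => prF_nonneg e s _

lemma expect_sq_prF_le (e : BinaryRules v m) (s : Pair v) :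
    𝔼 z, prF e s z ^ 2 ≤ (1 / c) ^ 2 * (1 / v) ^ 3 := by
  have := h.nonempty_fin
  have := h.nonempty_m2
  refine (expect_sq_rowAvg_le e fun _ => ind_nonneg _).trans ?_
  rw [sum_ind_eq_right, card_fin, card_fin, one_pow, ← one_div_mul_one_div,
    ← one_div_pow]
  calc 1 / (v : ℝ) * (1 / m) ^ 2 ≤ 1 / v * (1 / c * (1 / v)) ^ 2 :=
        mul_le_mul_of_nonneg_left (pow_le_pow_left₀ (by positivity) (inv_m2_le_mul h) 2)
          (inv_v_pos h).le
    _ = _ := by ring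

lemma cvar_prF_le (e : BinaryRules v m) (s : Pair v) :
    𝕍 (prF e s) ≤ (1 / c) ^ 2 * (1 / v) ^ 3 :=
  (cvar_self_le _).trans (expect_sq_prF_le h e s)

lemma expect_ind_fst (a : Fin v) : 𝔼 w : Pair v, ind (a = w.1) = 1 / (v : ℝ) := by
  rw [expect_fst₂ h fun y => ind (a = y)]; exact expect_ind_eq a

lemma expect_fsF_le (e : BinaryRules v m) (a : Fin v) :
    𝔼 z, fsF e a z ≤ 1 / c * (1 / v) := by
  have := h.nonempty_fin
  have := h.nonempty_m2
  refine (expect_rowAvg_le e fun _ => ind_nonneg _).trans ?_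
  rw [expect_ind_fst h]
  exact mul_le_mul_of_nonneg_right h.ratio₂_le (inv_v_pos h).le

lemma expect_sq_fsF_le (a : Fin v) :
    𝔼 e : BinaryRules v m, 𝔼 z, fsF e a z ^ 2 ≤ 3 * (1 / c) * (1 / v) ^ 2 := by
  obtain ⟨_, _, _, _, _, _⟩ := h.insts
  rw [expect_swap]
  refine expect_le_of_forall_le fun z => ?_
  refine (expect_rowAvg_sq_le (fun _ => ind_nonneg _) (fun _ => ind_le_one _) z).trans ?_
  rw [expect_ind_fst h, card_fin, div_eq_mul_one_div 2]
  have h1 := inv_m2_le_mul h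
  have h2 := one_le_inv h
  have h3 := inv_v_pos h
  calc 1 / (v : ℝ) * (1 / v + 2 * (1 / m)) ≤
        1 / v * (1 / c * (1 / v) + 2 * (1 / c * (1 / v))) := by
        gcongr
        exact le_mul_of_one_le_left h3.le h2
    _ = _ := by ring

lemma expect_cvar_fsF_le (a : Fin v) :
    𝔼 e : BinaryRules v m, 𝕍 (fsF e a) ≤ 3 * (1 / c) * (1 / v) ^ 2 :=
  (expect_mono fun _ => cvar_self_le _).trans (expect_sq_fsF_le h a)

lemma expect_sq_expect_fsF_sub_le (a : Fin v) :
    𝔼 e : BinaryRules v m, ((𝔼 z, fsF e a z) - 1 / (v : ℝ)) ^ 2 ≤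
      1 / c * (1 / v) ^ 3 := by
  obtain ⟨_, _, _, _, _, _⟩ := h.insts
  have h1 := expect_sq_expect_rowAvg_sub_le (α := Fin v) (κ := Fin m) h.card₂
    fun w : Pair v => ind (a = w.1)
  rw [expect_ind_fst h, card_fin, card_fin] at h1
  refine h1.trans ?_
  have h2 : 𝕍 (fun w : Pair v => ind (a = w.1)) ≤ 1 / v := by
    refine (cvar_self_le _).trans_eq ?_
    simp only [ind_sq, expect_ind_fst h]
  rw [← one_div_mul_one_div]
  calc 1 / (v : ℝ) * (1 / m) * 𝕍 (fun w : Pair v => ind (a = w.1)) ≤ 1 / v * (1 / c * (1 / v)) * (1 / v) := by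
        have h3 := inv_v_pos h
        have h4 := inv_m2_le_mul h
        have := cvar_self_nonneg (fun w : Pair v => ind (a = w.1))
        have := h.pos
        gcongr
    _ = _ := by ring

/-- Correlations between pairs and first symbols. -/
lemma expect_sq_cvar_prF_fsF_le (s : Pair v) (a : Fin v) :
    𝔼 e : BinaryRules v m, cvar (prF e s) (fsF e a) ^ 2 ≤
      30 * (1 / c) ^ 4 * (1 / v) ^ 6 := by
  obtain ⟨_, _, _, _, _, _⟩ := h.insts
  have hq := one_le_inv h
  have hx := inv_v_pos h
  have hm := inv_m2_le_mul h
  set q := 1 / c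
  set x := 1 / (v : ℝ) with hxdef
  have h1 : ∀ z, 𝔼 e : BinaryRules v m, prF e s z * fsF e a z ^ 2 ≤
      14 * q ^ 2 * x ^ 4 := by
    intro z
    refine (expect_rowAvg_mul_le (fun _ => ind_nonneg _) z
      (Z := fun e => 2 * fsF e a z ^ 2 + 8 * (1 / (m : ℝ)) ^ 2) fun e s t => ?_).trans ?_
    · have h2 := sq_sub_le_of_abs_sub_le (a := 0) (abs_rowAvg_relabel_swap_sub_le e
        (f := fun w => ind (a = w.1)) (fun _ => ind_nonneg _) (fun _ => ind_le_one _) s t z)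
      simp only [sub_zero, card_fin] at h2
      exact h2.trans_eq (by rw [fsF]; ring)
    · have h3 : 𝔼 e : BinaryRules v m, fsF e a z ^ 2 ≤ x * (x + 2 * (1 / m)) := by
        have := expect_rowAvg_sq_le (α := Fin v) (κ := Fin m) (f := fun w : Pair v =>
          ind (a = w.1)) (fun _ => ind_nonneg _) (fun _ => ind_le_one _) z
        rwa [expect_ind_fst h, card_fin, div_eq_mul_one_div 2] at this
      rw [expect_add, expect_const_mul, expect_const, expect_ind_eq', card_prod,
        card_fin]
      push_cast
      have h4 : (1 : ℝ) / (v * v) = x ^ 2 := by rw [hxdef, one_div_pow, sq]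
      rw [h4]
      have h5 : x ≤ q * x := le_mul_of_one_le_left hx.le hq
      calc x ^ 2 * (2 * (𝔼 e : BinaryRules v m, fsF e a z ^ 2) +
            8 * (1 / (m : ℝ)) ^ 2) ≤
          x ^ 2 * (2 * (q * x * (q * x + 2 * (q * x))) + 8 * (q * x) ^ 2) := by
            gcongr
            refine h3.trans ?_
            gcongr
        _ = _ := by ring
  have h2 : ∀ e : BinaryRules v m, cvar (prF e s) (fsF e a) ^ 2 ≤
      2 * (q * x ^ 2) * (𝔼 z, prF e s z * fsF e a z ^ 2) + 2 * q ^ 4 * x ^ 6 := by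
    intro e
    have e1 : (𝔼 z, prF e s z * fsF e a z) ^ 2 ≤
        q * x ^ 2 * 𝔼 z, prF e s z * fsF e a z ^ 2 := by
      have h3 := sq_expect_mul_le (fun z => Real.sqrt (prF e s z))
        (fun z => Real.sqrt (prF e s z) * fsF e a z)
      have h4 : ∀ z, Real.sqrt (prF e s z) * (Real.sqrt (prF e s z) * fsF e a z) =
          prF e s z * fsF e a z := fun z => by
        rw [← mul_assoc, Real.mul_self_sqrt (prF_nonneg e s z)]
      simp only [h4, mul_pow, Real.sq_sqrt (prF_nonneg e s _)] at h3
      refine h3.trans (mul_le_mul_of_nonneg_right (expect_prF_le h e s) ?_)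
      exact expect_nonneg fun z => mul_nonneg (prF_nonneg e s z) (sq_nonneg _)
    have e2 : ((𝔼 z, prF e s z) * 𝔼 z, fsF e a z) ^ 2 ≤ q ^ 4 * x ^ 6 := by
      have h5 := expect_prF_le h e s
      have h6 := expect_fsF_le h e a
      have h7 : 0 ≤ 𝔼 z, fsF e a z := expect_nonneg fun z => fsF_nonneg e a z
      calc ((𝔼 z, prF e s z) * 𝔼 z, fsF e a z) ^ 2 ≤ (q * x ^ 2 * (q * x)) ^ 2 := by
            have := expect_prF_nonneg h e s
            gcongr
        _ = _ := by ring
    rw [cvar]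
    nlinarith [sq_nonneg ((𝔼 z, prF e s z * fsF e a z) + (𝔼 z, prF e s z) * 𝔼 z, fsF e a z)]
  refine (expect_mono h2).trans ?_
  rw [expect_add, expect_const_mul, expect_const, expect_swap]
  have h3 := expect_le_of_forall_le h1
  calc 2 * (q * x ^ 2) * (𝔼 z, 𝔼 e : BinaryRules v m, prF e s z * fsF e a z ^ 2) +
        2 * q ^ 4 * x ^ 6 ≤ 2 * (q * x ^ 2) * (14 * q ^ 2 * x ^ 4) + 2 * q ^ 4 * x ^ 6 := by gcongr
    _ = 28 * q ^ 3 * x ^ 6 + 2 * q ^ 4 * x ^ 6 := by ring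
    _ ≤ 28 * q ^ 4 * x ^ 6 + 2 * q ^ 4 * x ^ 6 := by
        gcongr 28 * ?_ * x ^ 6 + _
        exact pow_le_pow_right₀ hq (by norm_num)
    _ = _ := by ring

lemma abs_expect_cvar_prF_mul_cvar_fsF_of_ne {s s' : Pair v} (hs : s ≠ s') (a a' : Fin v) :
    |𝔼 e : BinaryRules v m, cvar (prF e s) (prF e s') *
      cvar (fsF e a) (fsF e a')| ≤ 79 * (1 / c) ^ 3 * (1 / v) ^ 6 := by
  obtain ⟨_, _, _, _, _, _⟩ := h.insts
  have hq := one_le_inv h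
  have hx := inv_v_pos h
  have hm := inv_m2_le_mul h
  have hY1 := expect_sq_fsF_le h a
  have hY2 := expect_sq_fsF_le h a'
  set q := 1 / c
  set x := 1 / (v : ℝ) with hxdef
  set Y : BinaryRules v m → ℝ := fun e =>
    ((𝔼 z, fsF e a z ^ 2) + 𝔼 z, fsF e a' z ^ 2) / 2 with hY
  have hY0 : ∀ e, 0 ≤ Y e := fun e => by
    have h1 : 0 ≤ 𝔼 z, fsF e a z ^ 2 := expect_nonneg fun _ => sq_nonneg _
    have h2 : 0 ≤ 𝔼 z, fsF e a' z ^ 2 := expect_nonneg fun _ => sq_nonneg _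
    simp only [hY]; linarith
  have hYe : 𝔼 e, Y e ≤ 3 * q * x ^ 2 := by
    simp only [hY, div_eq_mul_inv]
    rw [expect_mul_const, expect_add]
    linarith
  have hYZ : ∀ e s t s' t', Y (relabel (Equiv.swap s t) (relabel (Equiv.swap s' t') e)) ≤
      2 * Y e + 32 * (1 / (m : ℝ)) ^ 2 := by
    intro e s t s' t'
    have h1 := expect_sq_rowAvg_swap_swap_le e (f := fun w => ind (a = w.1))
      (fun _ => ind_nonneg _) (fun _ => ind_le_one _) 0 s t s' t'
    have h2 := expect_sq_rowAvg_swap_swap_le e (f := fun w => ind (a' = w.1))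
      (fun _ => ind_nonneg _) (fun _ => ind_le_one _) 0 s t s' t'
    simp only [sub_zero, card_fin] at h1 h2
    simp only [hY, fsF]; linarith
  have h1 := expect_rowAvg_ind_mul_mul_le hY0 hYZ hs
  rw [expect_add, expect_const_mul, expect_const, card_prod, card_fin]
    at h1
  have h2 : ∀ e : BinaryRules v m,
      |cvar (prF e s) (prF e s') * cvar (fsF e a) (fsF e a')| ≤
        (𝔼 z, prF e s z * prF e s' z) * Y e + q ^ 2 * x ^ 4 * Y e := by
    intro e
    have h3 : |cvar (fsF e a) (fsF e a')| ≤ Y e := (abs_cvar_le _ _).trans <| by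
      have := cvar_self_le (fsF e a)
      have := cvar_self_le (fsF e a')
      simp only [hY]; linarith
    have h4 : |cvar (prF e s) (prF e s')| ≤ (𝔼 z, prF e s z * prF e s' z) + q ^ 2 * x ^ 4 := by
      have h5 : 0 ≤ 𝔼 z, prF e s z * prF e s' z :=
        expect_nonneg fun z => mul_nonneg (prF_nonneg _ _ _) (prF_nonneg _ _ _)
      have h6 : (𝔼 z, prF e s z) * (𝔼 z, prF e s' z) ≤ q ^ 2 * x ^ 4 := by
        calc (𝔼 z, prF e s z) * (𝔼 z, prF e s' z) ≤ q * x ^ 2 * (q * x ^ 2) :=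
              mul_le_mul (expect_prF_le h e s) (expect_prF_le h e s') (expect_prF_nonneg h e s')
                (by positivity)
          _ = _ := by ring
      have h7 := mul_nonneg (expect_prF_nonneg h e s) (expect_prF_nonneg h e s')
      rw [cvar, abs_le]
      constructor <;> linarith
    rw [abs_mul, ← add_mul]
    exact mul_le_mul h4 h3 (abs_nonneg _) ((abs_nonneg _).trans h4)
  refine (abs_expect_le_expect_abs _).trans ((expect_mono h2).trans ?_)
  rw [expect_add, expect_const_mul]
  have h3 : 𝔼 e, (𝔼 z, prF e s z * prF e s' z) * Y e ≤ 2 * x ^ 4 * (38 * q ^ 2 * x ^ 2) := by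
    refine h1.trans ?_
    have e1 : (2 : ℝ) / ((v * v : ℕ) : ℝ) ^ 2 = 2 * x ^ 4 := by
      rw [hxdef]; push_cast; field_simp
    rw [e1]
    refine mul_le_mul_of_nonneg_left ?_ (by positivity)
    calc 2 * (𝔼 e, Y e) + 32 * (1 / (m : ℝ)) ^ 2 ≤ 2 * (3 * q * x ^ 2) + 32 * (q * x) ^ 2 := by
          gcongr
      _ ≤ 2 * (3 * q * (q * x ^ 2)) + 32 * (q * x) ^ 2 := by
          gcongr
          exact le_mul_of_one_le_left (by positivity) hq
      _ = _ := by ring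
  calc _ ≤ 2 * x ^ 4 * (38 * q ^ 2 * x ^ 2) + q ^ 2 * x ^ 4 * (3 * q * x ^ 2) := by gcongr
    _ = 76 * (1 * q ^ 2 * x ^ 6) + 3 * q ^ 3 * x ^ 6 := by ring
    _ ≤ 76 * (q * q ^ 2 * x ^ 6) + 3 * q ^ 3 * x ^ 6 := by gcongr
    _ = _ := by ring

omit h in
lemma fsF_relabel (σ : Equiv.Perm (Fin v)) (e : BinaryRules v m) (a z : Fin v) :
    fsF (relabel (Equiv.prodCongr σ (Equiv.refl _)) e) (σ a) z = fsF e a z := by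
  simp only [fsF, rowAvg, relabel_apply]
  congr 1; funext k
  exact ind_congr (by simp)

omit h in
lemma prF_relabel (σ : Equiv.Perm (Fin v)) (e : BinaryRules v m) (a b z : Fin v) :
    prF (relabel (Equiv.prodCongr σ (Equiv.refl _)) e) (σ a, b) z = prF e (a, b) z := by
  simp only [prF, rowAvg, relabel_apply]
  congr 1; funext k
  exact ind_congr (by simp [Prod.ext_iff])

omit h in
lemma sum_fsF [Nonempty (Fin m)] (e : BinaryRules v m) (z : Fin v) :
    ∑ a, fsF e a z = 1 := by
  simp only [fsF, rowAvg]
  rw [← expect_sum]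
  have : ∀ k : Fin m, ∑ a, ind (a = (e (z, k)).1) = 1 := fun k => sum_ind_eq_right _
  simp only [this, expect_const]

lemma abs_expect_cvar_prF_mul_cvar_fsF_of_eq (hv : 4 ≤ v) (s : Pair v) {a a' : Fin v}
    (ha : a ≠ a') (has : a ≠ s.1) :
    |𝔼 e : BinaryRules v m, 𝕍 (prF e s) *
      cvar (fsF e a) (fsF e a')| ≤ 12 * (1 / c) ^ 3 * (1 / v) ^ 6 := by
  obtain ⟨_, _, _, _, _, _⟩ := h.insts
  obtain ⟨s₁, s₂⟩ := s
  set ψ : Fin v → ℝ := fun b => 𝔼 e : BinaryRules v m,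
    𝕍 (prF e (s₁, s₂)) * cvar (fsF e b) (fsF e a') with hψ
  have hsum : ∑ b, ψ b = 0 := by
    simp only [hψ]
    rw [← expect_sum]
    have : ∀ e : BinaryRules v m, ∑ b, 𝕍 (prF e (s₁, s₂)) *
        cvar (fsF e b) (fsF e a') = 0 := by
      intro e
      rw [← mul_sum, ← cvar_sum_left]
      have h1 : (fun z => ∑ b, fsF e b z) = fun _ => 1 := funext fun z => sum_fsF e z
      rw [h1, cvar_const_left, mul_zero]
    simp only [this, expect_const_zero]
  have hconst : ∀ b, b ≠ s₁ → b ≠ a' → ψ b = ψ a := by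
    intro b hb hb'
    simp only [hψ]
    rw [← expect_relabel (Equiv.prodCongr (Equiv.swap a b) (Equiv.refl _))]
    refine congrArg _ (funext fun e => ?_)
    have h1 : prF (relabel (Equiv.prodCongr (Equiv.swap a b) (Equiv.refl _)) e) (s₁, s₂) =
        prF e (s₁, s₂) := by
      funext z
      have := prF_relabel (Equiv.swap a b) e s₁ s₂ z
      rwa [Equiv.swap_apply_of_ne_of_ne (Ne.symm has) (Ne.symm hb)] at this
    have h2 : fsF (relabel (Equiv.prodCongr (Equiv.swap a b) (Equiv.refl _)) e) b =
        fsF e a := by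
      funext z
      have := fsF_relabel (Equiv.swap a b) e a z
      rwa [Equiv.swap_apply_left] at this
    have h3 : fsF (relabel (Equiv.prodCongr (Equiv.swap a b) (Equiv.refl _)) e) a' =
        fsF e a' := by
      funext z
      have := fsF_relabel (Equiv.swap a b) e a' z
      rwa [Equiv.swap_apply_of_ne_of_ne (Ne.symm ha) (Ne.symm hb')] at this
    rw [h1, h2, h3]
  have hbound : ∀ b, |ψ b| ≤ 3 * (1 / c) ^ 3 * (1 / v) ^ 5 := by
    intro b
    refine (abs_expect_le_expect_abs _).trans ?_
    have hq : 0 < 1 / c := one_div_pos.2 h.pos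
    have hx := inv_v_pos h
    calc _ ≤ 𝔼 e : BinaryRules v m, (1 / c) ^ 2 * (1 / v) ^ 3 *
          ((𝕍 (fsF e b) + 𝕍 (fsF e a')) * (1 / 2)) := by
          refine expect_mono fun e => ?_
          rw [abs_mul, abs_of_nonneg (cvar_self_nonneg _)]
          refine mul_le_mul (cvar_prF_le h e _) ((abs_cvar_le _ _).trans_eq (by ring))
            (abs_nonneg _) (by positivity)
      _ ≤ (1 / c) ^ 2 * (1 / v) ^ 3 * ((3 * (1 / c) * (1 / v) ^ 2 +
          3 * (1 / c) * (1 / v) ^ 2) * (1 / 2)) := by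
          rw [expect_const_mul, expect_mul_const, expect_add]
          have h1 := expect_cvar_fsF_le h b
          have h2 := expect_cvar_fsF_le h a'
          gcongr
      _ = _ := by ring
  have hle : ((v : ℝ) - 2) * |ψ a| ≤ 2 * (3 * (1 / c) ^ 3 * (1 / v) ^ 5) := by
    have h1 := Finset.sum_add_sum_compl {s₁, a'} ψ
    have h0 : ∑ b ∈ ({s₁, a'} : Finset (Fin v))ᶜ, ψ b =
        ∑ _b ∈ ({s₁, a'} : Finset (Fin v))ᶜ, ψ a := sum_congr rfl fun b hb => by
      rw [Finset.mem_compl, Finset.mem_insert, Finset.mem_singleton, not_or] at hb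
      exact hconst b hb.1 hb.2
    rw [hsum, h0] at h1
    · rw [Finset.sum_const, nsmul_eq_mul, Finset.card_compl, card_fin,
        Nat.cast_sub (by simpa using Finset.card_le_univ ({s₁, a'} : Finset (Fin v)))] at h1
      have h2 : ((({s₁, a'} : Finset (Fin v)).card : ℕ) : ℝ) ≤ 2 := by
        exact_mod_cast Finset.card_le_two
      have h3 : |∑ b ∈ {s₁, a'}, ψ b| ≤ 2 * (3 * (1 / c) ^ 3 * (1 / v) ^ 5) := by
        refine (Finset.abs_sum_le_sum_abs _ _).trans ((sum_le_sum fun b _ =>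
          hbound b).trans ?_)
        rw [Finset.sum_const, nsmul_eq_mul]
        have := (abs_nonneg _).trans (hbound a)
        gcongr
      have hv4 : (4 : ℝ) ≤ v := by exact_mod_cast hv
      have h4 : ((v : ℝ) - (({s₁, a'} : Finset (Fin v)).card : ℕ)) * ψ a =
          - ∑ b ∈ {s₁, a'}, ψ b := by linarith
      calc ((v : ℝ) - 2) * |ψ a| ≤ ((v : ℝ) - (({s₁, a'} : Finset (Fin v)).card : ℕ)) * |ψ a| := by
            gcongr
        _ = |∑ b ∈ {s₁, a'}, ψ b| := by
            rw [← abs_neg (∑ b ∈ _, ψ b), ← h4, abs_mul,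
              abs_of_nonneg (a := (v : ℝ) - _) (by linarith)]
        _ ≤ _ := h3
  have hv4 : (4 : ℝ) ≤ v := by exact_mod_cast hv
  have h1 : (v : ℝ) / 2 * |ψ a| ≤ 2 * (3 * (1 / c) ^ 3 * (1 / v) ^ 5) :=
    (mul_le_mul_of_nonneg_right (by linarith) (abs_nonneg _)).trans hle
  calc |ψ a| = 2 * (1 / v) * ((v : ℝ) / 2 * |ψ a|) := by
        have := h.v_pos.ne'
        field_simp
    _ ≤ 2 * (1 / v) * (2 * (3 * (1 / c) ^ 3 * (1 / v) ^ 5)) :=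
        mul_le_mul_of_nonneg_left h1 (mul_nonneg zero_le_two (inv_v_pos h).le)
    _ = _ := by ring

lemma abs_expect_cvar_prF_mul_cvar_fsF_le (hv : 4 ≤ v) {s s' : Pair v} {a a' : Fin v}
    (hne : s ≠ s' ∨ a ≠ a') :
    |𝔼 e : BinaryRules v m, cvar (prF e s) (prF e s') *
      cvar (fsF e a) (fsF e a')| ≤ 79 * (1 / c) ^ 3 * (1 / v) ^ 6 := by
  by_cases hs : s = s'
  · have ha : a ≠ a' := hne.resolve_left (not_not.2 hs)
    subst hs
    have hq : 0 < 1 / c := one_div_pos.2 h.pos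
    have hx := inv_v_pos h
    have h12 : 12 * (1 / c) ^ 3 * (1 / (v : ℝ)) ^ 6 ≤ 79 * (1 / c) ^ 3 * (1 / v) ^ 6 := by
      gcongr; norm_num
    by_cases has : a = s.1
    · have h1 := abs_expect_cvar_prF_mul_cvar_fsF_of_eq h hv s (Ne.symm ha)
        fun h' => ha (has.trans h'.symm)
      simp only [cvar_comm (fsF _ a') (fsF _ a)] at h1
      exact h1.trans h12
    · exact (abs_expect_cvar_prF_mul_cvar_fsF_of_eq h hv s ha has).trans h12
  · exact abs_expect_cvar_prF_mul_cvar_fsF_of_ne h hs a a'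

end Binary

section Centered

variable {α : Type*} [Fintype α] [Nonempty α]

/-- The centered version of a function. -/
noncomputable def cen (φ : α → ℝ) (x : α) : ℝ := φ x - 𝔼 y, φ y

lemma expect_cen (φ : α → ℝ) : 𝔼 x, cen φ x = 0 := by
  simp only [cen, expect_sub, expect_const, sub_self]

lemma expect_cen_mul_cen (φ ψ : α → ℝ) : 𝔼 x, cen φ x * cen ψ x = cvar φ ψ :=
  (cvar_eq_centered φ ψ).symm

lemma expect_mul_mul_mul (A A' B B' : α → ℝ) :
    𝔼 x, 𝔼 y, A x * B y * (A' x * B' y) = (𝔼 x, A x * A' x) * 𝔼 y, B y * B' y := by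
  have h : ∀ x y, A x * B y * (A' x * B' y) = A x * A' x * (B y * B' y) := fun x y => by ring
  simp only [h, expect_const_mul, expect_mul_const]

lemma cvar_prod_self_add {β : Type*} [Fintype β] [Nonempty β] (f : α → ℝ) (g : β → ℝ) :
    𝕍 (fun x : α × β => f x.1 + g x.2) =
      𝕍 f + 𝕍 g := cvar_prod_add f f g g

end Centered

section Binary

variable {v m : ℕ}

/-- The part of the noise kernel of two binary nodes that is centered in both variables. -/
noncomputable def mainK (e : BinaryRules v m) (t : Triple v)
    (z z' : Fin v) : ℝ :=
  cen (prF e (t.1, t.2.1)) z * cen (fsF e t.2.2) z' +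
    cen (snF e t.1) z * cen (prF e (t.2.1, t.2.2)) z'

lemma expect_mainK_right [Nonempty (Fin v)] (e : BinaryRules v m)
    (t : Triple v) (z : Fin v) : 𝔼 z', mainK e t z z' = 0 := by
  simp only [mainK, expect_add, expect_const_mul, expect_cen, mul_zero, add_zero]

lemma expect_mainK_left [Nonempty (Fin v)] (e : BinaryRules v m)
    (t : Triple v) (z' : Fin v) : 𝔼 z, mainK e t z z' = 0 := by
  simp only [mainK, expect_add, expect_mul_const, expect_cen, zero_mul, add_zero]

lemma expect_mainK_mul_mainK [Nonempty (Fin v)] (e : BinaryRules v m)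
    (t t' : Triple v) :
    𝔼 z, 𝔼 z', mainK e t z z' * mainK e t' z z' =
      cvar (prF e (t.1, t.2.1)) (prF e (t'.1, t'.2.1)) * cvar (fsF e t.2.2) (fsF e t'.2.2) +
      cvar (prF e (t.1, t.2.1)) (snF e t'.1) * cvar (fsF e t.2.2) (prF e (t'.2.1, t'.2.2)) +
      cvar (snF e t.1) (prF e (t'.1, t'.2.1)) * cvar (prF e (t.2.1, t.2.2)) (fsF e t'.2.2) +
      cvar (snF e t.1) (snF e t'.1) * cvar (prF e (t.2.1, t.2.2)) (prF e (t'.2.1, t'.2.2)) := by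
  simp only [mainK, add_mul, mul_add, expect_add, expect_mul_mul_mul, expect_cen_mul_cen]
  ring

variable {m3 : ℕ} {c : ℝ} (h : Regime c v m m3)

include h

lemma expect_cvar_snF_le (a : Fin v) :
    𝔼 e : BinaryRules v m, 𝕍 (snF e a) ≤ 3 * (1 / c) * (1 / v) ^ 2 := by
  have := expect_cvar_fsF_le h a
  rwa [← expect_mirror] at this

lemma expect_sq_expect_snF_sub_le (a : Fin v) :
    𝔼 e : BinaryRules v m, ((𝔼 z, snF e a z) - 1 / (v : ℝ)) ^ 2 ≤
      1 / c * (1 / v) ^ 3 := by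
  have := expect_sq_expect_fsF_sub_le h a
  rwa [← expect_mirror] at this

lemma expect_sq_cvar_prF_snF_le (s : Pair v) (a : Fin v) :
    𝔼 e : BinaryRules v m, cvar (prF e s) (snF e a) ^ 2 ≤
      30 * (1 / c) ^ 4 * (1 / v) ^ 6 := by
  have h1 := expect_sq_cvar_prF_fsF_le h s.swap a
  rw [← expect_mirror] at h1
  have h2 : ∀ e : BinaryRules v m, prF (mirror e) s.swap = prF e s := fun e => by
    funext z; rw [prF_mirror, Prod.swap_swap]
  simp only [h2] at h1
  exact h1

lemma expect_sq_mainK_le (t : Triple v) :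
    𝔼 e : BinaryRules v m, 𝔼 z, 𝔼 z', mainK e t z z' ^ 2 ≤
      12 * (1 / c) ^ 3 * (1 / v) ^ 5 := by
  have := h.nonempty_fin
  have hq : 0 < 1 / c := one_div_pos.2 h.pos
  have hx := inv_v_pos h
  have h1 : ∀ e : BinaryRules v m, 𝔼 z, 𝔼 z', mainK e t z z' ^ 2 ≤
      2 * ((1 / c) ^ 2 * (1 / v) ^ 3) * 𝕍 (fsF e t.2.2) +
      2 * ((1 / c) ^ 2 * (1 / v) ^ 3) * 𝕍 (snF e t.1) := by
    intro e
    have h2 : ∀ z z', mainK e t z z' ^ 2 ≤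
        2 * (cen (prF e (t.1, t.2.1)) z * cen (fsF e t.2.2) z' *
          (cen (prF e (t.1, t.2.1)) z * cen (fsF e t.2.2) z')) +
        2 * (cen (snF e t.1) z * cen (prF e (t.2.1, t.2.2)) z' *
          (cen (snF e t.1) z * cen (prF e (t.2.1, t.2.2)) z')) := by
      intro z z'
      rw [mainK]
      nlinarith [sq_nonneg (cen (prF e (t.1, t.2.1)) z * cen (fsF e t.2.2) z' -
        cen (snF e t.1) z * cen (prF e (t.2.1, t.2.2)) z')]
    refine (expect_mono fun z => expect_mono fun z' => h2 z z').trans ?_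
    simp only [expect_add, expect_const_mul, expect_mul_mul_mul, expect_cen_mul_cen]
    have h3 := mul_le_mul_of_nonneg_right (cvar_prF_le h e (t.1, t.2.1))
      (cvar_self_nonneg (fsF e t.2.2))
    have h4 := mul_le_mul_of_nonneg_right (cvar_prF_le h e (t.2.1, t.2.2))
      (cvar_self_nonneg (snF e t.1))
    linarith
  refine (expect_mono h1).trans ?_
  rw [expect_add, expect_const_mul, expect_const_mul]
  calc _ ≤ 2 * ((1 / c) ^ 2 * (1 / (v : ℝ)) ^ 3) * (3 * (1 / c) * (1 / v) ^ 2) +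
        2 * ((1 / c) ^ 2 * (1 / v) ^ 3) * (3 * (1 / c) * (1 / v) ^ 2) := by
        have h3 := expect_cvar_fsF_le h t.2.2
        have h4 := expect_cvar_snF_le h t.1
        gcongr
    _ = _ := by ring

/-- The kernels of distinct triples are almost uncorrelated. -/
lemma abs_expect_mainK_mul_mainK_le (hv : 4 ≤ v) {t t' : Triple v} (ht : t ≠ t') :
    |𝔼 e : BinaryRules v m, 𝔼 z, 𝔼 z', mainK e t z z' * mainK e t' z z'| ≤
      218 * (1 / c) ^ 4 * (1 / v) ^ 6 := by
  have := h.nonempty_fin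
  have hq := one_le_inv h
  have hx := inv_v_pos h
  simp only [expect_mainK_mul_mainK, expect_add]
  have hT1 := abs_expect_cvar_prF_mul_cvar_fsF_le h hv (s := (t.1, t.2.1)) (s' := (t'.1, t'.2.1))
    (a := t.2.2) (a' := t'.2.2) (by
      by_contra hcon
      rw [not_or, not_not, not_not, Prod.mk.injEq] at hcon
      exact ht (Prod.ext hcon.1.1 (Prod.ext hcon.1.2 hcon.2)))
  have hT4 : |𝔼 e : BinaryRules v m, cvar (snF e t.1) (snF e t'.1) *
      cvar (prF e (t.2.1, t.2.2)) (prF e (t'.2.1, t'.2.2))| ≤ 79 * (1 / c) ^ 3 * (1 / v) ^ 6 := by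
    have h1 := abs_expect_cvar_prF_mul_cvar_fsF_le h hv (s := (t.2.1, t.2.2).swap)
      (s' := (t'.2.1, t'.2.2).swap) (a := t.1) (a' := t'.1) (by
      by_contra hcon
      rw [not_or, not_not, not_not, Prod.swap_inj, Prod.mk.injEq] at hcon
      exact ht (Prod.ext hcon.2 (Prod.ext hcon.1.1 hcon.1.2)))
    rw [← expect_mirror] at h1
    have h2 : ∀ (e : BinaryRules v m) s, prF (mirror e) s.swap = prF e s :=
      fun e s => by funext z; rw [prF_mirror, Prod.swap_swap]
    simp only [h2] at h1
    simp only [mul_comm (cvar (snF _ _) _)]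
    exact h1
  have hcross : ∀ (s s' : Pair v) (a a' : Fin v),
      |𝔼 e : BinaryRules v m, cvar (prF e s) (snF e a) *
        cvar (prF e s') (fsF e a')| ≤ 30 * (1 / c) ^ 4 * (1 / v) ^ 6 := by
    intro s s' a a'
    refine (abs_expect_le_expect_abs _).trans ?_
    have h1 : ∀ e : BinaryRules v m, |cvar (prF e s) (snF e a) *
        cvar (prF e s') (fsF e a')| ≤ 1 / 2 * cvar (prF e s) (snF e a) ^ 2 +
          1 / 2 * cvar (prF e s') (fsF e a') ^ 2 := by
      intro e
      rw [abs_mul, ← sq_abs (cvar (prF e s) (snF e a)), ← sq_abs (cvar (prF e s') (fsF e a'))]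
      nlinarith [sq_nonneg (|cvar (prF e s) (snF e a)| - |cvar (prF e s') (fsF e a')|)]
    refine (expect_mono h1).trans ?_
    rw [expect_add, expect_const_mul, expect_const_mul]
    linarith [expect_sq_cvar_prF_snF_le h s a, expect_sq_cvar_prF_fsF_le h s' a']
  have hT2 := hcross (t.1, t.2.1) (t'.2.1, t'.2.2) t'.1 t.2.2
  have hT3 := hcross (t'.1, t'.2.1) (t.2.1, t.2.2) t.1 t'.2.2
  simp only [cvar_comm (prF _ (t'.2.1, t'.2.2)) (fsF _ t.2.2)] at hT2
  simp only [cvar_comm (prF _ (t'.1, t'.2.1)) (snF _ t.1)] at hT3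
  have h34 : 79 * (1 / c) ^ 3 * (1 / (v : ℝ)) ^ 6 ≤ 79 * (1 / c) ^ 4 * (1 / v) ^ 6 := by
    gcongr 79 * ?_ * _
    exact pow_le_pow_right₀ hq (by norm_num)
  refine (abs_add_le _ _).trans ((add_le_add ((abs_add_le _ _).trans
    (add_le_add ((abs_add_le _ _).trans (add_le_add hT1 hT2)) hT3)) hT4).trans ?_)
  linarith

end Binary

section Rules

variable {v m2 m3 : ℕ}

lemma endPair_false (Λ : Rules v m2 m3) (x y : Fin v) : endPair false Λ x y = prF Λ.1 (x, y) := by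
  funext z
  exact congrArg (fun f => rowAvg Λ.1 f z)
    (funext fun w => ind_congr (Prod.ext_iff (x := w) (y := (x, y))).symm)

lemma startPair_false (Λ : Rules v m2 m3) (x y : Fin v) :
    startPair false Λ x y = prF Λ.1 (x, y) := by
  funext z
  exact congrArg (fun f => rowAvg Λ.1 f z)
    (funext fun w => ind_congr (Prod.ext_iff (x := w) (y := (x, y))).symm)

lemma firstTok_false (Λ : Rules v m2 m3) (x : Fin v) : firstTok false Λ x = fsF Λ.1 x := rfl

lemma lastTok_false (Λ : Rules v m2 m3) (x : Fin v) : lastTok false Λ x = snF Λ.1 x := rfl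

lemma endPair_true (Λ : Rules v m2 m3) (x y : Fin v) : endPair true Λ x y =
    rowAvg Λ.2 (fun w => ind (w.2.1 = x ∧ w.2.2 = y)) := rfl

lemma startPair_true (Λ : Rules v m2 m3) (x y : Fin v) : startPair true Λ x y =
    rowAvg Λ.2 (fun w => ind (w.1 = x ∧ w.2.1 = y)) := rfl

lemma firstTok_true (Λ : Rules v m2 m3) (x : Fin v) : firstTok true Λ x =
    rowAvg Λ.2 (fun w => ind (x = w.1)) := rfl

lemma lastTok_true (Λ : Rules v m2 m3) (x : Fin v) : lastTok true Λ x =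
    rowAvg Λ.2 (fun w => ind (x = w.2.2)) := rfl

variable {c : ℝ} (h : Regime c v m2 m3)

include h

/-- The noise kernel of two binary nodes is close to its doubly centered part. -/
lemma cvar_noiseK_sub_mainK_le (a b d : Fin v) (Λ : Rules v m2 m3) : 𝕍 (fun x : Pair v => noiseK (false, false) Λ (a, b, d) x.1 x.2 -
        mainK Λ.1 (a, b, d) x.1 x.2) ≤
      2 * ((1 / c) ^ 2 * (1 / v) ^ 3) * ((𝔼 z, fsF Λ.1 d z) - 1 / v) ^ 2 +
      2 * (1 / c * (1 / v) ^ 2) ^ 2 * 𝕍 (snF Λ.1 a) +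
      (2 * (1 / c * (1 / v) ^ 2) ^ 2 * 𝕍 (fsF Λ.1 d) +
      2 * ((1 / c) ^ 2 * (1 / v) ^ 3) * ((𝔼 z, snF Λ.1 a z) - 1 / v) ^ 2) := by
  have := h.nonempty_fin
  have hq : 0 < 1 / c := one_div_pos.2 h.pos
  have hx := inv_v_pos h
  have e1 : (fun x : Pair v => noiseK (false, false) Λ (a, b, d) x.1 x.2 -
      mainK Λ.1 (a, b, d) x.1 x.2) = fun x =>
      (((𝔼 z, fsF Λ.1 d z) - 1 / v) * prF Λ.1 (a, b) x.1 +
        (𝔼 z, prF Λ.1 (b, d) z) * snF Λ.1 a x.1) +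
      ((𝔼 z, prF Λ.1 (a, b) z) * fsF Λ.1 d x.2 +
        ((𝔼 z, snF Λ.1 a z) - 1 / v) * prF Λ.1 (b, d) x.2) -
      ((𝔼 z, prF Λ.1 (a, b) z) * (𝔼 z, fsF Λ.1 d z) +
        (𝔼 z, snF Λ.1 a z) * 𝔼 z, prF Λ.1 (b, d) z) := by
    funext x
    simp only [noiseK, mainK, endPair_false, startPair_false, firstTok_false, lastTok_false, cen]
    ring
  have hp : ∀ s, (𝔼 z, prF Λ.1 s z) ^ 2 ≤ (1 / c * (1 / v) ^ 2) ^ 2 := fun s =>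
    pow_le_pow_left₀ (expect_prF_nonneg h _ _) (expect_prF_le h Λ.1 s) 2
  rw [e1, cvar_sub_const_left, cvar_sub_const_right]
  refine (cvar_prod_self_add
    (fun y => ((𝔼 z, fsF Λ.1 d z) - 1 / v) * prF Λ.1 (a, b) y +
        (𝔼 z, prF Λ.1 (b, d) z) * snF Λ.1 a y)
    (fun y => (𝔼 z, prF Λ.1 (a, b) z) * fsF Λ.1 d y +
        ((𝔼 z, snF Λ.1 a z) - 1 / v) * prF Λ.1 (b, d) y)).trans_le ?_
  refine add_le_add ((cvar_self_add_le _ _).trans ?_) ((cvar_self_add_le _ _).trans ?_)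
  · simp only [cvar_const_mul_left, cvar_const_mul_right]
    have h1 := mul_le_mul_of_nonneg_left (cvar_prF_le h Λ.1 (a, b))
      (sq_nonneg ((𝔼 z, fsF Λ.1 d z) - 1 / v))
    have h2 := mul_le_mul_of_nonneg_right (hp (b, d)) (cvar_self_nonneg (snF Λ.1 a))
    linarith
  · simp only [cvar_const_mul_left, cvar_const_mul_right]
    have h1 := mul_le_mul_of_nonneg_left (cvar_prF_le h Λ.1 (b, d))
      (sq_nonneg ((𝔼 z, snF Λ.1 a z) - 1 / v))
    have h2 := mul_le_mul_of_nonneg_right (hp (a, b)) (cvar_self_nonneg (fsF Λ.1 d))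
    linarith

end Rules

/-! ### Conditional statistics of the rules of the last level -/

section Weighted

variable {v m2 m3 : ℕ} {c : ℝ} (h : Regime c v m2 m3) {C : ℝ}
  {w : TernaryRules v m3 → ℝ} (hw : Transfers C w)

lemma Transfers.expect_nonneg {ι T : Type*} [Fintype ι] [DecidableEq ι] [Fintype T]
    [DecidableEq T] {C : ℝ} {w : (ι ↪ T) → ℝ} (hw : Transfers C w) : 0 ≤ 𝔼 e, w e :=
  RHM.expect_nonneg hw.nonneg

include h

lemma expect_rules_mul (f : BinaryRules v m2 → ℝ)
    (g : TernaryRules v m3 → ℝ) :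
    𝔼 Λ : Rules v m2 m3, f Λ.1 * g Λ.2 = (𝔼 e, f e) * 𝔼 e, g e := by
  rw [expect_rules]
  simp only [expect_const_mul, expect_mul_const]

lemma expect_rules_weight_snd (g : TernaryRules v m3 → ℝ) :
    𝔼 Λ : Rules v m2 m3, w Λ.2 * g Λ.2 = 𝔼 e, w e * g e := by
  have := h.nonempty₂
  exact expect_rules_snd (m2 := m2) fun e => w e * g e

lemma expect_rules_weight_fst (g : BinaryRules v m2 → ℝ) :
    𝔼 Λ : Rules v m2 m3, w Λ.2 * g Λ.1 = (𝔼 e, g e) * 𝔼 e, w e := by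
  simp only [mul_comm (w _)]
  exact expect_rules_mul h g w

lemma expect_ind_fst₃ (a : Fin v) :
    𝔼 s : Triple v, ind (a = s.1) = 1 / (v : ℝ) := by
  rw [expect_fst₃ h fun y => ind (a = y)]; exact expect_ind_eq a

lemma expect_ind_snd₃ (a : Fin v) :
    𝔼 s : Triple v, ind (a = s.2.2) = 1 / (v : ℝ) := by
  rw [expect_snd₃ h fun y => ind (a = y)]; exact expect_ind_eq a

omit h in
lemma expect_ind_fst_snd₃ [Nonempty (Fin v)] (x y : Fin v) :
    𝔼 s : Triple v, ind (s.1 = x ∧ s.2.1 = y) = (1 / (v : ℝ)) ^ 2 := by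
  rw [expect_prod]
  simp only [expect_prod, ind_and, expect_const, expect_const_mul, expect_mul_const,
    expect_ind_eq', card_fin]
  rw [sq]

omit h in
lemma expect_ind_snd_thd₃ [Nonempty (Fin v)] (x y : Fin v) :
    𝔼 s : Triple v, ind (s.2.1 = x ∧ s.2.2 = y) = (1 / (v : ℝ)) ^ 2 := by
  rw [expect_prod]
  simp only [expect_prod, ind_and, expect_const, expect_const_mul, expect_mul_const,
    expect_ind_eq', card_fin]
  rw [sq]

omit h in
lemma sum_eq_card_mul_expect {T : Type*} [Fintype T] [Nonempty T] (f : T → ℝ) :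
    ∑ t, f t = (Fintype.card T : ℝ) * 𝔼 t, f t := by
  have : (Fintype.card T : ℝ) ≠ 0 := by exact_mod_cast Fintype.card_ne_zero
  rw [expect_eq, ← mul_assoc, mul_one_div_cancel this, one_mul]

/-- Rows of pairs of symbols of ternary rules. -/
lemma expect_sq_rowAvg_pair_le (e : TernaryRules v m3)
    {f : Triple v → ℝ} (hf : ∀ s, 0 ≤ f s) (hE : 𝔼 s, f s = (1 / (v : ℝ)) ^ 2) :
    𝔼 z, rowAvg e f z ^ 2 ≤ (1 / c) ^ 2 * (1 / v) ^ 3 := by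
  have := h.nonempty_fin
  have := h.nonempty_m3
  have hv := h.v_pos
  refine (expect_sq_rowAvg_le e hf).trans ?_
  rw [sum_eq_card_mul_expect, hE]
  simp only [card_prod, card_fin]
  push_cast
  calc ((v : ℝ) * (v * v) * (1 / v) ^ 2) ^ 2 / (v * (m3 : ℝ) ^ 2) = v * (1 / m3) ^ 2 := by
        field_simp
    _ ≤ v * (1 / c * (1 / v) ^ 2) ^ 2 := by
        have := inv_m3_le_mul h
        gcongr
    _ = _ := by field_simp

include hw

lemma expect_weight_sq_rowAvg_pair_le {f : Triple v → ℝ} (hf : ∀ s, 0 ≤ f s)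
    (hf' : ∀ s, f s ≤ 1) (hE : 𝔼 s, f s = (1 / (v : ℝ)) ^ 2) (hC : 0 ≤ C) :
    𝔼 e, w e * 𝔼 z, rowAvg e f z ^ 2 ≤ 38 * C * (1 / c) ^ 2 * (1 / v) ^ 4 * 𝔼 e, w e := by
  obtain ⟨_, _, _, _, _, _⟩ := h.insts
  have hq := one_le_inv h
  have hx := inv_v_pos h
  have hm := inv_m3_le_mul h
  have hP := hw.expect_nonneg
  have h1 := hw.expect_mul_sq_rowAvg_sub_le hf hf' 0
  simp only [sub_zero, card_fin] at h1
  refine h1.trans ?_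
  set q := 1 / c
  set x := 1 / (v : ℝ) with hxdef
  have h2 : 𝔼 e : TernaryRules v m3, 𝔼 z, rowAvg e f z ^ 2 ≤
      3 * q * x ^ 4 := by
    rw [expect_swap]
    refine expect_le_of_forall_le fun z => ?_
    refine (expect_rowAvg_sq_le hf hf' z).trans ?_
    rw [hE, card_fin, div_eq_mul_one_div 2]
    calc x ^ 2 * (x ^ 2 + 2 * (1 / (m3 : ℝ))) ≤ x ^ 2 * (q * x ^ 2 + 2 * (q * x ^ 2)) := by
          gcongr
          exact le_mul_of_one_le_left (by positivity) hq
      _ = _ := by ring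
  calc _ ≤ C * (𝔼 e, w e) * (2 * (3 * q * x ^ 4) + 32 * (q * x ^ 2) ^ 2) := by gcongr
    _ = C * (𝔼 e, w e) * (6 * (q * 1) * x ^ 4 + 32 * q ^ 2 * x ^ 4) := by ring
    _ ≤ C * (𝔼 e, w e) * (6 * (q * q) * x ^ 4 + 32 * q ^ 2 * x ^ 4) := by gcongr
    _ = _ := by ring

lemma expect_weight_sq_rowAvg_sub_le {f : Triple v → ℝ} (hf : ∀ s, 0 ≤ f s)
    (hf' : ∀ s, f s ≤ 1) (hE : 𝔼 s, f s = 1 / (v : ℝ)) (hC : 0 ≤ C) :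
    𝔼 e, w e * 𝔼 z, (rowAvg e f z - 1 / v) ^ 2 ≤
      34 * C * (1 / c) ^ 2 * (1 / v) ^ 3 * 𝔼 e, w e := by
  obtain ⟨_, _, _, _, _, _⟩ := h.insts
  have hq := one_le_inv h
  have hx := inv_v_pos h
  have hx1 := inv_v_le_one h
  have hm := inv_m3_le_mul h
  have hP := hw.expect_nonneg
  have h1 := hw.expect_mul_sq_rowAvg_sub_le hf hf' (1 / v)
  simp only [card_fin] at h1
  refine h1.trans ?_
  set q := 1 / c
  set x := 1 / (v : ℝ) with hxdef
  have h2 : 𝔼 e : TernaryRules v m3, 𝔼 z, (rowAvg e f z - x) ^ 2 ≤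
      q * x ^ 3 := by
    rw [expect_swap]
    refine expect_le_of_forall_le fun z => ?_
    rw [← hE]
    refine (expect_sq_rowAvg_sub_le h.card₃ f z).trans ?_
    rw [card_fin]
    have h3 : 𝕍 f ≤ x := by
      refine (cvar_self_le f).trans ?_
      rw [← hE]
      refine expect_mono fun s => ?_
      rw [sq]; exact mul_le_of_le_one_left (hf s) (hf' s)
    calc 1 / (m3 : ℝ) * 𝕍 f ≤ q * x ^ 2 * x := by
          have := cvar_self_nonneg f
          gcongr
      _ = _ := by rw [hE]; ring
  calc _ ≤ C * (𝔼 e, w e) * (2 * (q * x ^ 3) + 32 * (q * x ^ 2) ^ 2) := by gcongr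
    _ = C * (𝔼 e, w e) * (2 * (q * 1 * x ^ 3) + 32 * (q ^ 2 * (x ^ 3 * x))) := by ring
    _ ≤ C * (𝔼 e, w e) * (2 * (q * q * x ^ 3) + 32 * (q ^ 2 * (x ^ 3 * 1))) := by gcongr
    _ = _ := by ring

/-! Second moments of the spans. -/

omit hw in
lemma expect_sq_endPair_le (b : Bool) (Λ : Rules v m2 m3) (x y : Fin v) :
    𝔼 z, endPair b Λ x y z ^ 2 ≤ (1 / c) ^ 2 * (1 / v) ^ 3 := by
  have := h.nonempty_fin
  cases b
  · rw [endPair_false]; exact expect_sq_prF_le h _ _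
  · rw [endPair_true]
    exact expect_sq_rowAvg_pair_le h _ (fun _ => ind_nonneg _) (expect_ind_snd_thd₃ x y)

omit hw in
lemma expect_sq_startPair_le (b : Bool) (Λ : Rules v m2 m3) (x y : Fin v) :
    𝔼 z, startPair b Λ x y z ^ 2 ≤ (1 / c) ^ 2 * (1 / v) ^ 3 := by
  have := h.nonempty_fin
  cases b
  · rw [startPair_false]; exact expect_sq_prF_le h _ _
  · rw [startPair_true]
    exact expect_sq_rowAvg_pair_le h _ (fun _ => ind_nonneg _) (expect_ind_fst_snd₃ x y)

lemma expect_weight_sq_endPair_le (hC : 0 ≤ C) (x y : Fin v) :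
    𝔼 e, w e * 𝔼 z, rowAvg e (fun s => ind (s.2.1 = x ∧ s.2.2 = y)) z ^ 2 ≤
      38 * C * (1 / c) ^ 2 * (1 / v) ^ 4 * 𝔼 e, w e := by
  have := h.nonempty_fin
  exact expect_weight_sq_rowAvg_pair_le h hw (fun _ => ind_nonneg _) (fun _ => ind_le_one _)
    (expect_ind_snd_thd₃ x y) hC

lemma expect_weight_sq_startPair_le (hC : 0 ≤ C) (x y : Fin v) :
    𝔼 e, w e * 𝔼 z, rowAvg e (fun s => ind (s.1 = x ∧ s.2.1 = y)) z ^ 2 ≤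
      38 * C * (1 / c) ^ 2 * (1 / v) ^ 4 * 𝔼 e, w e := by
  have := h.nonempty_fin
  exact expect_weight_sq_rowAvg_pair_le h hw (fun _ => ind_nonneg _) (fun _ => ind_le_one _)
    (expect_ind_fst_snd₃ x y) hC

omit hw in
lemma expect_sq_fsF_sub_le (a : Fin v) :
    𝔼 e : BinaryRules v m2, 𝔼 z, (fsF e a z - 1 / v) ^ 2 ≤
      1 / c * (1 / v) ^ 2 := by
  obtain ⟨_, _, _, _, _, _⟩ := h.insts
  rw [expect_swap]
  refine expect_le_of_forall_le fun z => ?_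
  have h1 := expect_sq_rowAvg_sub_le (α := Fin v) (κ := Fin m2) h.card₂
    (fun s : Pair v => ind (a = s.1)) z
  rw [expect_ind_fst h, card_fin] at h1
  refine h1.trans ?_
  have h2 : 𝕍 (fun s : Pair v => ind (a = s.1)) ≤ 1 / v := by
    refine (cvar_self_le _).trans_eq ?_
    simp only [ind_sq, expect_ind_fst h]
  calc 1 / (m2 : ℝ) * 𝕍 (fun s : Pair v => ind (a = s.1)) ≤
      1 / c * (1 / v) * (1 / v) := by
        have := inv_m2_le_mul h
        have := cvar_self_nonneg (fun s : Pair v => ind (a = s.1))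
        have := inv_v_pos h
        have := h.pos
        gcongr
    _ = _ := by ring

omit hw in
lemma expect_sq_snF_sub_le (a : Fin v) :
    𝔼 e : BinaryRules v m2, 𝔼 z, (snF e a z - 1 / v) ^ 2 ≤
      1 / c * (1 / v) ^ 2 := by
  have := expect_sq_fsF_sub_le h a
  rwa [← expect_mirror] at this

lemma expect_weight_mul_le (hC : 1 ≤ C) {A B : Bool → Rules v m2 m3 → ℝ}
    (hB0 : ∀ b Λ, 0 ≤ B b Λ) (hA : ∀ b Λ, A b Λ ≤ (1 / c) ^ 2 * (1 / v) ^ 3)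
    {A₃ B₃ : TernaryRules v m3 → ℝ} {B₂ : BinaryRules v m2 → ℝ} (hA₃ : ∀ Λ, A true Λ = A₃ Λ.2)
    (hB₃ : ∀ Λ, B true Λ = B₃ Λ.2) (hB₂ : ∀ Λ, B false Λ = B₂ Λ.1) (hA₃' : ∀ e, 0 ≤ A₃ e)
    (h1 : 𝔼 e, w e * A₃ e ≤ 38 * C * (1 / c) ^ 2 * (1 / v) ^ 4 * 𝔼 e, w e)
    (h2 : 𝔼 e, B₂ e ≤ 1 / c * (1 / v) ^ 2)
    (h3 : 𝔼 e, w e * B₃ e ≤ 34 * C * (1 / c) ^ 2 * (1 / v) ^ 3 * 𝔼 e, w e)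
    {i : Bool × Bool} (hi : i ≠ (false, false)) :
    𝔼 Λ : Rules v m2 m3, w Λ.2 * (A i.1 Λ * B i.2 Λ) ≤
      38 * C * (1 / c) ^ 4 * (1 / v) ^ 6 * 𝔼 e, w e := by
  have hq := one_le_inv h
  have hq0 := one_div_pos.2 h.pos
  have hx := inv_v_pos h
  have hP := hw.expect_nonneg
  obtain ⟨b, b'⟩ := i
  cases b'
  · cases b
    · exact absurd rfl hi
    · simp only [hA₃, hB₂, mul_comm (A₃ _), mul_left_comm (w _)]
      rw [expect_rules_mul h B₂ fun e => w e * A₃ e]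
      calc _ ≤ 1 / c * (1 / v) ^ 2 * (38 * C * (1 / c) ^ 2 * (1 / v) ^ 4 * 𝔼 e, w e) :=
            mul_le_mul h2 h1 (expect_nonneg fun e => mul_nonneg (hw.nonneg e) (hA₃' e))
              (by positivity)
        _ = 38 * C * (1 / c) ^ 3 * (1 / v) ^ 6 * 𝔼 e, w e := by ring
        _ ≤ _ := by
            gcongr 38 * C * ?_ * _ * _
            exact pow_le_pow_right₀ hq (by norm_num)
  · calc _ ≤ 𝔼 Λ : Rules v m2 m3, (1 / c) ^ 2 * (1 / v) ^ 3 * (w Λ.2 * B₃ Λ.2) := by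
          refine expect_mono fun Λ => ?_
          rw [mul_left_comm, ← hB₃]
          exact mul_le_mul_of_nonneg_right (hA b Λ) (mul_nonneg (hw.nonneg _) (hB0 _ _))
      _ ≤ (1 / c) ^ 2 * (1 / v) ^ 3 * (34 * C * (1 / c) ^ 2 * (1 / v) ^ 3 * 𝔼 e, w e) := by
          rw [expect_const_mul, expect_rules_weight_snd h]
          exact mul_le_mul_of_nonneg_left h3 (by positivity)
      _ = 34 * C * (1 / c) ^ 4 * (1 / v) ^ 6 * 𝔼 e, w e := by ring
      _ ≤ _ := by gcongr; norm_num

lemma expect_weight_endPair_mul_firstTok_le (hC : 1 ≤ C) {i : Bool × Bool} (hi : i ≠ (false, false))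
    (x y a : Fin v) :
    𝔼 Λ : Rules v m2 m3, w Λ.2 * ((𝔼 z, endPair i.1 Λ x y z ^ 2) *
      𝔼 z, (firstTok i.2 Λ a z - 1 / v) ^ 2) ≤
      38 * C * (1 / c) ^ 4 * (1 / v) ^ 6 * 𝔼 e, w e :=
  expect_weight_mul_le h hw hC (A := fun b Λ => 𝔼 z, endPair b Λ x y z ^ 2)
    (B := fun b Λ => 𝔼 z, (firstTok b Λ a z - 1 / v) ^ 2)
    (fun _ _ => expect_nonneg fun _ => sq_nonneg _) (fun b Λ => expect_sq_endPair_le h b Λ x y)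
    (fun _ => rfl) (fun _ => rfl) (fun _ => rfl) (fun _ => expect_nonneg fun _ => sq_nonneg _)
    (expect_weight_sq_endPair_le h hw (by linarith) x y) (expect_sq_fsF_sub_le h a)
    (expect_weight_sq_rowAvg_sub_le h hw (fun _ => ind_nonneg _) (fun _ => ind_le_one _)
      (expect_ind_fst₃ h a) (by linarith)) hi

lemma expect_weight_lastTok_mul_startPair_le (hC : 1 ≤ C) {i : Bool × Bool}
    (hi : i ≠ (false, false)) (x y a : Fin v) :
    𝔼 Λ : Rules v m2 m3, w Λ.2 * ((𝔼 z, (lastTok i.1 Λ a z - 1 / v) ^ 2) *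
      𝔼 z, startPair i.2 Λ x y z ^ 2) ≤
      38 * C * (1 / c) ^ 4 * (1 / v) ^ 6 * 𝔼 e, w e := by
  simp only [mul_comm (𝔼 z, (lastTok i.1 _ a z - 1 / (v : ℝ)) ^ 2)]
  exact expect_weight_mul_le h hw hC (A := fun b Λ => 𝔼 z, startPair b Λ x y z ^ 2)
    (B := fun b Λ => 𝔼 z, (lastTok b Λ a z - 1 / v) ^ 2) (i := i.swap)
    (fun _ _ => expect_nonneg fun _ => sq_nonneg _) (fun b Λ => expect_sq_startPair_le h b Λ x y)
    (fun _ => rfl) (fun _ => rfl) (fun _ => rfl) (fun _ => expect_nonneg fun _ => sq_nonneg _)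
    (expect_weight_sq_startPair_le h hw (by linarith) x y) (expect_sq_snF_sub_le h a)
    (expect_weight_sq_rowAvg_sub_le h hw (fun _ => ind_nonneg _) (fun _ => ind_le_one _)
      (expect_ind_snd₃ h a) (by linarith)) fun h => hi (Prod.swap_injective h)

/-- The noise kernel of two nodes that are not both binary. -/
lemma expect_weight_cvar_noiseK_le (hC : 1 ≤ C) {i : Bool × Bool} (hi : i ≠ (false, false))
    (t : Triple v) :
    𝔼 Λ : Rules v m2 m3, w Λ.2 * 𝕍 (fun x : Pair v => noiseK i Λ t x.1 x.2) ≤ 152 * C * (1 / c) ^ 4 * (1 / v) ^ 6 * 𝔼 e, w e := by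
  have h1 : ∀ Λ : Rules v m2 m3, 𝕍 (fun x : Pair v => noiseK i Λ t x.1 x.2) ≤
      2 * ((𝔼 z, endPair i.1 Λ t.1 t.2.1 z ^ 2) * 𝔼 z, (firstTok i.2 Λ t.2.2 z - 1 / v) ^ 2) +
      2 * ((𝔼 z, (lastTok i.1 Λ t.1 z - 1 / v) ^ 2) * 𝔼 z, startPair i.2 Λ t.2.1 t.2.2 z ^ 2) := by
    intro Λ
    refine (cvar_self_add_le _ _).trans ?_
    have h2 := cvar_self_le (fun x : Pair v => endPair i.1 Λ t.1 t.2.1 x.1 *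
      (firstTok i.2 Λ t.2.2 x.2 - 1 / (v : ℝ)))
    have h3 := cvar_self_le (fun x : Pair v => (lastTok i.1 Λ t.1 x.1 - 1 / (v : ℝ)) *
      startPair i.2 Λ t.2.1 t.2.2 x.2)
    simp only [mul_pow, expect_prod, expect_const_mul, expect_mul_const] at h2 h3
    linarith
  calc _ ≤ 𝔼 Λ : Rules v m2 m3, (2 * (w Λ.2 * ((𝔼 z, endPair i.1 Λ t.1 t.2.1 z ^ 2) *
        𝔼 z, (firstTok i.2 Λ t.2.2 z - 1 / v) ^ 2)) +
      2 * (w Λ.2 * ((𝔼 z, (lastTok i.1 Λ t.1 z - 1 / v) ^ 2) *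
        𝔼 z, startPair i.2 Λ t.2.1 t.2.2 z ^ 2))) := by
        refine expect_mono fun Λ => ?_
        have := mul_le_mul_of_nonneg_left (h1 Λ) (hw.nonneg Λ.2)
        linarith
    _ ≤ _ := by
        rw [expect_add, expect_const_mul, expect_const_mul]
        have h2 := expect_weight_endPair_mul_firstTok_le h hw hC hi t.1 t.2.1 t.2.2
        have h3 := expect_weight_lastTok_mul_startPair_le h hw hC hi t.2.1 t.2.2 t.1
        linarith

/-- Fourth-order collision statistics of single symbols. -/
lemma expect_weight_sq_expect_sq_rowAvg_le {f : Triple v → ℝ} (hf : ∀ s, 0 ≤ f s)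
    (hf' : ∀ s, f s ≤ 1) (hE : 𝔼 s, f s = 1 / (v : ℝ)) (hC : 1 ≤ C) :
    𝔼 e, w e * (𝔼 z, rowAvg e f z ^ 2) ^ 2 ≤
      552 * C * (1 / c) ^ 3 * (1 / v) ^ 4 * 𝔼 e, w e := by
  have := h.nonempty_fin
  have := h.nonempty_m3
  have hq := one_le_inv h
  have hx := inv_v_pos h
  have hx1 := inv_v_le_one h
  have hP := hw.expect_nonneg
  have hD := expect_weight_sq_rowAvg_sub_le h hw hf hf' hE (by linarith)
  have hr := h.ratio₃_le
  set q := 1 / c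
  set x := 1 / (v : ℝ) with hxdef
  have h1 : ∀ e : TernaryRules v m3, (𝔼 z, rowAvg e f z ^ 2) ^ 2 ≤
      16 * q * x * (𝔼 z, (rowAvg e f z - x) ^ 2) + 8 * x ^ 4 := by
    intro e
    set D := 𝔼 z, (rowAvg e f z - x) ^ 2 with hDdef
    have hD0 : 0 ≤ D := expect_nonneg fun _ => sq_nonneg _
    have h2 : 𝔼 z, rowAvg e f z ^ 2 ≤ 2 * D + 2 * x ^ 2 := by
      rw [hDdef, ← expect_const_mul, ← expect_const (ι := Fin v) (2 * x ^ 2),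
        ← expect_add]
      exact expect_mono fun z => by nlinarith [sq_nonneg (rowAvg e f z - 2 * x)]
    have h3 : D ≤ 2 * q * x := by
      have h4 : 𝔼 z, rowAvg e f z ≤ q * x := by
        refine (expect_rowAvg_le e hf).trans ?_
        rw [hE]
        exact mul_le_mul_of_nonneg_right hr hx.le
      have h5 : D ≤ 𝔼 z, (rowAvg e f z + x) := by
        rw [hDdef]
        refine expect_mono fun z => ?_
        have h6 := rowAvg_nonneg e hf z
        have h7 := rowAvg_le_one e hf' z
        nlinarith [mul_nonneg h6 hx.le]
      rw [expect_add, expect_const] at h5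
      have : x ≤ q * x := le_mul_of_one_le_left hx.le hq
      linarith
    have h0 : 0 ≤ 𝔼 z, rowAvg e f z ^ 2 := expect_nonneg fun _ => sq_nonneg _
    calc (𝔼 z, rowAvg e f z ^ 2) ^ 2 ≤ (2 * D + 2 * x ^ 2) ^ 2 := pow_le_pow_left₀ h0 h2 2
      _ ≤ 8 * (D * D) + 8 * x ^ 4 := by nlinarith [sq_nonneg (D - x ^ 2)]
      _ ≤ 8 * (2 * q * x * D) + 8 * x ^ 4 := by gcongr
      _ = _ := by ring
  calc _ ≤ 𝔼 e, (16 * q * x * (w e * 𝔼 z, (rowAvg e f z - x) ^ 2) + 8 * x ^ 4 * w e) := by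
        refine expect_mono fun e => ?_
        have := mul_le_mul_of_nonneg_left (h1 e) (hw.nonneg e)
        linarith
    _ ≤ 16 * q * x * (34 * C * q ^ 2 * x ^ 3 * 𝔼 e, w e) + 8 * x ^ 4 * 𝔼 e, w e := by
        rw [expect_add, expect_const_mul, expect_const_mul]
        gcongr
    _ = 544 * C * q ^ 3 * x ^ 4 * (𝔼 e, w e) + 8 * (1 * 1 ^ 3) * x ^ 4 * 𝔼 e, w e := by ring
    _ ≤ 544 * C * q ^ 3 * x ^ 4 * (𝔼 e, w e) + 8 * (C * q ^ 3) * x ^ 4 * 𝔼 e, w e := by gcongr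
    _ = _ := by ring

omit hw in
lemma expect_sq_expect_sq_fsF_le (a : Fin v) :
    𝔼 e : BinaryRules v m2, (𝔼 z, fsF e a z ^ 2) ^ 2 ≤
      11 * (1 / c) ^ 3 * (1 / v) ^ 4 := by
  obtain ⟨_, _, _, _, _, _⟩ := h.insts
  have hx := inv_v_pos h
  have hq0 := one_div_pos.2 h.pos
  have h1 : ∀ e : BinaryRules v m2, (𝔼 z, fsF e a z ^ 2) ^ 2 ≤
      1 / c * (1 / v) * 𝔼 z, fsF e a z ^ 3 := by
    intro e
    have h3 := sq_expect_mul_le (fun z => Real.sqrt (fsF e a z))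
      (fun z => Real.sqrt (fsF e a z) * fsF e a z)
    have h4 : ∀ z, Real.sqrt (fsF e a z) * (Real.sqrt (fsF e a z) * fsF e a z) =
        fsF e a z ^ 2 := fun z => by
      rw [← mul_assoc, Real.mul_self_sqrt (fsF_nonneg e a z), sq]
    have h5 : ∀ z, fsF e a z * fsF e a z ^ 2 = fsF e a z ^ 3 := fun z => by ring
    simp only [h4, mul_pow, Real.sq_sqrt (fsF_nonneg e a _), h5] at h3
    refine h3.trans (mul_le_mul_of_nonneg_right (expect_fsF_le h e a) ?_)
    exact expect_nonneg fun z => pow_nonneg (fsF_nonneg e a z) 3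
  refine (expect_mono h1).trans ?_
  rw [expect_const_mul, expect_swap]
  calc _ ≤ 1 / c * (1 / v) * (11 / (c ^ 2 * (v : ℝ) ^ 3)) := by
        refine mul_le_mul_of_nonneg_left (expect_le_of_forall_le fun z => ?_) (by positivity)
        have := expect_firstChild_cube_le h false a z
        exact (expect_rules_fst (m3 := m3) fun e : BinaryRules v m2 =>
          fsF e a z ^ 3).symm.trans_le this
    _ = _ := by
        have := h.pos.ne'
        have := h.v_pos.ne'
        field_simp

omit hw in
lemma expect_sq_expect_sq_snF_le (a : Fin v) :
    𝔼 e : BinaryRules v m2, (𝔼 z, snF e a z ^ 2) ^ 2 ≤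
      11 * (1 / c) ^ 3 * (1 / v) ^ 4 := by
  have := expect_sq_expect_sq_fsF_le h a
  rwa [← expect_mirror] at this

lemma expect_weight_sq_expect_sq_firstTok_le (hC : 1 ≤ C) (b : Bool) (a : Fin v) :
    𝔼 Λ : Rules v m2 m3, w Λ.2 * (𝔼 z, firstTok b Λ a z ^ 2) ^ 2 ≤
      552 * C * (1 / c) ^ 3 * (1 / v) ^ 4 * 𝔼 e, w e := by
  have hP := hw.expect_nonneg
  have hx := inv_v_pos h
  have hq0 := one_div_pos.2 h.pos
  cases b
  · simp only [firstTok_false]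
    rw [expect_rules_weight_fst h fun e => (𝔼 z, fsF e a z ^ 2) ^ 2]
    refine mul_le_mul_of_nonneg_right ((expect_sq_expect_sq_fsF_le h a).trans ?_) hP
    gcongr
    linarith
  · simp only [firstTok_true]
    rw [expect_rules_weight_snd h fun e => (𝔼 z, rowAvg e (fun s => ind (a = s.1)) z ^ 2) ^ 2]
    exact expect_weight_sq_expect_sq_rowAvg_le h hw (fun _ => ind_nonneg _)
      (fun _ => ind_le_one _) (expect_ind_fst₃ h a) hC

lemma expect_weight_sq_expect_sq_lastTok_le (hC : 1 ≤ C) (b : Bool) (a : Fin v) :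
    𝔼 Λ : Rules v m2 m3, w Λ.2 * (𝔼 z, lastTok b Λ a z ^ 2) ^ 2 ≤
      552 * C * (1 / c) ^ 3 * (1 / v) ^ 4 * 𝔼 e, w e := by
  have hP := hw.expect_nonneg
  have hx := inv_v_pos h
  have hq0 := one_div_pos.2 h.pos
  cases b
  · simp only [lastTok_false]
    rw [expect_rules_weight_fst h fun e => (𝔼 z, snF e a z ^ 2) ^ 2]
    refine mul_le_mul_of_nonneg_right ((expect_sq_expect_sq_snF_le h a).trans ?_) hP
    gcongr
    linarith
  · simp only [lastTok_true]
    rw [expect_rules_weight_snd h fun e => (𝔼 z, rowAvg e (fun s => ind (a = s.2.2)) z ^ 2) ^ 2]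
    exact expect_weight_sq_expect_sq_rowAvg_le h hw (fun _ => ind_nonneg _)
      (fun _ => ind_le_one _) (expect_ind_snd₃ h a) hC

/-- The kernel of the pairs at the boundary of two nodes. -/
lemma expect_weight_cvar_boundK_le (hC : 1 ≤ C) (i : Bool × Bool) (x y : Fin v) :
    𝔼 Λ : Rules v m2 m3, w Λ.2 * 𝕍 (fun s : Pair v => boundK i Λ x y s.1 s.2) ≤ 552 * C * (1 / c) ^ 3 * (1 / v) ^ 4 * 𝔼 e, w e := by
  have h1 : ∀ Λ : Rules v m2 m3, 𝕍 (fun s : Pair v => boundK i Λ x y s.1 s.2) ≤ 1 / 2 * (𝔼 z, lastTok i.1 Λ x z ^ 2) ^ 2 +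
        1 / 2 * (𝔼 z, firstTok i.2 Λ y z ^ 2) ^ 2 := by
    intro Λ
    refine (cvar_self_le _).trans ?_
    simp only [boundK, mul_pow, expect_prod, expect_const_mul, expect_mul_const]
    nlinarith [sq_nonneg ((𝔼 z, lastTok i.1 Λ x z ^ 2) - 𝔼 z, firstTok i.2 Λ y z ^ 2)]
  calc _ ≤ 𝔼 Λ : Rules v m2 m3, (1 / 2 * (w Λ.2 * (𝔼 z, lastTok i.1 Λ x z ^ 2) ^ 2) +
        1 / 2 * (w Λ.2 * (𝔼 z, firstTok i.2 Λ y z ^ 2) ^ 2)) := by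
        refine expect_mono fun Λ => ?_
        have := mul_le_mul_of_nonneg_left (h1 Λ) (hw.nonneg Λ.2)
        linarith
    _ ≤ _ := by
        rw [expect_add, expect_const_mul, expect_const_mul]
        have h2 := expect_weight_sq_expect_sq_lastTok_le h hw hC i.1 x
        have h3 := expect_weight_sq_expect_sq_firstTok_le h hw hC i.2 y
        linarith

/-- The pairs inside ternary spans. -/
lemma expect_weight_cvar_pairs_le (hC : 0 ≤ C) (x y x' y' : Fin v) :
    𝔼 Λ : Rules v m2 m3, w Λ.2 *
      𝕍 (fun z => startPair true Λ x y z + endPair true Λ x' y' z) ≤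
      152 * C * (1 / c) ^ 2 * (1 / v) ^ 4 * 𝔼 e, w e := by
  calc _ ≤ 𝔼 Λ : Rules v m2 m3, w Λ.2 *
        (2 * (𝔼 z, rowAvg Λ.2 (fun s => ind (s.1 = x ∧ s.2.1 = y)) z ^ 2) +
        2 * (𝔼 z, rowAvg Λ.2 (fun s => ind (s.2.1 = x' ∧ s.2.2 = y')) z ^ 2)) := by
        refine expect_mono fun Λ => mul_le_mul_of_nonneg_left
          ((cvar_self_add_le _ _).trans ?_) (hw.nonneg Λ.2)
        have h1 := cvar_self_le (startPair true Λ x y)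
        have h2 := cvar_self_le (endPair true Λ x' y')
        rw [startPair_true] at h1 ⊢
        rw [endPair_true] at h2 ⊢
        linarith
    _ = 𝔼 e, (2 * (w e * 𝔼 z, rowAvg e (fun s => ind (s.1 = x ∧ s.2.1 = y)) z ^ 2) +
        2 * (w e * 𝔼 z, rowAvg e (fun s => ind (s.2.1 = x' ∧ s.2.2 = y')) z ^ 2)) := by
        rw [expect_rules_weight_snd h fun e =>
          2 * (𝔼 z, rowAvg e (fun s => ind (s.1 = x ∧ s.2.1 = y)) z ^ 2) +
          2 * (𝔼 z, rowAvg e (fun s => ind (s.2.1 = x' ∧ s.2.2 = y')) z ^ 2)]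
        congr 1; funext e; ring
    _ ≤ _ := by
        rw [expect_add, expect_const_mul, expect_const_mul]
        have h2 := expect_weight_sq_startPair_le h hw hC x y
        have h3 := expect_weight_sq_endPair_le h hw hC x' y'
        linarith

omit hw in
lemma cvar_ruleF_le (Λ : Rules v m2 m3) (t : Triple v) :
    𝕍 (ruleF Λ t) ≤ (1 / c) ^ 2 * (1 / v) ^ 5 := by
  have := h.nonempty_fin
  have := h.nonempty_m3
  refine (cvar_self_le _).trans ((expect_sq_rowAvg_le Λ.2 fun _ => ind_nonneg _).trans ?_)
  rw [sum_ind_eq_right, card_fin, card_fin, one_pow, ← one_div_mul_one_div,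
    ← one_div_pow]
  calc 1 / (v : ℝ) * (1 / m3) ^ 2 ≤ 1 / v * (1 / c * (1 / v) ^ 2) ^ 2 :=
        mul_le_mul_of_nonneg_left (pow_le_pow_left₀ (by positivity) (inv_m3_le_mul h) 2)
          (inv_v_pos h).le
    _ = _ := by ring

omit hw in
/-- The noise kernel of two binary nodes is close to its doubly centered part. -/
lemma expect_weight_cvar_noiseK_sub_mainK_le (hw0 : ∀ e, 0 ≤ w e) (t : Triple v) :
    𝔼 Λ : Rules v m2 m3, w Λ.2 * 𝕍 (fun x : Pair v => noiseK (false, false) Λ t x.1 x.2 - mainK Λ.1 t x.1 x.2) ≤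
      16 * (1 / c) ^ 3 * (1 / v) ^ 6 * 𝔼 e, w e := by
  have hq : 0 < 1 / c := one_div_pos.2 h.pos
  have hx := inv_v_pos h
  obtain ⟨a, b, d⟩ := t
  refine (expect_mono fun Λ => mul_le_mul_of_nonneg_left (cvar_noiseK_sub_mainK_le h a b d Λ)
    (hw0 Λ.2)).trans ?_
  rw [expect_rules_weight_fst h fun e => 2 * ((1 / c) ^ 2 * (1 / (v : ℝ)) ^ 3) *
        ((𝔼 z, fsF e d z) - 1 / v) ^ 2 +
      2 * (1 / c * (1 / v) ^ 2) ^ 2 * 𝕍 (snF e a) +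
      (2 * (1 / c * (1 / v) ^ 2) ^ 2 * 𝕍 (fsF e d) +
      2 * ((1 / c) ^ 2 * (1 / v) ^ 3) * ((𝔼 z, snF e a z) - 1 / v) ^ 2)]
  refine mul_le_mul_of_nonneg_right ?_ (RHM.expect_nonneg hw0)
  simp only [expect_add, expect_const_mul]
  calc _ ≤ 2 * ((1 / c) ^ 2 * (1 / (v : ℝ)) ^ 3) * (1 / c * (1 / v) ^ 3) +
      2 * (1 / c * (1 / v) ^ 2) ^ 2 * (3 * (1 / c) * (1 / v) ^ 2) +
      (2 * (1 / c * (1 / v) ^ 2) ^ 2 * (3 * (1 / c) * (1 / v) ^ 2) +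
      2 * ((1 / c) ^ 2 * (1 / v) ^ 3) * (1 / c * (1 / v) ^ 3)) := by
        have h1 := expect_sq_expect_fsF_sub_le h d
        have h2 := expect_sq_expect_snF_sub_le h a
        have h3 := expect_cvar_fsF_le h d
        have h4 := expect_cvar_snF_le h a
        gcongr
    _ = _ := by ring

end Weighted

/-! ### Averages over the whole grammar -/

section Weight

variable {p : ℝ}

lemma abs_adjW_le (hp : 0 ≤ p) (hp' : p ≤ 1) (i : Bool × Bool) {n : ℕ} (hn : 2 ≤ n) :
    |adjW p tripleW i n| ≤ 1 / n := by
  have h0 : (0 : ℝ) < n := by exact_mod_cast (by omega : 0 < n)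
  have h1 := abs_lenE_le hp hp' tripleW (g := fun _ => 1 / (n : ℝ)) (n - 2)
    (arity i.1 + arity i.2) fun e he _ => by
      have := two_le_arity i.1
      have := two_le_arity i.2
      rw [tripleW, abs_of_nonneg (by positivity)]
      exact one_div_le_one_div_of_le h0 (by exact_mod_cast (by omega : n ≤ e - 2))
  rw [lenE_const] at h1
  rw [adjW, abs_mul, abs_mul, abs_of_nonneg (arityProb_nonneg hp hp' _),
    abs_of_nonneg (arityProb_nonneg hp hp' _), ← mul_assoc]
  refine (mul_le_of_le_one_left (abs_nonneg _) ?_).trans h1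
  exact mul_le_one₀ (arityProb_le_one hp hp' _) (arityProb_nonneg hp hp' _)
    (arityProb_le_one hp hp' _)

end Weight

section WeightedForm

variable {v m2 m3 ℓ : ℕ} (w : TernaryRules v m3 → ℝ)

/-- Average of the covariance of two functions of the root that depend on the grammar, with a
weight that depends on the ternary rules of the last level. -/
noncomputable def wq (Φ Ψ : Rules v m2 m3 → Grammar v m2 m3 ℓ → Fin v → ℝ) : ℝ :=
  𝔼 Λ, w Λ.2 * qf (Φ Λ) (Ψ Λ)

/-- The weighted average variance. -/
notation "𝕨" w:max f:max => wq w f f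

variable (Φ Φ' Ψ : Rules v m2 m3 → Grammar v m2 m3 ℓ → Fin v → ℝ)

lemma wq_comm : wq w Φ Ψ = wq w Ψ Φ := by
  simp only [wq, qf, cvar_comm]

lemma wq_add_left : wq w (fun Λ U r => Φ Λ U r + Φ' Λ U r) Ψ = wq w Φ Ψ + wq w Φ' Ψ := by
  simp only [wq, qf, cvar_add_left, expect_add, mul_add]

lemma wq_const_mul_left (a : ℝ) : wq w (fun Λ U r => a * Φ Λ U r) Ψ = a * wq w Φ Ψ := by
  simp only [wq, qf, cvar_const_mul_left, expect_const_mul, mul_left_comm _ a]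

lemma wq_add_right : wq w Ψ (fun Λ U r => Φ Λ U r + Φ' Λ U r) = wq w Ψ Φ + wq w Ψ Φ' := by
  rw [wq_comm, wq_add_left, wq_comm, wq_comm w Φ']

lemma wq_const_mul_right (a : ℝ) : wq w Ψ (fun Λ U r => a * Φ Λ U r) = a * wq w Ψ Φ := by
  rw [wq_comm, wq_const_mul_left, wq_comm]

lemma wq_self_const_mul (a : ℝ) :
    𝕨 w (fun Λ U r => a * Φ Λ U r) = a ^ 2 * 𝕨 w Φ := by
  rw [wq_const_mul_left, wq_const_mul_right]; ring

variable {w} (hw : ∀ e, 0 ≤ w e)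

include hw

lemma wq_self_nonneg : 0 ≤ 𝕨 w Φ :=
  expect_nonneg fun Λ => mul_nonneg (hw Λ.2) (qf_self_nonneg _)

lemma wq_self_add_le : 𝕨 w (fun Λ U r => Φ Λ U r + Φ' Λ U r) ≤
    2 * (𝕨 w Φ + 𝕨 w Φ') := by
  have h := wq_self_nonneg (fun Λ U r => Φ Λ U r + -1 * Φ' Λ U r) hw
  rw [wq_add_left, wq_add_right, wq_add_right, wq_const_mul_left, wq_const_mul_left,
    wq_const_mul_right, wq_const_mul_right, wq_comm w Φ'] at h
  rw [wq_add_left, wq_add_right, wq_add_right, wq_comm w Φ']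
  linarith

lemma wq_self_sum_le {κ : Type*} (s : Finset κ)
    (Φ : κ → Rules v m2 m3 → Grammar v m2 m3 ℓ → Fin v → ℝ) :
    𝕨 w (fun Λ U r => ∑ i ∈ s, Φ i Λ U r) ≤
      s.card * ∑ i ∈ s, 𝕨 w (Φ i) := by
  calc _ ≤ 𝔼 Λ : Rules v m2 m3, w Λ.2 * 𝔼 U : Grammar v m2 m3 ℓ,
        s.card * ∑ i ∈ s, 𝕍 (Φ i Λ U) :=
        expect_mono fun Λ => mul_le_mul_of_nonneg_left
          (expect_mono fun U => cvar_self_sum_le s fun i => Φ i Λ U) (hw Λ.2)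
    _ = _ := by
        simp only [wq, qf, expect_const_mul, expect_sum, mul_sum,
          mul_left_comm (w _) (s.card : ℝ)]

/-- Arithmetic-geometric mean form of the Cauchy-Schwarz inequality. -/
lemma two_mul_abs_wq_le {a : ℝ} (ha : 0 < a) :
    2 * |wq w Φ Ψ| ≤ a * 𝕨 w Φ + 1 / a * 𝕨 w Ψ := by
  have h1 : ∀ s : ℝ, s ^ 2 = 1 → 0 ≤ a * 𝕨 w Φ + 2 * s * wq w Φ Ψ + 1 / a * 𝕨 w Ψ := by
    intro s hs
    have h := wq_self_nonneg (fun Λ U r => a * Φ Λ U r + s * Ψ Λ U r) hw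
    rw [wq_add_left, wq_add_right, wq_add_right, wq_const_mul_left, wq_const_mul_left,
      wq_const_mul_left, wq_const_mul_left, wq_const_mul_right, wq_const_mul_right,
      wq_const_mul_right, wq_const_mul_right, wq_comm w Ψ Φ] at h
    have e : a * 𝕨 w Φ + 2 * s * wq w Φ Ψ + 1 / a * 𝕨 w Ψ = 1 / a *
        (a * (a * 𝕨 w Φ) + a * (s * wq w Φ Ψ) + (s * (a * wq w Φ Ψ) + s ^ 2 * 𝕨 w Ψ)) := by
      rw [hs]; field_simp; ring
    rw [e]
    refine mul_nonneg (by positivity) (h.trans_eq (by ring))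
  have h2 := h1 1 (by norm_num)
  have h3 := h1 (-1) (by norm_num)
  rcases abs_cases (wq w Φ Ψ) with h | h <;> rw [h.1] <;> linarith

end WeightedForm

section Master

variable {p : ℝ} {v m2 m3 ℓ : ℕ} {c C : ℝ} {w : TernaryRules v m3 → ℝ}

/-- The quadratic form of the node sums with weight `1 / n`. -/
noncomputable def theta₀ (p : ℝ) (v m2 m3 ℓ : ℕ) : ℝ :=
  theta p v m2 m3 ℓ (fun n => 1 / (n : ℝ)) (fun n => 1 / (n : ℝ))

/-- A crude comparison constant. -/
noncomputable def crude (c p : ℝ) (ℓ : ℕ) : ℝ := (1800 / (c ^ 2 * p ^ 2)) ^ ℓ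

variable (h : Regime c v m2 m3) (hp : 0 < p) (hp' : p < 1)

include h in
lemma theta₀_nonneg : 0 ≤ theta₀ p v m2 m3 ℓ := theta_self_nonneg h _ _

include h hp hp'

lemma one_le_crude : 1 ≤ crude c p ℓ := by
  have hc := h.pos
  have hc1 := h.le_one
  refine one_le_pow₀ ?_
  rw [le_div_iff₀ (by positivity)]
  have h1 : c ^ 2 ≤ 1 := pow_le_one₀ hc.le hc1
  have h2 : p ^ 2 ≤ 1 := pow_le_one₀ hp.le hp'.le
  nlinarith [mul_le_one₀ h1 (sq_nonneg p) h2]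

lemma pow_le_crude_mul : (200 / (c ^ 2 * v)) ^ ℓ ≤ crude c p ℓ * theta₀ p v m2 m3 ℓ := by
  have hc := h.pos
  have hv := h.v_pos
  have h3 : (0 : ℝ) < 3 ^ ℓ := by positivity
  have h1 := le_theta_self h hp.le hp'.le (a := 1 / 3 ^ ℓ) (by positivity) ℓ (3 ^ ℓ)
    (fun n => 1 / (n : ℝ)) (fun n hn hn' => one_div_le_one_div_of_le
      (by exact_mod_cast hn) (by exact_mod_cast hn')) le_rfl
  calc (200 / (c ^ 2 * v)) ^ ℓ = crude c p ℓ * ((p ^ 2 / v) ^ ℓ * (1 / 3 ^ ℓ) ^ 2) := by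
        rw [crude, ← one_div_pow, ← pow_mul, mul_comm ℓ 2, pow_mul, ← mul_pow (p ^ 2 / (v : ℝ)), ← mul_pow]
        congr 1
        field_simp
        norm_num
    _ ≤ _ := mul_le_mul_of_nonneg_left h1 (zero_le_one.trans (one_le_crude h hp hp'))

lemma theta_le {u : ℕ → ℝ} {A : ℝ} (hu : ∀ n, 2 ^ ℓ ≤ n → |u n| ≤ A * (1 / n)) :
    theta p v m2 m3 ℓ u u ≤ A ^ 2 * theta₀ p v m2 m3 ℓ :=
  theta_self_mono h hp.le hp'.le A ℓ u _ hu

lemma wq_nodeF_le (hw : ∀ e, 0 ≤ w e) {u : ℕ → ℝ} {A : ℝ}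
    (hu : ∀ n, 2 ^ ℓ ≤ n → |u n| ≤ A * (1 / n)) (F : Rules v m2 m3 → Fin v → ℝ) :
    𝕨 w (fun Λ (U : Grammar v m2 m3 ℓ) => nodeF p u (F Λ) U) ≤
      A ^ 2 * theta₀ p v m2 m3 ℓ * 𝔼 Λ : Rules v m2 m3, w Λ.2 * 𝕍 (F Λ) := by
  simp only [wq, qf_nodeF h, mul_left_comm (w _), expect_const_mul]
  exact mul_le_mul_of_nonneg_right (theta_le h hp hp' hu)
    (expect_nonneg fun Λ => mul_nonneg (hw _) (cvar_self_nonneg _))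

lemma wq_adjF_one_le (hw : ∀ e, 0 ≤ w e) {u : ℕ → ℝ} (hu : ∀ n, |u n| ≤ 1)
    (g : Rules v m2 m3 → Fin v → Fin v → ℝ) :
    𝕨 w (fun Λ (U : Grammar v m2 m3 ℓ) => adjF p (fun _ => 1) u (g Λ) U) ≤
      crude c p ℓ * theta₀ p v m2 m3 ℓ * 𝔼 Λ : Rules v m2 m3, w Λ.2 *
        𝕍 (fun x : Pair v => g Λ x.1 x.2) := by
  refine (expect_mono fun Λ => mul_le_mul_of_nonneg_left
    (qf_adjF_one_le h hp.le hp'.le (g Λ) ℓ u hu) (hw Λ.2)).trans ?_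
  simp only [mul_left_comm (w _), expect_const_mul]
  exact mul_le_mul_of_nonneg_right (pow_le_crude_mul h hp hp')
    (expect_nonneg fun Λ => mul_nonneg (hw _) (cvar_self_nonneg _))

/-- The signal with size weight `u`. -/
lemma wq_signal_le (hw : ∀ e, 0 ≤ w e) {u : ℕ → ℝ} {A : ℝ}
    (hu : ∀ n, 2 ^ ℓ ≤ n → |u n| ≤ A * (1 / n)) (t : Triple v) :
    𝕨 w (fun Λ (U : Grammar v m2 m3 ℓ) => nodeF p u (ruleF Λ t) U) ≤
      A ^ 2 * (1 / c) ^ 2 * (theta₀ p v m2 m3 ℓ * (1 / v) ^ 5) * 𝔼 e, w e := by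
  refine (wq_nodeF_le h hp hp' hw hu fun Λ => ruleF Λ t).trans ?_
  have h0 := theta₀_nonneg (p := p) (ℓ := ℓ) h
  calc _ ≤ A ^ 2 * theta₀ p v m2 m3 ℓ *
        𝔼 Λ : Rules v m2 m3, w Λ.2 * ((1 / c) ^ 2 * (1 / v) ^ 5) := by
        refine mul_le_mul_of_nonneg_left (expect_mono fun Λ =>
          mul_le_mul_of_nonneg_left (cvar_ruleF_le h Λ t) (hw _)) (by positivity)
    _ = _ := by
        have := h.nonempty₂
        rw [expect_mul_const, expect_rules_snd w]; ring

/-- The doubly centered part of the noise, restricted to sibling nodes. -/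
noncomputable def mainHat (p : ℝ) (Λ : Rules v m2 m3) (t : Triple v)
    (U : Grammar v m2 m3 ℓ) (r : Fin v) : ℝ :=
  adjF p sibW (adjW p tripleW (false, false)) (mainK Λ.1 t) U r

omit hp hp' in
lemma wq_mainHat_nodeF (hℓ : 1 ≤ ℓ) (t : Triple v) (u : ℕ → ℝ)
    (F : Rules v m2 m3 → Fin v → ℝ) :
    wq w (fun Λ (U : Grammar v m2 m3 ℓ) => mainHat p Λ t U) (fun Λ U => nodeF p u (F Λ) U) = 0 := by
  have := h.nonempty_fin
  obtain ⟨k, rfl⟩ : ∃ k, ℓ = k + 1 := ⟨ℓ - 1, by omega⟩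
  have h1 : ∀ Λ : Rules v m2 m3, qf (fun U : Grammar v m2 m3 (k + 1) => mainHat p Λ t U)
      (fun U => nodeF p u (F Λ) U) = 0 := fun Λ =>
    qf_sibW_nodeF h (mainK Λ.1 t) (expect_mainK_right _ t) (expect_mainK_left _ t) (F Λ) k _ u
  simp only [wq, h1, mul_zero, expect_const_zero]

omit hp hp' in
lemma wq_mainHat_eq (t t' : Triple v) :
    wq w (fun Λ (U : Grammar v m2 m3 (ℓ + 1)) => mainHat p Λ t U) (fun Λ U => mainHat p Λ t' U) =
      thetaSib p v m2 m3 ℓ (adjW p tripleW (false, false)) (adjW p tripleW (false, false)) *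
        ((𝔼 e : BinaryRules v m2, 𝔼 z, 𝔼 z', mainK e t z z' * mainK e t' z z') *
          𝔼 e, w e) := by
  have := h.nonempty_fin
  have h1 : ∀ Λ : Rules v m2 m3, qf (fun U : Grammar v m2 m3 (ℓ + 1) => mainHat p Λ t U)
      (fun U => mainHat p Λ t' U) = thetaSib p v m2 m3 ℓ (adjW p tripleW (false, false))
        (adjW p tripleW (false, false)) * 𝔼 z, 𝔼 z', mainK Λ.1 t z z' * mainK Λ.1 t' z z' :=
    fun Λ => qf_sibW h (mainK Λ.1 t) (mainK Λ.1 t') (expect_mainK_right _ t)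
      (expect_mainK_right _ t') ℓ _ _
  simp only [wq, h1, mul_left_comm (w _), expect_const_mul]
  rw [expect_rules_weight_fst h fun e => 𝔼 z, 𝔼 z', mainK e t z z' * mainK e t' z z']

omit h hp hp' in
lemma two_le_two_pow (hℓ : 1 ≤ ℓ) : 2 ≤ 2 ^ ℓ :=
  (pow_one 2).ge.trans (Nat.pow_le_pow_right (by norm_num) hℓ)

lemma thetaSib_le : thetaSib p v m2 m3 ℓ (adjW p tripleW (false, false))
    (adjW p tripleW (false, false)) ≤ theta₀ p v m2 m3 (ℓ + 1) := by
  refine (thetaSib_self_le h ℓ _).trans ?_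
  have := theta_le (ℓ := ℓ + 1) h hp hp' (u := adjW p tripleW (false, false)) (A := 1)
    fun n hn => by
      rw [one_mul]
      exact abs_adjW_le hp.le hp'.le _ ((two_le_two_pow (by omega)).trans hn)
  rwa [one_pow, one_mul] at this

lemma wq_mainHat_le (hℓ : 1 ≤ ℓ) (hw : ∀ e, 0 ≤ w e) (t : Triple v) :
    𝕨 w (fun Λ (U : Grammar v m2 m3 ℓ) => mainHat p Λ t U) ≤
      12 * (1 / c) ^ 3 * (theta₀ p v m2 m3 ℓ * (1 / v) ^ 5) * 𝔼 e, w e := by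
  obtain ⟨k, rfl⟩ : ∃ k, ℓ = k + 1 := ⟨ℓ - 1, by omega⟩
  rw [wq_mainHat_eq h]
  have h1 := expect_sq_mainK_le h t
  simp only [sq] at h1
  have h2 := thetaSib_le (ℓ := k) h hp hp'
  have h3 := theta₀_nonneg (p := p) (ℓ := k + 1) h
  have h4 := expect_nonneg hw
  have h5 : 0 ≤ 𝔼 e : BinaryRules v m2, 𝔼 z, 𝔼 z', mainK e t z z' * mainK e t z z' :=
    expect_nonneg fun e => expect_nonneg fun z => expect_nonneg fun z' => mul_self_nonneg _
  calc _ ≤ theta₀ p v m2 m3 (k + 1) * (12 * (1 / c) ^ 3 * (1 / v) ^ 5 * 𝔼 e, w e) := by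
        refine mul_le_mul h2 (mul_le_mul_of_nonneg_right ?_ h4) (mul_nonneg h5 h4) h3
        simpa only [sq] using expect_sq_mainK_le h t
    _ = _ := by ring

lemma abs_wq_mainHat_le (hℓ : 1 ≤ ℓ) (hv : 4 ≤ v) (hw : ∀ e, 0 ≤ w e)
    {t t' : Triple v} (ht : t ≠ t') :
    |wq w (fun Λ (U : Grammar v m2 m3 ℓ) => mainHat p Λ t U) (fun Λ U => mainHat p Λ t' U)| ≤
      218 * (1 / c) ^ 4 * (1 / v) * (theta₀ p v m2 m3 ℓ * (1 / v) ^ 5) * 𝔼 e, w e := by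
  obtain ⟨k, rfl⟩ : ∃ k, ℓ = k + 1 := ⟨ℓ - 1, by omega⟩
  rw [wq_mainHat_eq h]
  have h2 := thetaSib_le (ℓ := k) h hp hp'
  have h3 := theta₀_nonneg (p := p) (ℓ := k + 1) h
  have h4 := expect_nonneg hw
  rw [abs_mul, abs_mul, abs_of_nonneg h4, abs_of_nonneg (thetaSib_self_nonneg h k _)]
  calc _ ≤ theta₀ p v m2 m3 (k + 1) * (218 * (1 / c) ^ 4 * (1 / v) ^ 6 * 𝔼 e, w e) := by
        refine mul_le_mul h2 (mul_le_mul_of_nonneg_right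
          (abs_expect_mainK_mul_mainK_le h hv ht) h4) (mul_nonneg (abs_nonneg _) h4) h3
    _ = _ := by ring

/-- The doubly centered part of the noise, at nodes that are not siblings. -/
lemma wq_farW_mainK_le (hw0 : ∀ e, 0 ≤ w e) (t : Triple v) :
    𝕨 w (fun Λ (U : Grammar v m2 m3 ℓ) => adjF p farW (adjW p tripleW (false, false))
      (mainK Λ.1 t) U) ≤
      crude c p ℓ * theta₀ p v m2 m3 ℓ * (1 / v * (12 * (1 / c) ^ 3 * (1 / v) ^ 5)) *
        𝔼 e, w e := by
  have := h.nonempty_fin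
  have hcr := one_le_crude (ℓ := ℓ) h hp hp'
  have hθ := theta₀_nonneg (p := p) (ℓ := ℓ) h
  have hx := inv_v_pos h
  have h1 : ∀ Λ : Rules v m2 m3, 𝕢 (fun U : Grammar v m2 m3 ℓ =>
      adjF p farW (adjW p tripleW (false, false)) (mainK Λ.1 t) U) ≤
      crude c p ℓ * theta₀ p v m2 m3 ℓ * (1 / v * 𝔼 z, 𝔼 z', mainK Λ.1 t z z' ^ 2) := by
    intro Λ
    refine (qf_adjF_farW_le h hp.le hp'.le (mainK Λ.1 t) (expect_mainK_right _ t)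
      (expect_mainK_left _ t) ℓ _
      (abs_adjW_le_one hp.le hp'.le abs_tripleW_le_one _)).trans ?_
    refine mul_le_mul_of_nonneg_right (pow_le_crude_mul h hp hp') (mul_nonneg hx.le ?_)
    exact expect_nonneg fun z => expect_nonneg fun z' => sq_nonneg _
  refine (expect_mono fun Λ => mul_le_mul_of_nonneg_left (h1 Λ) (hw0 Λ.2)).trans ?_
  rw [expect_rules_weight_fst h fun e => crude c p ℓ * theta₀ p v m2 m3 ℓ *
    (1 / v * 𝔼 z, 𝔼 z', mainK e t z z' ^ 2), expect_const_mul, expect_const_mul]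
  refine mul_le_mul_of_nonneg_right (mul_le_mul_of_nonneg_left (mul_le_mul_of_nonneg_left
    (expect_sq_mainK_le h t) hx.le) (by positivity)) (expect_nonneg hw0)

/-- The remainder of the noise. -/
lemma wq_noiseHat_sub_le (hw : Transfers C w) (hC : 1 ≤ C) (t : Triple v) :
    𝕨 w (fun Λ (U : Grammar v m2 m3 ℓ) r => noiseHat p Λ t U r - mainHat p Λ t U r) ≤
      3800 * C * (1 / c) ^ 4 * crude c p ℓ * (1 / v) * (theta₀ p v m2 m3 ℓ * (1 / v) ^ 5) *
        𝔼 e, w e := by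
  have := h.nonempty_fin
  have hw0 := hw.nonneg
  have hP := hw.expect_nonneg
  have hθ := theta₀_nonneg (p := p) (ℓ := ℓ) h
  have hcr := one_le_crude (ℓ := ℓ) h hp hp'
  have hq := one_le_inv h
  have hx := inv_v_pos h
  set K : Bool × Bool → Rules v m2 m3 → Fin v → Fin v → ℝ := fun i Λ z z' =>
    noiseK i Λ t z z' - if i = (false, false) then mainK Λ.1 t z z' else 0 with hK
  have e1 : (fun Λ (U : Grammar v m2 m3 ℓ) r => noiseHat p Λ t U r - mainHat p Λ t U r) =
      fun Λ U r => (∑ i, adjF p (fun _ => 1) (adjW p tripleW i) (K i Λ) U r) +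
        adjF p farW (adjW p tripleW (false, false)) (mainK Λ.1 t) U r := by
    funext Λ U r
    have e2 : ∀ i, adjF p (fun _ => 1) (adjW p tripleW i) (noiseK i Λ t) U r =
        adjF p (fun _ => 1) (adjW p tripleW i) (K i Λ) U r + if i = (false, false) then
          adjF p (fun _ => 1) (adjW p tripleW (false, false)) (mainK Λ.1 t) U r else 0 := by
      intro i
      split_ifs with hi
      · subst hi
        rw [← adjF_add]
        congr 1; funext z z'
        simp [hK]
      · rw [add_zero]
        congr 1; funext z z'
        simp [hK, hi]
    simp only [noiseHat, e2, sum_add_distrib, Finset.sum_ite_eq', Finset.mem_univ, if_true]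
    rw [adjF_one, mainHat]; ring
  rw [e1]
  refine (wq_self_add_le _ _ hw0).trans ?_
  have h1 : ∀ i, 𝕨 w (fun Λ (U : Grammar v m2 m3 ℓ) => adjF p (fun _ => 1) (adjW p tripleW i)
      (K i Λ) U) ≤
      crude c p ℓ * theta₀ p v m2 m3 ℓ * ((if i = (false, false) then 16 else 152) * C *
        (1 / c) ^ 4 * (1 / v) ^ 6 * 𝔼 e, w e) := by
    intro i
    refine (wq_adjF_one_le h hp hp' hw0 (abs_adjW_le_one hp.le hp'.le abs_tripleW_le_one i)
      (K i)).trans (mul_le_mul_of_nonneg_left ?_ (by positivity))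
    split_ifs with hi
    · subst hi
      simp only [hK, if_true]
      refine (expect_weight_cvar_noiseK_sub_mainK_le h hw0 t).trans ?_
      calc 16 * (1 / c) ^ 3 * (1 / (v : ℝ)) ^ 6 * 𝔼 e, w e =
          16 * 1 * (1 / c) ^ 3 * (1 / (v : ℝ)) ^ 6 * 𝔼 e, w e := by ring
        _ ≤ 16 * C * (1 / c) ^ 4 * (1 / v) ^ 6 * 𝔼 e, w e := by
          gcongr 16 * ?_ * ?_ * _ * _
          exact pow_le_pow_right₀ hq (by norm_num)
    · simp only [hK, hi, if_false, sub_zero]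
      exact expect_weight_cvar_noiseK_le h hw hC hi t
  have h2 : 𝕨 w (fun Λ (U : Grammar v m2 m3 ℓ) r => ∑ i, adjF p (fun _ => 1) (adjW p tripleW i)
      (K i Λ) U r) ≤
      4 * (crude c p ℓ * theta₀ p v m2 m3 ℓ * (472 * C *
        (1 / c) ^ 4 * (1 / v) ^ 6 * 𝔼 e, w e)) := by
    refine (wq_self_sum_le hw0 Finset.univ fun i Λ U =>
      adjF p (fun _ => 1) (adjW p tripleW i) (K i Λ) U).trans ?_
    have h3 := sum_le_sum fun i (_ : i ∈ Finset.univ) => h1 i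
    have e3 : ((Finset.univ : Finset (Bool × Bool)).card : ℝ) = 4 := by
      simp [card_prod]
    rw [e3]
    refine (mul_le_mul_of_nonneg_left h3 (by norm_num)).trans_eq ?_
    rw [sum_prod_type]
    simp only [sum_bool, Prod.mk.injEq, Bool.true_eq_false, and_false, false_and, if_false,
      and_self, if_true]
    ring
  have h3 := wq_farW_mainK_le (ℓ := ℓ) h hp hp' hw0 t
  refine (mul_le_mul_of_nonneg_left (add_le_add h2 h3) zero_le_two).trans ?_
  generalize 𝔼 e, w e = P at hP ⊢
  generalize crude c p ℓ = k at hcr ⊢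
  generalize theta₀ p v m2 m3 ℓ = θ at hθ ⊢
  generalize 1 / (v : ℝ) = x at hx ⊢
  generalize 1 / c = q at hq ⊢
  have h4 : q ^ 3 ≤ C * q ^ 4 := (pow_le_pow_right₀ hq (by norm_num : 3 ≤ 4)).trans
    (le_mul_of_one_le_left (by positivity) hC)
  have h5 : 0 ≤ k * x ^ 6 * θ * P := by positivity
  nlinarith [mul_le_mul_of_nonneg_left h4 h5]

/-- Boundary pairs, with any size weight. -/
lemma wq_boundK_le (hw : Transfers C w) (hC : 1 ≤ C) {u : Bool × Bool → ℕ → ℝ}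
    (hu : ∀ i n, |u i n| ≤ 1) (x y : Fin v) :
    𝕨 w (fun Λ (U : Grammar v m2 m3 ℓ) r => ∑ i, adjF p (fun _ => 1) (u i) (boundK i Λ x y) U r) ≤
      8832 * C * (1 / c) ^ 3 * crude c p ℓ * theta₀ p v m2 m3 ℓ * (1 / v) ^ 4 * 𝔼 e, w e := by
  have hw0 := hw.nonneg
  have hθ := theta₀_nonneg (p := p) (ℓ := ℓ) h
  have hcr := one_le_crude (ℓ := ℓ) h hp hp'
  have h1 : ∀ i, 𝕨 w (fun Λ (U : Grammar v m2 m3 ℓ) => adjF p (fun _ => 1) (u i)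
      (boundK i Λ x y) U) ≤
      crude c p ℓ * theta₀ p v m2 m3 ℓ * (552 * C * (1 / c) ^ 3 * (1 / v) ^ 4 * 𝔼 e, w e) :=
    fun i => (wq_adjF_one_le h hp hp' hw0 (hu i) fun Λ => boundK i Λ x y).trans
      (mul_le_mul_of_nonneg_left (expect_weight_cvar_boundK_le h hw hC i x y) (by positivity))
  refine (wq_self_sum_le hw0 Finset.univ fun i Λ U =>
      adjF p (fun _ => 1) (u i) (boundK i Λ x y) U).trans ?_
  have h3 := sum_le_sum fun i (_ : i ∈ Finset.univ) => h1 i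
  have e3 : ((Finset.univ : Finset (Bool × Bool)).card : ℝ) = 4 := by
    simp [card_prod]
  rw [e3]
  refine (mul_le_mul_of_nonneg_left h3 (by norm_num)).trans_eq ?_
  rw [Finset.sum_const, nsmul_eq_mul, e3]
  ring

/-- The error of the decomposition at the position of the triple. -/
lemma wq_errHat_le (hℓ : 1 ≤ ℓ) (hw : Transfers C w) (hC : 1 ≤ C) (t : Triple v) :
    𝕨 w (fun Λ (U : Grammar v m2 m3 ℓ) => errHat p Λ t U) ≤
      80000 * C * (1 / c) ^ 3 * crude c p ℓ * (1 / v) * (theta₀ p v m2 m3 ℓ * (1 / v) ^ 5) *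
        𝔼 e, w e := by
  have hw0 := hw.nonneg
  have hP := hw.expect_nonneg
  have hθ := theta₀_nonneg (p := p) (ℓ := ℓ) h
  have hcr := one_le_crude (ℓ := ℓ) h hp hp'
  have hq := one_le_inv h
  have hx := inv_v_pos h
  have e1 : (fun Λ (U : Grammar v m2 m3 ℓ) => errHat p Λ t U) = fun Λ U r => -(1 / (v : ℝ)) *
      (nodeF p (nodeW p tripleW true) (fun z => startPair true Λ t.1 t.2.1 z +
        endPair true Λ t.2.1 t.2.2 z) U r +
      ((∑ i, adjF p (fun _ => 1) (adjW p tripleW i) (boundK i Λ t.1 t.2.1) U r) +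
        ∑ i, adjF p (fun _ => 1) (adjW p tripleW i) (boundK i Λ t.2.1 t.2.2) U r)) := by
    funext Λ U r
    rw [errHat]
    simp only [adjF_add, sum_add_distrib]
  have h2 := two_le_two_pow hℓ
  have hN := wq_nodeF_le (ℓ := ℓ) h hp hp' hw0 (u := nodeW p tripleW true) (A := 1) (fun n hn => by
      rw [one_mul]; exact abs_nodeW_tripleW_le hp.le hp'.le true (h2.trans hn))
    fun Λ z => startPair true Λ t.1 t.2.1 z + endPair true Λ t.2.1 t.2.2 z
  have hN' := mul_le_mul_of_nonneg_left
    (expect_weight_cvar_pairs_le h hw (zero_le_one.trans hC) t.1 t.2.1 t.2.1 t.2.2) hθ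
  rw [one_pow, one_mul] at hN
  have hB := fun x y => wq_boundK_le (ℓ := ℓ) h hp hp' hw hC
    (abs_adjW_le_one hp.le hp'.le abs_tripleW_le_one) x y
  rw [e1, wq_self_const_mul]
  calc _ ≤ (-(1 / (v : ℝ))) ^ 2 * (2 * (theta₀ p v m2 m3 ℓ *
          (152 * C * (1 / c) ^ 2 * (1 / v) ^ 4 * 𝔼 e, w e) +
        2 * (8832 * C * (1 / c) ^ 3 * crude c p ℓ * theta₀ p v m2 m3 ℓ * (1 / v) ^ 4 * (𝔼 e, w e) +
        8832 * C * (1 / c) ^ 3 * crude c p ℓ * theta₀ p v m2 m3 ℓ * (1 / v) ^ 4 * 𝔼 e, w e))) := by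
        refine mul_le_mul_of_nonneg_left ((wq_self_add_le _ _ hw0).trans ?_) (sq_nonneg _)
        refine mul_le_mul_of_nonneg_left (add_le_add (hN.trans hN') ?_) zero_le_two
        refine (wq_self_add_le _ _ hw0).trans ?_
        exact mul_le_mul_of_nonneg_left (add_le_add (hB _ _) (hB _ _)) zero_le_two
    _ ≤ _ := by
        generalize 𝔼 e, w e = P at hP ⊢
        generalize crude c p ℓ = k at hcr ⊢
        generalize theta₀ p v m2 m3 ℓ = θ at hθ ⊢
        generalize 1 / (v : ℝ) = x at hx ⊢
        generalize 1 / c = q at hq ⊢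
        have h4 : q ^ 2 ≤ q ^ 3 * k := by
          nlinarith [pow_le_pow_right₀ hq (by norm_num : 2 ≤ 3), pow_pos (zero_lt_one.trans_le hq) 3]
        have h5 : 0 ≤ C * x ^ 6 * θ * P := by positivity
        have h6 : 0 ≤ C * x ^ 6 * θ * P * (q ^ 3 * k) := by positivity
        nlinarith [mul_le_mul_of_nonneg_left h4 h5]

end Master

/-! ### Pair covariances at their own positions -/

section Positions

variable {p : ℝ} {v m2 m3 ℓ : ℕ}

/-- Change of the root-conditional frequency of a pair with the length weight. -/
noncomputable def weightHat (p : ℝ) (Λ : Rules v m2 m3) (x y : Fin v) (U : Grammar v m2 m3 ℓ)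
    (r : Fin v) : ℝ := pairHat p tripleW Λ x y U r - pairHat p pairW Λ x y U r

/-- Contribution of the ends of the sentence. -/
noncomputable def endsHat (p : ℝ) (Λ : Rules v m2 m3) (t : Triple v)
    (U : Grammar v m2 m3 ℓ) (r : Fin v) : ℝ :=
  (∑ b, lastF p (nodeW p tripleW b) (endPair b Λ t.1 t.2.1) U r) +
    ∑ b, firstF p (nodeW p tripleW b) (startPair b Λ t.2.1 t.2.2) U r

/-- Root-conditional average of the error of the decomposition when every covariance is taken at
its own position. -/
noncomputable def errHatFree (p : ℝ) (Λ : Rules v m2 m3) (t : Triple v)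
    (U : Grammar v m2 m3 ℓ) (r : Fin v) : ℝ :=
  (errHat p Λ t U r +
      nodeF p (fun n => nodeW p tripleW true n - signalW p m2 m3 ℓ n) (ruleF Λ t) U r) +
    1 / (v : ℝ) * ((weightHat p Λ t.1 t.2.1 U r + weightHat p Λ t.2.1 t.2.2 U r) +
      -1 * endsHat p Λ t U r)

lemma sub_whitened_eq [NeZero v] [Nonempty (Fin m2)] [Nonempty (Fin m3)]
    (G : Grammar v m2 m3 (ℓ + 1)) (t : Triple v) (α : Fin v) :
    C3 p G t.1 t.2.1 t.2.2 α - (signal p G t α +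
      1 / (v : ℝ) * (C2 p G t.1 t.2.1 α + C2 p G t.2.1 t.2.2 α) + noise p G t α) =
      rootVec (errHatFree p (G (Fin.last ℓ)) t (Fin.init G)) α := by
  have h1 := sub_whitenedCond_eq p G t α
  rw [signalCond_eq, C2left_eq, C2right_eq] at h1
  rw [signal_eq, C2_eq, C2_eq]
  change _ = rootVec (fun r => errHatFree p (G (Fin.last ℓ)) t (Fin.init G) r) α
  simp only [errHatFree, endsHat, weightHat, nodeF_sub_weight, rootVec_add, rootVec_sub,
    rootVec_const_mul] at h1 ⊢
  linarith

variable {c C : ℝ} {w : TernaryRules v m3 → ℝ}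
  (h : Regime c v m2 m3) (hp : 0 < p) (hp' : p < 1)

include h

lemma cvar_pairOcc_le (b : Bool) (Λ : Rules v m2 m3) (x y : Fin v) :
    𝕍 (pairOcc b Λ x y) ≤ 4 * ((1 / c) ^ 2 * (1 / v) ^ 3) := by
  have h1 := fun b => expect_sq_endPair_le h b Λ x y
  have h2 := fun b => expect_sq_startPair_le h b Λ x y
  have h3 := fun b => cvar_self_le (endPair b Λ x y)
  have h4 := fun b => cvar_self_le (startPair b Λ x y)
  have := inv_v_pos h
  have h0 : 0 ≤ (1 / c) ^ 2 * (1 / (v : ℝ)) ^ 3 := by positivity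
  cases b
  · exact (h3 false).trans ((h1 false).trans (by linarith))
  · refine (cvar_self_add_le (startPair true Λ x y) (endPair true Λ x y)).trans ?_
    linarith [h1 true, h2 true, h3 true, h4 true]

include hp hp'

lemma wq_ends_le (hw : ∀ e, 0 ≤ w e) {Q : (ℕ → ℝ) → (Fin v → ℝ) → Grammar v m2 m3 ℓ → Fin v → ℝ}
    (hQ : ∀ u F, 𝕢 (Q u F) ≤ (1 / 2) ^ ℓ * theta p v m2 m3 ℓ u u * 𝕍 F)
    (hℓ : 1 ≤ ℓ) {F : Bool → Rules v m2 m3 → Fin v → ℝ}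
    (hF : ∀ b Λ, 𝔼 z, F b Λ z ^ 2 ≤ (1 / c) ^ 2 * (1 / v) ^ 3) :
    𝕨 w (fun Λ U r => ∑ b, Q (nodeW p tripleW b) (F b Λ) U r) ≤
      4 * (1 / 2) ^ ℓ * (1 / c) ^ 2 * (theta₀ p v m2 m3 ℓ * (1 / v) ^ 3) * 𝔼 e, w e := by
  have h2 := two_le_two_pow hℓ
  have hθ := theta₀_nonneg (p := p) (ℓ := ℓ) h
  have := h.nonempty₂
  have h1 : ∀ b, 𝕨 w (fun Λ => Q (nodeW p tripleW b) (F b Λ)) ≤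
      (1 / 2) ^ ℓ * theta₀ p v m2 m3 ℓ * ((1 / c) ^ 2 * (1 / v) ^ 3) * 𝔼 e, w e := by
    intro b
    rw [mul_comm _ (𝔼 e, w e), ← expect_rules_snd (m2 := m2) w, ← expect_mul_const]
    refine expect_mono fun Λ => mul_le_mul_of_nonneg_left ((hQ _ _).trans ?_) (hw _)
    have h3 := theta_le (ℓ := ℓ) h hp hp' (u := nodeW p tripleW b) (A := 1) fun n hn => by
      rw [one_mul]; exact abs_nodeW_tripleW_le hp.le hp'.le b (h2.trans hn)
    rw [one_pow, one_mul] at h3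
    gcongr
    · exact cvar_self_nonneg _
    · exact (cvar_self_le _).trans (hF b Λ)
  refine (wq_self_sum_le hw Finset.univ fun b Λ => Q (nodeW p tripleW b) (F b Λ)).trans ?_
  have h3 := sum_le_sum fun b (_ : b ∈ Finset.univ) => h1 b
  rw [Finset.card_univ, Fintype.card_bool]
  push_cast
  refine (mul_le_mul_of_nonneg_left h3 zero_le_two).trans_eq ?_
  rw [Finset.sum_const, Finset.card_univ, Fintype.card_bool, nsmul_eq_mul]
  push_cast; ring

lemma wq_endsHat_le (hw : ∀ e, 0 ≤ w e) (hℓ : 1 ≤ ℓ) (t : Triple v) :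
    𝕨 w (fun Λ (U : Grammar v m2 m3 ℓ) => endsHat p Λ t U) ≤
      16 * (1 / 2) ^ ℓ * (1 / c) ^ 2 * (theta₀ p v m2 m3 ℓ * (1 / v) ^ 3) * 𝔼 e, w e := by
  refine (wq_self_add_le (fun Λ (U : Grammar v m2 m3 ℓ) r =>
    ∑ b, lastF p (nodeW p tripleW b) (endPair b Λ t.1 t.2.1) U r) _ hw).trans ?_
  have h1 := wq_ends_le h hp hp' hw (Q := fun u F (U : Grammar v m2 m3 ℓ) => lastF p u F U)
    (qf_lastF_le h ℓ) hℓ fun b Λ => expect_sq_endPair_le h b Λ t.1 t.2.1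
  have h2 := wq_ends_le h hp hp' hw (Q := fun u F (U : Grammar v m2 m3 ℓ) => firstF p u F U)
    (qf_firstF_le h ℓ) hℓ fun b Λ => expect_sq_startPair_le h b Λ t.2.1 t.2.2
  linarith

lemma wq_weightHat_le (hℓ : 1 ≤ ℓ) (hw : Transfers C w) (hC : 1 ≤ C) (x y : Fin v) :
    𝕨 w (fun Λ (U : Grammar v m2 m3 ℓ) => weightHat p Λ x y U) ≤
      (32 * (1 / 2) ^ ℓ * (1 / c) ^ 2 + 70656 * C * (1 / c) ^ 3 * crude c p ℓ * (1 / v)) *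
        (theta₀ p v m2 m3 ℓ * (1 / v) ^ 3) * 𝔼 e, w e := by
  have hw0 := hw.nonneg
  have hP := hw.expect_nonneg
  have hx := inv_v_pos h
  have h2 := two_le_two_pow hℓ
  have hθ := theta₀_nonneg (p := p) (ℓ := ℓ) h
  have := h.nonempty₂
  have e1 : (fun Λ (U : Grammar v m2 m3 ℓ) => weightHat p Λ x y U) = fun Λ U r =>
      (∑ b, nodeF p (fun n => nodeW p tripleW b n - nodeW p pairW b n) (pairOcc b Λ x y) U r) +
      ((∑ i, adjF p (fun _ => 1) (adjW p tripleW i) (boundK i Λ x y) U r) +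
        -1 * ∑ i, adjF p (fun _ => 1) (adjW p pairW i) (boundK i Λ x y) U r) := by
    funext Λ U r
    simp only [weightHat, pairHat, nodeF_sub_weight, sum_sub_distrib]
    ring
  have h1 : ∀ b, 𝕨 w (fun Λ (U : Grammar v m2 m3 ℓ) =>
      nodeF p (fun n => nodeW p tripleW b n - nodeW p pairW b n) (pairOcc b Λ x y) U) ≤
      (1 / 2) ^ ℓ * theta₀ p v m2 m3 ℓ * ((𝔼 e, w e) * (4 * ((1 / c) ^ 2 * (1 / v) ^ 3))) := by
    intro b
    refine (wq_nodeF_le (ℓ := ℓ) h hp hp' hw0 (A := (1 / 2) ^ ℓ) (fun n hn => ?_)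
      fun Λ => pairOcc b Λ x y).trans ?_
    · refine (abs_nodeW_sub_le hp.le hp'.le b h2 hn).trans_eq ?_
      rw [one_div_pow]; push_cast; rfl
    · rw [← expect_rules_snd (m2 := m2) w, ← expect_mul_const]
      have h3 : ((1 / 2 : ℝ) ^ ℓ) ^ 2 ≤ (1 / 2) ^ ℓ := by
        rw [sq]
        exact mul_le_of_le_one_left (by positivity) (pow_le_one₀ (by norm_num) (by norm_num))
      refine mul_le_mul (mul_le_mul_of_nonneg_right h3 hθ) (expect_mono fun Λ =>
        mul_le_mul_of_nonneg_left (cvar_pairOcc_le h b Λ x y) (hw0 _))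
        (expect_nonneg fun Λ => mul_nonneg (hw0 _) (cvar_self_nonneg _)) (by positivity)
  rw [e1]
  refine (wq_self_add_le _ _ hw0).trans ?_
  have h3 := wq_self_sum_le hw0 Finset.univ fun b Λ (U : Grammar v m2 m3 ℓ) =>
    nodeF p (fun n => nodeW p tripleW b n - nodeW p pairW b n) (pairOcc b Λ x y) U
  rw [Finset.card_univ, Fintype.card_bool, sum_bool] at h3
  push_cast at h3
  have h4 := wq_self_add_le (fun Λ (U : Grammar v m2 m3 ℓ) r =>
    ∑ i, adjF p (fun _ => 1) (adjW p tripleW i) (boundK i Λ x y) U r)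
    (fun Λ U r => -1 * ∑ i, adjF p (fun _ => 1) (adjW p pairW i) (boundK i Λ x y) U r) hw0
  rw [wq_self_const_mul] at h4
  have h5 := wq_boundK_le (ℓ := ℓ) h hp hp' hw hC
    (abs_adjW_le_one hp.le hp'.le abs_tripleW_le_one) x y
  have h6 := wq_boundK_le (ℓ := ℓ) h hp hp' hw hC
    (abs_adjW_le_one hp.le hp'.le abs_pairW_le_one) x y
  linarith [h1 true, h1 false]

lemma wq_errHatFree_le (hℓ : 1 ≤ ℓ) (hw : Transfers C w) (hC : 1 ≤ C)
    (t : Triple v) :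
    𝕨 w (fun Λ (U : Grammar v m2 m3 ℓ) => errHatFree p Λ t U) ≤
      (592 * (1 / 2) ^ ℓ * (1 / c) ^ 2 + 1450496 * C * (1 / c) ^ 3 * crude c p ℓ * (1 / v)) *
        (theta₀ p v m2 m3 ℓ * (1 / v) ^ 5) * 𝔼 e, w e := by
  have hw0 := hw.nonneg
  have hs2 : (2 / Real.sqrt 2 ^ ℓ) ^ 2 = 4 * (1 / 2) ^ ℓ := by
    rw [div_pow, ← pow_mul, mul_comm, pow_mul, Real.sq_sqrt (by norm_num), one_div_pow]
    ring
  have h1 := wq_errHat_le (ℓ := ℓ) h hp hp' hℓ hw hC t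
  have h2 := wq_signal_le (ℓ := ℓ) h hp hp' hw0 (u := fun n => nodeW p tripleW true n -
    signalW p m2 m3 ℓ n) (A := 2 / Real.sqrt 2 ^ ℓ) (fun n hn => by
      have := h.nonempty_m2
      have := h.nonempty_m3
      exact abs_nodeW_sub_signalW_le hp.le hp'.le hℓ hn) t
  rw [hs2] at h2
  have h3 := fun x y => wq_weightHat_le (ℓ := ℓ) h hp hp' hℓ hw hC x y
  have h4 := wq_endsHat_le (ℓ := ℓ) h hp hp' hw0 hℓ t
  refine (wq_self_add_le (fun Λ (U : Grammar v m2 m3 ℓ) r => errHat p Λ t U r +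
    nodeF p (fun n => nodeW p tripleW true n - signalW p m2 m3 ℓ n) (ruleF Λ t) U r) _ hw0).trans ?_
  have h5 := wq_self_add_le (fun Λ (U : Grammar v m2 m3 ℓ) r => errHat p Λ t U r)
    (fun Λ U r => nodeF p (fun n => nodeW p tripleW true n - signalW p m2 m3 ℓ n)
      (ruleF Λ t) U r) hw0
  have h6 := wq_self_add_le (fun Λ (U : Grammar v m2 m3 ℓ) r =>
    weightHat p Λ t.1 t.2.1 U r + weightHat p Λ t.2.1 t.2.2 U r)
    (fun Λ U r => -1 * endsHat p Λ t U r) hw0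
  have h7 := wq_self_add_le (fun Λ (U : Grammar v m2 m3 ℓ) r => weightHat p Λ t.1 t.2.1 U r)
    (fun Λ U r => weightHat p Λ t.2.1 t.2.2 U r) hw0
  rw [wq_self_const_mul w (fun Λ (U : Grammar v m2 m3 ℓ) r => endsHat p Λ t U r)] at h6
  have h8 : 𝕨 w (fun Λ (U : Grammar v m2 m3 ℓ) r =>
      (weightHat p Λ t.1 t.2.1 U r + weightHat p Λ t.2.1 t.2.2 U r) + -1 * endsHat p Λ t U r) ≤ (288 * (1 / 2) ^ ℓ * (1 / c) ^ 2 +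
        565248 * C * (1 / c) ^ 3 * crude c p ℓ * (1 / v)) *
        (theta₀ p v m2 m3 ℓ * (1 / v) ^ 3) * 𝔼 e, w e := by
    linarith [h3 t.1 t.2.1, h3 t.2.1 t.2.2]
  rw [wq_self_const_mul]
  have h9 := mul_le_mul_of_nonneg_left h8 (sq_nonneg (1 / (v : ℝ)))
  linarith

end Positions

/-! ### Averages over grammars of inner products -/

section Average

variable {v m2 m3 ℓ : ℕ}

lemma expect_grammar_last (f : Rules v m2 m3 → Grammar v m2 m3 ℓ → ℝ) :
    𝔼 G : Grammar v m2 m3 (ℓ + 1), f (G (Fin.last ℓ)) (Fin.init G) = 𝔼 Λ, 𝔼 U, f Λ U := by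
  rw [← expect_equiv (Fin.snocEquiv fun _ : Fin (ℓ + 1) => Rules v m2 m3), expect_prod]
  refine expect_congr rfl fun Λ _ => expect_congr rfl fun U _ => ?_
  simp [Fin.snocEquiv]

variable [NeZero v] (w : TernaryRules v m3 → ℝ)
  (Φ Ψ : Rules v m2 m3 → Grammar v m2 m3 ℓ → Fin v → ℝ)

lemma expect_mul_rootVec_dotProduct :
    𝔼 G : Grammar v m2 m3 (ℓ + 1), w (G (Fin.last ℓ)).2 *
      (rootVec (Φ (G (Fin.last ℓ)) (Fin.init G)) ⬝ᵥ rootVec (Ψ (G (Fin.last ℓ)) (Fin.init G))) =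
      1 / (v : ℝ) * wq w Φ Ψ := by
  rw [expect_grammar_last fun Λ U => w Λ.2 * (rootVec (Φ Λ U) ⬝ᵥ rootVec (Ψ Λ U)), wq]
  simp only [rootVec_dotProduct, expect_const_mul, qf, mul_left_comm (w _)]

end Average

/-! ### Permutations of the root symbol -/

section Root

variable {v m2 m3 ℓ : ℕ}

/-- Permutation of the symbols of level `0`. -/
def reroot (π : Equiv.Perm (Fin v)) (U : Grammar v m2 m3 (ℓ + 1)) : Grammar v m2 m3 (ℓ + 1) :=
  Fin.cons ((π.prodCongr (Equiv.refl _)).toEmbedding.trans (U 0).1,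
    (π.prodCongr (Equiv.refl _)).toEmbedding.trans (U 0).2) (Fin.tail U)

lemma expect_reroot (π : Equiv.Perm (Fin v)) (f : Grammar v m2 m3 (ℓ + 1) → ℝ) :
    𝔼 U, f (reroot π U) = 𝔼 U, f U := by
  rw [expect_grammar_succ, expect_grammar_succ f]
  refine expect_congr rfl fun U _ => ?_
  simp only [reroot, Fin.cons_zero, Fin.tail_cons, expect_rules]
  rw [expect_reindex (π.prodCongr (Equiv.refl (Fin m2))) fun e : BinaryRules v m2 =>
    𝔼 e₃ : TernaryRules v m3, f (Fin.cons (e,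
      (π.prodCongr (Equiv.refl _)).toEmbedding.trans e₃) U)]
  refine expect_congr rfl fun e _ => ?_
  exact expect_reindex (π.prodCongr (Equiv.refl (Fin m3)))
    fun e₃ : TernaryRules v m3 => f (Fin.cons (e, e₃) U)

variable (π : Equiv.Perm (Fin v)) (U : Grammar v m2 m3 (ℓ + 1)) (r : Fin v) (p : ℝ)

lemma nodeF_reroot (u : ℕ → ℝ) (F : Fin v → ℝ) :
    nodeF p u F (reroot π U) r = nodeF p u F U (π r) := by
  have h : ∀ τ, nodes (reroot π U) r τ = nodes U (π r) τ := by rintro (⟨k, s, t⟩ | ⟨k, s, t, u⟩) <;> rfl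
  simp only [nodeF, h]

lemma firstF_reroot (u : ℕ → ℝ) (F : Fin v → ℝ) :
    firstF p u F (reroot π U) r = firstF p u F U (π r) := by
  have h : ∀ τ, firstNode (reroot π U) r τ = firstNode U (π r) τ := by
    rintro (⟨k, s, t⟩ | ⟨k, s, t, u⟩) <;> rfl
  simp only [firstF, h]

lemma lastF_reroot (u : ℕ → ℝ) (F : Fin v → ℝ) :
    lastF p u F (reroot π U) r = lastF p u F U (π r) := by
  have h : ∀ τ, lastNode (reroot π U) r τ = lastNode U (π r) τ := by
    rintro (⟨k, s, t⟩ | ⟨k, s, t, u⟩) <;> rfl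
  simp only [lastF, h]

lemma adjF_reroot (a u : ℕ → ℝ) (g : Fin v → Fin v → ℝ) :
    adjF p a u g (reroot π U) r = adjF p a u g U (π r) := by
  have h : ∀ τ, adjSum a g (reroot π U) r τ = adjSum a g U (π r) τ := by
    rintro (⟨k, s, t⟩ | ⟨k, s, t, u⟩) <;> rfl
  simp only [adjF, h]

lemma noiseHat_reroot (Λ : Rules v m2 m3) (t : Triple v) :
    noiseHat p Λ t (reroot π U) r = noiseHat p Λ t U (π r) := by
  simp only [noiseHat, adjF_reroot]

lemma errHat_reroot (Λ : Rules v m2 m3) (t : Triple v) :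
    errHat p Λ t (reroot π U) r = errHat p Λ t U (π r) := by
  simp only [errHat, nodeF_reroot, adjF_reroot]

lemma errHatFree_reroot (Λ : Rules v m2 m3) (t : Triple v) :
    errHatFree p Λ t (reroot π U) r = errHatFree p Λ t U (π r) := by
  simp only [errHatFree, errHat_reroot, weightHat, pairHat, endsHat, nodeF_reroot, adjF_reroot,
    firstF_reroot, lastF_reroot]

lemma rootVec_reroot {Φ : Grammar v m2 m3 (ℓ + 1) → Fin v → ℝ}
    (hΦ : ∀ π U r, Φ (reroot π U) r = Φ U (π r)) (α : Fin v) :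
    rootVec (Φ (reroot π U)) α = rootVec (Φ U) (π α) := by
  simp only [rootVec, hΦ, expect_equiv π]

/-- The entries of an average vector are equal. -/
lemma expect_rootVec_eq [NeZero v] {Φ : Grammar v m2 m3 (ℓ + 1) → Fin v → ℝ}
    (hΦ : ∀ π U r, Φ (reroot π U) r = Φ U (π r)) (g : ℝ → ℝ) (α : Fin v) :
    𝔼 U, g (rootVec (Φ U) α) = 1 / (v : ℝ) * 𝔼 U, ∑ β, g (rootVec (Φ U) β) := by
  have h1 : ∀ β, 𝔼 U, g (rootVec (Φ U) β) = 𝔼 U, g (rootVec (Φ U) α) := by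
    intro β
    rw [← expect_reroot (Equiv.swap α β) fun U => g (rootVec (Φ U) α)]
    simp only [rootVec_reroot _ _ hΦ, Equiv.swap_apply_left]
  have hv : (v : ℝ) ≠ 0 := NeZero.ne _
  rw [expect_sum]
  simp only [h1, Finset.sum_const, Finset.card_univ, card_fin, nsmul_eq_mul]
  field_simp

lemma expect_rootVec_eq_zero [NeZero v] {Φ : Grammar v m2 m3 (ℓ + 1) → Fin v → ℝ}
    (hΦ : ∀ π U r, Φ (reroot π U) r = Φ U (π r)) (α : Fin v) : 𝔼 U, rootVec (Φ U) α = 0 := by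
  rw [expect_rootVec_eq hΦ fun x => x]
  simp only [sum_rootVec, expect_const_zero, mul_zero]

lemma expect_rootVec_sq [NeZero v] {Φ : Grammar v m2 m3 (ℓ + 1) → Fin v → ℝ}
    (hΦ : ∀ π U r, Φ (reroot π U) r = Φ U (π r)) (α : Fin v) :
    𝔼 U, rootVec (Φ U) α ^ 2 = (1 / (v : ℝ)) ^ 2 * 𝕢 Φ := by
  rw [expect_rootVec_eq hΦ fun x => x ^ 2]
  have h1 : ∀ U, ∑ β, rootVec (Φ U) β ^ 2 = 1 / (v : ℝ) * 𝕍 (Φ U) := by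
    intro U
    rw [← rootVec_dotProduct, dotProduct]
    exact sum_congr rfl fun β _ => sq _
  simp only [h1, expect_const_mul, qf]
  ring

lemma expect_grammar_rootVec_sq [NeZero v]
    {Φ : Rules v m2 m3 → Grammar v m2 m3 (ℓ + 1) → Fin v → ℝ}
    (hΦ : ∀ Λ π U r, Φ Λ (reroot π U) r = Φ Λ U (π r)) (α : Fin v) :
    𝔼 G : Grammar v m2 m3 (ℓ + 2), rootVec (Φ (G (Fin.last _)) (Fin.init G)) α ^ 2 =
      (1 / (v : ℝ)) ^ 2 * 𝕨 (fun _ => 1) Φ := by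
  rw [expect_grammar_last fun Λ U => rootVec (Φ Λ U) α ^ 2, wq, ← expect_const_mul]
  simp only [expect_rootVec_sq (hΦ _), one_mul]

end Root

/-! ### The signal -/

section Signal

variable {p : ℝ} {v m2 m3 ℓ : ℕ} {c : ℝ} (h : Regime c v m2 m3) (hp : 0 < p) (hp' : p < 1)

lemma ruleF_eq (Λ : Rules v m2 m3) {o : Option (Fin v)} {t : Triple v}
    (ho : HasParent Λ.2 o t) (y : Fin v) : ruleF Λ t y = 1 / (m3 : ℝ) * ind (o = some y) := by
  rw [ruleF, rowAvg, expect_eq, card_fin, ← ind_hasParent_some]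
  congr 1
  refine ind_congr ?_
  rcases o with _ | z
  · exact ⟨fun ⟨k, hk⟩ => (ho y k hk).elim, fun h => by simp at h⟩
  · obtain ⟨k, hk⟩ := ho
    refine ⟨fun ⟨k', hk'⟩ => ?_, fun h => ?_⟩
    · have h1 := Λ.2.injective (hk.trans hk'.symm)
      rw [(Prod.mk.inj h1).1]
    · obtain rfl := Option.some.inj h
      exact ⟨k, hk⟩

include h

lemma cvar_parent_le (o : Option (Fin v)) :
    𝕍 (fun y => 1 / (m3 : ℝ) * ind (o = some y)) ≤
      (1 / c) ^ 2 * (1 / v) ^ 5 := by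
  have := h.nonempty_fin
  have hx := inv_v_pos h
  have h1 : 𝔼 y : Fin v, ind (o = some y) ≤ 1 / v := by
    rcases o with _ | z
    · simp only [reduceCtorEq, ind_false not_false, expect_const_zero]; exact hx.le
    · simp only [Option.some.injEq, ind_eq_comm z, expect_ind_eq', card_fin, le_refl]
  rw [cvar_const_mul_left, cvar_const_mul_right]
  have h2 := (cvar_self_le fun y : Fin v => ind (o = some y)).trans
    (by simpa only [ind_sq] using h1)
  calc _ ≤ 1 / c * (1 / (v : ℝ)) ^ 2 * (1 / c * (1 / v) ^ 2 * (1 / v)) := by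
        have h3 := inv_m3_le_mul h
        have h4 : 0 ≤ 1 / (m3 : ℝ) := by positivity
        have := cvar_self_nonneg fun y : Fin v => ind (o = some y)
        have h5 := h4.trans h3
        gcongr
    _ = _ := by ring

lemma abs_cvar_parent_le {o o' : Option (Fin v)} (ho : o ≠ o') :
    |cvar (fun y => 1 / (m3 : ℝ) * ind (o = some y))
      (fun y => 1 / (m3 : ℝ) * ind (o' = some y))| ≤ (1 / c) ^ 2 * (1 / v) ^ 6 := by
  have := h.nonempty_fin
  have hx := inv_v_pos h
  have h0 : ∀ o : Option (Fin v), |𝔼 y : Fin v, ind (o = some y)| ≤ 1 / v := by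
    intro o
    rw [abs_of_nonneg (expect_nonneg fun _ => ind_nonneg _)]
    rcases o with _ | z
    · simp only [reduceCtorEq, ind_false not_false, expect_const_zero]; exact hx.le
    · simp only [Option.some.injEq, ind_eq_comm z, expect_ind_eq', card_fin, le_refl]
  have h1 : ∀ y : Fin v, ind (o = some y) * ind (o' = some y) = 0 := fun y => by
    rw [← ind_and]
    exact ind_false fun hh => ho (hh.1.trans hh.2.symm)
  rw [cvar_const_mul_left, cvar_const_mul_right, cvar]
  simp only [h1, expect_const_zero, zero_sub, abs_mul, abs_neg]
  have h4 : 0 ≤ 1 / (m3 : ℝ) := by positivity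
  rw [abs_of_nonneg h4]
  calc _ ≤ 1 / c * (1 / (v : ℝ)) ^ 2 * (1 / c * (1 / v) ^ 2 * (1 / v * (1 / v))) := by
        have h3 := inv_m3_le_mul h
        have h5 := h4.trans h3
        gcongr
        exacts [h0 o, h0 o']
    _ = _ := by ring

include hp hp'

lemma theta₀_le_theta_signalW : ((1 - p) / 3) ^ 2 * theta₀ p v m2 m3 ℓ ≤
    theta p v m2 m3 ℓ (signalW p m2 m3 ℓ) (signalW p m2 m3 ℓ) := by
  have := h.nonempty_m2
  have := h.nonempty_m3
  have h1 : 0 < (1 - p) / 3 := by linarith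
  have h2 := theta_self_mono h hp.le hp'.le (3 / (1 - p)) ℓ (fun n => 1 / (n : ℝ))
    (signalW p m2 m3 ℓ) fun n hn => by
      have h3 := le_terProb (m2 := m2) (m3 := m3) (ℓ := ℓ) hp.le hp'.le
      rw [abs_of_nonneg (by positivity), signalW, ← mul_assoc]
      refine le_mul_of_one_le_left (by positivity) ?_
      calc 1 = 3 / (1 - p) * ((1 - p) / 3) := by
            have : 1 - p ≠ 0 := by linarith
            field_simp
        _ ≤ _ := mul_le_mul_of_nonneg_left h3 (div_nonneg (by norm_num) (by linarith))
  rw [theta₀]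
  refine (mul_le_mul_of_nonneg_left h2 (sq_nonneg _)).trans_eq ?_
  have : 1 - p ≠ 0 := by linarith
  field_simp

lemma theta₀_le_scale : theta₀ p v m2 m3 ℓ * (1 / v) ^ 6 ≤ 18 / (1 - p) ^ 2 * scale p v m2 m3 ℓ := by
  obtain ⟨_, _, _, _, _, _⟩ := h.insts
  have hx := inv_v_pos h
  have h2 : 1 / (v : ℝ) ≤ 1 / 2 := one_div_le_one_div_of_le (by norm_num) h.two_le_real
  have e1 : scale p v m2 m3 ℓ = (1 / v) ^ 2 * (1 / m3) ^ 2 * (1 - 1 / v) *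
      theta p v m2 m3 ℓ (signalW p m2 m3 ℓ) (signalW p m2 m3 ℓ) := by
    have e2 : ∀ z : Fin v, 𝔼 G : Grammar v m2 m3 (ℓ + 1), center p G z ⬝ᵥ center p G z =
        1 / v * (theta p v m2 m3 ℓ (signalW p m2 m3 ℓ) (signalW p m2 m3 ℓ) *
          (1 / m3 * (1 / m3 * (1 / v - 1 / v * (1 / v))))) := by
      intro z
      have e3 := expect_mul_rootVec_dotProduct (m2 := m2) (m3 := m3) (ℓ := ℓ) (fun _ => 1)
        (fun _ U => nodeF p (signalW p m2 m3 ℓ) (fun y => 1 / (m3 : ℝ) * ind (y = z)) U)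
        fun _ U => nodeF p (signalW p m2 m3 ℓ) (fun y => 1 / (m3 : ℝ) * ind (y = z)) U
      have e4 : ∀ G : Grammar v m2 m3 (ℓ + 1), center p G z = rootVec (nodeF p (signalW p m2 m3 ℓ)
        (fun y => 1 / (m3 : ℝ) * ind (y = z)) (Fin.init G)) := fun G => funext (center_eq p G z)
      simp only [one_mul, ← e4] at e3
      have e5 : 𝕍 (fun y => 1 / (m3 : ℝ) * ind (y = z)) =
          1 / m3 * (1 / m3 * (1 / v - 1 / v * (1 / v))) := by
        rw [cvar_const_mul_left, cvar_const_mul_right, cvar_self_eq]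
        simp only [ind_sq, expect_ind_eq', card_fin]
        ring
      rw [e3, wq]
      simp only [qf_nodeF h, expect_const, one_mul, e5]
    rw [scale, expect_const_mul, expect_sum]
    simp only [e2, Finset.sum_const, Finset.card_univ, card_fin, nsmul_eq_mul]
    have : (v : ℝ) ≠ 0 := h.v_pos.ne'
    have : (m3 : ℝ) ≠ 0 := h.m3_pos_real.ne'
    field_simp
  have h3 : (1 / (v : ℝ)) ^ 2 ≤ 1 / m3 := by
    rw [one_div_pow]
    exact one_div_le_one_div_of_le h.m3_pos_real h.m3_le_sq
  have h4 := theta₀_le_theta_signalW (ℓ := ℓ) h hp hp'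
  have hθ := theta₀_nonneg (p := p) (ℓ := ℓ) h
  have h5 : 0 < (1 - p) ^ 2 := pow_pos (by linarith) 2
  calc theta₀ p v m2 m3 ℓ * (1 / v) ^ 6 = 18 / (1 - p) ^ 2 *
        ((1 / v) ^ 2 * ((1 / (v : ℝ)) ^ 2) ^ 2 * (1 - 1 / 2) *
          (((1 - p) / 3) ^ 2 * theta₀ p v m2 m3 ℓ)) := by
        have : 1 - p ≠ 0 := by linarith
        field_simp; ring
    _ ≤ _ := by
        rw [e1]
        have h6 : 0 ≤ 1 - 1 / (v : ℝ) := by linarith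
        gcongr

end Signal

/-! ### Whitening -/

section Abstract

variable {v m2 m3 ℓ : ℕ} {w : TernaryRules v m3 → ℝ} (hw : ∀ e, 0 ≤ w e)
  {N M ρ δ : ℝ} (hδ : 0 < δ) (hN : 0 ≤ N)

include hw hδ hN

lemma abs_wq_le_of {Φ Ψ : Rules v m2 m3 → Grammar v m2 m3 ℓ → Fin v → ℝ} (hM : 0 < M)
    (hρ : M * ρ ≤ δ ^ 2) (hΦ : 𝕨 w Φ ≤ M * N) (hΨ : 𝕨 w Ψ ≤ ρ * N) :
    |wq w Φ Ψ| ≤ δ * N := by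
  have h1 := two_mul_abs_wq_le Φ Ψ hw (div_pos hδ hM)
  have h2 : δ / M * 𝕨 w Φ ≤ δ * N :=
    (mul_le_mul_of_nonneg_left hΦ (div_pos hδ hM).le).trans_eq (by field_simp)
  have h3 : 1 / (δ / M) * 𝕨 w Ψ ≤ δ * N := by
    refine (mul_le_mul_of_nonneg_left hΨ (by positivity)).trans ?_
    calc 1 / (δ / M) * (ρ * N) = M * ρ * (N / δ) := by field_simp
      _ ≤ δ ^ 2 * (N / δ) := mul_le_mul_of_nonneg_right hρ (by positivity)
      _ = δ * N := by field_simp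
  linarith

/-- Inner products of sums of a signal, a decorrelated noise and a small remainder. -/
lemma abs_wq_sub_le {S S' A A' R R' : Rules v m2 m3 → Grammar v m2 m3 ℓ → Fin v → ℝ} (hM : 0 < M)
    (hρ : M * ρ ≤ δ ^ 2) (hρ' : ρ ≤ δ) (hS : 𝕨 w S ≤ M * N) (hS' : 𝕨 w S' ≤ M * N)
    (hA : 𝕨 w A ≤ M * N) (hA' : 𝕨 w A' ≤ M * N) (hR : 𝕨 w R ≤ ρ * N)
    (hR' : 𝕨 w R' ≤ ρ * N) (hSA : wq w S A' = 0) (hAS : wq w A S' = 0)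
    (hAA : |wq w A A'| ≤ δ * N) :
    |wq w (fun Λ U r => S Λ U r + (A Λ U r + R Λ U r))
      (fun Λ U r => S' Λ U r + (A' Λ U r + R' Λ U r)) - wq w S S'| ≤ 6 * δ * N := by
  have h1 := abs_wq_le_of hw hδ hN hM hρ hS hR'
  have h2 := abs_wq_le_of hw hδ hN hM hρ hA hR'
  have h3 := abs_wq_le_of hw hδ hN hM hρ hS' hR
  have h4 := abs_wq_le_of hw hδ hN hM hρ hA' hR
  have h5 : |wq w R R'| ≤ δ * N := abs_wq_le_of hw hδ hN hδ
    (by rw [sq]; exact mul_le_mul_of_nonneg_left hρ' hδ.le)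
    (hR.trans (mul_le_mul_of_nonneg_right hρ' hN)) hR'
  have e : wq w (fun Λ U r => S Λ U r + (A Λ U r + R Λ U r))
      (fun Λ U r => S' Λ U r + (A' Λ U r + R' Λ U r)) - wq w S S' =
      wq w A A' + wq w S R' + wq w A R' + wq w S' R + wq w A' R + wq w R R' := by
    simp only [wq_add_left, wq_add_right]
    rw [hSA, hAS, wq_comm w S' R, wq_comm w A' R]
    ring
  rw [abs_le] at h1 h2 h3 h4 h5 hAA
  rw [e, abs_le]
  constructor <;> linarith [h1.1, h1.2, h2.1, h2.2, h3.1, h3.2, h4.1, h4.2, h5.1, h5.2, hAA.1, hAA.2]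

end Abstract

section Whitening

variable {p : ℝ} {v m2 m3 ℓ : ℕ} {c C δ : ℝ} {w : TernaryRules v m3 → ℝ}

lemma expect_grammar_weight [Nonempty (Rules v m2 m3)]
    [Nonempty (BinaryRules v m2)] (w : TernaryRules v m3 → ℝ) :
    𝔼 G : Grammar v m2 m3 (ℓ + 1), w (G (Fin.last ℓ)).2 = 𝔼 e, w e := by
  rw [expect_grammar_last fun (Λ : Rules v m2 m3) (_ : Grammar v m2 m3 ℓ) => w Λ.2]
  simp only [expect_const, expect_rules_snd w]

/-- Bound of the remainder terms, relative to `1 / v`. -/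
noncomputable def errC (c p : ℝ) (ℓ : ℕ) : ℝ := 6000000 * (1 / c) ^ 6 * crude c p ℓ

variable (h : Regime c v m2 m3) (hp : 0 < p) (hp' : p < 1)

include h hp hp'

lemma wq_noise_remainder_le (hw : Transfers C w) (hC : 1 ≤ C) (hC' : C ≤ 2 * (1 / c) ^ 2)
    (t : Triple v) :
    𝕨 w (fun Λ (U : Grammar v m2 m3 ℓ) r => noiseHat p Λ t U r - mainHat p Λ t U r) ≤
      errC c p ℓ * (1 / v) * (theta₀ p v m2 m3 ℓ * (1 / v) ^ 5 * 𝔼 e, w e) := by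
  have h1 := wq_noiseHat_sub_le (ℓ := ℓ) h hp hp' hw hC t
  have hP := hw.expect_nonneg
  have hθ := theta₀_nonneg (p := p) (ℓ := ℓ) h
  have hcr := one_le_crude (ℓ := ℓ) h hp hp'
  have hq := one_le_inv h
  have hx := inv_v_pos h
  rw [errC]
  generalize 𝔼 e, w e = P at h1 hP ⊢
  generalize crude c p ℓ = k at h1 hcr ⊢
  generalize theta₀ p v m2 m3 ℓ = θ at h1 hθ ⊢
  generalize 1 / (v : ℝ) = x at h1 hx ⊢
  generalize 1 / c = q at h1 hq hC' ⊢
  have h2 : 0 ≤ q ^ 4 * k * x ^ 6 * θ * P := by positivity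
  have h3 : 0 ≤ q ^ 6 * k * x ^ 6 * θ * P := by positivity
  linarith [mul_le_mul_of_nonneg_right hC' h2]

lemma wq_remainder_le_of (hw : Transfers C w) (hC : 1 ≤ C) (hC' : C ≤ 2 * (1 / c) ^ 2)
    (t : Triple v) {R : Rules v m2 m3 → Grammar v m2 m3 ℓ → Fin v → ℝ} {a : ℝ}
    (hR : 𝕨 w R ≤ (a + 1450496 * C * (1 / c) ^ 3 * crude c p ℓ * (1 / v)) *
      (theta₀ p v m2 m3 ℓ * (1 / v) ^ 5) * 𝔼 e, w e) :
    𝕨 w (fun Λ (U : Grammar v m2 m3 ℓ) r =>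
        (noiseHat p Λ t U r - mainHat p Λ t U r) + R Λ U r) ≤
      (2 * a + errC c p ℓ * (1 / v)) * (theta₀ p v m2 m3 ℓ * (1 / v) ^ 5 * 𝔼 e, w e) := by
  refine (wq_self_add_le (fun Λ (U : Grammar v m2 m3 ℓ) r =>
    noiseHat p Λ t U r - mainHat p Λ t U r) _ hw.nonneg).trans ?_
  have h1 := wq_noiseHat_sub_le (ℓ := ℓ) h hp hp' hw hC t
  have hP := hw.expect_nonneg
  have hθ := theta₀_nonneg (p := p) (ℓ := ℓ) h
  have hcr := one_le_crude (ℓ := ℓ) h hp hp'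
  have hq := one_le_inv h
  have hx := inv_v_pos h
  rw [errC]
  generalize 𝔼 e, w e = P at h1 hR hP ⊢
  generalize crude c p ℓ = k at h1 hR hcr ⊢
  generalize theta₀ p v m2 m3 ℓ = θ at h1 hR hθ ⊢
  generalize 1 / (v : ℝ) = x at h1 hR hx ⊢
  generalize 1 / c = q at h1 hR hq hC' ⊢
  have h2 : 0 ≤ k * x ^ 6 * θ * P := by positivity
  have h3 : 0 ≤ q ^ 6 * k * x ^ 6 * θ * P := by positivity
  have h4 : C * q ^ 4 ≤ 2 * q ^ 6 := by nlinarith [pow_pos (zero_lt_one.trans_le hq) 4]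
  have h5 : C * q ^ 3 ≤ C * q ^ 4 :=
    mul_le_mul_of_nonneg_left (pow_le_pow_right₀ hq (by norm_num)) (by linarith)
  linarith [mul_le_mul_of_nonneg_right h4 h2, mul_le_mul_of_nonneg_right (h5.trans h4) h2]

lemma wq_errHat_le_add (hℓ : 1 ≤ ℓ) (hw : Transfers C w) (hC : 1 ≤ C) (t : Triple v) :
    𝕨 w (fun Λ (U : Grammar v m2 m3 ℓ) => errHat p Λ t U) ≤
      (0 + 1450496 * C * (1 / c) ^ 3 * crude c p ℓ * (1 / v)) *
      (theta₀ p v m2 m3 ℓ * (1 / v) ^ 5) * 𝔼 e, w e := by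
  have hP := hw.expect_nonneg
  have hθ := theta₀_nonneg (p := p) (ℓ := ℓ) h
  have hcr := one_le_crude (ℓ := ℓ) h hp hp'
  have hq := one_le_inv h
  have hx := inv_v_pos h
  rw [zero_add]
  refine (wq_errHat_le h hp hp' hℓ hw hC t).trans ?_
  gcongr
  norm_num

lemma scale_nonneg : 0 ≤ scale p v m2 m3 ℓ := by
  have h1 := theta₀_le_scale (ℓ := ℓ) h hp hp'
  have hθ := theta₀_nonneg (p := p) (ℓ := ℓ) h
  have h2 : 0 < (1 - p) ^ 2 := pow_pos (by linarith) 2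
  have hx := inv_v_pos h
  exact nonneg_of_mul_nonneg_right ((by positivity : (0 : ℝ) ≤ _).trans h1) (by positivity)

lemma mul_theta₀_le_scale {X P : ℝ} (hX : 0 ≤ X) (hP : 0 ≤ P) :
    1 / (v : ℝ) * (X * (theta₀ p v m2 m3 ℓ * (1 / v) ^ 5 * P)) ≤
      X * (18 / (1 - p) ^ 2) * scale p v m2 m3 ℓ * P := by
  have h1 := mul_le_mul_of_nonneg_right (theta₀_le_scale (ℓ := ℓ) h hp hp') (mul_nonneg hX hP)
  linarith

lemma errC_pos : 0 < errC c p ℓ := by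
  have := h.pos
  have := one_le_crude (ℓ := ℓ) h hp hp'
  rw [errC]; positivity

lemma pow_mul_le_of_errC_le {A : ℝ} (hA : errC c p ℓ * (1 / v) ≤ A) :
    218 * (1 / c) ^ 4 * (1 / v) ≤ A ∧ (1 / c) ^ 2 * (1 / v) ≤ A := by
  have hq := one_le_inv h
  have hx := inv_v_pos h
  have hcr := one_le_crude (ℓ := ℓ) h hp hp'
  have h1 := pow_le_pow_right₀ hq (by norm_num : 4 ≤ 6)
  have h2 := pow_le_pow_right₀ hq (by norm_num : 2 ≤ 6)
  have h4 := one_le_pow₀ hq (n := 6)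
  have h3 : (1 / c) ^ 6 ≤ (1 / c) ^ 6 * crude c p ℓ := le_mul_of_one_le_right (by linarith) hcr
  rw [errC] at hA
  constructor
  · exact (mul_le_mul_of_nonneg_right (by linarith) hx.le).trans hA
  · exact (mul_le_mul_of_nonneg_right (by linarith) hx.le).trans hA

/-- Clustering, for a sum of the signal, the doubly centered noise and a small remainder. -/
lemma clusters_of (hℓ : 1 ≤ ℓ) (hv : 4 ≤ v) (hcv : 2 ≤ c * v) {u : ℕ → ℝ}
    (hu : ∀ n, 2 ^ ℓ ≤ n → |u n| ≤ 1 / n) {ρ : ℝ}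
    {R : Rules v m2 m3 → Triple v → Grammar v m2 m3 ℓ → Fin v → ℝ}
    (hR : ∀ w, Transfers (2 / c ^ 2) w → ∀ t, 𝕨 w (fun Λ => R Λ t) ≤
      ρ * (theta₀ p v m2 m3 ℓ * (1 / v) ^ 5 * 𝔼 e, w e))
    (hδ : 0 < δ) (hρ : 12 * (1 / c) ^ 3 * ρ ≤ δ ^ 2) (hρ' : ρ ≤ δ)
    (hx4 : 218 * (1 / c) ^ 4 * (1 / v) ≤ δ) (hx2 : (1 / c) ^ 2 * (1 / v) ≤ δ)
    {s W : Grammar v m2 m3 (ℓ + 1) → Triple v → Fin v → ℝ}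
    (hs : ∀ G t, s G t = rootVec (nodeF p u (ruleF (G (Fin.last ℓ)) t) (Fin.init G)))
    (hW : ∀ G t, W G t = rootVec fun r => nodeF p u (ruleF (G (Fin.last ℓ)) t) (Fin.init G) r +
      (mainHat p (G (Fin.last ℓ)) t (Fin.init G) r + R (G (Fin.last ℓ)) t (Fin.init G) r)) :
    Clusters (7 * δ * (18 / (1 - p) ^ 2) * scale p v m2 m3 ℓ) s W := by
  intro t t' ht o o'
  obtain ⟨_, _, _, _, _, _⟩ := h.insts
  have hq := one_le_inv h
  have hx := inv_v_pos h
  have hθ := theta₀_nonneg (p := p) (ℓ := ℓ) h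
  have hw := transfers_parents h hcv ht o o'
  set w : TernaryRules v m3 → ℝ :=
    fun e => ind (HasParent e o t ∧ HasParent e o' t') with hwdef
  have hP := hw.expect_nonneg
  set N : ℝ := theta₀ p v m2 m3 ℓ * (1 / v) ^ 5 * 𝔼 e, w e with hNdef
  have hN : 0 ≤ N := by positivity
  have hM : 0 < 12 * (1 / c) ^ 3 := by positivity
  have hS : ∀ t, 𝕨 w (fun Λ (U : Grammar v m2 m3 ℓ) => nodeF p u (ruleF Λ t) U) ≤ 12 * (1 / c) ^ 3 * N := by
    intro t
    refine (wq_signal_le (ℓ := ℓ) h hp hp' hw.nonneg (A := 1) (fun n hn => by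
      rw [one_mul]; exact hu n hn) t).trans ?_
    have h1 := pow_le_pow_right₀ hq (by norm_num : 2 ≤ 3)
    have h2 : (1 / c) ^ 2 ≤ 12 * (1 / c) ^ 3 := by linarith [pow_nonneg (zero_le_one.trans hq) 3]
    rw [one_pow, one_mul, mul_assoc]
    exact mul_le_mul_of_nonneg_right h2 hN
  have hA : ∀ t, 𝕨 w (fun Λ (U : Grammar v m2 m3 ℓ) => mainHat p Λ t U) ≤ 12 * (1 / c) ^ 3 * N := fun t =>
    (wq_mainHat_le (ℓ := ℓ) h hp hp' hℓ hw.nonneg t).trans_eq (by rw [hNdef]; ring)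
  have hAA : |wq w (fun Λ (U : Grammar v m2 m3 ℓ) => mainHat p Λ t U)
      (fun Λ U => mainHat p Λ t' U)| ≤ δ * N :=
    (abs_wq_mainHat_le (ℓ := ℓ) h hp hp' hℓ hv hw.nonneg ht).trans
      (by rw [mul_assoc]; exact mul_le_mul_of_nonneg_right hx4 hN)
  have key := abs_wq_sub_le hw.nonneg hδ hN hM hρ hρ' (hS t) (hS t') (hA t) (hA t') (hR w hw t)
    (hR w hw t') ((wq_comm _ _ _).trans (wq_mainHat_nodeF h hℓ t' u fun Λ => ruleF Λ t))
    (wq_mainHat_nodeF h hℓ t u fun Λ => ruleF Λ t') hAA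
  set g : Option (Fin v) → Fin v → ℝ := fun o y => 1 / (m3 : ℝ) * ind (o = some y) with hg
  have hSS : ∀ {s s' : Triple v} {a a' : Option (Fin v)},
      (∀ e, w e ≠ 0 → HasParent e a s) → (∀ e, w e ≠ 0 → HasParent e a' s') →
      wq w (fun Λ (U : Grammar v m2 m3 ℓ) => nodeF p u (ruleF Λ s) U)
        (fun Λ U => nodeF p u (ruleF Λ s') U) =
      (𝔼 e, w e) * (theta p v m2 m3 ℓ u u * cvar (g a) (g a')) := by
    intro s s' a a' ha ha'
    rw [wq, ← expect_rules_snd (m2 := m2) w, ← expect_mul_const]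
    refine expect_congr rfl fun Λ _ => ?_
    by_cases h0 : w Λ.2 = 0
    · rw [h0, zero_mul, zero_mul]
    · rw [qf_nodeF h, funext (ruleF_eq Λ (ha _ h0)), funext (ruleF_eq Λ (ha' _ h0))]
  have hwt : ∀ e, w e ≠ 0 → HasParent e o t ∧ HasParent e o' t' := fun e he => by
    by_contra hh; exact he (ind_false hh)
  have hdiff : |wq w (fun Λ (U : Grammar v m2 m3 ℓ) => nodeF p u (ruleF Λ t) U)
      (fun Λ U => nodeF p u (ruleF Λ t') U) - ind (o = o') *
      𝕨 w (fun Λ (U : Grammar v m2 m3 ℓ) => nodeF p u (ruleF Λ t) U)| ≤ δ * N := by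
    rw [hSS (fun e he => (hwt e he).1) fun e he => (hwt e he).2,
      hSS (fun e he => (hwt e he).1) fun e he => (hwt e he).1]
    by_cases ho : o = o'
    · rw [ind_true ho, one_mul, ho, sub_self, abs_zero]
      positivity
    · rw [ind_false ho, zero_mul, sub_zero, abs_mul, abs_mul, abs_of_nonneg hP,
        abs_of_nonneg (theta_self_nonneg h _ _)]
      have h1 := theta_le (ℓ := ℓ) h hp hp' (u := u) (A := 1) fun n hn => by
        rw [one_mul]; exact hu n hn
      rw [one_pow, one_mul] at h1
      have h2 := abs_cvar_parent_le h ho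
      calc _ ≤ (𝔼 e, w e) * (theta₀ p v m2 m3 ℓ * ((1 / c) ^ 2 * (1 / v) ^ 6)) := by gcongr
        _ = (1 / c) ^ 2 * (1 / v) * N := by rw [hNdef]; ring
        _ ≤ _ := mul_le_mul_of_nonneg_right hx2 hN
  have e1 : ∀ G : Grammar v m2 m3 (ℓ + 1), ind (ParentIs G o t ∧ ParentIs G o' t') =
      w (G (Fin.last ℓ)).2 := fun G => by rw [parentIs_iff, parentIs_iff]
  simp only [e1, mul_sub, expect_sub, mul_left_comm _ (ind (o = o')), expect_const_mul, hs, hW]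
  rw [expect_mul_rootVec_dotProduct w (fun Λ (U : Grammar v m2 m3 ℓ) r => nodeF p u (ruleF Λ t) U r +
      (mainHat p Λ t U r + R Λ t U r)) fun Λ U r => nodeF p u (ruleF Λ t') U r +
      (mainHat p Λ t' U r + R Λ t' U r),
    expect_mul_rootVec_dotProduct w (fun Λ (U : Grammar v m2 m3 ℓ) => nodeF p u (ruleF Λ t) U)
      fun Λ U => nodeF p u (ruleF Λ t) U, expect_grammar_weight w, mul_left_comm, ← mul_sub,
    abs_mul, abs_of_pos hx]
  refine le_trans (mul_le_mul_of_nonneg_left ?_ hx.le) (mul_theta₀_le_scale (ℓ := ℓ) h hp hp'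
    (X := 7 * δ) (by positivity) hP)
  have h3 := abs_add_le _ _ |>.trans (add_le_add key hdiff)
  refine le_trans (le_of_eq ?_) (h3.trans_eq (by ring))
  congr 1
  ring

end Whitening

section Conclusions

variable {p : ℝ} {v m2 m3 ℓ : ℕ} {c δ : ℝ}

lemma whitenedCond_eq [NeZero v] [Nonempty (Fin m2)] [Nonempty (Fin m3)]
    (G : Grammar v m2 m3 (ℓ + 1)) (t : Triple v) :
    whitenedCond p G t = rootVec fun r =>
      nodeF p (nodeW p tripleW true) (ruleF (G (Fin.last ℓ)) t) (Fin.init G) r +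
      (mainHat p (G (Fin.last ℓ)) t (Fin.init G) r +
        ((noiseHat p (G (Fin.last ℓ)) t (Fin.init G) r - mainHat p (G (Fin.last ℓ)) t (Fin.init G) r) +
          errHat p (G (Fin.last ℓ)) t (Fin.init G) r)) := by
  funext α
  have h1 := sub_whitenedCond_eq p G t α
  rw [signalCond_eq, noise_eq] at h1
  simp only [rootVec_add, rootVec_sub]
  rw [whitenedCond]
  linarith

lemma whitened_eq [NeZero v] [Nonempty (Fin m2)] [Nonempty (Fin m3)]
    (G : Grammar v m2 m3 (ℓ + 1)) (t : Triple v) :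
    whitened p G t = rootVec fun r =>
      nodeF p (signalW p m2 m3 ℓ) (ruleF (G (Fin.last ℓ)) t) (Fin.init G) r +
      (mainHat p (G (Fin.last ℓ)) t (Fin.init G) r +
        ((noiseHat p (G (Fin.last ℓ)) t (Fin.init G) r - mainHat p (G (Fin.last ℓ)) t (Fin.init G) r) +
          errHatFree p (G (Fin.last ℓ)) t (Fin.init G) r)) := by
  funext α
  have h1 := sub_whitened_eq (p := p) G t α
  rw [signal_eq, noise_eq] at h1
  simp only [rootVec_add, rootVec_sub]
  rw [whitened]
  linarith

lemma noise_eq_add [NeZero v] [Nonempty (Fin m2)] [Nonempty (Fin m3)]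
    (G : Grammar v m2 m3 (ℓ + 1)) (t : Triple v) :
    noise p G t = rootVec fun r => 0 + (mainHat p (G (Fin.last ℓ)) t (Fin.init G) r +
      (noiseHat p (G (Fin.last ℓ)) t (Fin.init G) r -
        mainHat p (G (Fin.last ℓ)) t (Fin.init G) r)) := by
  funext α
  rw [noise_eq]
  congr 1; funext r; ring

variable (h : Regime c v m2 m3) (hp : 0 < p) (hp' : p < 1)

include h in
lemma one_le_two_div_sq : 1 ≤ 2 / c ^ 2 := by
  have := h.pos
  rw [le_div_iff₀ (by positivity)]
  linarith [pow_le_one₀ this.le h.le_one (n := 2)]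

omit h hp hp' in
lemma two_div_sq_le : 2 / c ^ 2 ≤ 2 * (1 / c) ^ 2 := by
  rw [one_div_pow]; exact (by ring : 2 / c ^ 2 = 2 * (1 / c ^ 2)).le

include h hp hp'

lemma abs_signalW_le (hℓ : 1 ≤ ℓ) (n : ℕ) : |signalW p m2 m3 ℓ n| ≤ 1 / n := by
  have := h.nonempty_m2
  have := h.nonempty_m3
  have h1 := terProb_le_one (m2 := m2) (m3 := m3) hp.le hp'.le hℓ
  have h2 := le_terProb (m2 := m2) (m3 := m3) (ℓ := ℓ) hp.le hp'.le
  rw [signalW, abs_mul, abs_of_nonneg (by linarith : 0 ≤ terProb p m2 m3 ℓ),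
    abs_of_nonneg (by positivity : 0 ≤ 1 / (n : ℝ))]
  exact mul_le_of_le_one_left (by positivity) h1

lemma expect_sq_rootVec_le_of {Φ : Rules v m2 m3 → Grammar v m2 m3 ℓ → Fin v → ℝ}
    (hΦ : ∀ α, 𝔼 G : Grammar v m2 m3 (ℓ + 1), rootVec (Φ (G (Fin.last ℓ)) (Fin.init G)) α ^ 2 =
      (1 / (v : ℝ)) ^ 2 * 𝕨 (fun _ => 1) Φ) {a : ℝ} (ha : 0 ≤ a)
    (h1 : 𝕨 (fun _ => 1) Φ ≤ (a + 1450496 * 1 * (1 / c) ^ 3 * crude c p ℓ * (1 / v)) *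
      (theta₀ p v m2 m3 ℓ * (1 / v) ^ 5) * 𝔼 _e : TernaryRules v m3, 1) (α : Fin v) :
    𝔼 G : Grammar v m2 m3 (ℓ + 1), rootVec (Φ (G (Fin.last ℓ)) (Fin.init G)) α ^ 2 ≤
      (a + errC c p ℓ * (1 / v)) * (18 / (1 - p) ^ 2) * (scale p v m2 m3 ℓ / v) := by
  have := h.nonempty₃
  have hx := inv_v_pos h
  have hq := one_le_inv h
  have hcr := one_le_crude (ℓ := ℓ) h hp hp'
  have hB := errC_pos (ℓ := ℓ) h hp hp'
  have hθ := theta₀_nonneg (p := p) (ℓ := ℓ) h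
  have h2 : 𝕨 (fun _ => 1) Φ ≤ (a + errC c p ℓ * (1 / v)) *
      (theta₀ p v m2 m3 ℓ * (1 / v) ^ 5 * 1) := by
    refine h1.trans ?_
    rw [expect_const, mul_one, mul_one, mul_one, errC]
    have h3 := pow_le_pow_right₀ hq (by norm_num : 3 ≤ 6)
    gcongr
    norm_num
  have h3 := mul_theta₀_le_scale (ℓ := ℓ) h hp hp' (X := a + errC c p ℓ * (1 / v))
    (by positivity) zero_le_one
  rw [hΦ]
  calc _ ≤ (1 / (v : ℝ)) ^ 2 * ((a + errC c p ℓ * (1 / v)) *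
        (theta₀ p v m2 m3 ℓ * (1 / v) ^ 5 * 1)) := by gcongr
    _ = 1 / v * (1 / v * ((a + errC c p ℓ * (1 / v)) *
        (theta₀ p v m2 m3 ℓ * (1 / v) ^ 5 * 1))) := by ring
    _ ≤ _ := (mul_le_mul_of_nonneg_left h3 hx.le).trans_eq (by ring)

lemma expect_sq_errHat_le (hℓ : 1 ≤ ℓ) (t : Triple v) (α : Fin v) :
    𝔼 G : Grammar v m2 m3 (ℓ + 1), (C3 p G t.1 t.2.1 t.2.2 α - (signalCond p G t α +
      1 / (v : ℝ) * (C2left p G t.1 t.2.1 α + C2right p G t.2.1 t.2.2 α) + noise p G t α)) ^ 2 ≤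
      errC c p ℓ * (1 / v) * (18 / (1 - p) ^ 2) * (scale p v m2 m3 ℓ / v) := by
  obtain ⟨_, _, _, _, _, _⟩ := h.insts
  have h1 := wq_errHat_le_add (ℓ := ℓ) h hp hp' hℓ (transfers_one h) le_rfl t
  simp only [sub_whitenedCond_eq]
  refine (expect_sq_rootVec_le_of h hp hp' (fun α => ?_) le_rfl h1 α).trans_eq
    (by rw [zero_add])
  obtain ⟨k, rfl⟩ : ∃ k, ℓ = k + 1 := ⟨ℓ - 1, by omega⟩
  exact expect_grammar_rootVec_sq (fun Λ π U r => errHat_reroot π U r p Λ t) α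

lemma expect_sq_errHatFree_le (hℓ : 1 ≤ ℓ) (t : Triple v) (α : Fin v) :
    𝔼 G : Grammar v m2 m3 (ℓ + 1), (C3 p G t.1 t.2.1 t.2.2 α - (signal p G t α +
      1 / (v : ℝ) * (C2 p G t.1 t.2.1 α + C2 p G t.2.1 t.2.2 α) + noise p G t α)) ^ 2 ≤
      (592 * (1 / 2) ^ ℓ * (1 / c) ^ 2 + errC c p ℓ * (1 / v)) * (18 / (1 - p) ^ 2) *
        (scale p v m2 m3 ℓ / v) := by
  obtain ⟨_, _, _, _, _, _⟩ := h.insts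
  have h1 := wq_errHatFree_le (ℓ := ℓ) h hp hp' hℓ (transfers_one h) le_rfl t
  simp only [sub_whitened_eq]
  refine expect_sq_rootVec_le_of h hp hp' (fun α => ?_) (by positivity) h1 α
  obtain ⟨k, rfl⟩ : ∃ k, ℓ = k + 1 := ⟨ℓ - 1, by omega⟩
  exact expect_grammar_rootVec_sq (fun Λ π U r => errHatFree_reroot π U r p Λ t) α

omit hp hp' in
lemma expect_ind_mul_noise (hℓ : 1 ≤ ℓ) (o : Option (Fin v)) (t : Triple v)
    (α : Fin v) :
    𝔼 G : Grammar v m2 m3 (ℓ + 1), ind (ParentIs G o t) * noise p G t α = 0 := by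
  obtain ⟨_, _, _, _, _, _⟩ := h.insts
  obtain ⟨k, rfl⟩ : ∃ k, ℓ = k + 1 := ⟨ℓ - 1, by omega⟩
  simp only [noise_eq, parentIs_iff]
  rw [expect_grammar_last fun (Λ : Rules v m2 m3) (U : Grammar v m2 m3 (k + 1)) =>
    ind (HasParent Λ.2 o t) * rootVec (noiseHat p Λ t U) α]
  simp only [expect_const_mul, expect_rootVec_eq_zero (fun π U r => noiseHat_reroot π U r p _ t),
    mul_zero, expect_const_zero]

variable (hℓ : 1 ≤ ℓ)

include hℓ

lemma expect_noise_dotProduct_self_le (h1 : errC c p ℓ * (1 / v) ≤ 1) (z : Fin v)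
    (t : Triple v) :
    𝔼 G : Grammar v m2 m3 (ℓ + 1),
        ind (ParentIs G (some z) t) * (noise p G t ⬝ᵥ noise p G t) ≤
      26 * (1 / c) ^ 3 * (18 / (1 - p) ^ 2) * scale p v m2 m3 ℓ *
        𝔼 G : Grammar v m2 m3 (ℓ + 1), ind (ParentIs G (some z) t) := by
  obtain ⟨_, _, _, _, _, _⟩ := h.insts
  have hx := inv_v_pos h
  have hq := one_le_inv h
  have hθ := theta₀_nonneg (p := p) (ℓ := ℓ) h
  have hw := transfers_some h z t
  have hP := hw.expect_nonneg
  simp only [noise_eq_add, parentIs_iff]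
  rw [expect_mul_rootVec_dotProduct (fun e => ind (HasParent e (some z) t))
      (fun Λ (U : Grammar v m2 m3 ℓ) r => 0 + (mainHat p Λ t U r +
        (noiseHat p Λ t U r - mainHat p Λ t U r)))
      fun Λ U r => 0 + (mainHat p Λ t U r + (noiseHat p Λ t U r - mainHat p Λ t U r)),
    expect_grammar_weight fun e => ind (HasParent e (some z) t)]
  refine le_trans (mul_le_mul_of_nonneg_left ?_ hx.le) (mul_theta₀_le_scale (ℓ := ℓ) h hp hp'
    (X := 26 * (1 / c) ^ 3) (by positivity) hP)
  simp only [zero_add]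
  refine (wq_self_add_le (fun Λ (U : Grammar v m2 m3 ℓ) r => mainHat p Λ t U r) _ hw.nonneg).trans ?_
  have h2 := wq_mainHat_le (ℓ := ℓ) h hp hp' hℓ hw.nonneg t
  have h3 := wq_noise_remainder_le (ℓ := ℓ) h hp hp' hw le_rfl
    (by linarith [one_le_pow₀ hq (n := 2)]) t
  set N := theta₀ p v m2 m3 ℓ * (1 / v) ^ 5 *
    𝔼 e : TernaryRules v m3, ind (HasParent e (some z) t)
  have hN : 0 ≤ N := by positivity
  have h4 : errC c p ℓ * (1 / v) * N ≤ (1 / c) ^ 3 * N :=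
    mul_le_mul_of_nonneg_right (h1.trans (one_le_pow₀ hq)) hN
  linarith

variable (hδ : 0 < δ) (h3 : 12 * (1 / c) ^ 3 * (errC c p ℓ * (1 / v)) ≤ δ ^ 2)

include hδ h3

lemma abs_expect_noise_dotProduct_center_le (z : Fin v) (t : Triple v) :
    |𝔼 G : Grammar v m2 m3 (ℓ + 1),
        ind (ParentIs G (some z) t) * (noise p G t ⬝ᵥ center p G z)| ≤
      δ * (18 / (1 - p) ^ 2) * scale p v m2 m3 ℓ *
        𝔼 G : Grammar v m2 m3 (ℓ + 1), ind (ParentIs G (some z) t) := by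
  obtain ⟨_, _, _, _, _, _⟩ := h.insts
  have hx := inv_v_pos h
  have hq := one_le_inv h
  have hθ := theta₀_nonneg (p := p) (ℓ := ℓ) h
  have hw := transfers_some h z t
  have hP := hw.expect_nonneg
  have e1 : ∀ G : Grammar v m2 m3 (ℓ + 1), center p G z = rootVec (nodeF p (signalW p m2 m3 ℓ)
      (fun y => 1 / (m3 : ℝ) * ind (some z = some y)) (Fin.init G)) := by
    intro G
    funext α
    rw [center_eq]
    simp only [Option.some.injEq, ind_eq_comm z]
  simp only [noise_eq_add, parentIs_iff, e1]
  rw [expect_mul_rootVec_dotProduct (fun e => ind (HasParent e (some z) t))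
      (fun Λ (U : Grammar v m2 m3 ℓ) r => 0 + (mainHat p Λ t U r +
        (noiseHat p Λ t U r - mainHat p Λ t U r)))
      fun _ U => nodeF p (signalW p m2 m3 ℓ) (fun y => 1 / (m3 : ℝ) * ind (some z = some y)) U,
    expect_grammar_weight fun e => ind (HasParent e (some z) t), abs_mul, abs_of_pos hx]
  refine le_trans (mul_le_mul_of_nonneg_left ?_ hx.le) (mul_theta₀_le_scale (ℓ := ℓ) h hp hp'
    hδ.le hP)
  simp only [zero_add]
  rw [wq_add_left (fun e => ind (HasParent e (some z) t))
    (fun Λ (U : Grammar v m2 m3 ℓ) r => mainHat p Λ t U r),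
    wq_mainHat_nodeF h hℓ t _ fun _ y => 1 / (m3 : ℝ) * ind (some z = some y), zero_add, wq_comm]
  have h4 := wq_noise_remainder_le (ℓ := ℓ) h hp hp' hw le_rfl
    (by linarith [one_le_pow₀ hq (n := 2)]) t
  refine abs_wq_le_of hw.nonneg hδ (by positivity) (by positivity) h3 ?_ h4
  refine (wq_nodeF_le (ℓ := ℓ) h hp hp' hw.nonneg (A := 1) (fun n _ => by
    rw [one_mul]; exact abs_signalW_le h hp hp' hℓ n)
    fun _ y => 1 / (m3 : ℝ) * ind (some z = some y)).trans ?_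
  rw [expect_mul_const, expect_rules_snd fun e => ind (HasParent e (some z) t), one_pow, one_mul]
  have h5 := pow_le_pow_right₀ hq (by norm_num : 2 ≤ 3)
  have h6 : (1 / c) ^ 2 ≤ 12 * (1 / c) ^ 3 := by linarith [pow_nonneg (zero_le_one.trans hq) 3]
  calc _ ≤ theta₀ p v m2 m3 ℓ * ((𝔼 e : TernaryRules v m3,
        ind (HasParent e (some z) t)) * (12 * (1 / c) ^ 3 * (1 / v) ^ 5)) := by
        gcongr
        exact (cvar_parent_le h _).trans (by gcongr)
    _ = _ := by ring

variable (hv : 4 ≤ v) (hcv : 2 ≤ c * v) (h2 : errC c p ℓ * (1 / v) ≤ δ)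

include hv hcv h2

lemma abs_expect_noise_dotProduct_noise_le {t t' : Triple v} (ht : t ≠ t') (z : Fin v) :
    |𝔼 G : Grammar v m2 m3 (ℓ + 1), ind (ParentIs G (some z) t ∧ ParentIs G (some z) t') *
        (noise p G t ⬝ᵥ noise p G t')| ≤
      6 * δ * (18 / (1 - p) ^ 2) * scale p v m2 m3 ℓ *
        𝔼 G : Grammar v m2 m3 (ℓ + 1), ind (ParentIs G (some z) t ∧ ParentIs G (some z) t') := by
  obtain ⟨_, _, _, _, _, _⟩ := h.insts
  have hx := inv_v_pos h
  have hq := one_le_inv h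
  have hθ := theta₀_nonneg (p := p) (ℓ := ℓ) h
  have hw := transfers_parents h hcv ht (some z) (some z)
  have hP := hw.expect_nonneg
  simp only [noise_eq_add, parentIs_iff]
  rw [expect_mul_rootVec_dotProduct
      (fun e => ind (HasParent e (some z) t ∧ HasParent e (some z) t'))
      (fun Λ (U : Grammar v m2 m3 ℓ) r => 0 + (mainHat p Λ t U r +
        (noiseHat p Λ t U r - mainHat p Λ t U r)))
      fun Λ U r => 0 + (mainHat p Λ t' U r + (noiseHat p Λ t' U r - mainHat p Λ t' U r)),
    expect_grammar_weight fun e => ind (HasParent e (some z) t ∧ HasParent e (some z) t'),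
    abs_mul, abs_of_pos hx]
  refine le_trans (mul_le_mul_of_nonneg_left ?_ hx.le) (mul_theta₀_le_scale (ℓ := ℓ) h hp hp'
    (X := 6 * δ) (by positivity) hP)
  have hN : 0 ≤ theta₀ p v m2 m3 ℓ * (1 / v) ^ 5 * 𝔼 e : TernaryRules v m3,
    ind (HasParent e (some z) t ∧ HasParent e (some z) t') := by positivity
  have h0 : ∀ Ψ : Rules v m2 m3 → Grammar v m2 m3 ℓ → Fin v → ℝ,
      wq (fun e => ind (HasParent e (some z) t ∧ HasParent e (some z) t')) (fun _ _ _ => 0) Ψ = 0 :=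
    fun Ψ => by simp only [wq, qf, cvar_zero_left, expect_const_zero, mul_zero]
  have hR := fun t => wq_noise_remainder_le (ℓ := ℓ) h hp hp' hw (one_le_two_div_sq h)
    two_div_sq_le t
  have hA := fun t => wq_mainHat_le (ℓ := ℓ) h hp hp' hℓ hw.nonneg t
  have hAA := abs_wq_mainHat_le (ℓ := ℓ) h hp hp' hℓ hv hw.nonneg ht
  have hM : 0 < 12 * (1 / c) ^ 3 := by positivity
  have h4 := mul_le_mul_of_nonneg_right ((pow_mul_le_of_errC_le h hp hp' h2).1) hN
  have h5 := abs_wq_sub_le hw.nonneg hδ hN hM h3 h2 ((h0 _).le.trans (by positivity))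
    ((h0 _).le.trans (by positivity)) ((hA t).trans_eq (mul_assoc _ _ _))
    ((hA t').trans_eq (mul_assoc _ _ _)) (hR t) (hR t') (h0 _) ((wq_comm _ _ _).trans (h0 _))
    ((hAA.trans_eq (mul_assoc _ _ _)).trans h4)
  rwa [h0 (fun _ _ _ => 0), sub_zero] at h5

lemma clusters_whitenedCond : Clusters (7 * δ * (18 / (1 - p) ^ 2) * scale p v m2 m3 ℓ)
    (fun G : Grammar v m2 m3 (ℓ + 1) => signalCond p G) (fun G => whitenedCond p G) := by
  obtain ⟨_, _, _, _, _, _⟩ := h.insts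
  have hb := pow_mul_le_of_errC_le h hp hp' h2
  exact clusters_of h hp hp' hℓ hv hcv
    (fun n hn => abs_nodeW_tripleW_le hp.le hp'.le true ((two_le_two_pow hℓ).trans hn))
    (fun w hw t => (wq_remainder_le_of h hp hp' hw (one_le_two_div_sq h) two_div_sq_le t
      (wq_errHat_le_add h hp hp' hℓ hw (one_le_two_div_sq h) t)).trans_eq
      (by rw [mul_zero, zero_add]))
    hδ h3 h2 hb.1 hb.2 (fun G t => funext fun α => signalCond_eq p G t α) whitenedCond_eq

lemma clusters_whitened : Clusters
    (7 * (1184 * (1 / c) ^ 3 / Real.sqrt 2 ^ ℓ + δ) * (18 / (1 - p) ^ 2) * scale p v m2 m3 ℓ)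
    (fun G : Grammar v m2 m3 (ℓ + 1) => signal p G) (fun G => whitened p G) := by
  obtain ⟨_, _, _, _, _, _⟩ := h.insts
  have hq := one_le_inv h
  have hb := pow_mul_le_of_errC_le h hp hp' h2
  have hs : 0 < Real.sqrt 2 ^ ℓ := by positivity
  have hs2 : (1 / Real.sqrt 2 ^ ℓ) ^ 2 = (1 / 2) ^ ℓ := by
    rw [div_pow, ← pow_mul, mul_comm, pow_mul, Real.sq_sqrt (by norm_num), one_pow, one_div_pow]
  have hs1 : 1 / Real.sqrt 2 ^ ℓ ≤ 1 := by
    rw [div_le_one hs]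
    exact one_le_pow₀ (Real.one_le_sqrt.2 (by norm_num))
  have hy : 0 < 1 / Real.sqrt 2 ^ ℓ := by positivity
  rw [div_eq_mul_one_div (1184 * (1 / c) ^ 3)]
  generalize 1 / Real.sqrt 2 ^ ℓ = y at hs2 hs1 hy ⊢
  have hδ' : δ ≤ 1184 * (1 / c) ^ 3 * y + δ := le_add_of_nonneg_left (by positivity)
  refine clusters_of h hp hp' hℓ hv hcv
    (ρ := 2 * (592 * (1 / 2) ^ ℓ * (1 / c) ^ 2) + errC c p ℓ * (1 / v))
    (fun n _ => abs_signalW_le h hp hp' hℓ n)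
    (fun w hw t => wq_remainder_le_of h hp hp' hw (one_le_two_div_sq h) two_div_sq_le t
      (wq_errHatFree_le h hp hp' hℓ hw (one_le_two_div_sq h) t))
    (by positivity) ?_ ?_ (hb.1.trans hδ') (hb.2.trans hδ')
    (fun G t => funext fun α => signal_eq p G t α) whitened_eq
  · rw [← hs2]
    generalize 1 / c = q at hq h3 ⊢
    have h4 : q ^ 5 ≤ q ^ 6 := pow_le_pow_right₀ hq (by norm_num)
    have h5 : 0 ≤ q ^ 3 * y * δ := by positivity
    have h6 := mul_le_mul_of_nonneg_right h4 (sq_nonneg y)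
    have h7 : 0 ≤ q ^ 6 * y ^ 2 := by positivity
    nlinarith
  · rw [← hs2]
    generalize 1 / c = q at hq h3 ⊢
    have h4 : q ^ 2 ≤ q ^ 3 := pow_le_pow_right₀ hq (by norm_num)
    have h5 : y ^ 2 ≤ y := by nlinarith
    have h6 : y ^ 2 * q ^ 2 ≤ y * q ^ 3 := mul_le_mul h5 h4 (by positivity) hy.le
    linarith

end Conclusions

/-- The sizes of the rule sets of large random grammars. -/
lemma eventually_regime {f₂ f₃ : ℝ} (hf₂ : 0 < f₂) (hf₂' : f₂ < 1) (hf₃ : 0 < f₃) (hf₃' : f₃ < 1)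
    {m2 m3 : ℕ → ℕ} (h₂ : Tendsto (fun v : ℕ => (m2 v : ℝ) / (v : ℝ)) atTop (𝓝 f₂))
    (h₃ : Tendsto (fun v : ℕ => (m3 v : ℝ) / (v : ℝ) ^ 2) atTop (𝓝 f₃)) :
    ∀ᶠ v : ℕ in atTop,
      Regime (min (min (f₂ / 2) (f₃ / 2)) ((1 - f₃) / 2)) v (m2 v) (m3 v) := by
  filter_upwards [eventually_ge_atTop 2, h₂.eventually_lt_const hf₂',
    h₂.eventually_const_lt (by linarith : f₂ / 2 < f₂),
    h₃.eventually_const_lt (by linarith : f₃ / 2 < f₃),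
    h₃.eventually_lt_const (by linarith : f₃ < 1 - (1 - f₃) / 2)] with v hv a1 a2 a3 a4
  have hv0 : (0 : ℝ) < v := by exact_mod_cast (by omega : 0 < v)
  rw [div_lt_iff₀ hv0] at a1
  rw [lt_div_iff₀ hv0] at a2
  rw [lt_div_iff₀ (by positivity)] at a3
  rw [div_lt_iff₀ (by positivity)] at a4
  have hc1 := min_le_left (min (f₂ / 2) (f₃ / 2)) ((1 - f₃) / 2)
  have hc2 := min_le_right (min (f₂ / 2) (f₃ / 2)) ((1 - f₃) / 2)
  have hc3 := hc1.trans (min_le_left _ _)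
  have hc4 := hc1.trans (min_le_right _ _)
  refine ⟨lt_min (lt_min (by linarith) (by linarith)) (by linarith), hv, ?_, ?_, ?_, ?_⟩
  · rw [one_mul] at a1; exact_mod_cast a1.le
  · exact (mul_le_mul_of_nonneg_right hc3 hv0.le).trans a2.le
  · exact (mul_le_mul_of_nonneg_right hc4 (sq_nonneg _)).trans a3.le
  · exact a4.le.trans (mul_le_mul_of_nonneg_right (by linarith) (sq_nonneg _))

end RHM

theorem mainTheorem4 (p f₂ f₃ : ℝ) (hp : 0 < p) (hp' : p < 1)
    (hf₂ : 0 < f₂) (hf₂' : f₂ < 1) (hf₃ : 0 < f₃) (hf₃' : f₃ < 1) :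
    ∃ K : ℝ, ∀ m₂ m₃ : ℕ → ℕ,
      Tendsto (fun v : ℕ => (m₂ v : ℝ) / (v : ℝ)) atTop (𝓝 f₂) →
      Tendsto (fun v : ℕ => (m₃ v : ℝ) / (v : ℝ) ^ 2) atTop (𝓝 f₃) →
      ∀ ℓ : ℕ, 1 ≤ ℓ → ∀ ε : ℝ, 0 < ε → ∀ᶠ v : ℕ in atTop,
        -- the decomposition, all terms taken at the position of the triple
        (∀ (t : Fin v × Fin v × Fin v) (α : Fin v),
          𝔼 G : RHM.Grammar v (m₂ v) (m₃ v) (ℓ + 1),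
            (RHM.C3 p G t.1 t.2.1 t.2.2 α -
              (RHM.signalCond p G t α +
                1 / (v : ℝ) * (RHM.C2left p G t.1 t.2.1 α + RHM.C2right p G t.2.1 t.2.2 α) +
                RHM.noise p G t α)) ^ 2 ≤
          ε * (RHM.scale p v (m₂ v) (m₃ v) ℓ / v)) ∧
        -- the decomposition, every covariance at its own uniformly random position
        (∀ (t : Fin v × Fin v × Fin v) (α : Fin v),
          𝔼 G : RHM.Grammar v (m₂ v) (m₃ v) (ℓ + 1),
            (RHM.C3 p G t.1 t.2.1 t.2.2 α -
              (RHM.signal p G t α +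
                1 / (v : ℝ) * (RHM.C2 p G t.1 t.2.1 α + RHM.C2 p G t.2.1 t.2.2 α) +
                RHM.noise p G t α)) ^ 2 ≤
          (K / 2 ^ ℓ + ε) * (RHM.scale p v (m₂ v) (m₃ v) ℓ / v)) ∧
        -- the noise has mean zero over the triples of a nonterminal
        (∀ (t : Fin v × Fin v × Fin v) (z α : Fin v),
          𝔼 G : RHM.Grammar v (m₂ v) (m₃ v) (ℓ + 1),
            RHM.ind (RHM.ParentIs G (some z) t) * RHM.noise p G t α = 0) ∧
        -- its norm is at most comparable with that of the signal
        (∀ (t : Fin v × Fin v × Fin v) (z : Fin v),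
          𝔼 G : RHM.Grammar v (m₂ v) (m₃ v) (ℓ + 1),
            RHM.ind (RHM.ParentIs G (some z) t) * (RHM.noise p G t ⬝ᵥ RHM.noise p G t) ≤
          K * RHM.scale p v (m₂ v) (m₃ v) ℓ *
            𝔼 G : RHM.Grammar v (m₂ v) (m₃ v) (ℓ + 1), RHM.ind (RHM.ParentIs G (some z) t)) ∧
        -- it decorrelates from the signal
        (∀ (t : Fin v × Fin v × Fin v) (z : Fin v),
          |𝔼 G : RHM.Grammar v (m₂ v) (m₃ v) (ℓ + 1),
            RHM.ind (RHM.ParentIs G (some z) t) * (RHM.noise p G t ⬝ᵥ RHM.center p G z)| ≤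
          ε * RHM.scale p v (m₂ v) (m₃ v) ℓ *
            𝔼 G : RHM.Grammar v (m₂ v) (m₃ v) (ℓ + 1), RHM.ind (RHM.ParentIs G (some z) t)) ∧
        -- it decorrelates across triples sharing the same ternary nonterminal
        (∀ t t' : Fin v × Fin v × Fin v, t ≠ t' → ∀ z : Fin v,
          |𝔼 G : RHM.Grammar v (m₂ v) (m₃ v) (ℓ + 1),
            RHM.ind (RHM.ParentIs G (some z) t ∧ RHM.ParentIs G (some z) t') *
              (RHM.noise p G t ⬝ᵥ RHM.noise p G t')| ≤
          ε * RHM.scale p v (m₂ v) (m₃ v) ℓ *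
            𝔼 G : RHM.Grammar v (m₂ v) (m₃ v) (ℓ + 1),
              RHM.ind (RHM.ParentIs G (some z) t ∧ RHM.ParentIs G (some z) t')) ∧
        -- subtracting the pair covariances restores the clustering of the triples
        RHM.Clusters (m₂ := m₂ v) (m₃ := m₃ v) (ε * RHM.scale p v (m₂ v) (m₃ v) ℓ)
          (fun G : RHM.Grammar v (m₂ v) (m₃ v) (ℓ + 1) => RHM.signalCond p G)
          (fun G => RHM.whitenedCond p G) ∧
        RHM.Clusters (m₂ := m₂ v) (m₃ := m₃ v)
          ((K / (Real.sqrt 2) ^ ℓ + ε) * RHM.scale p v (m₂ v) (m₃ v) ℓ)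
          (fun G : RHM.Grammar v (m₂ v) (m₃ v) (ℓ + 1) => RHM.signal p G)
          (fun G => RHM.whitened p G) := by
  set c := min (min (f₂ / 2) (f₃ / 2)) ((1 - f₃) / 2) with hc
  have hc0 : 0 < c := lt_min (lt_min (by linarith) (by linarith)) (by linarith)
  set D := 18 / (1 - p) ^ 2 with hD
  have hD0 : 0 < D := div_pos (by norm_num) (pow_pos (by linarith) 2)
  refine ⟨8288 * (1 / c) ^ 3 * D, fun m₂ m₃ h₂ h₃ ℓ hℓ ε hε => ?_⟩
  set δ := ε / (7 * D) with hδ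
  have hδ0 : 0 < δ := by positivity
  have hεδ : 7 * δ * D = ε := by rw [hδ]; field_simp
  have hsmall : ∀ {A : ℝ}, 0 < A → ∀ᶠ v : ℕ in atTop, RHM.errC c p ℓ * (1 / (v : ℝ)) < A := by
    intro A hA
    have h1 := (tendsto_const_nhds (x := RHM.errC c p ℓ)).mul
      (tendsto_one_div_atTop_nhds_zero_nat (𝕜 := ℝ))
    rw [mul_zero] at h1
    exact h1.eventually_lt_const hA
  have hlarge : ∀ᶠ v : ℕ in atTop, 2 ≤ c * (v : ℝ) :=
    (tendsto_natCast_atTop_atTop.const_mul_atTop hc0).eventually_ge_atTop 2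
  filter_upwards [RHM.eventually_regime hf₂ hf₂' hf₃ hf₃' h₂ h₃, hlarge, eventually_ge_atTop 4,
    hsmall zero_lt_one, hsmall hδ0,
    hsmall (by positivity : 0 < δ ^ 2 / (12 * (1 / c) ^ 3))] with v h hcv hv a1 a2 a3
  rw [lt_div_iff₀ (by positivity), mul_comm] at a3
  have hσ := RHM.scale_nonneg (ℓ := ℓ) h hp hp'
  have hq := RHM.one_le_inv h
  have hP : ∀ F : RHM.Grammar v (m₂ v) (m₃ v) (ℓ + 1) → Prop, 0 ≤ 𝔼 G, RHM.ind (F G) :=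
    fun F => RHM.expect_nonneg fun _ => RHM.ind_nonneg _
  have hD2 : ∀ a : ℝ, a ≤ 7 * δ → a * D ≤ ε := fun a ha =>
    (mul_le_mul_of_nonneg_right ha hD0.le).trans_eq hεδ
  have hq23 := pow_le_pow_right₀ hq (by norm_num : 2 ≤ 3)
  have hq3 : 0 < (1 / c) ^ 3 := by positivity
  refine ⟨fun t α => ?_, fun t α => ?_, fun t z α => ?_, fun t z => ?_, fun t z => ?_,
    fun t t' ht z => ?_, ?_, ?_⟩
  · refine (RHM.expect_sq_errHat_le h hp hp' hℓ t α).trans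
      (mul_le_mul_of_nonneg_right (hD2 _ (by linarith)) (by positivity))
  · refine (RHM.expect_sq_errHatFree_le h hp hp' hℓ t α).trans
      (mul_le_mul_of_nonneg_right ?_ (by positivity))
    rw [add_mul]
    refine add_le_add ?_ (hD2 _ (by linarith))
    rw [div_eq_mul_one_div _ ((2 : ℝ) ^ ℓ), ← one_div_pow]
    calc _ = 592 * (1 / c) ^ 2 * (D * (1 / 2) ^ ℓ) := by ring
      _ ≤ 8288 * (1 / c) ^ 3 * (D * (1 / 2) ^ ℓ) :=
          mul_le_mul_of_nonneg_right (by linarith) (by positivity)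
      _ = _ := by ring
  · exact RHM.expect_ind_mul_noise h hℓ (some z) t α
  · refine (RHM.expect_noise_dotProduct_self_le h hp hp' hℓ a1.le z t).trans ?_
    gcongr
    · exact hP _
    · norm_num
  · refine (RHM.abs_expect_noise_dotProduct_center_le h hp hp' hℓ hδ0 a3.le z t).trans ?_
    have := hD2 δ (by linarith)
    gcongr
    exact hP _
  · refine (RHM.abs_expect_noise_dotProduct_noise_le h hp hp' hℓ hδ0 a3.le hv hcv a2.le ht z).trans ?_
    have := hD2 (6 * δ) (by linarith)
    gcongr
    exact hP _
  · have := RHM.clusters_whitenedCond h hp hp' hℓ hδ0 a3.le hv hcv a2.le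
    rwa [← hD, hεδ] at this
  · have := RHM.clusters_whitened h hp hp' hℓ hδ0 a3.le hv hcv a2.le
    have e : 8288 * (1 / c) ^ 3 * D / Real.sqrt 2 ^ ℓ + ε =
        7 * (1184 * (1 / c) ^ 3 / Real.sqrt 2 ^ ℓ + δ) * D := by
      rw [← hεδ]; ring
    rwa [e]
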